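/- Let $a,b,c\ge 0$ and $r$ be integers with $a+b+c>0$, and put $d=2a+b+c$. Let $S$ be a sphere with two holes, bounded by the circles $C'$ and $C''$, i.e. an annulus. On each circle mark $d$ vertices, and number them $0,\dots,d-1$ in cyclic order, for one and the same direction of going round the annulus. Draw in $S$ pairwise disjoint arcs of four kinds: for $0\le p<a$, an arc joining the vertices $p$ and $d-1-p$ of $C'$ and cutting off a disc of $S$ that contains the part of $C'$ from $d-1$ to $0$; for $0\le q<a$, an arc joining the vertices $q$ and $d-1-q$ of $C''$ and cutting off a disc of $S$ that contains the part of $C''$ from $d-1$ to $0$; for $0\le k<b$, an arc joining the vertex $a+k$ of $C'$ with the vertex $a+c+k$ of $C''$; for $0\le k<c$, an arc joining the vertex $a+b+k$ of $C'$ with the vertex $a+k$ of $C''$. (This is unique up to homeomorphisms of the annulus that fix its boundary pointwise.) Glue $C'$ to $C''$ so that the vertex $p$ of $C'$ is identified with the vertex $p+r \pmod d$ of $C''$. This gives a torus $T$ with a simple closed curve $C=C'=C''$, and the arcs form a system $\mathcal D$ of disjoint simple closed curves in $T$. The tuple $(a,b,c,1,r,0)$ is called admissible if $\mathcal D$ consists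 of exactly one curve $D$ and $T\setminus D$ is connected. In that case $(T;C,D)$ is a genus one Heegaard diagram, and the Dunwoody manifold $M(a,b,c,1,r,0)$ is the closed 3-manifold it represents: the union of two solid tori meeting exactly in their common boundary $T$, with $C$ a meridian of the first and $D$ a meridian of the second. Orient $D$ so that the arc with an end at the vertex $a+b \pmod d$ of $C'$ starts there, and run once along $D$ beginning with this arc; the associated word $w$ in the free group on one generator $x$ has a letter $x$ for each arc of $D$ that starts on $C'$ and a letter $x^{-1}$ for each arc that starts on $C''$. Let $\varepsilon_w\in\mathbb Z$ be the exponent sum of $w$. If $(a,b,c,1,r,0)$ is admissible, then the Dunwoody manifold $M(a,b,c,1,r,0)$ exists, and every manifold represented by its Heegaard diagram is homeomorphic to (i) $S^3$, if $\varepsilon_w=\pm1$; (ii) $S^1\times S^2$, if $\varepsilon_w=0$; (iii) a lens space $L(\alpha,\beta)$ with $\alpha=|\varepsilon_w|$ and some $\beta$ coprime to $\alpha$ that depends only on $a,b,c,r$, if $|\varepsilon_w|>1$. -/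

import Mathlib

open Set

namespace Dunwoody

/-! ### The torus, the solid torus, genus one Heegaard diagrams -/

/-- The torus `ℝ/ℤ × ℝ/ℤ`. -/
abbrev Torus : Type := UnitAddCircle × UnitAddCircle

/-- The covering projection `ℝ² → ℝ²/ℤ²`. -/
def torusProj (v : ℝ × ℝ) : Torus := ((v.1 : UnitAddCircle), (v.2 : UnitAddCircle))

/-- The solid torus `D² × S¹`. -/
abbrev SolidTorus : Type := Metric.closedBall (0 : ℂ) 1 × Circle

/-- The boundary torus `∂D² × S¹`. -/
def solidTorusBoundary : Set SolidTorus := {v | ‖(v.1 : ℂ)‖ = 1}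

/-- The meridian `∂D² × {1}`, the boundary of the meridian disc `D² × {1}`. -/
def solidTorusMeridian : Set SolidTorus := {v | ‖(v.1 : ℂ)‖ = 1 ∧ v.2 = 1}

/-- `M` is the 3-manifold represented by the genus one Heegaard diagram `(Torus; C, D)`: it is
the union of two solid tori (the images of `f` and `g`) which meet exactly in their common boundary,
and this common boundary is identified with the torus (by `τ`) in such a way that `C` is a meridian
of the first solid torus and `D` is a meridian of the second one. -/
def IsRepresentedBy (M : Type*) [TopologicalSpace M] (C D : Set Torus) : Prop :=
  ∃ (f g : SolidTorus → M) (τ : Torus → M),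
    Topology.IsClosedEmbedding f ∧ Topology.IsClosedEmbedding g ∧ Topology.IsClosedEmbedding τ ∧
    range f ∪ range g = univ ∧
    range f ∩ range g = range τ ∧
    f '' solidTorusBoundary = range τ ∧
    g '' solidTorusBoundary = range τ ∧
    f '' solidTorusMeridian = τ '' C ∧
    g '' solidTorusMeridian = τ '' D

/-! ### The Dunwoody diagram for `n = 1`, `s = 0`

The sphere with two holes bounded by `C'` and `C''` is the annulus `ℝ/ℤ × [0, 1]`, with `C'` the
circle at height `1` and `C''` the circle at height `0`. Each of the two circles has
`d = 2a + b + c` vertices, and the vertex labelled `j` is placed at the angle `(j - 1) / d` on both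
of them; both circles are oriented in the direction of increasing angle. Gluing equally labelled
vertices of `C'` and `C''` is then the identification of `(x, 1)` with `(x, 0)`, so
that the glued surface is `Torus`, with `C = C' = C''` the curve at height `0`.

Vertices of `C'` are numbered `p = 0, …, d - 1`, where `p` is the label minus one. Vertices of
`C''` are numbered `q = 0, …, d - 1` starting with the first arc that joins `C''` to the next
lower cycle, which has the label `1 - r`, so `q` is the label minus one plus `r` (mod `d`).
In cyclic order, starting from number `0`,
* `C'` has `a` arcs to the next upper cycle, `b` arcs to the next lower cycle, `c` arcs to the lower
  cycle with the same index, `a` arcs to the previous upper cycle;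
* `C''` has `a` arcs to the next lower cycle, `c` arcs to the upper cycle with the same index,
  `b` arcs to the previous upper cycle, `a` arcs to the previous lower cycle.
As `n = 1`, all the upper cycles are `C'` and all the lower cycles are `C''`. -/

/-- The number of vertices on each of the cycles. -/
def numVertices (a b c : ℕ) : ℕ := 2 * a + b + c

/-- The point of the universal cover of the annulus at angle `x / d` and height `t`. -/
noncomputable def pt (d : ℕ) (x t : ℝ) : ℝ × ℝ := (x / d, t)

/-- The arc joining the vertex `p` of `C'` with the vertex `d - 1 - p` of `C'`, for `p < a`; it cuts
off the part of `C'` between the numbers `-1 - p` and `p`. -/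
noncomputable def upperArc (d p : ℕ) : Set (ℝ × ℝ) :=
  segment ℝ (pt d p 1) (pt d (-1 / 2) (1 - (2 * p + 1) / (6 * d))) ∪
  segment ℝ (pt d (-1 / 2) (1 - (2 * p + 1) / (6 * d))) (pt d (-1 - p) 1)

/-- The arc joining the vertex `q` of `C''` with the vertex `d - 1 - q` of `C''`, for `q < a`; it
cuts off the part of `C''` between the numbers `-1 - q` and `q`. -/
noncomputable def lowerArc (d : ℕ) (r : ℤ) (q : ℕ) : Set (ℝ × ℝ) :=
  segment ℝ (pt d (q - r) 0) (pt d (-1 / 2 - r) ((2 * q + 1) / (6 * d))) ∪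
  segment ℝ (pt d (-1 / 2 - r) ((2 * q + 1) / (6 * d))) (pt d (-1 - q - r) 0)

/-- An arc going down from `C'` at `x / d` to `C''` at `y / d`: vertical in the upper and
lower thirds of the annulus (which contain the arcs above), straight in the middle third. -/
noncomputable def throughArc (d : ℕ) (x y : ℝ) : Set (ℝ × ℝ) :=
  segment ℝ (pt d x 1) (pt d x (2 / 3)) ∪
  segment ℝ (pt d x (2 / 3)) (pt d y (1 / 3)) ∪
  segment ℝ (pt d y (1 / 3)) (pt d y 0)

/-- The union of all the arcs, in the universal cover of the annulus. The `k`-th oblique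
arc joins the vertex `a + k` of `C'` with the vertex `a + c + k` of `C''`, which lies at
`a + c + k - r`, or equivalently at `a + c + k - r - d` (mod `d`). The `k`-th vertical
arc joins the vertex `a + b + k` of `C'` with the vertex `a + k` of `C''`. -/
noncomputable def arcs (a b c : ℕ) (r : ℤ) : Set (ℝ × ℝ) :=
  (⋃ p : Fin a, upperArc (numVertices a b c) p) ∪
  (⋃ q : Fin a, lowerArc (numVertices a b c) r q) ∪
  (⋃ k : Fin b, throughArc (numVertices a b c) (a + (k : ℕ))
    (a + c + (k : ℕ) - r - numVertices a b c)) ∪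
  (⋃ k : Fin c, throughArc (numVertices a b c) (a + b + (k : ℕ)) (a + (k : ℕ) - r))

/-- The curve `C = C' = C''` on the glued surface. -/
def curveC : Set Torus := {v | v.2 = 0}

/-- The union of the cycles of the system `𝒟` on the glued surface. -/
noncomputable def curveD (a b c : ℕ) (r : ℤ) : Set Torus := torusProj '' arcs a b c r

/-- Admissibility of `(a, b, c, 1, r, 0)`: `a + b + c > 0`, the system `𝒟` has exactly one cycle
(its cycles are the connected components of their union), and the cut along `𝒟`
does not disconnect the torus. -/
def Admissible (a b c : ℕ) (r : ℤ) : Prop :=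
  0 < a + b + c ∧ IsConnected (curveD a b c r) ∧ IsConnected (curveD a b c r)ᶜ

/-- `M` is the Dunwoody manifold `M(a, b, c, 1, r, 0)`. -/
def IsDunwoodyManifold (a b c : ℕ) (r : ℤ) (M : Type*) [TopologicalSpace M] : Prop :=
  IsRepresentedBy M curveC (curveD a b c r)

/-! ### The word associated with the diagram -/

/-- The other end of the arc with a given end. The end `(true, p)` is the vertex number `p`
of `C'`, the end `(false, q)` is the vertex number `q` of `C''`. -/
def otherEnd (a b c : ℕ) : Bool × ℤ → Bool × ℤ
  | (true, p) =>
      if p < a ∨ a + b + c ≤ p then (true, 2 * a + b + c - 1 - p)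
      else if p < a + b then (false, p + c)
      else (false, p - b)
  | (false, q) =>
      if q < a ∨ a + b + c ≤ q then (false, 2 * a + b + c - 1 - q)
      else if q < a + c then (true, q + b)
      else (true, q - c)

/-- The vertex glued to a given vertex: it has the same label on the other circle. -/
def gluedVertex (d : ℕ) (r : ℤ) : Bool × ℤ → Bool × ℤ
  | (true, p) => (false, (p + r) % d)
  | (false, q) => (true, (q - r) % d)

/-- The initial end of the arc `e_{h+1}` of the oriented cycle `D₁`, where `e₁` comes out
from the vertex of `C'` labelled `a + b + 1` (mod `d`). -/
def arcStart (a b c : ℕ) (r : ℤ) (h : ℕ) : Bool × ℤ :=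
  (fun e => gluedVertex (numVertices a b c) r (otherEnd a b c e))^[h]
    (true, ((a : ℤ) + b) % (numVertices a b c))

/-- The word `w` in the free group `F₁` obtained by reading the arcs `e₁, …, e_d` of `D₁`: the letter
is `x` for an arc that comes out from `C'`, and `x⁻¹` for an arc that comes out from `C''`. -/
def word (a b c : ℕ) (r : ℤ) : FreeGroup (Fin 1) :=
  ((List.range (numVertices a b c)).map fun h =>
    if (arcStart a b c r h).1 then FreeGroup.of 0 else (FreeGroup.of 0)⁻¹).prod

/-- The exponent sum of an element of a free group: the homomorphism to `ℤ` sending each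
generator to `1`. -/
def exponentSum {n : ℕ} (w : FreeGroup (Fin n)) : ℤ :=
  Multiplicative.toAdd (FreeGroup.lift (fun _ : Fin n => Multiplicative.ofAdd (1 : ℤ)) w)

/-! ### The model manifolds -/

/-- The unit sphere of `ℝ⁴`. -/
abbrev S3 : Type := Metric.sphere (0 : EuclideanSpace ℝ (Fin 4)) 1

/-- The unit sphere of `ℝ³`. -/
abbrev S2 : Type := Metric.sphere (0 : EuclideanSpace ℝ (Fin 3)) 1

/-- The unit sphere of `ℂ²`. -/
abbrev S3C : Type := Metric.sphere (0 : EuclideanSpace ℂ (Fin 2)) 1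

/-- The orbit relation of the action of the cyclic group of order `p` on the unit sphere of `ℂ²`
generated by `(z, w) ↦ (e^{2πi/p} z, e^{2πiq/p} w)`. -/
def lensSetoid (p q : ℕ) : Setoid S3C where
  r u v := ∃ k : ℤ,
    v.1 0 = Complex.exp (2 * Real.pi * Complex.I * k / p) * u.1 0 ∧
    v.1 1 = Complex.exp (2 * Real.pi * Complex.I * (k * q) / p) * u.1 1
  iseqv := by
    refine ⟨fun u => ⟨0, by simp, by simp⟩, ?_, ?_⟩
    · rintro u v ⟨k, h0, h1⟩
      refine ⟨-k, ?_, ?_⟩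
      · rw [h0, ← mul_assoc, ← Complex.exp_add]
        have : 2 * (Real.pi : ℂ) * Complex.I * ((-k : ℤ) : ℂ) / p
            + 2 * Real.pi * Complex.I * k / p = 0 := by push_cast; ring
        rw [this]; simp
      · rw [h1, ← mul_assoc, ← Complex.exp_add]
        have : 2 * (Real.pi : ℂ) * Complex.I * (((-k : ℤ) : ℂ) * q) / p
            + 2 * Real.pi * Complex.I * (k * q) / p = 0 := by push_cast; ring
        rw [this]; simp
    · rintro u v w ⟨k, h0, h1⟩ ⟨l, h2, h3⟩
      refine ⟨l + k, ?_, ?_⟩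
      · rw [h2, h0, ← mul_assoc, ← Complex.exp_add]
        congr 2; push_cast; ring
      · rw [h3, h1, ← mul_assoc, ← Complex.exp_add]
        congr 2; push_cast; ring

/-- The lens space `L(p, q)` (for `p > 0` and `q` prime to `p`). -/
abbrev LensSpace (p q : ℕ) : Type := Quotient (lensSetoid p q)

end Dunwoody

-- The manifold depends on very little. A homeomorphism of the torus that maps `curveC` onto itself
-- extends over the solid torus (`extends_of_image_curveC`, Alexander's trick after cutting along a
-- meridian disc). Hence a represented manifold is determined by the curve `D`
-- (`isRepresentedBy_iff`, `IsGluedAlong.unique`), and `D` may be changed by any homeomorphism of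
-- the torus that extends over the first solid torus (`IsGluedAlong.of_related`). Explicit
-- decompositions give the models: a curve parallel to `C` gives `S¹ × S²` (`isGluedAlong_product`),
-- and the line `n x + m t ∈ ℤ` gives the lens space `L(n, β)` with `β m ≡ 1` modulo `n`, which is
-- `S³` for `n = 1` (`isGluedAlong_lensSpace`, `isGluedAlong_S3`). It remains to bring `D` to one of
-- these forms and to read off `n`.
--
-- Cut open along `C`, the torus is a strip whose two sides are glued by a homeomorphism `φ` of the
-- circle, and `D` is drawn in it by vertical strands that are born and die in pairs. Since the top
-- level is a copy of the bottom one, births and deaths balance. Moving the cut permutes the events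
-- cyclically, so a birth can be placed directly before a death. If the two have no strand in common
-- they are interchanged, which lowers the number of strands. If they share one strand they cancel,
-- at the cost of a change of `φ`, unless they close up around the annulus; in that case the
-- resulting circle is all of `D`. If they share both strands and bound a disc, the complement of
-- `D` is disconnected, which admissibility excludes. When no events are left, `φ` permutes the
-- strands transitively, and averaging the iterates of `φ` gives a coordinate in which the strands
-- are straight lines (`exists_linearCurve`). This is `isStandard_of_draw`.
--
-- The number `n` is followed by means of weights in an abelian group: the two strands of a birth
-- get opposite weights, so the total weight of a level never changes. At the end all weights are
-- `g` or `-g` for one `g`, and the total is `n • g`, or `0` for the parallel curve. The weights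
-- used for the diagram are the functions `direction` on the set of ends of arcs: the indicator of
-- the cycle of an end, under "run along the arc, then pass through the gluing", minus the indicator
-- of the reversed cycle. That all of them agree up to sign shows that the ends form a single curve,
-- so that the word runs once along `D`. Their sum over the vertices is the exponent sum times the
-- weight of the starting end (`sum_direction`), so `n` is the absolute value of the exponent sum.

local notation "𝕋" => UnitAddCircle

/-! ### Extension of homeomorphisms of the boundary torus over the solid torus. -/

namespace Dunwoody

open Topology unitInterval

/-! ### Quotient maps with the same fibres -/

/-- Serves to produce homeomorphisms without formulas for the inverse: two spaces are presented as
quotients of one model, and only the fibres have to be compared. -/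
theorem exists_homeomorph_of_fibers {X Y Z : Type*} [TopologicalSpace X] [TopologicalSpace Y]
    [TopologicalSpace Z] {q : X → Y} {q' : X → Z} (hq : IsQuotientMap q) (hq' : IsQuotientMap q')
    (h : ∀ a b, q a = q b ↔ q' a = q' b) : ∃ K : Y ≃ₜ Z, ∀ x, K (q x) = q' x := by
  let f : C(X, Y) := ⟨q, hq.continuous⟩
  let g : C(X, Z) := ⟨q', hq'.continuous⟩
  have hf : IsQuotientMap f := hq
  have hg : IsQuotientMap g := hq'
  let F := hf.lift g fun a b hab => (h a b).1 hab
  let G := hg.lift f fun a b hab => (h a b).2 hab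
  have hF : ∀ x, F (q x) = q' x := fun x => by
    have := hf.lift_comp g (fun a b hab => (h a b).1 hab)
    exact congrArg (fun u : C(X, Z) => u x) this
  have hG : ∀ x, G (q' x) = q x := fun x => by
    have := hg.lift_comp f (fun a b hab => (h a b).2 hab)
    exact congrArg (fun u : C(X, Y) => u x) this
  refine ⟨⟨⟨F, G, ?_, ?_⟩, F.continuous, G.continuous⟩, hF⟩
  · intro y
    obtain ⟨x, rfl⟩ := hq.surjective y
    rw [hF, hG]
  · intro z
    obtain ⟨x, rfl⟩ := hq'.surjective z
    rw [hG, hF]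

theorem isQuotientMap_of_compact {X Y : Type*} [TopologicalSpace X] [TopologicalSpace Y]
    [CompactSpace X] [T2Space Y] {q : X → Y} (hc : Continuous q) (hs : Function.Surjective q) :
    IsQuotientMap q :=
  hc.isClosedMap.isQuotientMap hc hs

/-! ### The circle -/

theorem coe_eq_coe_iff {x y : ℝ} : (x : 𝕋) = y ↔ ∃ n : ℤ, y = x + n := by
  rw [eq_comm, ← sub_eq_zero, ← AddCircle.coe_sub, AddCircle.coe_eq_zero_iff]
  constructor
  · rintro ⟨n, hn⟩
    exact ⟨n, by simp at hn; linarith⟩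
  · rintro ⟨n, hn⟩
    exact ⟨n, by simp; linarith⟩

theorem coe_eq_zero_iff {x : ℝ} : (x : 𝕋) = 0 ↔ ∃ n : ℤ, x = n := by
  have := @coe_eq_coe_iff 0 x
  rw [AddCircle.coe_zero, eq_comm] at this
  simpa using this

@[simp] theorem coe_add_int (x : ℝ) (n : ℤ) : ((x + n : ℝ) : 𝕋) = x :=
  (coe_eq_coe_iff.2 ⟨n, rfl⟩).symm

theorem exists_coe_Ico (a : 𝕋) (b : ℝ) : ∃ x ∈ Ico b (b + 1), (x : 𝕋) = a := by
  obtain ⟨x, rfl⟩ := QuotientAddGroup.mk_surjective a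
  refine ⟨b + Int.fract (x - b), ⟨by linarith [Int.fract_nonneg (x - b)],
    by linarith [Int.fract_lt_one (x - b)]⟩, ?_⟩
  refine coe_eq_coe_iff.2 ⟨⌊x - b⌋, ?_⟩
  have := Int.fract_add_floor (x - b)
  linarith

/-- The point of the unit circle of `ℂ` at a given angle. -/
noncomputable def ang (a : 𝕋) : Circle := AddCircle.toCircle a

theorem continuous_ang : Continuous ang := AddCircle.continuous_toCircle

theorem ang_injective : Function.Injective ang := AddCircle.injective_toCircle one_ne_zero

theorem ang_coe (x : ℝ) : ang (x : 𝕋) = Circle.exp (2 * Real.pi * x) := by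
  rw [ang, AddCircle.toCircle_apply_mk, div_one]

theorem ang_zero : ang 0 = 1 := AddCircle.toCircle_zero

theorem ang_surjective : Function.Surjective ang := by
  intro z
  refine ⟨((Complex.arg z / (2 * Real.pi) : ℝ) : 𝕋), ?_⟩
  rw [ang_coe, mul_div_cancel₀ _ (by positivity), Circle.exp_arg]

theorem exists_polar (z : ℂ) : ∃ a : 𝕋, z = ‖z‖ * (ang a : ℂ) := by
  by_cases h : z = 0
  · exact ⟨0, by simp [h]⟩
  · have hz : ‖z‖ ≠ 0 := norm_ne_zero_iff.2 h
    obtain ⟨a, ha⟩ := ang_surjective ⟨z / ‖z‖, by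
      simp [Submonoid.unitSphere, hz]⟩
    refine ⟨a, ?_⟩
    rw [ha]
    exact (mul_div_cancel₀ z (by exact_mod_cast hz)).symm

/-! ### Extending homeomorphisms of the boundary over the solid torus -/

theorem isPreconnected_open_cylinder :
    IsPreconnected {u : I × 𝕋 | (0 : ℝ) < u.1 ∧ (u.1 : ℝ) < 1} := by
  have : {u : I × 𝕋 | (0 : ℝ) < u.1 ∧ (u.1 : ℝ) < 1}
      = (Ioo (0 : I) 1) ×ˢ (univ : Set 𝕋) := by
    ext u
    simp only [mem_ofPred_eq, mem_prod, mem_Ioo, mem_univ, and_true]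
    rfl
  rw [this]
  exact isPreconnected_Ioo.prod isPreconnected_univ

/-- If `k (1, a)` were `0`, then by connectedness of the circle `k` would vanish on the whole upper
end. Its maximum would be less than `1`, and `κ`, which is onto, would miss the heights between this
maximum and `1`. -/
theorem height_end_aux (κ : Torus ≃ₜ Torus) (hκ : ∀ v, (κ v).2 = 0 ↔ v.2 = 0)
    (k : C(I × 𝕋, ℝ))
    (hk : ∀ t a, ((k (t, a) : ℝ) : 𝕋) = (κ (a, ((t : ℝ) : 𝕋))).2)
    (h0 : ∀ a, k (0, a) = 0)
    (hin : ∀ (t : I) a, (0 : ℝ) < t → (t : ℝ) < 1 → 0 < k (t, a) ∧ k (t, a) < 1) (a : 𝕋) :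
    k (1, a) = 1 := by
  have hint : ∀ b, k (1, b) = 0 ∨ k (1, b) = 1 := by
    intro b
    have h1 : ((k (1, b) : ℝ) : 𝕋) = 0 := by
      rw [hk, hκ]
      simp
    obtain ⟨n, hn⟩ := coe_eq_zero_iff.1 h1
    have hmem : (1 : I) ∈ closure (Ioo (0 : I) 1) := by
      rw [closure_Ioo (by simp)]
      simp
    have hcl : k (1, b) ∈ Icc (0 : ℝ) 1 := by
      have hc : Continuous fun t : I => k (t, b) := by fun_prop
      have := map_mem_closure hc hmem (t := Icc (0 : ℝ) 1) (fun t ht => by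
        have := hin t b ht.1 ht.2
        exact ⟨this.1.le, this.2.le⟩)
      rwa [isClosed_Icc.closure_eq] at this
    rw [hn] at hcl ⊢
    have h2 : 0 ≤ n := by exact_mod_cast hcl.1
    have h3 : n ≤ 1 := by exact_mod_cast hcl.2
    interval_cases n <;> simp
  by_contra hne
  have ha0 : k (1, a) = 0 := (hint a).resolve_right hne
  have hall : ∀ b, k (1, b) = 0 := by
    intro b
    refine (hint b).resolve_right fun hb => ?_
    have hc : Continuous fun b : 𝕋 => k (1, b) := by fun_prop
    obtain ⟨c, hc⟩ := mem_range_of_exists_le_of_exists_ge hc (c := 1 / 2)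
      ⟨a, by rw [ha0]; norm_num⟩ ⟨b, by rw [hb]; norm_num⟩
    rcases hint c with h | h <;> simp only [h] at hc <;> norm_num at hc
  obtain ⟨m, -, hm⟩ := isCompact_univ.exists_isMaxOn (f := k) ⟨(0, 0), mem_univ _⟩
    k.continuous.continuousOn
  have hlt : ∀ u, k u < 1 := by
    rintro ⟨t, b⟩
    rcases eq_or_lt_of_le t.2.1 with ht | ht
    · have : t = 0 := Subtype.ext ht.symm
      rw [this, h0]; norm_num
    rcases eq_or_lt_of_le t.2.2 with ht1 | ht1
    · have : t = 1 := Subtype.ext ht1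
      rw [this, hall]; norm_num
    · exact (hin t b ht ht1).2
  obtain ⟨y, hy0, hy1⟩ := exists_between (max_lt (hlt m) one_pos)
  obtain ⟨⟨b, c⟩, hbc⟩ := κ.surjective (0, ((y : ℝ) : 𝕋))
  obtain ⟨t, ht, rfl⟩ := exists_coe_Ico c 0
  rw [zero_add] at ht
  have e1 := hk ⟨t, ht.1, ht.2.le⟩ b
  simp only at e1
  rw [hbc] at e1
  obtain ⟨n, hn⟩ := coe_eq_coe_iff.1 e1
  have hy2 : 0 < y := lt_of_le_of_lt (le_max_right _ _) hy0
  have hle : k (⟨t, ht.1, ht.2.le⟩, b) < y :=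
    lt_of_le_of_lt (hm (mem_univ _)) (lt_of_le_of_lt (le_max_left _ _) hy0)
  have hge : 0 ≤ k (⟨t, ht.1, ht.2.le⟩, b) := by
    rcases eq_or_lt_of_le ht.1 with h | h
    · have : (⟨t, ht.1, ht.2.le⟩ : I) = 0 := Subtype.ext h.symm
      rw [this, h0]
    · exact (hin ⟨t, ht.1, ht.2.le⟩ b h ht.2).1.le
  have n1 : (0 : ℝ) < n := by linarith
  have n2 : (n : ℝ) < 1 := by linarith
  have n1' : 0 < n := by exact_mod_cast n1
  have n2' : n < 1 := by exact_mod_cast n2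
  omega

/-- Cut along `curveC` the torus is a cylinder, and `κ` acts on it once its second coordinate is
lifted to `ℝ`. The lift avoids the integers in the interior of the cylinder, so by connectedness it
stays in `(0, 1)` or in `(-1, 0)` there. In the second case the two ends are exchanged, `j = -1`,
and the lift is raised by `1`. -/
theorem exists_height (κ : Torus ≃ₜ Torus) (hκ : ∀ v, (κ v).2 = 0 ↔ v.2 = 0) :
    ∃ (k : C(I × 𝕋, ℝ)) (j : ℝ), (j = 1 ∨ j = -1) ∧
      (∀ t a, ((k (t, a) : ℝ) : 𝕋) = (κ (a, ((t : ℝ) : 𝕋))).2) ∧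
      (∀ (t : I) a, (0 : ℝ) < t → (t : ℝ) < 1 → 0 < k (t, a) ∧ k (t, a) < 1) ∧
      ∀ a, k (0, a) = (1 - j) / 2 ∧ k (1, a) = (1 + j) / 2 := by
  let H : C(I × 𝕋, 𝕋) :=
    ⟨fun u => (κ (u.2, ((u.1 : ℝ) : 𝕋))).2, by
      have : Continuous (fun x : ℝ => (x : 𝕋)) := AddCircle.continuous_mk' 1
      fun_prop⟩
  have H0 : ∀ a, H (0, a) = (((0 : C(𝕋, ℝ)) a : ℝ) : 𝕋) := by
    intro a
    simp only [ContinuousMap.zero_apply, AddCircle.coe_zero]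
    exact (hκ _).2 (by simp)
  have cov := AddCircle.isCoveringMap_coe (1 : ℝ)
  let k := cov.liftHomotopy H 0 H0
  have hk : ∀ t a, ((k (t, a) : ℝ) : 𝕋) = (κ (a, ((t : ℝ) : 𝕋))).2 :=
    fun t a => congrFun (cov.liftHomotopy_lifts H 0 H0) (t, a)
  have h0 : ∀ a, k (0, a) = 0 := fun a => cov.liftHomotopy_zero H 0 H0 a
  have hnint : ∀ (t : I) a, (0 : ℝ) < t → (t : ℝ) < 1 → ∀ n : ℤ, k (t, a) ≠ n := by
    intro t a ht0 ht1 n hn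
    have h1 : ((k (t, a) : ℝ) : 𝕋) = 0 := coe_eq_zero_iff.2 ⟨n, hn⟩
    rw [hk, hκ] at h1
    obtain ⟨m, hm⟩ := coe_eq_zero_iff.1 h1
    rw [hm] at ht0 ht1
    have h2 : 0 < m := by exact_mod_cast ht0
    have h3 : m < 1 := by exact_mod_cast ht1
    omega
  set U := {u : I × 𝕋 | (0 : ℝ) < u.1 ∧ (u.1 : ℝ) < 1} with hU
  have hpre : (k '' U).OrdConnected :=
    (isPreconnected_open_cylinder.image k k.continuous.continuousOn).ordConnected
  -- The lift is `0` on the lower end, so close to it the values lie in `(-1, 1)`; one such point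
  -- decides between the two intervals.
  obtain ⟨u0, hu0, hv0⟩ : ∃ u0 ∈ U, k u0 ∈ Ioo (-1 : ℝ) 1 := by
    have hmem : ((0 : I), (0 : 𝕋)) ∈ closure U := by
      have h1 : (0 : I) ∈ closure (Ioo (0 : I) 1) := by
        rw [closure_Ioo (by simp)]
        simp
      have h2 : Continuous fun t : I => (t, (0 : 𝕋)) := by fun_prop
      exact map_mem_closure (f := fun t : I => (t, (0 : 𝕋))) h2 h1
        (fun t ht => ⟨ht.1, ht.2⟩)
    have hopen : IsOpen (k ⁻¹' Ioo (-1 : ℝ) 1) := isOpen_Ioo.preimage k.continuous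
    obtain ⟨u, hu1, hu2⟩ := mem_closure_iff.1 hmem _ hopen (by simp [h0])
    exact ⟨u, hu2, hu1⟩
  have hne0 : ∀ u ∈ U, ∀ n : ℤ, k u ≠ n := fun u hu n => hnint u.1 u.2 hu.1 hu.2 n
  have key : ∀ u ∈ U, ∀ n : ℤ, ¬ ((n : ℝ) ∈ Icc (k u0) (k u) ∨ (n : ℝ) ∈ Icc (k u) (k u0)) := by
    rintro u hu n (h | h)
    · obtain ⟨w, hw, e⟩ := hpre.out (mem_image_of_mem k hu0) (mem_image_of_mem k hu) h
      exact hne0 w hw n e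
    · obtain ⟨w, hw, e⟩ := hpre.out (mem_image_of_mem k hu) (mem_image_of_mem k hu0) h
      exact hne0 w hw n e
  have z0 := hne0 u0 hu0 0
  rw [Int.cast_zero] at z0
  rcases lt_or_gt_of_ne z0 with hneg | hpos
  · have hin : ∀ (t : I) a, (0 : ℝ) < t → (t : ℝ) < 1 → -1 < k (t, a) ∧ k (t, a) < 0 := by
      intro t a ht0 ht1
      have e1 := key (t, a) ⟨ht0, ht1⟩ 0
      have e2 := key (t, a) ⟨ht0, ht1⟩ (-1)
      simp only [mem_Icc, Int.cast_zero, Int.cast_neg, Int.cast_one, not_or, not_and, not_le] at e1 e2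
      exact ⟨e2.2.mt (by simp [hv0.1.le]) |> lt_of_not_ge, e1.1 hneg.le⟩
    let κ' : Torus ≃ₜ Torus :=
      κ.trans ((Homeomorph.refl 𝕋).prodCongr (Homeomorph.neg 𝕋))
    have hκ' : ∀ v, (κ' v).2 = -(κ v).2 := fun v => rfl
    have h1 := height_end_aux κ' (by intro v; rw [hκ', neg_eq_zero, hκ]) (-k)
      (by intro t a; rw [hκ', ← hk]; simp) (by intro a; simp [h0])
      (by intro t a ht0 ht1; have := hin t a ht0 ht1; simp; constructor <;> linarith)
    refine ⟨k + 1, -1, Or.inr rfl, ?_, ?_, ?_⟩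
    · intro t a
      rw [← hk]
      simp
    · intro t a ht0 ht1
      have := hin t a ht0 ht1
      simp only [ContinuousMap.add_apply, ContinuousMap.one_apply]
      constructor <;> linarith
    · intro a
      have := h1 a
      simp only [ContinuousMap.neg_apply] at this
      simp only [ContinuousMap.add_apply, ContinuousMap.one_apply, h0]
      constructor
      · norm_num
      · linarith
  · have hin : ∀ (t : I) a, (0 : ℝ) < t → (t : ℝ) < 1 → 0 < k (t, a) ∧ k (t, a) < 1 := by
      intro t a ht0 ht1
      have e1 := key (t, a) ⟨ht0, ht1⟩ 0
      have e2 := key (t, a) ⟨ht0, ht1⟩ 1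
      simp only [mem_Icc, Int.cast_zero, Int.cast_one, not_or, not_and, not_le] at e1 e2
      exact ⟨e1.2.mt (by simp [hpos.le]) |> lt_of_not_ge, e2.1 hv0.2.le⟩
    have h1 := height_end_aux κ hκ k hk h0 hin
    refine ⟨k, 1, Or.inl rfl, hk, hin, fun a => ?_⟩
    rw [h0, h1]
    norm_num

@[simp] theorem norm_ang (a : 𝕋) : ‖(ang a : ℂ)‖ = 1 := Circle.norm_coe _

/-- The standard parametrization of the boundary of the solid torus. -/
noncomputable def bdry (v : Torus) : SolidTorus :=
  (⟨(ang v.1 : ℂ), by simp⟩, ang v.2)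

theorem continuous_bdry : Continuous bdry := by
  have := continuous_ang
  unfold bdry
  fun_prop

theorem bdry_injective : Function.Injective bdry := by
  intro v w h
  simp only [bdry, Prod.mk.injEq, Subtype.mk.injEq] at h
  exact Prod.ext (ang_injective (Circle.ext h.1)) (ang_injective h.2)

theorem range_bdry : range bdry = solidTorusBoundary := by
  ext v
  constructor
  · rintro ⟨w, rfl⟩
    simp [bdry, solidTorusBoundary]
  · intro hv
    have hv : ‖(v.1 : ℂ)‖ = 1 := hv
    obtain ⟨a, ha⟩ := exists_polar (v.1 : ℂ)
    obtain ⟨c, hc⟩ := ang_surjective v.2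
    rw [hv] at ha
    refine ⟨(a, c), ?_⟩
    refine Prod.ext (Subtype.ext ?_) hc
    rw [ha]
    simp [bdry]

theorem bdry_image_curveC : bdry '' curveC = solidTorusMeridian := by
  ext v
  constructor
  · rintro ⟨w, hw, rfl⟩
    have hw : w.2 = 0 := hw
    simp [bdry, solidTorusMeridian, hw, ang_zero]
  · intro hv
    have hv : ‖(v.1 : ℂ)‖ = 1 ∧ v.2 = 1 := hv
    obtain ⟨w, rfl⟩ : v ∈ range bdry := by rw [range_bdry]; exact hv.1
    refine ⟨w, ?_, rfl⟩
    have : ang w.2 = ang 0 := by rw [ang_zero]; exact hv.2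
    exact ang_injective this

/-- A height function for a homeomorphism of the torus which preserves the curve at height `0`. -/
structure IsHeight (κ : Torus ≃ₜ Torus) (k : C(I × 𝕋, ℝ)) (j : ℝ) : Prop where
  pres : ∀ v, (κ v).2 = 0 ↔ v.2 = 0
  sign : j = 1 ∨ j = -1
  lift : ∀ t a, ((k (t, a) : ℝ) : 𝕋) = (κ (a, ((t : ℝ) : 𝕋))).2
  mem : ∀ (t : I) a, (0 : ℝ) < t → (t : ℝ) < 1 → 0 < k (t, a) ∧ k (t, a) < 1
  ends : ∀ a, k (0, a) = (1 - j) / 2 ∧ k (1, a) = (1 + j) / 2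

/-- The cone over the boundary of a cylinder: `(a, ρ, s, l)` is the point at distance `l` from the
centre, in the direction of the point at angle `a`, radius `ρ` and height `s`. -/
def coneSet : Set (𝕋 × ℝ × ℝ × ℝ) :=
  {x | x.2.1 ∈ Icc (0 : ℝ) 1 ∧ x.2.2.1 ∈ Icc (-1 : ℝ) 1 ∧ x.2.2.2 ∈ Icc (0 : ℝ) 1 ∧
    (x.2.1 = 1 ∨ |x.2.2.1| = 1)}

instance : CompactSpace coneSet := by
  have h : IsCompact ((univ : Set 𝕋) ×ˢ (Icc (0 : ℝ) 1 ×ˢ (Icc (-1 : ℝ) 1 ×ˢ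
      Icc (0 : ℝ) 1))) :=
    isCompact_univ.prod (isCompact_Icc.prod (isCompact_Icc.prod isCompact_Icc))
  have hc : IsClosed {x : 𝕋 × ℝ × ℝ × ℝ | x.2.1 = 1 ∨ |x.2.2.1| = 1} := by
    have h1 : IsClosed {x : 𝕋 × ℝ × ℝ × ℝ | x.2.1 = 1} :=
      isClosed_eq (by fun_prop) (by fun_prop)
    have h2 : IsClosed {x : 𝕋 × ℝ × ℝ × ℝ | |x.2.2.1| = 1} :=
      isClosed_eq (by fun_prop) (by fun_prop)
    exact h1.union h2
  rw [← isCompact_iff_compactSpace]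
  convert! h.inter_right hc using 1
  ext x
  constructor
  · rintro ⟨h1, h2, h3, h4⟩
    exact ⟨⟨mem_univ _, h1, h2, h3⟩, h4⟩
  · rintro ⟨⟨-, h1, h2, h3⟩, h4⟩
    exact ⟨h1, h2, h3, h4⟩

/-- Heights of the cylinder run over `[-1, 1]`, so that the cone point is at height `0`; times run
over `[0, 1]`. The projection only makes the function total. -/
noncomputable def coneTime (s : ℝ) : I := projIcc 0 1 zero_le_one ((s + 1) / 2)

/-- The height of the image of a point of the boundary of the cylinder. -/
noncomputable def coneHeight (k : C(I × 𝕋, ℝ)) (j : ℝ)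
    (x : 𝕋 × ℝ × ℝ × ℝ) : ℝ :=
  x.2.1 * (2 * k (coneTime x.2.2.1, x.1) - 1) + (1 - x.2.1) * (x.2.2.1 * j)

noncomputable def coneAngle (κ : Torus ≃ₜ Torus) (x : 𝕋 × ℝ × ℝ × ℝ) : 𝕋 :=
  (κ (x.1, ((coneTime x.2.2.1 : ℝ) : 𝕋))).1

theorem coneTime_coe {s : ℝ} (hs : s ∈ Icc (-1 : ℝ) 1) : (coneTime s : ℝ) = (s + 1) / 2 := by
  rw [coneTime, projIcc_of_mem zero_le_one ⟨by linarith [hs.1], by linarith [hs.2]⟩]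

namespace IsHeight

variable {κ : Torus ≃ₜ Torus} {k : C(I × 𝕋, ℝ)} {j : ℝ}

theorem abs_j (h : IsHeight κ k j) : |j| = 1 := by
  rcases h.sign with h | h <;> simp [h]

/-- On a cap the image height must not depend on the radius. There `k` is constant, and `2 k - 1`
agrees with the other term `s j` of the interpolation. -/
theorem coneHeight_cap (h : IsHeight κ k j) (x : 𝕋 × ℝ × ℝ × ℝ)
    (hs : |x.2.2.1| = 1) : coneHeight k j x = x.2.2.1 * j := by
  rcases eq_or_eq_neg_of_abs_eq hs with hs | hs
  · have : coneTime x.2.2.1 = 1 := by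
      apply Subtype.ext
      rw [coneTime_coe (by rw [hs]; simp), hs]; norm_num
    rw [coneHeight, this, (h.ends _).2, hs]
    ring
  · have : coneTime x.2.2.1 = 0 := by
      apply Subtype.ext
      rw [coneTime_coe (by rw [hs]; simp), hs]; norm_num
    rw [coneHeight, this, (h.ends _).1, hs]
    ring

theorem coneTime_mem {x : 𝕋 × ℝ × ℝ × ℝ} (hx : x ∈ coneSet) (hs : |x.2.2.1| ≠ 1) :
    0 < (coneTime x.2.2.1 : ℝ) ∧ (coneTime x.2.2.1 : ℝ) < 1 := by
  have h1 : |x.2.2.1| < 1 := lt_of_le_of_ne (abs_le.2 hx.2.1) hs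
  rw [abs_lt] at h1
  rw [coneTime_coe hx.2.1]
  constructor <;> linarith

theorem coneHeight_side (h : IsHeight κ k j) {x : 𝕋 × ℝ × ℝ × ℝ} (hx : x ∈ coneSet)
    (hs : |x.2.2.1| ≠ 1) : x.2.1 = 1 ∧ coneHeight k j x = 2 * k (coneTime x.2.2.1, x.1) - 1 ∧
      |coneHeight k j x| < 1 := by
  have h1 : x.2.1 = 1 := hx.2.2.2.resolve_right hs
  have h2 : coneHeight k j x = 2 * k (coneTime x.2.2.1, x.1) - 1 := by
    rw [coneHeight, h1]; ring
  refine ⟨h1, h2, ?_⟩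
  have h3 := coneTime_mem hx hs
  have h4 := h.mem (coneTime x.2.2.1) x.1 h3.1 h3.2
  rw [h2, abs_lt]
  constructor <;> linarith

theorem coneHeight_abs (h : IsHeight κ k j) {x : 𝕋 × ℝ × ℝ × ℝ} (hx : x ∈ coneSet) :
    |coneHeight k j x| ≤ 1 ∧ (|coneHeight k j x| = 1 ↔ |x.2.2.1| = 1) := by
  by_cases hs : |x.2.2.1| = 1
  · have : |coneHeight k j x| = 1 := by
      rw [h.coneHeight_cap x hs, abs_mul, hs, h.abs_j, one_mul]
    exact ⟨this.le, by simp [this, hs]⟩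
  · have := (h.coneHeight_side hx hs).2.2
    exact ⟨this.le, by simp [this.ne, hs]⟩

end IsHeight

/-- The map from the cone to the solid torus extending a homeomorphism of the boundary. -/
noncomputable def coneMap {κ : Torus ≃ₜ Torus} {k : C(I × 𝕋, ℝ)} {j : ℝ}
    (_ : IsHeight κ k j) (x : coneSet) : SolidTorus :=
  (⟨((x.1.2.2.2 * x.1.2.1 : ℝ) : ℂ) * (ang (coneAngle κ x.1) : ℂ), by
    obtain ⟨h1, -, h3, -⟩ := x.2
    rw [mem_closedBall_zero_iff, norm_mul, Circle.norm_coe, mul_one, Complex.norm_real,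
      Real.norm_of_nonneg (mul_nonneg h3.1 h1.1)]
    exact mul_le_one₀ h3.2 h1.1 h1.2⟩,
  Circle.exp (Real.pi * (x.1.2.2.2 * coneHeight k j x.1 + 1)))

theorem continuous_coneMap {κ : Torus ≃ₜ Torus} {k : C(I × 𝕋, ℝ)} {j : ℝ}
    (h : IsHeight κ k j) : Continuous (coneMap h) := by
  have h1 := continuous_ang
  have h2 : Continuous coneTime := by unfold coneTime; fun_prop
  have h3 : Continuous (fun x : ℝ => (x : 𝕋)) := AddCircle.continuous_mk' 1
  have h4 : Continuous (coneAngle κ) := by unfold coneAngle; fun_prop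
  have h5 : Continuous (coneHeight k j) := by unfold coneHeight; fun_prop
  unfold coneMap
  fun_prop

/-- Heights from `-1` to `1` go exactly once around the core circle, so only the two extreme heights
are identified. -/
theorem exp_height_eq_iff {s s' : ℝ} (hs : |s| ≤ 1) (hs' : |s'| ≤ 1) :
    Circle.exp (Real.pi * (s + 1)) = Circle.exp (Real.pi * (s' + 1)) ↔
      s = s' ∨ (|s| = 1 ∧ s' = -s) := by
  have e : ∀ u : ℝ, Circle.exp (Real.pi * (u + 1)) = ang (((u + 1) / 2 : ℝ) : 𝕋) := by
    intro u
    rw [ang_coe]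
    congr 1
    ring
  rw [e, e, ang_injective.eq_iff, coe_eq_coe_iff]
  rw [abs_le] at hs hs'
  constructor
  · rintro ⟨n, hn⟩
    have h1 : (-1 : ℝ) ≤ n := by linarith
    have h2 : (n : ℝ) ≤ 1 := by linarith
    have h1' : -1 ≤ n := by exact_mod_cast h1
    have h2' : n ≤ 1 := by exact_mod_cast h2
    interval_cases n
    · have : s = 1 := by push_cast at hn; linarith
      have : s' = -1 := by push_cast at hn; linarith
      right; simp [*]
    · left; push_cast at hn; linarith
    · have : s = -1 := by push_cast at hn; linarith
      have : s' = 1 := by push_cast at hn; linarith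
      right; simp [*]
  · rintro (rfl | ⟨h1, rfl⟩)
    · exact ⟨0, by simp⟩
    · rcases eq_or_eq_neg_of_abs_eq h1 with rfl | rfl
      · exact ⟨-1, by norm_num⟩
      · exact ⟨1, by norm_num⟩

/-- The scale `l` is recovered as the larger of `l ρ` and `l |s|`, because one of `ρ` and `|s|` is
`1`. The other coordinates follow after division by `l`, except that the angle is lost at radius `0`
and the two caps are identified at scale `1`. -/
theorem cone_fiber {a a' : 𝕋} {ρ ρ' s s' l l' : ℝ} (hρ : 0 ≤ ρ ∧ ρ ≤ 1)
    (hρ' : 0 ≤ ρ' ∧ ρ' ≤ 1) (hs : |s| ≤ 1) (hs' : |s'| ≤ 1) (hl : 0 ≤ l ∧ l ≤ 1)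
    (hl' : 0 ≤ l' ∧ l' ≤ 1) (h1 : ρ = 1 ∨ |s| = 1) (h1' : ρ' = 1 ∨ |s'| = 1) :
    (((l * ρ : ℝ) : ℂ) * (ang a : ℂ) = ((l' * ρ' : ℝ) : ℂ) * (ang a' : ℂ) ∧
      Circle.exp (Real.pi * (l * s + 1)) = Circle.exp (Real.pi * (l' * s' + 1))) ↔
    l = l' ∧ (l = 0 ∨ (ρ = ρ' ∧ (ρ = 0 ∨ a = a') ∧ (s = s' ∨ (l = 1 ∧ |s| = 1 ∧ s' = -s)))) := by
  have hb : ∀ u v : ℝ, 0 ≤ u ∧ u ≤ 1 → |v| ≤ 1 → |u * v| ≤ 1 := by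
    intro u v hu hv
    rw [abs_mul, abs_of_nonneg hu.1]
    exact mul_le_one₀ hu.2 (abs_nonneg _) hv
  rw [exp_height_eq_iff (hb _ _ hl hs) (hb _ _ hl' hs')]
  constructor
  · rintro ⟨hz, hh⟩
    have hn : l * ρ = l' * ρ' := by
      have := congrArg norm hz
      simpa only [norm_mul, Circle.norm_coe, mul_one, Complex.norm_real,
        Real.norm_of_nonneg (mul_nonneg hl.1 hρ.1),
        Real.norm_of_nonneg (mul_nonneg hl'.1 hρ'.1)] using this
    have hn2 : l * |s| = l' * |s'| := by
      have : |l * s| = |l' * s'| := by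
        rcases hh with hh | ⟨-, hh⟩
        · rw [hh]
        · rw [hh, abs_neg]
      rwa [abs_mul, abs_mul, abs_of_nonneg hl.1, abs_of_nonneg hl'.1] at this
    have hll : l = l' := by
      apply le_antisymm
      · rcases h1 with h | h
        · rw [h, mul_one] at hn; rw [hn]
          exact mul_le_of_le_one_right hl'.1 hρ'.2
        · rw [h, mul_one] at hn2; rw [hn2]
          exact mul_le_of_le_one_right hl'.1 hs'
      · rcases h1' with h | h
        · rw [h, mul_one] at hn; rw [← hn]
          exact mul_le_of_le_one_right hl.1 hρ.2
        · rw [h, mul_one] at hn2; rw [← hn2]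
          exact mul_le_of_le_one_right hl.1 hs
    subst hll
    refine ⟨rfl, ?_⟩
    by_cases h0 : l = 0
    · exact Or.inl h0
    right
    have hρρ : ρ = ρ' := mul_left_cancel₀ h0 hn
    subst hρρ
    refine ⟨rfl, ?_, ?_⟩
    · by_cases hρ0 : ρ = 0
      · exact Or.inl hρ0
      · right
        have : ((l * ρ : ℝ) : ℂ) ≠ 0 := by exact_mod_cast mul_ne_zero h0 hρ0
        exact ang_injective (Circle.ext (mul_left_cancel₀ this hz))
    · rcases hh with hh | ⟨ha, hh⟩
      · exact Or.inl (mul_left_cancel₀ h0 hh)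
      · right
        rw [abs_mul, abs_of_nonneg hl.1] at ha
        have hl1 : l = 1 := le_antisymm hl.2 (by
          rw [← ha]; exact mul_le_of_le_one_right hl.1 hs)
        rw [hl1, one_mul] at ha
        rw [hl1, one_mul, one_mul] at hh
        exact ⟨hl1, ha, hh⟩
  · rintro ⟨rfl, h⟩
    rcases h with rfl | ⟨rfl, h2, h3⟩
    · simp
    · constructor
      · rcases h2 with rfl | rfl <;> simp
      · rcases h3 with rfl | ⟨rfl, h4, rfl⟩
        · exact Or.inl rfl
        · right; simpa using h4

/-- The point is that the condition does not mention `κ`: the cone maps of `κ` and of the identity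
have the same fibres. On the side of the cylinder, angle and height of the image determine the value
of `κ`, which is injective; on the caps only the restriction of `κ` to `curveC` matters. -/
theorem coneMap_eq_iff {κ : Torus ≃ₜ Torus} {k : C(I × 𝕋, ℝ)} {j : ℝ}
    (h : IsHeight κ k j) (x y : coneSet) : coneMap h x = coneMap h y ↔
      x.1.2.2.2 = y.1.2.2.2 ∧ (x.1.2.2.2 = 0 ∨ (x.1.2.1 = y.1.2.1 ∧
        (x.1.2.1 = 0 ∨ x.1.1 = y.1.1) ∧ (x.1.2.2.1 = y.1.2.2.1 ∨
          (x.1.2.2.2 = 1 ∧ |x.1.2.2.1| = 1 ∧ y.1.2.2.1 = -x.1.2.2.1)))) := by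
  obtain ⟨x, hx⟩ := x
  obtain ⟨y, hy⟩ := y
  have ax := h.coneHeight_abs hx
  have ay := h.coneHeight_abs hy
  have := cone_fiber (a := coneAngle κ x) (a' := coneAngle κ y) hx.1 hy.1 ax.1 ay.1
    hx.2.2.1 hy.2.2.1 (by rw [ax.2]; exact hx.2.2.2) (by rw [ay.2]; exact hy.2.2.2)
  simp only [coneMap, Prod.mk.injEq, Subtype.mk.injEq]
  rw [this]
  refine and_congr_right fun hl => or_congr_right (and_congr_right fun hρ => ?_)
  have j0 : j ≠ 0 := by rcases h.sign with h | h <;> simp [h]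
  have time0 : ∀ z : 𝕋 × ℝ × ℝ × ℝ, |z.2.2.1| = 1 →
      ((coneTime z.2.2.1 : ℝ) : 𝕋) = 0 := by
    intro z hz
    rcases eq_or_eq_neg_of_abs_eq hz with hz | hz
    · rw [hz, coneTime_coe (by simp)]; norm_num
    · rw [hz, coneTime_coe (by simp)]; norm_num
  constructor
  · rintro ⟨h1, h2⟩
    have cap : |x.2.2.1| = 1 → |y.2.2.1| = 1 → (x.2.1 = 0 ∨ x.1 = y.1) := by
      intro cx cy
      refine h1.imp_right fun h1 => ?_
      rw [coneAngle, coneAngle, time0 x cx, time0 y cy] at h1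
      have h3 : κ (x.1, 0) = κ (y.1, 0) :=
        Prod.ext h1 (((h.pres _).2 rfl).trans ((h.pres _).2 rfl).symm)
      exact (Prod.mk.inj (κ.injective h3)).1
    by_cases cx : |x.2.2.1| = 1
    · have cy : |y.2.2.1| = 1 := by
        rw [← ay.2]
        rcases h2 with h2 | ⟨-, h3, h2⟩
        · rw [← h2, ax.2, cx]
        · rw [h2, abs_neg, h3]
      refine ⟨cap cx cy, ?_⟩
      rw [h.coneHeight_cap x cx, h.coneHeight_cap y cy] at h2
      rcases h2 with h2 | ⟨hl1, -, h2⟩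
      · exact Or.inl (mul_right_cancel₀ j0 h2)
      · exact Or.inr ⟨hl1, cx, mul_right_cancel₀ j0 (by rw [h2]; ring)⟩
    · have sx := h.coneHeight_side hx cx
      have h2 : coneHeight k j x = coneHeight k j y :=
        h2.resolve_right fun h2 => sx.2.2.ne h2.2.1
      have cy : |y.2.2.1| ≠ 1 := by
        rw [← ay.2.ne, ← h2]; exact sx.2.2.ne
      have sy := h.coneHeight_side hy cy
      have h1 := h1.resolve_left (by rw [sx.1]; norm_num)
      have hk : k (coneTime x.2.2.1, x.1) = k (coneTime y.2.2.1, y.1) := by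
        have e1 := sx.2.1
        have e2 := sy.2.1
        linarith
      have h3 : κ (x.1, ((coneTime x.2.2.1 : ℝ) : 𝕋))
          = κ (y.1, ((coneTime y.2.2.1 : ℝ) : 𝕋)) := by
        refine Prod.ext h1 ?_
        rw [← h.lift, ← h.lift, hk]
      obtain ⟨e1, e2⟩ := Prod.mk.inj (κ.injective h3)
      refine ⟨Or.inr e1, Or.inl ?_⟩
      obtain ⟨n, hn⟩ := coe_eq_coe_iff.1 e2
      have tx := IsHeight.coneTime_mem hx cx
      have ty := IsHeight.coneTime_mem hy cy
      have n1 : (-1 : ℝ) < n := by linarith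
      have n2 : (n : ℝ) < 1 := by linarith
      have n1' : -1 < n := by exact_mod_cast n1
      have n2' : n < 1 := by exact_mod_cast n2
      have n0 : n = 0 := by omega
      rw [n0, coneTime_coe hx.2.1, coneTime_coe hy.2.1] at hn
      push_cast at hn
      linarith
  · rintro ⟨h1, h2⟩
    rcases h2 with h2 | ⟨hl1, h3, h2⟩
    · rcases h1 with h0 | h1
      · have cx : |x.2.2.1| = 1 := hx.2.2.2.resolve_left (by rw [h0]; norm_num)
        have cy : |y.2.2.1| = 1 := by rw [← h2, cx]
        exact ⟨Or.inl h0, Or.inl (by rw [h.coneHeight_cap x cx, h.coneHeight_cap y cy, h2])⟩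
      · exact ⟨Or.inr (by simp only [coneAngle, h1, h2]),
          Or.inl (by simp only [coneHeight, h1, h2, hρ])⟩
    · have cy : |y.2.2.1| = 1 := by rw [h2, abs_neg, h3]
      refine ⟨h1.imp_right fun h1 => ?_, Or.inr ⟨hl1, ax.2.2 h3, ?_⟩⟩
      · rw [coneAngle, coneAngle, time0 x h3, time0 y cy, h1]
      · rw [h.coneHeight_cap x h3, h.coneHeight_cap y cy, h2]; ring

theorem coneMap_surjective {κ : Torus ≃ₜ Torus} {k : C(I × 𝕋, ℝ)} {j : ℝ}
    (h : IsHeight κ k j) : Function.Surjective (coneMap h) := by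
  rintro ⟨⟨ζ, hζ⟩, μ⟩
  have hζ' : ‖ζ‖ ≤ 1 := by simpa using hζ
  obtain ⟨a', ha'⟩ := exists_polar ζ
  obtain ⟨sg, hsg, hμ⟩ : ∃ sg : ℝ, |sg| ≤ 1 ∧ Circle.exp (Real.pi * (sg + 1)) = μ := by
    obtain ⟨c, hc⟩ := ang_surjective μ
    obtain ⟨t, ht, rfl⟩ := exists_coe_Ico c 0
    refine ⟨2 * t - 1, abs_le.2 ⟨by linarith [ht.1], by linarith [ht.2]⟩, ?_⟩
    rw [← hc, ang_coe]
    congr 1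
    ring
  obtain ⟨l, ρ, B, hl, hρ, hB, h1, e1, e2⟩ : ∃ l ρ B : ℝ, (0 ≤ l ∧ l ≤ 1) ∧ (0 ≤ ρ ∧ ρ ≤ 1) ∧
      |B| ≤ 1 ∧ (ρ = 1 ∨ |B| = 1) ∧ l * ρ = ‖ζ‖ ∧ l * B = sg := by
    -- The scale is the norm whose unit ball is the cylinder; dividing by it projects the point
    -- radially to the boundary of the cylinder.
    set l := max ‖ζ‖ |sg| with hl
    have hl0 : 0 ≤ l := le_max_of_le_left (norm_nonneg _)
    rcases hl0.eq_or_lt with h0 | h0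
    · refine ⟨0, 1, 0, by simp, by simp, by simp, by simp, ?_, ?_⟩
      · have : ‖ζ‖ ≤ 0 := h0 ▸ le_max_left _ _
        rw [zero_mul]; exact le_antisymm (norm_nonneg _) this
      · have : |sg| ≤ 0 := h0 ▸ le_max_right _ _
        rw [zero_mul]; exact (abs_nonpos_iff.1 this).symm
    · refine ⟨l, ‖ζ‖ / l, sg / l, ⟨hl0, max_le hζ' hsg⟩, ⟨by positivity, ?_⟩, ?_, ?_, ?_, ?_⟩
      · rw [div_le_one h0]; exact le_max_left _ _
      · rw [abs_div, abs_of_pos h0, div_le_one h0]; exact le_max_right _ _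
      · rcases max_choice ‖ζ‖ |sg| with hm | hm
        · left; rw [div_eq_one_iff_eq h0.ne', hl, hm]
        · right; rw [abs_div, abs_of_pos h0, div_eq_one_iff_eq h0.ne', hl, hm]
      · field_simp
      · field_simp
  suffices H : ∃ x : 𝕋 × ℝ × ℝ × ℝ, ∃ hx : x ∈ coneSet, x.2.2.2 = l ∧ x.2.1 = ρ ∧
      coneAngle κ x = a' ∧ coneHeight k j x = B by
    obtain ⟨x, hx, h2, h3, h4, h5⟩ := H
    refine ⟨⟨x, hx⟩, ?_⟩
    refine Prod.ext (Subtype.ext ?_) ?_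
    · simp only [coneMap, h2, h3, h4, e1]
      exact ha'.symm
    · simp only [coneMap, h2, h5, e2]
      exact hμ
  by_cases hB1 : |B| = 1
  · obtain ⟨⟨a, c⟩, hac⟩ := κ.surjective (a', 0)
    have hc : c = 0 := (h.pres (a, c)).1 (by rw [hac])
    subst hc
    have hsj : |B * j| = 1 := by rw [abs_mul, hB1, h.abs_j, one_mul]
    have hmem : (a, ρ, B * j, l) ∈ coneSet := ⟨hρ, abs_le.1 hsj.le, hl, Or.inr hsj⟩
    refine ⟨_, hmem, rfl, rfl, ?_, ?_⟩
    · have : ((coneTime (B * j) : ℝ) : 𝕋) = 0 := by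
        rw [coneTime_coe (abs_le.1 hsj.le)]
        rcases eq_or_eq_neg_of_abs_eq hsj with hz | hz <;> rw [hz] <;> norm_num
      simp only [coneAngle, this, hac]
    · rw [h.coneHeight_cap _ hsj]
      have : j * j = 1 := by rcases h.sign with h | h <;> rw [h] <;> norm_num
      simp only [mul_assoc, this, mul_one]
  · have hρ1 := h1.resolve_right hB1
    have hB2 := abs_lt.1 (lt_of_le_of_ne hB hB1)
    obtain ⟨⟨a, c⟩, hac⟩ := κ.surjective (a', (((B + 1) / 2 : ℝ) : 𝕋))
    obtain ⟨t, ht, rfl⟩ := exists_coe_Ico c 0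
    rw [zero_add] at ht
    have ht0 : t ≠ 0 := by
      rintro rfl
      have := (h.pres (a, ((0 : ℝ) : 𝕋))).2 (by simp)
      rw [hac, coe_eq_zero_iff] at this
      obtain ⟨n, hn⟩ := this
      have n1 : (0 : ℝ) < n := by linarith
      have n2 : (n : ℝ) < 1 := by linarith
      have n1' : 0 < n := by exact_mod_cast n1
      have n2' : n < 1 := by exact_mod_cast n2
      omega
    have ht1 : 0 < t := lt_of_le_of_ne ht.1 (Ne.symm ht0)
    have hmem : (a, ρ, 2 * t - 1, l) ∈ coneSet :=
      ⟨hρ, ⟨by linarith, by linarith [ht.2]⟩, hl, Or.inl hρ1⟩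
    have htime : (coneTime (2 * t - 1) : ℝ) = t := by
      rw [coneTime_coe hmem.2.1]; ring
    refine ⟨_, hmem, rfl, rfl, ?_, ?_⟩
    · simp only [coneAngle, htime, hac]
    · have hs : |2 * t - 1| ≠ 1 := by
        apply ne_of_lt
        rw [abs_lt]
        constructor <;> linarith [ht.2]
      rw [(h.coneHeight_side hmem hs).2.1]
      simp only
      have e := h.lift (coneTime (2 * t - 1)) a
      rw [htime, hac] at e
      obtain ⟨n, hn⟩ := coe_eq_coe_iff.1 e
      have hm := h.mem (coneTime (2 * t - 1)) a (by rw [htime]; exact ht1) (by rw [htime]; exact ht.2)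
      have n1 : (-1 : ℝ) < n := by linarith
      have n2 : (n : ℝ) < 1 := by linarith
      have n1' : -1 < n := by exact_mod_cast n1
      have n2' : n < 1 := by exact_mod_cast n2
      have n0 : n = 0 := by omega
      rw [n0] at hn
      push_cast at hn
      linarith

theorem coneMap_bdry {κ : Torus ≃ₜ Torus} {k : C(I × 𝕋, ℝ)} {j : ℝ}
    (h : IsHeight κ k j) (a : 𝕋) (t : I)
    (hx : ((a, 1, 2 * (t : ℝ) - 1, 1) : 𝕋 × ℝ × ℝ × ℝ) ∈ coneSet) :
    coneMap h ⟨_, hx⟩ = bdry (κ (a, ((t : ℝ) : 𝕋))) := by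
  have htime : coneTime (2 * (t : ℝ) - 1) = t := by
    apply Subtype.ext
    rw [coneTime_coe hx.2.1]; ring
  simp only [coneMap, bdry, coneAngle, coneHeight, htime]
  rw [← h.lift, ang_coe]
  refine Prod.ext (Subtype.ext ?_) ?_
  · simp
  · simp only
    congr 1
    ring

theorem isHeight_refl : IsHeight (Homeomorph.refl Torus) ⟨fun u => (u.1 : ℝ), by fun_prop⟩ 1 where
  pres _ := Iff.rfl
  sign := Or.inl rfl
  lift _ _ := rfl
  mem _ _ h0 h1 := ⟨h0, h1⟩
  ends _ := by simp

/-- A homeomorphism of the torus extends over the solid torus. -/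
def Extends (κ : Torus ≃ₜ Torus) : Prop :=
  ∃ K : SolidTorus ≃ₜ SolidTorus, ∀ v, K (bdry v) = bdry (κ v)

/-- Alexander's trick. The meridian disc is cut open, the homeomorphism of the boundary of the
resulting cylinder is extended radially over each cap, and then coned off from the centre. The cone
maps for the identity and for `κ` are quotient maps with equal fibres, so one is the other followed
by a homeomorphism, which restricts to `κ` at radius and scale `1`. -/
theorem extends_of_image_curveC {κ : Torus ≃ₜ Torus} (hκ : κ '' curveC = curveC) : Extends κ := by
  have hp : ∀ v, (κ v).2 = 0 ↔ v.2 = 0 := by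
    intro v
    change κ v ∈ curveC ↔ v ∈ curveC
    rw [← hκ, κ.injective.mem_set_image, hκ]
  obtain ⟨k, j, h1, h2, h3, h4⟩ := exists_height κ hp
  have h : IsHeight κ k j := ⟨hp, h1, h2, h3, h4⟩
  obtain ⟨K, hK⟩ := exists_homeomorph_of_fibers
    (isQuotientMap_of_compact (continuous_coneMap isHeight_refl) (coneMap_surjective isHeight_refl))
    (isQuotientMap_of_compact (continuous_coneMap h) (coneMap_surjective h))
    (fun x y => by rw [coneMap_eq_iff, coneMap_eq_iff])
  refine ⟨K, ?_⟩
  rintro ⟨a, c⟩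
  obtain ⟨t, ht, rfl⟩ := exists_coe_Ico c 0
  rw [zero_add] at ht
  have hx : ((a, 1, 2 * t - 1, 1) : 𝕋 × ℝ × ℝ × ℝ) ∈ coneSet :=
    ⟨by simp, ⟨by linarith [ht.1], by linarith [ht.2]⟩, by simp, by simp⟩
  have := hK ⟨_, hx⟩
  rwa [coneMap_bdry isHeight_refl a ⟨t, ht.1, ht.2.le⟩ hx,
    coneMap_bdry h a ⟨t, ht.1, ht.2.le⟩ hx] at this

theorem Extends.trans {κ κ' : Torus ≃ₜ Torus} (h : Extends κ) (h' : Extends κ') :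
    Extends (κ.trans κ') := by
  obtain ⟨K, hK⟩ := h
  obtain ⟨K', hK'⟩ := h'
  exact ⟨K.trans K', fun v => by simp [hK, hK']⟩

theorem Extends.symm {κ : Torus ≃ₜ Torus} (h : Extends κ) : Extends κ.symm := by
  obtain ⟨K, hK⟩ := h
  refine ⟨K.symm, fun v => ?_⟩
  rw [Homeomorph.symm_apply_eq, hK, Homeomorph.apply_symm_apply]

/-- A translation need not preserve `curveC`, so it needs its own extension: rotations of the disc
and of the circle. -/
theorem extends_translation (c : Torus) : Extends (Homeomorph.addRight c) := by
  refine ⟨(⟨⟨fun v => (⟨v.1 * (ang c.1 : ℂ), ?_⟩, v.2 * ang c.2),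
    fun v => (⟨v.1 * (ang (-c.1) : ℂ), ?_⟩, v.2 * ang (-c.2)), ?_, ?_⟩, ?_, ?_⟩ :
      SolidTorus ≃ₜ SolidTorus), ?_⟩
  · simpa using mem_closedBall_zero_iff.1 v.1.2
  · simpa using mem_closedBall_zero_iff.1 v.1.2
  · intro v
    refine Prod.ext (Subtype.ext ?_) ?_
    · simp [ang, AddCircle.toCircle_neg]
    · simp [ang, AddCircle.toCircle_neg, mul_assoc]
  · intro v
    refine Prod.ext (Subtype.ext ?_) ?_
    · simp [ang, AddCircle.toCircle_neg]
    · simp [ang, AddCircle.toCircle_neg, mul_assoc]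
  · fun_prop
  · fun_prop
  · intro v
    refine Prod.ext (Subtype.ext ?_) ?_
    · simp [bdry, ang, AddCircle.toCircle_add]
    · simp [bdry, ang, AddCircle.toCircle_add]

end Dunwoody

/-! ### Uniqueness of the glued manifold, and the model manifolds. -/

namespace Dunwoody

open Topology

/-! ### Uniqueness of the represented manifold -/

/-- `M` is the union of two solid tori glued so that the meridian of the second one is the curve `D`
on the boundary of the first one. -/
def IsGluedAlong (M : Type*) [TopologicalSpace M] (D : Set Torus) : Prop :=
  ∃ f g : SolidTorus → M, IsClosedEmbedding f ∧ IsClosedEmbedding g ∧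
    range f ∪ range g = univ ∧ range f ∩ range g = f '' solidTorusBoundary ∧
    f '' solidTorusBoundary = g '' solidTorusBoundary ∧
    g '' solidTorusMeridian = f '' (bdry '' D)

theorem isClosedEmbedding_bdry : IsClosedEmbedding bdry :=
  continuous_bdry.isClosedEmbedding bdry_injective

theorem exists_homeomorph_of_range_eq {X Y M : Type*} [TopologicalSpace X] [TopologicalSpace Y]
    [TopologicalSpace M] {f : X → M} {g : Y → M} (hf : IsEmbedding f) (hg : IsEmbedding g)
    (h : range f = range g) : ∃ η : X ≃ₜ Y, ∀ x, g (η x) = f x := by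
  refine ⟨(hf.toHomeomorph.trans (Homeomorph.setCongr h)).trans hg.toHomeomorph.symm, fun x => ?_⟩
  have : ∀ y, g (hg.toHomeomorph.symm y) = y := fun y => by
    rw [← hg.toHomeomorph_apply_coe, Homeomorph.apply_symm_apply]
  simp only [Homeomorph.trans_apply, this]
  rfl

/-- The identification `τ` differs from `f ∘ bdry` by a homeomorphism of the torus that preserves
`curveC`. It extends over the solid torus, so it can be absorbed in `f`. -/
theorem isRepresentedBy_iff {M : Type*} [TopologicalSpace M] {D : Set Torus} :
    IsRepresentedBy M curveC D ↔ IsGluedAlong M D := by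
  constructor
  · rintro ⟨f, g, τ, hf, hg, hτ, hu, hi, hfb, hgb, hfm, hgm⟩
    obtain ⟨η, hη⟩ := exists_homeomorph_of_range_eq (hf.comp isClosedEmbedding_bdry).isEmbedding
      hτ.isEmbedding (by rw [range_comp, range_bdry, hfb])
    have hC : η '' curveC = curveC := by
      apply hτ.injective.image_injective
      rw [← hfm, ← bdry_image_curveC, image_image, image_image]
      simp only [hη, Function.comp]
    obtain ⟨K, hK⟩ := extends_of_image_curveC hC
    have hfK : ∀ v, (f ∘ K.symm) (bdry v) = τ v := by
      intro v
      have : K.symm (bdry v) = bdry (η.symm v) := by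
        rw [Homeomorph.symm_apply_eq, hK, Homeomorph.apply_symm_apply]
      rw [Function.comp, this, ← Function.comp_apply (f := f), ← hη, Homeomorph.apply_symm_apply]
    have hr : range (f ∘ K.symm) = range f := by
      rw [range_comp, K.symm.range_coe, image_univ]
    have hb : (f ∘ K.symm) '' solidTorusBoundary = range τ := by
      rw [← range_bdry, ← range_comp]
      exact congrArg range (funext hfK)
    refine ⟨f ∘ K.symm, g, hf.comp K.symm.isClosedEmbedding, hg, by rw [hr, hu], by rw [hr, hi, hb],
      by rw [hb, hgb], ?_⟩
    rw [hgm, image_image]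
    simp only [hfK]
  · rintro ⟨f, g, hf, hg, hu, hi, hb, hm⟩
    refine ⟨f, g, f ∘ bdry, hf, hg, hf.comp isClosedEmbedding_bdry, hu, ?_, ?_, ?_, ?_, ?_⟩
    · rw [hi, range_comp, range_bdry]
    · rw [range_comp, range_bdry]
    · rw [← hb, range_comp, range_bdry]
    · rw [image_comp, bdry_image_curveC]
    · rw [image_comp, hm]

/-- `D` is carried to `D'` by a homeomorphism of the torus which extends over the solid torus. -/
def Related (D D' : Set Torus) : Prop := ∃ κ : Torus ≃ₜ Torus, Extends κ ∧ κ '' D = D'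

theorem Related.refl (D : Set Torus) : Related D D :=
  ⟨Homeomorph.refl _, ⟨Homeomorph.refl _, fun _ => rfl⟩, by simp⟩

theorem Related.symm {D D' : Set Torus} (h : Related D D') : Related D' D := by
  obtain ⟨κ, hκ, rfl⟩ := h
  exact ⟨κ.symm, hκ.symm, by simp [image_image]⟩

theorem Related.trans {D D' D'' : Set Torus} (h : Related D D') (h' : Related D' D'') :
    Related D D'' := by
  obtain ⟨κ, hκ, rfl⟩ := h
  obtain ⟨κ', hκ', rfl⟩ := h'
  exact ⟨κ.trans κ', hκ.trans hκ', by rw [image_image]; rfl⟩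

/-- Precomposing `f` with the inverse of the extension replaces `D` by `D'` as the preimage of the
second meridian, and leaves all the images in `M` as they were. -/
theorem IsGluedAlong.of_related {M : Type*} [TopologicalSpace M] {D D' : Set Torus}
    (h : IsGluedAlong M D) (hD : Related D D') : IsGluedAlong M D' := by
  obtain ⟨f, g, hf, hg, hu, hi, hb, hm⟩ := h
  obtain ⟨κ, ⟨K, hK⟩, rfl⟩ := hD
  have hr : range (f ∘ K.symm) = range f := by
    rw [range_comp, K.symm.range_coe, image_univ]
  have hfK : ∀ v, (f ∘ K.symm) (bdry (κ v)) = f (bdry v) := by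
    intro v
    rw [Function.comp, ← hK, Homeomorph.symm_apply_apply]
  have hbd : (f ∘ K.symm) '' solidTorusBoundary = f '' solidTorusBoundary := by
    rw [← range_bdry, ← range_comp, ← range_comp]
    calc range ((f ∘ K.symm) ∘ bdry) = range (((f ∘ K.symm) ∘ bdry) ∘ κ) := by
          rw [range_comp _ κ, κ.range_coe, image_univ]
      _ = _ := congrArg range (funext hfK)
  refine ⟨f ∘ K.symm, g, hf.comp K.symm.isClosedEmbedding, hg, by rw [hr, hu], by rw [hr, hi, hbd],
    by rw [hbd, hb], ?_⟩
  rw [hm, image_image, image_image, image_image]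
  simp only [hfK]

theorem image_bdry_homeomorph {M M' : Type*} [TopologicalSpace M] [TopologicalSpace M']
    {f g : SolidTorus → M} {f' g' : SolidTorus → M'}
    (hf : IsClosedEmbedding f) (hg : IsClosedEmbedding g)
    (hf' : IsClosedEmbedding f') (hg' : IsClosedEmbedding g')
    (hb : f '' solidTorusBoundary = g '' solidTorusBoundary)
    (hb' : f' '' solidTorusBoundary = g' '' solidTorusBoundary) :
    ∃ μ : Torus ≃ₜ Torus, ∀ v w, g (bdry v) = f (bdry w) ↔ g' (bdry (μ v)) = f' (bdry w) := by
  have cb := isClosedEmbedding_bdry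
  obtain ⟨η, hη⟩ := exists_homeomorph_of_range_eq (hg.comp cb).isEmbedding (hf.comp cb).isEmbedding
    (by rw [range_comp, range_comp, range_bdry, hb])
  obtain ⟨η', hη'⟩ := exists_homeomorph_of_range_eq (hf'.comp cb).isEmbedding
    (hg'.comp cb).isEmbedding (by rw [range_comp, range_comp, range_bdry, hb'])
  refine ⟨η.trans η', fun v w => ?_⟩
  have h1 : g (bdry v) = f (bdry (η v)) := (hη v).symm
  have h2 : g' (bdry (η' (η v))) = f' (bdry (η v)) := hη' (η v)
  rw [h1, Homeomorph.trans_apply, h2, hf.injective.eq_iff, hf'.injective.eq_iff]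

theorem isQuotientMap_sumElim {M : Type*} [TopologicalSpace M] {f g : SolidTorus → M}
    (hf : IsClosedEmbedding f) (hg : IsClosedEmbedding g) (hu : range f ∪ range g = univ) :
    IsQuotientMap (Sum.elim f g) := by
  have h1 : Continuous (Sum.elim f g) := hf.continuous.sumElim hg.continuous
  have h2 : IsClosedMap (Sum.elim f g) := by
    rw [isClosedMap_sum]
    exact ⟨hf.isClosedMap, hg.isClosedMap⟩
  refine h2.isQuotientMap h1 fun m => ?_
  have : m ∈ range f ∪ range g := hu ▸ mem_univ m
  rcases this with ⟨v, rfl⟩ | ⟨v, rfl⟩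
  · exact ⟨Sum.inl v, rfl⟩
  · exact ⟨Sum.inr v, rfl⟩

theorem mem_boundary_of_eq {M : Type*} [TopologicalSpace M] {f g : SolidTorus → M}
    (hf : IsClosedEmbedding f) (hg : IsClosedEmbedding g)
    (hi : range f ∩ range g = f '' solidTorusBoundary)
    (hb : f '' solidTorusBoundary = g '' solidTorusBoundary) {v w : SolidTorus} (h : g v = f w) :
    v ∈ range bdry ∧ w ∈ range bdry := by
  have hm : f w ∈ f '' solidTorusBoundary := hi ▸ ⟨⟨w, rfl⟩, ⟨v, h⟩⟩
  rw [range_bdry]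
  refine ⟨?_, hf.injective.mem_set_image.1 hm⟩
  rw [hb, ← h] at hm
  exact hg.injective.mem_set_image.1 hm

/-- The two gluings differ by a homeomorphism `μ` of the boundary of the second solid torus. Both
attach the meridian along `D`, so `μ` preserves `curveC` and extends over that solid torus. After
correcting `g'` by the extension, both manifolds are the same quotient of two disjoint solid tori.
-/
theorem IsGluedAlong.unique {M M' : Type*} [TopologicalSpace M] [TopologicalSpace M']
    {D : Set Torus} (h : IsGluedAlong M D) (h' : IsGluedAlong M' D) : Nonempty (M ≃ₜ M') := by
  obtain ⟨f, g, hf, hg, hu, hi, hb, hm⟩ := h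
  obtain ⟨f', g', hf', hg', hu', hi', hb', hm'⟩ := h'
  obtain ⟨μ, hμ⟩ := image_bdry_homeomorph hf hg hf' hg' hb hb'
  have hbd : ∀ v, ∃ w, g (bdry v) = f (bdry w) := by
    intro v
    have : g (bdry v) ∈ f '' solidTorusBoundary := by
      rw [hb, ← range_bdry]
      exact mem_image_of_mem g (mem_range_self v)
    rw [← range_bdry] at this
    obtain ⟨_, ⟨w, rfl⟩, hw⟩ := this
    exact ⟨w, hw.symm⟩
  have hC : ∀ v, μ v ∈ curveC ↔ v ∈ curveC := by
    intro v
    obtain ⟨w, hw⟩ := hbd v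
    have e1 : v ∈ curveC ↔ w ∈ D := by
      rw [← bdry_injective.mem_set_image, bdry_image_curveC, ← hg.injective.mem_set_image, hm, hw,
        hf.injective.mem_set_image, bdry_injective.mem_set_image]
    have e2 : μ v ∈ curveC ↔ w ∈ D := by
      rw [← bdry_injective.mem_set_image, bdry_image_curveC, ← hg'.injective.mem_set_image, hm',
        (hμ v w).1 hw, hf'.injective.mem_set_image, bdry_injective.mem_set_image]
    rw [e1, e2]
  have hC' : μ '' curveC = curveC := by
    ext v
    constructor
    · rintro ⟨w, hw, rfl⟩
      exact (hC w).2 hw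
    · intro hv
      refine ⟨μ.symm v, (hC _).1 (by simpa using hv), by simp⟩
  obtain ⟨K, hK⟩ := extends_of_image_curveC hC'
  have hg'K : IsClosedEmbedding (g' ∘ K) := hg'.comp K.isClosedEmbedding
  have hrK : range (g' ∘ K) = range g' := by rw [range_comp, K.range_coe, image_univ]
  have cross : ∀ v w, g v = f w ↔ g' (K v) = f' w := by
    intro v w
    constructor
    · intro h
      obtain ⟨⟨v, rfl⟩, ⟨w, rfl⟩⟩ := mem_boundary_of_eq hf hg hi hb h
      rw [hK]
      exact (hμ v w).1 h
    · intro h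
      obtain ⟨⟨v', hv'⟩, ⟨w, rfl⟩⟩ := mem_boundary_of_eq hf' hg' hi' hb' h
      have : v = bdry (μ.symm v') := by
        apply K.injective
        rw [hK, Homeomorph.apply_symm_apply, hv']
      subst this
      rw [hK] at h
      exact (hμ _ w).2 h
  obtain ⟨F, -⟩ := exists_homeomorph_of_fibers (isQuotientMap_sumElim hf hg hu)
    (isQuotientMap_sumElim hf' hg'K (by rw [hrK, hu'])) (by
      rintro (v | v) (w | w)
      · simp [hf.injective.eq_iff, hf'.injective.eq_iff]
      · simp only [Sum.elim_inl, Sum.elim_inr, Function.comp]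
        rw [eq_comm, cross, eq_comm]
      · simp only [Sum.elim_inl, Sum.elim_inr, Function.comp]
        exact cross v w
      · simp [hg.injective.eq_iff, hg'.injective.eq_iff])
  exact ⟨F⟩

/-! ### `S¹ × S²` -/

/-- The curve at height `1/2` on the torus. -/
def middleCurve : Set Torus := {v | v.2 = ((1 / 2 : ℝ) : 𝕋)}

/-- The closed hemisphere `{x₂ ε ≥ 0}`, as a graph over the disc. -/
noncomputable def hemisphere (ε : ℝ) (hε : ε ^ 2 = 1) (ζ : Metric.closedBall (0 : ℂ) 1) : S2 :=
  ⟨!₂[(ζ : ℂ).re, (ζ : ℂ).im, ε * √(1 - ‖(ζ : ℂ)‖ ^ 2)], by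
    have h1 : ‖(ζ : ℂ)‖ ≤ 1 := mem_closedBall_zero_iff.1 ζ.2
    have h2 : 0 ≤ 1 - ‖(ζ : ℂ)‖ ^ 2 := by nlinarith [norm_nonneg (ζ : ℂ)]
    rw [mem_sphere_zero_iff_norm, EuclideanSpace.norm_eq, Real.sqrt_eq_one, Fin.sum_univ_three]
    simp only [Real.norm_eq_abs, sq_abs]
    simp only [Matrix.cons_val, mul_pow, hε, Real.sq_sqrt h2]
    rw [Complex.sq_norm, Complex.normSq_apply]
    ring⟩

theorem continuous_hemisphere {ε : ℝ} (hε : ε ^ 2 = 1) : Continuous (hemisphere ε hε) := by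
  unfold hemisphere
  refine Continuous.subtype_mk ?_ _
  refine (PiLp.continuous_toLp 2 _).comp (continuous_pi fun i => ?_)
  fin_cases i <;> simp <;> fun_prop

theorem hemisphere_injective {ε : ℝ} (hε : ε ^ 2 = 1) : Function.Injective (hemisphere ε hε) := by
  intro ζ η h
  have h' : ∀ i, (hemisphere ε hε ζ).1 i = (hemisphere ε hε η).1 i := fun i => by rw [h]
  exact Subtype.ext (Complex.ext (h' 0) (h' 1))

theorem range_hemisphere {ε : ℝ} (hε : ε ^ 2 = 1) (x : S2) (hx : 0 ≤ ε * x.1 2) :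
    ∃ ζ, hemisphere ε hε ζ = x ∧ ‖(ζ : ℂ)‖ ^ 2 = 1 - x.1 2 ^ 2 := by
  have h1 : x.1 0 ^ 2 + x.1 1 ^ 2 + x.1 2 ^ 2 = 1 := by
    have := mem_sphere_zero_iff_norm.1 x.2
    rw [EuclideanSpace.norm_eq, Real.sqrt_eq_one, Fin.sum_univ_three] at this
    simpa only [Real.norm_eq_abs, sq_abs] using this
  have h2 : ‖(⟨x.1 0, x.1 1⟩ : ℂ)‖ ^ 2 = 1 - x.1 2 ^ 2 := by
    rw [Complex.sq_norm, Complex.normSq_apply]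
    simp only
    linarith
  refine ⟨⟨⟨x.1 0, x.1 1⟩, ?_⟩, ?_, h2⟩
  · rw [mem_closedBall_zero_iff]
    nlinarith [norm_nonneg (⟨x.1 0, x.1 1⟩ : ℂ), sq_nonneg (x.1 2)]
  · apply Subtype.ext
    ext i
    fin_cases i
    · rfl
    · rfl
    · simp only [hemisphere, h2]
      have : √(1 - (1 - x.1 2 ^ 2)) = ε * x.1 2 := by
        rw [show 1 - (1 - x.1 2 ^ 2) = (ε * x.1 2) ^ 2 by rw [mul_pow, hε]; ring, Real.sqrt_sq hx]
      simp only [this]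
      have : ε * (ε * x.1 2) = x.1 2 := by rw [← mul_assoc, ← sq, hε, one_mul]
      simpa using this

theorem hemisphere_two {ε : ℝ} (hε : ε ^ 2 = 1) (ζ : Metric.closedBall (0 : ℂ) 1) :
    (hemisphere ε hε ζ).1 2 = ε * √(1 - ‖(ζ : ℂ)‖ ^ 2) := rfl

/-- The solid torus in `S¹ × S²` over a hemisphere. -/
noncomputable def productTorus (ε : ℝ) (hε : ε ^ 2 = 1) (μ : Circle) (v : SolidTorus) : Circle × S2 :=
  (μ * v.2, hemisphere ε hε v.1)

theorem isClosedEmbedding_productTorus {ε : ℝ} (hε : ε ^ 2 = 1) (μ : Circle) :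
    IsClosedEmbedding (productTorus ε hε μ) := by
  have h := continuous_hemisphere hε
  refine Continuous.isClosedEmbedding (by unfold productTorus; fun_prop) ?_
  rintro ⟨a, b⟩ ⟨a', b'⟩ h
  simp only [productTorus, Prod.mk.injEq, mul_right_inj] at h
  exact Prod.ext (hemisphere_injective hε h.2) h.1

theorem range_productTorus {ε : ℝ} (hε : ε ^ 2 = 1) (μ : Circle) :
    range (productTorus ε hε μ) = {x | 0 ≤ ε * x.2.1 2} := by
  ext x
  constructor
  · rintro ⟨v, rfl⟩
    change 0 ≤ ε * (hemisphere ε hε v.1).1 2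
    rw [hemisphere_two, ← mul_assoc, ← sq, hε, one_mul]
    positivity
  · intro hx
    obtain ⟨ζ, hζ, -⟩ := range_hemisphere hε x.2 hx
    exact ⟨(ζ, μ⁻¹ * x.1), Prod.ext (by simp [productTorus]) hζ⟩

theorem productTorus_boundary {ε : ℝ} (hε : ε ^ 2 = 1) (μ : Circle) (s : Set Circle) :
    productTorus ε hε μ '' {v | ‖(v.1 : ℂ)‖ = 1 ∧ μ * v.2 ∈ s} = {x | x.2.1 2 = 0 ∧ x.1 ∈ s} := by
  ext x
  constructor
  · rintro ⟨v, hv, rfl⟩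
    refine ⟨?_, hv.2⟩
    change (hemisphere ε hε v.1).1 2 = 0
    rw [hemisphere_two, hv.1]
    simp
  · rintro ⟨hx, hs⟩
    obtain ⟨ζ, hζ, hn⟩ := range_hemisphere hε x.2 (by rw [hx, mul_zero])
    rw [hx] at hn
    refine ⟨(ζ, μ⁻¹ * x.1), ⟨?_, by simpa using hs⟩, Prod.ext (by simp [productTorus]) hζ⟩
    exact (pow_eq_one_iff_of_nonneg (norm_nonneg _) two_ne_zero).1 (by linarith)

/-- The equator of `S²` splits the product into two solid tori whose meridians are copies of the
equator. The second one is turned by half the circle, so that its meridian is the parallel of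
`curveC` at height `1/2`; this is the form in which the parallel curve appears at the end of the
reduction. -/
theorem isGluedAlong_product : IsGluedAlong (Circle × S2) middleCurve := by
  have e1 : (1 : ℝ) ^ 2 = 1 := by norm_num
  have e2 : (-1 : ℝ) ^ 2 = 1 := by norm_num
  have half : ang ((1 / 2 : ℝ) : 𝕋) = Circle.exp Real.pi := by
    rw [ang_coe]; congr 1; ring
  have bd : solidTorusBoundary = {v : SolidTorus | ‖(v.1 : ℂ)‖ = 1 ∧ (1 : Circle) * v.2 ∈ univ} := by
    ext v; simp [solidTorusBoundary]
  have bd' : solidTorusBoundary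
      = {v : SolidTorus | ‖(v.1 : ℂ)‖ = 1 ∧ Circle.exp Real.pi * v.2 ∈ univ} := by
    ext v; simp [solidTorusBoundary]
  have md : solidTorusMeridian = {v : SolidTorus | ‖(v.1 : ℂ)‖ = 1 ∧
      Circle.exp Real.pi * v.2 ∈ ({Circle.exp Real.pi} : Set Circle)} := by
    ext v; simp [solidTorusMeridian]
  have cd : bdry '' middleCurve = {v : SolidTorus | ‖(v.1 : ℂ)‖ = 1 ∧
      (1 : Circle) * v.2 ∈ ({Circle.exp Real.pi} : Set Circle)} := by
    ext v
    constructor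
    · rintro ⟨w, hw, rfl⟩
      have hw : w.2 = ((1 / 2 : ℝ) : 𝕋) := hw
      refine ⟨norm_ang _, ?_⟩
      simp [bdry, hw, ← half]
    · rintro ⟨h1, h2⟩
      obtain ⟨w, rfl⟩ : v ∈ range bdry := by rw [range_bdry]; exact h1
      refine ⟨w, ?_, rfl⟩
      rw [← half, one_mul] at h2
      exact ang_injective h2
  refine ⟨productTorus 1 e1 1, productTorus (-1) e2 (Circle.exp Real.pi),
    isClosedEmbedding_productTorus e1 1, isClosedEmbedding_productTorus e2 _, ?_, ?_, ?_, ?_⟩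
  · rw [range_productTorus, range_productTorus]
    ext x
    simp only [mem_union, mem_ofPred_eq, mem_univ, iff_true]
    rcases le_total 0 (x.2.1 2) with h | h
    · left; linarith
    · right; linarith
  · rw [range_productTorus, range_productTorus, bd, productTorus_boundary]
    ext x
    simp only [mem_inter_iff, mem_ofPred_eq, mem_univ, and_true]
    constructor
    · rintro ⟨h1, h2⟩; linarith
    · intro h; rw [h]; simp
  · nth_rw 1 [bd]
    rw [bd', productTorus_boundary, productTorus_boundary]
  · rw [md, cd, productTorus_boundary, productTorus_boundary]

/-! ### Lens spaces -/

/-- `E x = exp(2πix)`. -/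
noncomputable def E (x : ℝ) : ℂ := ang (x : 𝕋)

theorem E_add (x y : ℝ) : E (x + y) = E x * E y := by
  simp [E, ang, AddCircle.toCircle_add]

theorem E_int (n : ℤ) : E n = 1 := by
  rw [E, (coe_eq_zero_iff (x := n)).2 ⟨n, rfl⟩, ang_zero]
  rfl

theorem E_zero : E 0 = 1 := by simpa using E_int 0

@[simp] theorem norm_E (x : ℝ) : ‖E x‖ = 1 := norm_ang _

theorem E_ne_zero (x : ℝ) : E x ≠ 0 := by
  rw [← norm_ne_zero_iff, norm_E]; exact one_ne_zero

theorem E_eq_iff {x y : ℝ} : E x = E y ↔ ∃ n : ℤ, y = x + n := by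
  rw [← coe_eq_coe_iff]
  exact ⟨fun h => ang_injective (Circle.ext h), fun h => by rw [E, E, h]⟩

theorem E_eq_exp (x : ℝ) : E x = Complex.exp (2 * Real.pi * Complex.I * x) := by
  rw [E, ang_coe, Circle.coe_exp]
  congr 1
  push_cast
  ring

theorem continuous_E : Continuous E := by
  have h1 := continuous_ang
  have h2 : Continuous (fun x : ℝ => (x : 𝕋)) := AddCircle.continuous_mk' 1
  unfold E
  fun_prop

theorem exists_polar_E (z : ℂ) : ∃ x : ℝ, z = ‖z‖ * E x := by
  obtain ⟨a, ha⟩ := exists_polar z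
  obtain ⟨x, rfl⟩ := QuotientAddGroup.mk_surjective a
  exact ⟨x, ha⟩

/-- A point of the unit sphere of `ℂ²`. -/
noncomputable def sphereMk (z w : ℂ) (h : ‖z‖ ^ 2 + ‖w‖ ^ 2 = 1) : S3C :=
  ⟨!₂[z, w], by
    rw [mem_sphere_zero_iff_norm, EuclideanSpace.norm_eq, Real.sqrt_eq_one, Fin.sum_univ_two]
    simpa using h⟩

theorem sphere_norm (u : S3C) : ‖u.1 0‖ ^ 2 + ‖u.1 1‖ ^ 2 = 1 := by
  have := mem_sphere_zero_iff_norm.1 u.2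
  rwa [EuclideanSpace.norm_eq, Real.sqrt_eq_one, Fin.sum_univ_two] at this

theorem sphere_ext {u v : S3C} (h0 : u.1 0 = v.1 0) (h1 : u.1 1 = v.1 1) : u = v := by
  apply Subtype.ext
  ext i
  fin_cases i
  · exact h0
  · exact h1

theorem continuous_sphereMk {X : Type*} [TopologicalSpace X] {z w : X → ℂ} (hz : Continuous z)
    (hw : Continuous w) (h : ∀ x, ‖z x‖ ^ 2 + ‖w x‖ ^ 2 = 1) :
    Continuous fun x => sphereMk (z x) (w x) (h x) := by
  unfold sphereMk
  refine Continuous.subtype_mk ?_ _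
  refine (PiLp.continuous_toLp 2 _).comp (continuous_pi fun i => ?_)
  fin_cases i
  · exact hz
  · exact hw

noncomputable def swapSphere (u : S3C) : S3C :=
  sphereMk (u.1 1) (u.1 0) (by rw [add_comm]; exact sphere_norm u)

theorem continuous_swapSphere : Continuous swapSphere := by
  unfold swapSphere
  exact continuous_sphereMk (by fun_prop) (by fun_prop) _

theorem swapSphere_swapSphere (u : S3C) : swapSphere (swapSphere u) = u := sphere_ext rfl rfl

/-- The point of the solid torus `|z| ≤ |w|` over the point `ζ` of the disc, at core angle `θ/p`;
the disc turns by `θ m / p`. -/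
noncomputable def lensPt (p : ℕ) (m : ℤ) (ζ : ℂ) (θ : ℝ) : S3C :=
  sphereMk ((√(1 + ‖ζ‖ ^ 2))⁻¹ * (ζ * E (θ * m / p))) ((√(1 + ‖ζ‖ ^ 2))⁻¹ * E (θ / p)) (by
    have h : 0 < 1 + ‖ζ‖ ^ 2 := by positivity
    have h1 : ‖(((√(1 + ‖ζ‖ ^ 2))⁻¹ : ℝ) : ℂ)‖ ^ 2 = (1 + ‖ζ‖ ^ 2)⁻¹ := by
      rw [Complex.norm_real, Real.norm_of_nonneg (by positivity), inv_pow, Real.sq_sqrt h.le]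
    simp only [norm_mul, norm_E, mul_pow, mul_one, h1]
    field_simp
    ring)

theorem lensPt_zero (p : ℕ) (m : ℤ) (ζ : ℂ) (θ : ℝ) :
    (lensPt p m ζ θ).1 0 = (√(1 + ‖ζ‖ ^ 2))⁻¹ * (ζ * E (θ * m / p)) := rfl

theorem lensPt_one (p : ℕ) (m : ℤ) (ζ : ℂ) (θ : ℝ) :
    (lensPt p m ζ θ).1 1 = (√(1 + ‖ζ‖ ^ 2))⁻¹ * E (θ / p) := rfl

theorem norm_lensPt_zero (p : ℕ) (m : ℤ) (ζ : ℂ) (θ : ℝ) :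
    ‖(lensPt p m ζ θ).1 0‖ = (√(1 + ‖ζ‖ ^ 2))⁻¹ * ‖ζ‖ := by
  rw [lensPt_zero, norm_mul, norm_mul, norm_E, Complex.norm_real,
    Real.norm_of_nonneg (by positivity), mul_one]

theorem norm_lensPt_one (p : ℕ) (m : ℤ) (ζ : ℂ) (θ : ℝ) :
    ‖(lensPt p m ζ θ).1 1‖ = (√(1 + ‖ζ‖ ^ 2))⁻¹ := by
  rw [lensPt_one, norm_mul, norm_E, Complex.norm_real,
    Real.norm_of_nonneg (by positivity), mul_one]

theorem continuous_lensPt (p : ℕ) (m : ℤ) :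
    Continuous fun v : Metric.closedBall (0 : ℂ) 1 × ℝ => lensPt p m v.1 v.2 := by
  have := continuous_E
  have hne : ∀ v : Metric.closedBall (0 : ℂ) 1 × ℝ, √(1 + ‖(v.1 : ℂ)‖ ^ 2) ≠ 0 := by
    intro v
    positivity
  unfold lensPt
  refine continuous_sphereMk ?_ ?_ _
  · fun_prop (disch := exact hne)
  · fun_prop (disch := exact hne)

/-- The orbit relation of the action generated by `(z, w) ↦ (E(m/p) z, E(1/p) w)`. -/
def LensRel (p : ℕ) (m : ℤ) (u v : S3C) : Prop :=
  ∃ k : ℤ, v.1 0 = E (k * m / p) * u.1 0 ∧ v.1 1 = E (k / p) * u.1 1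

theorem LensRel.norm_eq {p : ℕ} {m : ℤ} {u v : S3C} (h : LensRel p m u v) :
    ‖v.1 0‖ = ‖u.1 0‖ ∧ ‖v.1 1‖ = ‖u.1 1‖ := by
  obtain ⟨k, h0, h1⟩ := h
  rw [h0, h1]
  simp

/-- The generator raises `θ` by `1` and turns the first coordinate by `m / p`; the factor `E (θ * m
/ p)` compensates this turn. So the orbits are labelled by `ζ` and the class of `θ` modulo `1`. -/
theorem lensRel_lensPt {p : ℕ} (hp : 0 < p) (m : ℤ) (ζ ζ' : ℂ) (θ θ' : ℝ) :
    LensRel p m (lensPt p m ζ θ) (lensPt p m ζ' θ') ↔ ζ = ζ' ∧ E θ = E θ' := by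
  have hp0 : (p : ℝ) ≠ 0 := by exact_mod_cast hp.ne'
  have hN : ∀ ζ : ℂ, (((√(1 + ‖ζ‖ ^ 2))⁻¹ : ℝ) : ℂ) ≠ 0 := fun ζ => by
    have : 0 < (√(1 + ‖ζ‖ ^ 2))⁻¹ := by positivity
    exact_mod_cast this.ne'
  constructor
  · intro h
    have hn := h.norm_eq.2
    obtain ⟨k, h0, h1⟩ := h
    rw [norm_lensPt_one, norm_lensPt_one] at hn
    rw [lensPt_one, lensPt_one, hn, mul_left_comm (E _)] at h1
    rw [lensPt_zero, lensPt_zero, hn, mul_left_comm (E _)] at h0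
    have h1 := mul_left_cancel₀ (hN ζ) h1
    have h0 := mul_left_cancel₀ (hN ζ) h0
    rw [← E_add, E_eq_iff] at h1
    obtain ⟨n, hn⟩ := h1
    have hθ : θ' = θ + ((k - n * p : ℤ) : ℝ) := by
      push_cast
      field_simp at hn
      linarith
    refine ⟨?_, E_eq_iff.2 ⟨_, hθ⟩⟩
    have e : E (θ' * m / p) = E (k * m / p) * E (θ * m / p) := by
      rw [← E_add, E_eq_iff]
      refine ⟨n * m, ?_⟩
      rw [hθ]
      push_cast
      field_simp
      ring
    rw [e, mul_left_comm] at h0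
    have h0 := mul_left_cancel₀ (E_ne_zero _) h0
    exact (mul_right_cancel₀ (E_ne_zero _) h0).symm
  · rintro ⟨rfl, h⟩
    obtain ⟨k, rfl⟩ := E_eq_iff.1 h
    refine ⟨k, ?_, ?_⟩
    · rw [lensPt_zero, lensPt_zero, add_mul, add_div, E_add]
      ring
    · rw [lensPt_one, lensPt_one, add_div, E_add]
      ring

theorem exists_lensPt {p : ℕ} (hp : 0 < p) (m : ℤ) (u : S3C) (h : ‖u.1 0‖ ≤ ‖u.1 1‖) :
    ∃ ζ θ, ‖ζ‖ ≤ 1 ∧ lensPt p m ζ θ = u := by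
  have hp0 : (p : ℝ) ≠ 0 := by exact_mod_cast hp.ne'
  obtain ⟨x, hx⟩ := exists_polar_E (u.1 1)
  have hs := sphere_norm u
  have hw : 0 < ‖u.1 1‖ := by
    by_contra hc
    have : ‖u.1 1‖ = 0 := le_antisymm (not_lt.1 hc) (norm_nonneg _)
    rw [this] at h hs
    have : ‖u.1 0‖ = 0 := le_antisymm h (norm_nonneg _)
    rw [this] at hs
    norm_num at hs
  have hwc : (‖u.1 1‖ : ℂ) ≠ 0 := by exact_mod_cast hw.ne'
  set ζ : ℂ := u.1 0 * E (-(x * m)) / ‖u.1 1‖ with hζ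
  have hζn : ‖ζ‖ = ‖u.1 0‖ / ‖u.1 1‖ := by
    rw [hζ, norm_div, norm_mul, norm_E, mul_one, Complex.norm_real, norm_norm]
  have hN : (√(1 + ‖ζ‖ ^ 2))⁻¹ = ‖u.1 1‖ := by
    have : 1 + ‖ζ‖ ^ 2 = (‖u.1 1‖⁻¹) ^ 2 := by
      rw [hζn]
      field_simp
      linarith
    rw [this, Real.sqrt_sq (by positivity), inv_inv]
  refine ⟨ζ, x * p, by rw [hζn, div_le_one hw]; exact h, sphere_ext ?_ ?_⟩
  · rw [lensPt_zero, hN, hζ]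
    have e : E (-(x * m)) * E (x * p * m / p) = 1 := by
      rw [← E_add, ← E_zero]
      congr 1
      field_simp
      ring
    rw [div_mul_eq_mul_div, mul_assoc, e, mul_one, mul_div_cancel₀ _ hwc]
  · rw [lensPt_one, hN, mul_div_cancel_right₀ _ hp0, ← hx]

/-- A quotient of the sphere by the action of a cyclic group contains a solid torus. -/
theorem exists_lens_torus {X : Type*} [TopologicalSpace X] [T2Space X] {π : S3C → X}
    (hc : Continuous π) {p : ℕ} (hp : 0 < p) {m : ℤ} (hπ : ∀ u v, π u = π v ↔ LensRel p m u v) :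
    ∃ h : SolidTorus → X, IsClosedEmbedding h ∧
      ∀ (ζ : Metric.closedBall (0 : ℂ) 1) (θ : ℝ), h (ζ, ang (θ : 𝕋)) =
        π (lensPt p m ζ θ) := by
  let Q : Metric.closedBall (0 : ℂ) 1 × ℝ → SolidTorus := fun v => (v.1, ang (v.2 : 𝕋))
  have hsurj : Function.Surjective fun θ : ℝ => ang (θ : 𝕋) :=
    ang_surjective.comp QuotientAddGroup.mk_surjective
  choose σ hσ using hsurj
  simp only at hσ
  let h : SolidTorus → X := fun v => π (lensPt p m v.1 (σ v.2))
  have hval : ∀ (ζ : Metric.closedBall (0 : ℂ) 1) (θ : ℝ), h (ζ, ang (θ : 𝕋)) =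
        π (lensPt p m ζ θ) := by
    intro ζ θ
    rw [hπ, lensRel_lensPt hp]
    exact ⟨rfl, congrArg Subtype.val (hσ _)⟩
  have hQ : IsQuotientMap Q := by
    have h1 : IsOpenQuotientMap fun θ : ℝ => ang (θ : 𝕋) := by
      have h2 : IsOpenQuotientMap (fun x : ℝ => (x : 𝕋)) :=
        QuotientAddGroup.isOpenQuotientMap_mk
      have h3 : IsOpenQuotientMap ang :=
        (continuous_ang.isClosedEmbedding ang_injective).toIsEmbedding.toHomeomorphOfSurjective
          ang_surjective |>.isOpenQuotientMap
      exact h3.comp h2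
    exact (IsOpenQuotientMap.id.prodMap h1).isQuotientMap
  have hcont : Continuous h := by
    rw [hQ.continuous_iff]
    have : h ∘ Q = fun v => π (lensPt p m v.1 v.2) := funext fun v => hval v.1 v.2
    rw [this]
    exact hc.comp (continuous_lensPt p m)
  refine ⟨h, hcont.isClosedEmbedding ?_, hval⟩
  rintro ⟨ζ, a⟩ ⟨ζ', a'⟩ e
  rw [← hσ a, ← hσ a'] at e ⊢
  rw [hval, hval, hπ, lensRel_lensPt hp] at e
  exact Prod.ext (Subtype.ext e.1) (Circle.ext e.2)

theorem lensSetoid_iff_swap {p q : ℕ} {u v : S3C} :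
    (lensSetoid p q).r u v ↔ LensRel p q (swapSphere u) (swapSphere v) := by
  have e0 : ∀ k : ℤ, E (k / p) = Complex.exp (2 * Real.pi * Complex.I * k / p) := fun k => by
    rw [E_eq_exp]; congr 1; push_cast; ring
  have e1 : ∀ k : ℤ, E (k * (q : ℤ) / p) = Complex.exp (2 * Real.pi * Complex.I * (k * q) / p) :=
    fun k => by rw [E_eq_exp]; congr 1; push_cast; ring
  change (∃ k : ℤ, _) ↔ (∃ k : ℤ, _)
  refine exists_congr fun k => ?_
  rw [e0, e1, and_comm]
  rfl

/-- The `m`-th power of the generator acts by `m / p` and `q m / p ≡ 1 / p`, and it generates the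
same group. This puts the action into the normal form of `lensPt` around the other core as well. -/
theorem lensSetoid_iff {p q : ℕ} (hp : 0 < p) {m : ℤ} (h : ∃ z : ℤ, (q : ℤ) * m = 1 + p * z)
    {u v : S3C} : (lensSetoid p q).r u v ↔ LensRel p m u v := by
  have hp0 : (p : ℝ) ≠ 0 := by exact_mod_cast hp.ne'
  obtain ⟨z, hz⟩ := h
  have hz' : (q : ℝ) * m = 1 + p * z := by exact_mod_cast hz
  rw [lensSetoid_iff_swap]
  constructor
  · rintro ⟨k, h0, h1⟩
    refine ⟨k * q, ?_, h0.trans ?_⟩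
    · refine h1.trans ?_
      congr 1
      rw [E_eq_iff]
      refine ⟨k * z, ?_⟩
      push_cast
      field_simp
      linear_combination (k : ℝ) * hz'
    · have : (((k * q : ℤ)) : ℝ) = k * ((q : ℤ) : ℝ) := by push_cast; rfl
      rw [this]
      rfl
  · rintro ⟨k, h0, h1⟩
    refine ⟨k * m, h1.trans ?_, h0.trans ?_⟩
    · congr 1
      rw [E_eq_iff]
      refine ⟨k * z, ?_⟩
      push_cast
      field_simp
      linear_combination (k : ℝ) * hz'
    · have : (((k * m : ℤ)) : ℝ) = k * (m : ℝ) := by push_cast; rfl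
      rw [this]
      rfl

theorem lensRel_iff_mod {p : ℕ} (hp : 0 < p) {m : ℤ} {u v : S3C} :
    LensRel p m u v ↔ ∃ k ∈ Finset.range p,
      v.1 0 = E (k * m / p) * u.1 0 ∧ v.1 1 = E (k / p) * u.1 1 := by
  have hp0 : (p : ℝ) ≠ 0 := by exact_mod_cast hp.ne'
  have hpz : (p : ℤ) ≠ 0 := by exact_mod_cast hp.ne'
  constructor
  · rintro ⟨k, h0, h1⟩
    have hk := Int.emod_nonneg k hpz
    have hk' := Int.emod_lt_of_pos k (b := p) (by exact_mod_cast hp)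
    refine ⟨(k % p).toNat, by simp; omega, h0.trans ?_, h1.trans ?_⟩
    all_goals
      have e : (((k % p).toNat : ℕ) : ℝ) = k - p * (k / p : ℤ) := by
        have : (((k % p).toNat : ℕ) : ℤ) = k - p * (k / p) := by
          rw [Int.toNat_of_nonneg hk, Int.emod_def]
        exact_mod_cast this
      rw [e]
      congr 1
      rw [E_eq_iff]
    · exact ⟨-((k / p) * m), by push_cast; field_simp; ring⟩
    · exact ⟨-(k / p), by push_cast; field_simp; ring⟩
  · rintro ⟨k, -, h0, h1⟩
    exact ⟨k, by simpa using h0, by simpa using h1⟩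

theorem isOpenQuotientMap_lens {p q : ℕ} :
    IsOpenQuotientMap (Quotient.mk (lensSetoid p q)) := by
  refine ⟨Quotient.mk_surjective, continuous_quotient_mk', fun U hU => ?_⟩
  rw [← isQuotientMap_quotient_mk'.isOpen_preimage]
  let act (k : ℤ) (u : S3C) : S3C := sphereMk (E (k / p) * u.1 0) (E (k * (q : ℤ) / p) * u.1 1)
    (by simpa using sphere_norm u)
  have hact : ∀ k, Continuous (act k) := fun k =>
    continuous_sphereMk (by fun_prop) (by fun_prop) _
  have : Quotient.mk (lensSetoid p q) ⁻¹' (Quotient.mk (lensSetoid p q) '' U)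
      = ⋃ k : ℤ, act k ⁻¹' U := by
    ext u
    simp only [mem_preimage, mem_image, mem_iUnion]
    constructor
    · rintro ⟨v, hv, e⟩
      obtain ⟨k, h1, h0⟩ := lensSetoid_iff_swap.1 ((lensSetoid p q).symm (Quotient.exact e))
      refine ⟨k, ?_⟩
      have : act k u = v := sphere_ext h0.symm h1.symm
      rwa [this]
    · rintro ⟨k, hk⟩
      refine ⟨_, hk, Quotient.sound ?_⟩
      exact (lensSetoid p q).symm (lensSetoid_iff_swap.2 ⟨k, rfl, rfl⟩)
  change IsOpen (Quotient.mk (lensSetoid p q) ⁻¹' (Quotient.mk (lensSetoid p q) '' U))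
  rw [this]
  exact isOpen_iUnion fun k => hU.preimage (hact k)

/-- Only the exponents below `p` matter, so the orbit relation is a finite union of closed sets, and
the quotient map is open. -/
theorem t2Space_lensSpace {p q : ℕ} (hp : 0 < p) : T2Space (LensSpace p q) := by
  rw [t2Space_iff_of_isOpenQuotientMap isOpenQuotientMap_lens]
  have : {x : S3C × S3C | Quotient.mk (lensSetoid p q) x.1 = Quotient.mk (lensSetoid p q) x.2}
      = ⋃ k ∈ Finset.range p, {x : S3C × S3C |
        (swapSphere x.2).1 0 = E (k * (q : ℤ) / p) * (swapSphere x.1).1 0 ∧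
        (swapSphere x.2).1 1 = E (k / p) * (swapSphere x.1).1 1} := by
    ext x
    simp only [mem_ofPred_eq, mem_iUnion, exists_prop]
    rw [Quotient.eq]
    exact lensSetoid_iff_swap.trans (lensRel_iff_mod hp)
  rw [this]
  have := continuous_swapSphere
  refine isClosed_biUnion_finset fun k _ => ?_
  exact (isClosed_eq (by fun_prop) (by fun_prop)).inter (isClosed_eq (by fun_prop) (by fun_prop))

/-- The linear curve `n x + m t ∈ ℤ` on the torus. -/
def linearCurve (n : ℕ) (m : ℤ) : Set Torus :=
  torusProj '' {v | ∃ k : ℤ, (n : ℝ) * v.1 + m * v.2 = k}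

theorem torusProj_mem_linearCurve {n : ℕ} {m : ℤ} {v : ℝ × ℝ} :
    torusProj v ∈ linearCurve n m ↔ ∃ k : ℤ, (n : ℝ) * v.1 + m * v.2 = k := by
  constructor
  · rintro ⟨w, ⟨k, hk⟩, e⟩
    obtain ⟨i, hi⟩ := coe_eq_coe_iff.1 (congrArg Prod.fst e)
    obtain ⟨j, hj⟩ := coe_eq_coe_iff.1 (congrArg Prod.snd e)
    refine ⟨k + n * i + m * j, ?_⟩
    rw [hi, hj]
    push_cast
    linarith
  · exact fun h => ⟨v, h, rfl⟩

theorem torusProj_surjective : Function.Surjective torusProj := by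
  rintro ⟨a, b⟩
  obtain ⟨x, rfl⟩ := QuotientAddGroup.mk_surjective a
  obtain ⟨y, rfl⟩ := QuotientAddGroup.mk_surjective b
  exact ⟨(x, y), rfl⟩

theorem norm_lensPt_le {p : ℕ} {m : ℤ} {ζ : ℂ} {θ : ℝ} (h : ‖ζ‖ ≤ 1) :
    ‖(lensPt p m ζ θ).1 0‖ ≤ ‖(lensPt p m ζ θ).1 1‖ := by
  rw [norm_lensPt_zero, norm_lensPt_one]
  exact mul_le_of_le_one_right (by positivity) h

theorem norm_lensPt_eq_iff {p : ℕ} {m : ℤ} {ζ : ℂ} {θ : ℝ} :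
    ‖(lensPt p m ζ θ).1 0‖ = ‖(lensPt p m ζ θ).1 1‖ ↔ ‖ζ‖ = 1 := by
  rw [norm_lensPt_zero, norm_lensPt_one]
  have : 0 < (√(1 + ‖ζ‖ ^ 2))⁻¹ := by positivity
  constructor
  · intro h
    exact mul_left_cancel₀ this.ne' (h.trans (mul_one _).symm)
  · intro h
    rw [h, mul_one]

theorem exists_E_coe (a : Circle) : ∃ x : ℝ, a = ang (x : 𝕋) := by
  obtain ⟨b, rfl⟩ := ang_surjective a
  obtain ⟨x, rfl⟩ := QuotientAddGroup.mk_surjective b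
  exact ⟨x, rfl⟩

/-- The solid tori are the images of `|z| ≤ |w|` and of `|w| ≤ |z|`. In the coordinates `(x, t)` of
the boundary of the first, a point is on the meridian of the second when its orbit contains a point
with positive first coordinate. This says that `x + m t / p` is a multiple of `m / p` modulo `1`,
and as `m` is invertible modulo `p` it becomes `p x + m t ∈ ℤ`. -/
theorem isGluedAlong_of_lensRel {X : Type*} [TopologicalSpace X] [T2Space X] {π : S3C → X}
    (hπc : Continuous π) (hs : Function.Surjective π) {p : ℕ} (hp : 0 < p) {q m : ℤ}
    (h : ∃ z : ℤ, q * m = 1 + p * z) (hπ : ∀ u v, π u = π v ↔ LensRel p m u v)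
    (hπ' : ∀ u v, π (swapSphere u) = π (swapSphere v) ↔ LensRel p q u v) :
    IsGluedAlong X (linearCurve p m) := by
  have hp0 : (p : ℝ) ≠ 0 := by exact_mod_cast hp.ne'
  obtain ⟨f, hf, ef⟩ := exists_lens_torus hπc hp hπ
  obtain ⟨g, hg, eg⟩ := exists_lens_torus (π := fun u => π (swapSphere u))
    (hπc.comp continuous_swapSphere) hp hπ'
  have hn : ∀ u v, π u = π v → ‖u.1 0‖ = ‖v.1 0‖ ∧ ‖u.1 1‖ = ‖v.1 1‖ := fun u v e => by
    have := ((hπ u v).1 e).norm_eq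
    exact ⟨this.1.symm, this.2.symm⟩
  have rf : ∀ u, π u ∈ range f ↔ ‖u.1 0‖ ≤ ‖u.1 1‖ := by
    intro u
    constructor
    · rintro ⟨⟨ζ, a⟩, e⟩
      obtain ⟨θ, rfl⟩ := exists_E_coe a
      rw [ef] at e
      obtain ⟨h0, h1⟩ := hn _ _ e
      rw [← h0, ← h1]
      exact norm_lensPt_le (mem_closedBall_zero_iff.1 ζ.2)
    · intro hu
      obtain ⟨ζ, θ, hζ, rfl⟩ := exists_lensPt hp m u hu
      exact ⟨_, ef ⟨ζ, mem_closedBall_zero_iff.2 hζ⟩ θ⟩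
  have rg : ∀ u, π u ∈ range g ↔ ‖u.1 1‖ ≤ ‖u.1 0‖ := by
    intro u
    constructor
    · rintro ⟨⟨ζ, a⟩, e⟩
      obtain ⟨θ, rfl⟩ := exists_E_coe a
      rw [eg] at e
      obtain ⟨h0, h1⟩ := hn _ _ e
      rw [← h0, ← h1]
      exact norm_lensPt_le (p := p) (m := q) (θ := θ) (mem_closedBall_zero_iff.1 ζ.2)
    · intro hu
      obtain ⟨ζ, θ, hζ, e⟩ := exists_lensPt hp q (swapSphere u) hu
      refine ⟨_, (eg ⟨ζ, mem_closedBall_zero_iff.2 hζ⟩ θ).trans ?_⟩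
      simp only [e, swapSphere_swapSphere]
  have bf : ∀ u, π u ∈ f '' solidTorusBoundary ↔ ‖u.1 0‖ = ‖u.1 1‖ := by
    intro u
    constructor
    · rintro ⟨⟨ζ, a⟩, hζ, e⟩
      obtain ⟨θ, rfl⟩ := exists_E_coe a
      rw [ef] at e
      obtain ⟨h0, h1⟩ := hn _ _ e
      rw [← h0, ← h1]
      exact norm_lensPt_eq_iff.2 hζ
    · intro hu
      obtain ⟨ζ, θ, hζ, rfl⟩ := exists_lensPt hp m u hu.le
      rw [← ef ⟨ζ, mem_closedBall_zero_iff.2 hζ⟩ θ]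
      exact mem_image_of_mem f (norm_lensPt_eq_iff.1 hu)
  have bg : ∀ u, π u ∈ g '' solidTorusBoundary ↔ ‖u.1 0‖ = ‖u.1 1‖ := by
    intro u
    constructor
    · rintro ⟨⟨ζ, a⟩, hζ, e⟩
      obtain ⟨θ, rfl⟩ := exists_E_coe a
      rw [eg] at e
      obtain ⟨h0, h1⟩ := hn _ _ e
      rw [← h0, ← h1]
      exact ((norm_lensPt_eq_iff (p := p) (m := q) (θ := θ)).2 hζ).symm
    · intro hu
      obtain ⟨ζ, θ, hζ, e⟩ := exists_lensPt hp q (swapSphere u) hu.ge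
      have h1 : ‖(swapSphere u).1 0‖ = ‖(swapSphere u).1 1‖ := hu.symm
      rw [← e, norm_lensPt_eq_iff] at h1
      have h2 := eg ⟨ζ, mem_closedBall_zero_iff.2 hζ⟩ θ
      simp only [e, swapSphere_swapSphere] at h2
      rw [← h2]
      exact mem_image_of_mem g h1
  have hb : f '' solidTorusBoundary = g '' solidTorusBoundary := by
    ext y
    obtain ⟨u, rfl⟩ := hs y
    rw [bf, bg]
  refine ⟨f, g, hf, hg, ?_, ?_, hb, ?_⟩
  · ext y
    obtain ⟨u, rfl⟩ := hs y
    simp only [mem_union, rf, rg, mem_univ, iff_true]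
    exact le_total _ _
  · ext y
    obtain ⟨u, rfl⟩ := hs y
    simp only [mem_inter_iff, rf, rg, bf]
    exact ⟨fun h => le_antisymm h.1 h.2, fun h => ⟨h.le, h.ge⟩⟩
  · have key : ∀ v : ℝ × ℝ, f (bdry (torusProj v)) ∈ g '' solidTorusMeridian ↔
        ∃ k : ℤ, (p : ℝ) * v.1 + m * v.2 = k := by
      rintro ⟨x, t⟩
      have hfv : f (bdry (torusProj (x, t))) = π (lensPt p m (E x) t) :=
        ef ⟨E x, by simp⟩ t
      rw [hfv]
      constructor
      · rintro ⟨⟨ζ, a⟩, ⟨h1, h2⟩, e⟩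
        have h2 : a = ang ((0 : ℝ) : 𝕋) := by rw [AddCircle.coe_zero, ang_zero]; exact h2
        have h1 : ‖(ζ : ℂ)‖ = 1 := h1
        rw [h2, eg, hπ] at e
        obtain ⟨k, h0, -⟩ := e
        have h3 : (swapSphere (lensPt p q ζ 0)).1 0 = ((√(1 + ‖(ζ : ℂ)‖ ^ 2))⁻¹ : ℝ) * E (0 / p) := rfl
        rw [h3, lensPt_zero, h1, norm_E, zero_div, E_zero, mul_left_comm (E (k * m / p))] at h0
        have hN : (((√(1 + 1 ^ 2))⁻¹ : ℝ) : ℂ) ≠ 0 := by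
          have : 0 < (√(1 + 1 ^ 2))⁻¹ := by positivity
          exact_mod_cast this.ne'
        have h0 := mul_left_cancel₀ hN h0
        rw [mul_one, ← E_add, E_eq_iff] at h0
        obtain ⟨n, hn⟩ := h0
        refine ⟨k * m - p * n, ?_⟩
        push_cast
        field_simp at hn
        linarith
      · rintro ⟨k, hk⟩
        simp only at hk
        obtain ⟨z, hz⟩ := h
        have hz' : (q : ℝ) * m = 1 + p * z := by exact_mod_cast hz
        obtain ⟨y, hy⟩ : ∃ y : ℝ, t = k * q + p * y := ⟨(t - k * q) / p, by field_simp; ring⟩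
        refine ⟨(⟨E y, by simp⟩, ang ((0 : ℝ) : 𝕋)), ⟨norm_E _, ?_⟩, ?_⟩
        · rw [AddCircle.coe_zero, ang_zero]
        rw [eg, hπ]
        -- The first coordinate has to be turned by `k / p`, and the group element `k q` does this
        -- because `k q m ≡ k` modulo `p`.
        refine ⟨k * q, ?_, ?_⟩
        · have h3 : (swapSphere (lensPt p q (E y) 0)).1 0
            = ((√(1 + ‖E y‖ ^ 2))⁻¹ : ℝ) * E (0 / p) := rfl
          rw [h3, lensPt_zero, norm_E, norm_E, zero_div, E_zero, mul_one, ← E_add,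
            mul_comm (E _)]
          congr 1
          rw [E_eq_iff]
          refine ⟨k * z, ?_⟩
          push_cast
          field_simp
          linear_combination (k : ℝ) * hz' - hk
        · have h3 : (swapSphere (lensPt p q (E y) 0)).1 1
            = ((√(1 + ‖E y‖ ^ 2))⁻¹ : ℝ) * (E y * E (0 * q / p)) := rfl
          rw [h3, lensPt_one, norm_E, norm_E, zero_mul, zero_div, E_zero, mul_one, mul_left_comm,
            ← E_add]
          congr 2
          push_cast
          field_simp
          linarith
    ext y
    constructor
    · intro hy
      have : y ∈ f '' solidTorusBoundary := by
        rw [hb]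
        obtain ⟨v, hv, rfl⟩ := hy
        exact ⟨v, hv.1, rfl⟩
      rw [← range_bdry] at this
      obtain ⟨_, ⟨w, rfl⟩, rfl⟩ := this
      obtain ⟨v, rfl⟩ := torusProj_surjective w
      exact ⟨_, ⟨_, torusProj_mem_linearCurve.2 ((key v).1 hy), rfl⟩, rfl⟩
    · rintro ⟨_, ⟨w, hw, rfl⟩, rfl⟩
      obtain ⟨v, rfl⟩ := torusProj_surjective w
      exact (key v).2 (torusProj_mem_linearCurve.1 hw)

theorem isGluedAlong_lensSpace {p q : ℕ} (hp : 0 < p) {m : ℤ}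
    (h : ∃ z : ℤ, (q : ℤ) * m = 1 + p * z) : IsGluedAlong (LensSpace p q) (linearCurve p m) := by
  have := t2Space_lensSpace (q := q) hp
  refine isGluedAlong_of_lensRel (π := Quotient.mk (lensSetoid p q)) continuous_quotient_mk'
    Quotient.mk_surjective hp h (fun u v => ?_) (fun u v => ?_)
  · rw [← lensSetoid_iff hp h]
    exact Quotient.eq
  · have : LensRel p q u v ↔ (lensSetoid p q).r (swapSphere u) (swapSphere v) := by
      rw [lensSetoid_iff_swap, swapSphere_swapSphere, swapSphere_swapSphere]
    rw [this]
    exact Quotient.eq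

/-- The unit spheres of `ℂ²` and of `ℝ⁴` are homeomorphic. -/
theorem nonempty_S3C_homeomorph_S3 : Nonempty (S3C ≃ₜ S3) := by
  let f : S3C → S3 := fun u => ⟨!₂[(u.1 0).re, (u.1 0).im, (u.1 1).re, (u.1 1).im], by
    have h := sphere_norm u
    rw [Complex.sq_norm, Complex.sq_norm, Complex.normSq_apply, Complex.normSq_apply] at h
    rw [mem_sphere_zero_iff_norm, EuclideanSpace.norm_eq, Real.sqrt_eq_one, Fin.sum_univ_four]
    simp only [Real.norm_eq_abs, sq_abs, Matrix.cons_val]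
    linarith⟩
  let g : S3 → S3C := fun x => sphereMk ⟨x.1 0, x.1 1⟩ ⟨x.1 2, x.1 3⟩ (by
    have h := mem_sphere_zero_iff_norm.1 x.2
    rw [EuclideanSpace.norm_eq, Real.sqrt_eq_one, Fin.sum_univ_four] at h
    simp only [Real.norm_eq_abs, sq_abs] at h
    rw [Complex.sq_norm, Complex.sq_norm, Complex.normSq_apply, Complex.normSq_apply]
    simp only
    linarith)
  have hf : Continuous f := by
    refine Continuous.subtype_mk ?_ _
    refine (PiLp.continuous_toLp 2 _).comp (continuous_pi fun i => ?_)
    fin_cases i <;> simp <;> fun_prop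
  have hfg : Function.Bijective f := by
    refine Function.bijective_iff_has_inverse.2 ⟨g, fun u => sphere_ext rfl rfl, fun x => ?_⟩
    apply Subtype.ext
    ext i
    fin_cases i <;> rfl
  exact ⟨Continuous.homeoOfEquivCompactToT2 (f := Equiv.ofBijective f hfg) hf⟩

/-- For `p = 1` the group acts trivially, so that the quotient is the sphere itself, whatever `m`
is. -/
theorem isGluedAlong_S3 (m : ℤ) : IsGluedAlong S3C (linearCurve 1 m) := by
  have key : ∀ (k : ℤ) (u v : S3C), LensRel 1 k u v ↔ u = v := by
    intro k u v
    constructor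
    · rintro ⟨l, h0, h1⟩
      have e0 : E (l * k / (1 : ℕ)) = 1 := by rw [← E_int (l * k)]; push_cast; rw [div_one]
      have e1 : E (l / (1 : ℕ)) = 1 := by rw [← E_int l]; push_cast; rw [div_one]
      rw [e0, one_mul] at h0
      rw [e1, one_mul] at h1
      exact sphere_ext h0.symm h1.symm
    · rintro rfl
      exact ⟨0, by simp [E_zero], by simp [E_zero]⟩
  refine isGluedAlong_of_lensRel (π := fun u => u) (q := 1) continuous_id Function.surjective_id one_pos
    ⟨m - 1, by push_cast; ring⟩ (fun u v => (key _ _ _).symm) (fun u v => ?_)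
  rw [key]
  refine ⟨fun h => ?_, fun h => by rw [h]⟩
  rw [← swapSphere_swapSphere u, h, swapSphere_swapSphere]

end Dunwoody

/-! ### Curves on the torus cut open along `C`, drawn by births and deaths of strands. -/

namespace Dunwoody

open Topology Filter

/-! ### Homeomorphisms of the line commuting with integer translations -/

/-- The group of increasing homeomorphisms of the line which commute with `x ↦ x + 1`. -/
abbrev Twist : Type := CircleDeg1Liftˣ

theorem Twist.strictMono (φ : Twist) : StrictMono φ := (CircleDeg1Lift.toOrderIso φ).strictMono

theorem Twist.continuous (φ : Twist) : Continuous φ := (CircleDeg1Lift.toOrderIso φ).continuous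

theorem Twist.mul_apply (φ ψ : Twist) (p : ℝ) : (φ * ψ : Twist) p = φ (ψ p) := rfl

theorem Twist.one_apply (p : ℝ) : (1 : Twist) p = p := rfl

theorem surjective_of_add_one {f : ℝ → ℝ} (hc : Continuous f) (hp : ∀ p, f (p + 1) = f p + 1) :
    Function.Surjective f := by
  intro y
  have hn : ∀ n : ℤ, f n = f 0 + n := by
    intro n
    induction n with
    | zero => simp
    | succ n ih => push_cast at ih ⊢; rw [hp, ih]; ring
    | pred n ih =>
      have := hp (-(n : ℝ) - 1)
      rw [sub_add_cancel] at this
      push_cast at ih ⊢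
      linarith
  obtain ⟨x, -, hx⟩ := intermediate_value_Icc (a := ((⌊y - f 0⌋ : ℤ) : ℝ))
    (b := ((⌊y - f 0⌋ + 1 : ℤ) : ℝ)) (by push_cast; linarith) hc.continuousOn
    (show y ∈ _ by
      rw [hn, hn]
      push_cast
      constructor
      · linarith [Int.floor_le (y - f 0)]
      · linarith [Int.lt_floor_add_one (y - f 0)])
  exact ⟨x, hx⟩

theorem exists_twist {f : ℝ → ℝ} (hc : Continuous f) (hm : StrictMono f)
    (hp : ∀ p, f (p + 1) = f p + 1) : ∃ φ : Twist, ∀ p, φ p = f p := by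
  let g : CircleDeg1Lift := ⟨⟨f, hm.monotone⟩, hp⟩
  obtain ⟨u, hu⟩ := CircleDeg1Lift.isUnit_iff_bijective.2
    (show Function.Bijective g from ⟨hm.injective, surjective_of_add_one hc hp⟩)
  exact ⟨u, fun p => by rw [hu]; rfl⟩

theorem add_int_of_add_one {f : ℝ → ℝ} (hp : ∀ p, f (p + 1) = f p + 1) (p : ℝ) (n : ℤ) :
    f (p + n) = f p + n := by
  induction n with
  | zero => simp
  | succ n ih => push_cast at ih ⊢; rw [← add_assoc, hp, ih]; ring
  | pred n ih =>
    have := hp (p + (-(n : ℝ) - 1))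
    rw [show p + (-(n : ℝ) - 1) + 1 = p + -(n : ℝ) by ring] at this
    push_cast at ih ⊢
    linarith

/-! ### Homeomorphisms preserving a fibration by lines -/

/-- Continuity of the inverse is a matter of order: it exceeds `a` exactly where `g (x, a) < s`,
which is an open condition on `(x, s)`, and likewise from the other side. -/
theorem exists_fiber_homeomorph {X : Type*} [TopologicalSpace X] {g : X × ℝ → ℝ}
    (hc : Continuous g) (hm : ∀ x, StrictMono fun t => g (x, t))
    (hs : ∀ x, Function.Surjective fun t => g (x, t)) :
    ∃ H : X × ℝ ≃ₜ X × ℝ, ∀ v, H v = (v.1, g v) := by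
  choose h hh using hs
  simp only at hh
  have hl : ∀ x t, h x (g (x, t)) = t := fun x t => (hm x).injective (hh x (g (x, t)))
  have hcont : Continuous fun v : X × ℝ => h v.1 v.2 := by
    rw [continuous_iff_continuousAt]
    rintro ⟨x, s⟩
    refine tendsto_order.2 ⟨fun a ha => ?_, fun a ha => ?_⟩
    · have h1 : g (x, a) < s := by rw [← hh x s]; exact hm x ha
      have h2 : ∀ᶠ v : X × ℝ in 𝓝 (x, s), g (v.1, a) < v.2 := by
        refine (isOpen_lt (f := fun v : X × ℝ => g (v.1, a)) (by fun_prop) (by fun_prop)).mem_nhds ?_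
        exact h1
      filter_upwards [h2] with v hv
      rw [← (hm v.1).lt_iff_lt, hh]
      exact hv
    · have h1 : s < g (x, a) := by
        rw [← hh x s]; exact hm x ha
      have h2 : ∀ᶠ v : X × ℝ in 𝓝 (x, s), v.2 < g (v.1, a) := by
        refine (isOpen_lt (g := fun v : X × ℝ => g (v.1, a)) (by fun_prop) (by fun_prop)).mem_nhds ?_
        exact h1
      filter_upwards [h2] with v hv
      rw [← (hm v.1).lt_iff_lt, hh]
      exact hv
  refine ⟨⟨⟨fun v => (v.1, g v), fun v => (v.1, h v.1 v.2), ?_, ?_⟩, ?_, ?_⟩, fun _ => rfl⟩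
  · rintro ⟨x, t⟩
    simp [hl]
  · rintro ⟨x, t⟩
    simp [hh]
  · fun_prop
  · fun_prop

/-! ### Cutting the torus open along the curve at height `0` -/

/-- The strip `0 ≤ t ≤ 1`. -/
def strip : Set (ℝ × ℝ) := {v | v.2 ∈ Icc (0 : ℝ) 1}

/-- A family of homeomorphisms of the line with monodromy `φ`. -/
structure IsShear (φ : Twist) (F : ℝ → ℝ → ℝ) : Prop where
  cont : Continuous fun v : ℝ × ℝ => F v.1 v.2
  mono : ∀ t ∈ Icc (0 : ℝ) 1, StrictMono fun p => F p t
  per : ∀ p, ∀ t ∈ Icc (0 : ℝ) 1, F (p + 1) t = F p t + 1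
  glue : ∀ p, F p 1 = F (φ p) 0

/-- The projection of the strip to the torus given by a family of homeomorphisms of the line. -/
def cut (F : ℝ → ℝ → ℝ) (v : ℝ × ℝ) : Torus := torusProj (F v.1 v.2, v.2)

/-- The points of the strip which become equal when its ends are glued by `φ`. -/
def Glued (φ : Twist) (v w : ℝ × ℝ) : Prop :=
  (v.2 = w.2 ∧ ∃ n : ℤ, w.1 = v.1 + n) ∨ (v.2 = 1 ∧ w.2 = 0 ∧ ∃ n : ℤ, w.1 = φ v.1 + n) ∨
    (v.2 = 0 ∧ w.2 = 1 ∧ ∃ n : ℤ, v.1 = φ w.1 + n)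

theorem continuous_torusProj : Continuous torusProj := by
  have : Continuous (fun x : ℝ => (x : 𝕋)) := AddCircle.continuous_mk' 1
  unfold torusProj
  fun_prop

namespace IsShear

variable {φ : Twist} {F : ℝ → ℝ → ℝ}

theorem continuous_cut (h : IsShear φ F) : Continuous (cut F) := by
  have h1 := h.cont
  have h2 := continuous_torusProj
  unfold cut
  fun_prop

theorem add_int (h : IsShear φ F) (p : ℝ) {t : ℝ} (ht : t ∈ Icc (0 : ℝ) 1) (n : ℤ) :
    F (p + n) t = F p t + n :=
  add_int_of_add_one (f := fun p => F p t) (fun p => h.per p t ht) p n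

theorem coe_eq_iff (h : IsShear φ F) {p p' t : ℝ} (ht : t ∈ Icc (0 : ℝ) 1) :
    ((F p t : ℝ) : 𝕋) = F p' t ↔ ∃ n : ℤ, p' = p + n := by
  rw [coe_eq_coe_iff]
  refine exists_congr fun n => ?_
  rw [← h.add_int p ht, (h.mono t ht).injective.eq_iff]

theorem cut_add_int (h : IsShear φ F) {v : ℝ × ℝ} (hv : v ∈ strip) (n : ℤ) :
    cut F (v.1 + n, v.2) = cut F v :=
  Prod.ext ((h.coe_eq_iff hv).2 ⟨-n, by simp⟩) rfl

theorem cut_mem_curveC {v : ℝ × ℝ} (hv : v ∈ strip) : cut F v ∈ curveC ↔ v.2 = 0 ∨ v.2 = 1 := by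
  change ((v.2 : ℝ) : 𝕋) = 0 ↔ _
  rw [coe_eq_zero_iff]
  constructor
  · rintro ⟨n, hn⟩
    have h0 := hv.1
    have h1 := hv.2
    rw [hn] at h0 h1
    have h0 : 0 ≤ n := by exact_mod_cast h0
    have h1 : n ≤ 1 := by exact_mod_cast h1
    rw [hn]
    interval_cases n <;> simp
  · rintro (h | h)
    · exact ⟨0, by simp [h]⟩
    · exact ⟨1, by simp [h]⟩

theorem cut_eq_iff (h : IsShear φ F) {v w : ℝ × ℝ} (hv : v ∈ strip) (hw : w ∈ strip) :
    cut F v = cut F w ↔ Glued φ v w := by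
  have z0 : (0 : ℝ) ∈ Icc (0 : ℝ) 1 := by simp
  have z1 : (1 : ℝ) ∈ Icc (0 : ℝ) 1 := by simp
  obtain ⟨p, t⟩ := v
  obtain ⟨p', t'⟩ := w
  simp only [cut, torusProj, Prod.mk.injEq, Glued]
  constructor
  · rintro ⟨h1, h2⟩
    obtain ⟨n, hn⟩ := coe_eq_coe_iff.1 h2
    have ht : t ∈ Icc (0 : ℝ) 1 := hv
    obtain ⟨a0, a1⟩ := ht
    obtain ⟨b0, b1⟩ : 0 ≤ t' ∧ t' ≤ 1 := hw
    have c1 : (-1 : ℝ) ≤ n := by linarith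
    have c2 : (n : ℝ) ≤ 1 := by linarith
    have c1 : -1 ≤ n := by exact_mod_cast c1
    have c2 : n ≤ 1 := by exact_mod_cast c2
    interval_cases n
    · have : t = 1 := by push_cast at hn; linarith
      have : t' = 0 := by push_cast at hn; linarith
      subst t t'
      rw [h.glue, h.coe_eq_iff z0] at h1
      exact Or.inr (Or.inl ⟨rfl, rfl, h1⟩)
    · have : t' = t := by push_cast at hn; linarith
      rw [this] at h1 ⊢
      rw [h.coe_eq_iff (t := t) ⟨a0, a1⟩] at h1
      exact Or.inl ⟨rfl, h1⟩
    · have : t = 0 := by push_cast at hn; linarith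
      have : t' = 1 := by push_cast at hn; linarith
      subst t t'
      rw [h.glue, eq_comm, h.coe_eq_iff z0] at h1
      exact Or.inr (Or.inr ⟨rfl, rfl, h1⟩)
  · rintro (⟨rfl, h1⟩ | ⟨rfl, rfl, h1⟩ | ⟨rfl, rfl, h1⟩)
    · exact ⟨(h.coe_eq_iff hv).2 h1, rfl⟩
    · refine ⟨?_, by simp⟩
      rw [h.glue, h.coe_eq_iff z0]
      exact h1
    · refine ⟨?_, ?_⟩
      · rw [h.glue, eq_comm, h.coe_eq_iff z0]
        exact h1
      · exact coe_eq_coe_iff.2 ⟨1, by simp⟩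

theorem surjective (h : IsShear φ F) {t : ℝ} (ht : t ∈ Icc (0 : ℝ) 1) :
    Function.Surjective fun p => F p t := by
  have := h.cont
  exact surjective_of_add_one (by fun_prop) (fun p => h.per p t ht)

/-- Every point of the torus comes from the unit square. -/
theorem exists_cut_eq (h : IsShear φ F) (x : Torus) :
    ∃ v ∈ Icc (0 : ℝ) 1 ×ˢ Icc (0 : ℝ) 1, v ∈ strip ∧ cut F v = x := by
  obtain ⟨a, b⟩ := x
  obtain ⟨y, rfl⟩ := QuotientAddGroup.mk_surjective a
  obtain ⟨t, ht, rfl⟩ := exists_coe_Ico b 0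
  rw [zero_add] at ht
  have ht' : t ∈ Icc (0 : ℝ) 1 := Ico_subset_Icc_self ht
  obtain ⟨p, hp⟩ := h.surjective ht' y
  refine ⟨(p + (-⌊p⌋ : ℤ), t), ⟨⟨?_, ?_⟩, ht'⟩, ht', ?_⟩
  · simp only; push_cast; linarith [Int.floor_le p]
  · simp only; push_cast; linarith [Int.lt_floor_add_one p]
  · refine (h.cut_add_int (v := (p, t)) ht' _).trans ?_
    simp only at hp
    simp only [cut, torusProj, hp]

end IsShear

/-- A homeomorphism of the plane, commuting with the horizontal unit translation, which maps the
strip to itself by `ψ₀` on the lower side and by `ψ₁` on the upper side. -/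
structure IsStripMap (ψ₀ ψ₁ : Twist) (H : ℝ × ℝ ≃ₜ ℝ × ℝ) : Prop where
  per : ∀ p t, H (p + 1, t) = ((H (p, t)).1 + 1, (H (p, t)).2)
  lower : ∀ p t, t ≤ 0 → H (p, t) = (ψ₀ p, t)
  upper : ∀ p t, 1 ≤ t → H (p, t) = (ψ₁ p, t)

namespace IsStripMap

variable {ψ₀ ψ₁ ψ₂ : Twist} {H H' : ℝ × ℝ ≃ₜ ℝ × ℝ}

theorem add_int (h : IsStripMap ψ₀ ψ₁ H) (p t : ℝ) (n : ℤ) :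
    H (p + n, t) = ((H (p, t)).1 + n, (H (p, t)).2) := by
  induction n with
  | zero => simp
  | succ n ih =>
    push_cast at ih ⊢
    rw [← add_assoc, h.per, ih]
    simp only [Prod.mk.injEq, and_true]
    ring
  | pred n ih =>
    have := h.per (p + (-(n : ℝ) - 1)) t
    rw [show p + (-(n : ℝ) - 1) + 1 = p + -(n : ℝ) by ring] at this
    push_cast at ih ⊢
    rw [this] at ih
    have e1 := congrArg Prod.fst ih
    have e2 := congrArg Prod.snd ih
    refine Prod.ext ?_ e2
    simp only at e1 ⊢
    linarith

theorem symm (h : IsStripMap ψ₀ ψ₁ H) : IsStripMap ψ₀⁻¹ ψ₁⁻¹ H.symm := by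
  refine ⟨fun p t => ?_, fun p t ht => ?_, fun p t ht => ?_⟩
  · rw [Homeomorph.symm_apply_eq, h.per]
    simp
  · rw [Homeomorph.symm_apply_eq, h.lower _ _ ht]
    simp
  · rw [Homeomorph.symm_apply_eq, h.upper _ _ ht]
    simp

theorem trans {χ₀ χ₁ : Twist} (h : IsStripMap ψ₀ ψ₁ H) (h' : IsStripMap χ₀ χ₁ H') :
    IsStripMap (χ₀ * ψ₀) (χ₁ * ψ₁) (H.trans H') := by
  refine ⟨fun p t => ?_, fun p t ht => ?_, fun p t ht => ?_⟩
  · simp only [Homeomorph.trans_apply]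
    rw [h.per, h'.per]
  · simp only [Homeomorph.trans_apply]
    rw [h.lower _ _ ht, h'.lower _ _ ht]
    rfl
  · simp only [Homeomorph.trans_apply]
    rw [h.upper _ _ ht, h'.upper _ _ ht]
    rfl

theorem le_zero_iff (h : IsStripMap ψ₀ ψ₁ H) (v : ℝ × ℝ) : (H v).2 ≤ 0 ↔ v.2 ≤ 0 := by
  constructor
  · intro hv
    have := h.symm.lower (H v).1 (H v).2 hv
    rw [Prod.mk.eta, Homeomorph.symm_apply_apply] at this
    rw [this]
    exact hv
  · intro hv
    have := h.lower v.1 v.2 hv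
    rw [Prod.mk.eta] at this
    rw [this]
    exact hv

theorem one_le_iff (h : IsStripMap ψ₀ ψ₁ H) (v : ℝ × ℝ) : 1 ≤ (H v).2 ↔ 1 ≤ v.2 := by
  constructor
  · intro hv
    have := h.symm.upper (H v).1 (H v).2 hv
    rw [Prod.mk.eta, Homeomorph.symm_apply_apply] at this
    rw [this]
    exact hv
  · intro hv
    have := h.upper v.1 v.2 hv
    rw [Prod.mk.eta] at this
    rw [this]
    exact hv

theorem eq_zero_iff (h : IsStripMap ψ₀ ψ₁ H) (v : ℝ × ℝ) : (H v).2 = 0 ↔ v.2 = 0 := by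
  constructor
  · intro hv
    have := h.symm.lower (H v).1 (H v).2 hv.le
    rw [Prod.mk.eta, Homeomorph.symm_apply_apply] at this
    rw [this]
    exact hv
  · intro hv
    have := h.lower v.1 v.2 hv.le
    rw [Prod.mk.eta] at this
    rw [this]
    exact hv

theorem eq_one_iff (h : IsStripMap ψ₀ ψ₁ H) (v : ℝ × ℝ) : (H v).2 = 1 ↔ v.2 = 1 := by
  constructor
  · intro hv
    have := h.symm.upper (H v).1 (H v).2 hv.ge
    rw [Prod.mk.eta, Homeomorph.symm_apply_apply] at this
    rw [this]
    exact hv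
  · intro hv
    have := h.upper v.1 v.2 hv.ge
    rw [Prod.mk.eta] at this
    rw [this]
    exact hv

theorem nonneg_iff (h : IsStripMap ψ₀ ψ₁ H) (v : ℝ × ℝ) : 0 ≤ (H v).2 ↔ 0 ≤ v.2 := by
  rw [le_iff_lt_or_eq, le_iff_lt_or_eq, ← not_le, ← not_le, h.le_zero_iff, eq_comm,
    h.eq_zero_iff, eq_comm]

theorem le_one_iff (h : IsStripMap ψ₀ ψ₁ H) (v : ℝ × ℝ) : (H v).2 ≤ 1 ↔ v.2 ≤ 1 := by
  rw [le_iff_lt_or_eq, le_iff_lt_or_eq, ← not_le, ← not_le, h.one_le_iff, h.eq_one_iff]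

theorem mem_strip_iff (h : IsStripMap ψ₀ ψ₁ H) (v : ℝ × ℝ) : H v ∈ strip ↔ v ∈ strip :=
  and_congr (h.nonneg_iff v) (h.le_one_iff v)

/-- The condition says that going up to the top side by `ψ₁` and then gluing is the same as gluing
first and then applying `ψ₀` on the bottom side. -/
theorem glued_iff {φ φ' : Twist} (h : IsStripMap ψ₀ ψ₁ H) (hφ : φ' * ψ₁ = ψ₀ * φ) (v w : ℝ × ℝ) :
    Glued φ v w ↔ Glued φ' (H v) (H w) := by
  have comm : ∀ p, φ' (ψ₁ p) = ψ₀ (φ p) := fun p => by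
    rw [← Twist.mul_apply, hφ, Twist.mul_apply]
  have key : ∀ v w : ℝ × ℝ, v.2 = 1 ∧ w.2 = 0 ∧ (∃ n : ℤ, w.1 = φ v.1 + n) ↔
      (H v).2 = 1 ∧ (H w).2 = 0 ∧ ∃ n : ℤ, (H w).1 = φ' (H v).1 + n := by
    rintro ⟨p, t⟩ ⟨p', t'⟩
    rw [h.eq_one_iff, h.eq_zero_iff]
    simp only
    constructor
    · rintro ⟨rfl, rfl, n, rfl⟩
      refine ⟨rfl, rfl, n, ?_⟩
      rw [h.upper _ _ le_rfl, h.lower _ _ le_rfl]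
      simp [comm]
    · rintro ⟨rfl, rfl, n, hn⟩
      refine ⟨rfl, rfl, n, ?_⟩
      rw [h.upper _ _ le_rfl, h.lower _ _ le_rfl] at hn
      simp only [comm] at hn
      rw [← CircleDeg1Lift.map_add_int] at hn
      exact ψ₀.strictMono.injective hn
  have key1 : v.2 = w.2 ∧ (∃ n : ℤ, w.1 = v.1 + n) ↔
      (H v).2 = (H w).2 ∧ ∃ n : ℤ, (H w).1 = (H v).1 + n := by
    constructor
    · rintro ⟨e, n, hn⟩
      have : w = (v.1 + n, v.2) := Prod.ext hn e.symm
      rw [this, h.add_int]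
      exact ⟨rfl, n, rfl⟩
    · rintro ⟨e, n, hn⟩
      have e2 : H w = H (v.1 + n, v.2) := by
        rw [h.add_int]
        exact Prod.ext hn e.symm
      have := H.injective e2
      rw [this]
      exact ⟨rfl, n, rfl⟩
  unfold Glued
  rw [key1, key v w, and_left_comm (a := v.2 = 0), key w v,
    and_left_comm (a := (H w).2 = 1)]

end IsStripMap

/-- Two subsets of the strip correspond under a homeomorphism of the strip. -/
def Iso (ψ₀ ψ₁ : Twist) (A B : Set (ℝ × ℝ)) : Prop :=
  ∃ H : ℝ × ℝ ≃ₜ ℝ × ℝ, IsStripMap ψ₀ ψ₁ H ∧ ∀ v ∈ strip, v ∈ A ↔ H v ∈ B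

theorem Iso.symm {ψ₀ ψ₁ : Twist} {A B : Set (ℝ × ℝ)} (h : Iso ψ₀ ψ₁ A B) :
    Iso ψ₀⁻¹ ψ₁⁻¹ B A := by
  obtain ⟨H, h1, h2⟩ := h
  refine ⟨H.symm, h1.symm, fun v hv => ?_⟩
  rw [h2 _ ((h1.symm.mem_strip_iff v).2 hv), Homeomorph.apply_symm_apply]

theorem Iso.symm_one {A B : Set (ℝ × ℝ)} (h : Iso 1 1 A B) : Iso 1 1 B A := by
  simpa using h.symm

theorem Iso.trans {ψ₀ ψ₁ χ₀ χ₁ : Twist} {A B C : Set (ℝ × ℝ)} (h : Iso ψ₀ ψ₁ A B)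
    (h' : Iso χ₀ χ₁ B C) : Iso (χ₀ * ψ₀) (χ₁ * ψ₁) A C := by
  obtain ⟨H, h1, h2⟩ := h
  obtain ⟨H', h3, h4⟩ := h'
  refine ⟨H.trans H', h1.trans h3, fun v hv => ?_⟩
  rw [h2 v hv, h4 _ ((h1.mem_strip_iff v).2 hv)]
  rfl

theorem isStripMap_refl : IsStripMap 1 1 (Homeomorph.refl _) :=
  ⟨fun _ _ => rfl, fun _ _ _ => rfl, fun _ _ _ => rfl⟩

theorem Iso.of_eqOn {A B : Set (ℝ × ℝ)} (h : ∀ v ∈ strip, v ∈ A ↔ v ∈ B) : Iso 1 1 A B :=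
  ⟨Homeomorph.refl _, isStripMap_refl, h⟩

theorem Iso.trans_one {ψ₀ ψ₁ : Twist} {A B C : Set (ℝ × ℝ)} (h : Iso ψ₀ ψ₁ A B)
    (h' : Iso 1 1 B C) : Iso ψ₀ ψ₁ A C := by
  simpa using h.trans h'

theorem Iso.one_trans {ψ₀ ψ₁ : Twist} {A B C : Set (ℝ × ℝ)} (h : Iso 1 1 A B)
    (h' : Iso ψ₀ ψ₁ B C) : Iso ψ₀ ψ₁ A C := by
  simpa using h.trans h'

/-- A homeomorphism of the strip that intertwines the two gluings descends to the torus. It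
preserves the sides of the strip, hence `curveC`, so it extends over the solid torus. This turns
deformations in the plane into relations between curves. -/
theorem related_cut {φ φ' ψ₀ ψ₁ : Twist} {F F' : ℝ → ℝ → ℝ} (hF : IsShear φ F)
    (hF' : IsShear φ' F') {A B : Set (ℝ × ℝ)} (h : Iso ψ₀ ψ₁ A B) (hφ : φ' * ψ₁ = ψ₀ * φ) :
    Related (cut F '' (A ∩ strip)) (cut F' '' (B ∩ strip)) := by
  obtain ⟨H, h1, h2⟩ := h
  let X : Set (ℝ × ℝ) := Icc (0 : ℝ) 1 ×ˢ Icc (0 : ℝ) 1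
  have hX : IsCompact X := isCompact_Icc.prod isCompact_Icc
  have : CompactSpace X := isCompact_iff_compactSpace.1 hX
  have hXs : ∀ x : X, (x : ℝ × ℝ) ∈ strip := fun x => x.2.2
  let q : X → Torus := fun x => cut F x
  let q' : X → Torus := fun x => cut F' (H x)
  have red : ∀ v ∈ strip, ∃ x : X, ∃ n : ℤ, v = (x.1.1 + n, x.1.2) := by
    intro v hv
    refine ⟨⟨(v.1 - ⌊v.1⌋, v.2), ⟨⟨?_, ?_⟩, hv⟩⟩, ⌊v.1⌋, ?_⟩
    · linarith [Int.floor_le v.1]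
    · linarith [Int.lt_floor_add_one v.1]
    · simp
  have red' : ∀ x : X, ∀ n : ℤ, cut F' (H (x.1.1 + n, x.1.2)) = q' x := by
    intro x n
    rw [h1.add_int]
    exact hF'.cut_add_int ((h1.mem_strip_iff _).2 (hXs x)) n
  have hq : IsQuotientMap q := isQuotientMap_of_compact
    (hF.continuous_cut.comp continuous_subtype_val) fun y => by
      obtain ⟨v, hv, -, e⟩ := hF.exists_cut_eq y
      exact ⟨⟨v, hv⟩, e⟩
  have hq' : IsQuotientMap q' := isQuotientMap_of_compact
    (hF'.continuous_cut.comp (H.continuous.comp continuous_subtype_val)) fun y => by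
      obtain ⟨v, -, hv, e⟩ := hF'.exists_cut_eq y
      obtain ⟨x, n, hx⟩ := red (H.symm v) ((h1.symm.mem_strip_iff v).2 hv)
      refine ⟨x, ?_⟩
      rw [← red' x n, ← hx, Homeomorph.apply_symm_apply, e]
  obtain ⟨K, hK⟩ := exists_homeomorph_of_fibers hq hq' fun x y => by
    simp only [q, q']
    rw [hF.cut_eq_iff (hXs x) (hXs y), h1.glued_iff hφ,
      hF'.cut_eq_iff ((h1.mem_strip_iff _).2 (hXs x)) ((h1.mem_strip_iff _).2 (hXs y))]
  have hKs : ∀ v ∈ strip, K (cut F v) = cut F' (H v) := by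
    intro v hv
    obtain ⟨x, n, rfl⟩ := red v hv
    rw [red', ← hK x]
    exact congrArg K (hF.cut_add_int (hXs x) n)
  refine ⟨K, extends_of_image_curveC ?_, ?_⟩
  · ext y
    obtain ⟨z, rfl⟩ := K.surjective y
    rw [K.injective.mem_set_image]
    obtain ⟨v, -, hv, rfl⟩ := hF.exists_cut_eq z
    rw [hKs v hv, IsShear.cut_mem_curveC hv, IsShear.cut_mem_curveC ((h1.mem_strip_iff _).2 hv),
      h1.eq_zero_iff, h1.eq_one_iff]
  · ext y
    constructor
    · rintro ⟨_, ⟨v, ⟨hA, hv⟩, rfl⟩, rfl⟩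
      exact ⟨H v, ⟨(h2 v hv).1 hA, (h1.mem_strip_iff v).2 hv⟩, (hKs v hv).symm⟩
    · rintro ⟨w, ⟨hB, hw⟩, rfl⟩
      obtain ⟨v, rfl⟩ := H.surjective w
      have hv := (h1.mem_strip_iff v).1 hw
      exact ⟨_, ⟨v, ⟨(h2 v hv).2 hB, hv⟩, rfl⟩, hKs v hv⟩

/-- The curve `D` on the torus is drawn by the subset `A` of the strip glued by `φ`, up to a
homeomorphism which extends over the solid torus. -/
def Draw (φ : Twist) (A : Set (ℝ × ℝ)) (D : Set Torus) : Prop :=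
  ∃ F, IsShear φ F ∧ Related D (cut F '' (A ∩ strip))

/-- Only the monodromy matters: two shears with the same `φ` are compared by the identity of the
strip. -/
theorem Draw.related {φ : Twist} {A : Set (ℝ × ℝ)} {D : Set Torus} (h : Draw φ A D)
    {F : ℝ → ℝ → ℝ} (hF : IsShear φ F) : Related D (cut F '' (A ∩ strip)) := by
  obtain ⟨F', hF', hD⟩ := h
  exact hD.trans (related_cut hF' hF (Iso.of_eqOn fun _ _ => Iff.rfl) (by simp))

theorem isShear_standard (φ : Twist) : IsShear φ fun p t => (1 - t) * p + t * φ p := by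
  have := φ.continuous
  refine ⟨by fun_prop, fun t ht p p' h => ?_, fun p t _ => ?_, fun p => by simp⟩
  · have := φ.strictMono h
    simp only
    rcases eq_or_lt_of_le ht.1 with rfl | h0
    · simpa using h
    · have : t * φ p < t * φ p' := mul_lt_mul_of_pos_left this h0
      have : (1 - t) * p ≤ (1 - t) * p' := mul_le_mul_of_nonneg_left h.le (by linarith [ht.2])
      linarith
  · simp only [CircleDeg1Lift.map_add_one]
    ring

theorem Draw.iso {φ φ' ψ₀ ψ₁ : Twist} {A B : Set (ℝ × ℝ)} {D : Set Torus} (h : Draw φ A D)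
    (hi : Iso ψ₀ ψ₁ A B) (hφ : φ' * ψ₁ = ψ₀ * φ) : Draw φ' B D := by
  obtain ⟨F, hF, hD⟩ := h
  exact ⟨_, isShear_standard φ', hD.trans (related_cut hF (isShear_standard φ') hi hφ)⟩

theorem Draw.iso_one {φ : Twist} {A B : Set (ℝ × ℝ)} {D : Set Torus} (h : Draw φ A D)
    (hi : Iso 1 1 A B) : Draw φ B D := h.iso hi (by simp)

/-! ### Homeomorphisms of the strip -/

theorem surjective_of_eq_outside {f : ℝ → ℝ} (hc : Continuous f) (h0 : ∀ t ≤ 0, f t = t)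
    (h1 : ∀ t, 1 ≤ t → f t = t) : Function.Surjective f := by
  intro y
  rcases le_total y 0 with hy | hy
  · exact ⟨y, h0 y hy⟩
  rcases le_total 1 y with hy1 | hy1
  · exact ⟨y, h1 y hy1⟩
  obtain ⟨x, -, hx⟩ := intermediate_value_Icc (zero_le_one' ℝ) hc.continuousOn
    (show y ∈ Icc (f 0) (f 1) by rw [h0 0 le_rfl, h1 1 le_rfl]; exact ⟨hy, hy1⟩)
  exact ⟨x, hx⟩

theorem Iso.vertical {g : ℝ → ℝ → ℝ} (hc : Continuous fun v : ℝ × ℝ => g v.1 v.2)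
    (hm : ∀ p, StrictMono (g p)) (hp : ∀ p t, g (p + 1) t = g p t) (h0 : ∀ p, ∀ t ≤ 0, g p t = t)
    (h1 : ∀ p t, 1 ≤ t → g p t = t) {A B : Set (ℝ × ℝ)}
    (hAB : ∀ p, ∀ t ∈ Icc (0 : ℝ) 1, (p, t) ∈ A ↔ (p, g p t) ∈ B) : Iso 1 1 A B := by
  obtain ⟨H, hH⟩ := exists_fiber_homeomorph (g := fun v : ℝ × ℝ => g v.1 v.2) hc hm
    (fun p => surjective_of_eq_outside (by fun_prop) (h0 p) (h1 p))
  refine ⟨H, ⟨fun p t => ?_, fun p t ht => ?_, fun p t ht => ?_⟩, fun v hv => ?_⟩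
  · simp [hH, hp]
  · simp [hH, h0 p t ht]
  · simp [hH, h1 p t ht]
  · rw [hH]
    exact hAB v.1 v.2 hv

theorem Iso.level {ψ₀ ψ₁ : Twist} {ψ : ℝ → ℝ → ℝ} (hc : Continuous fun v : ℝ × ℝ => ψ v.1 v.2)
    (hm : ∀ t, StrictMono (ψ t)) (hp : ∀ t p, ψ t (p + 1) = ψ t p + 1)
    (h0 : ∀ t ≤ 0, ∀ p, ψ t p = ψ₀ p) (h1 : ∀ t, 1 ≤ t → ∀ p, ψ t p = ψ₁ p) {A B : Set (ℝ × ℝ)}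
    (hAB : ∀ p, ∀ t ∈ Icc (0 : ℝ) 1, (p, t) ∈ A ↔ (ψ t p, t) ∈ B) : Iso ψ₀ ψ₁ A B := by
  obtain ⟨K, hK⟩ := exists_fiber_homeomorph (g := fun v : ℝ × ℝ => ψ v.1 v.2) hc hm
    (fun t => surjective_of_add_one (by fun_prop) (hp t))
  let H : ℝ × ℝ ≃ₜ ℝ × ℝ :=
    ((Homeomorph.prodComm ℝ ℝ).trans K).trans (Homeomorph.prodComm ℝ ℝ)
  have hH : ∀ v, H v = (ψ v.2 v.1, v.2) := fun v => by
    simp [H, hK]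
  refine ⟨H, ⟨fun p t => ?_, fun p t ht => ?_, fun p t ht => ?_⟩, fun v hv => ?_⟩
  · simp [hH, hp]
  · simp [hH, h0 t ht p]
  · simp [hH, h1 t ht p]
  · rw [hH]
    exact hAB v.1 v.2 hv

/-! ### Stacking -/

/-- The set `B` on top of the set `A`. -/
def stack (A B : Set (ℝ × ℝ)) : Set (ℝ × ℝ) :=
  {v | (v.2 ≤ 1 / 2 ∧ (v.1, 2 * v.2) ∈ A) ∨ (1 / 2 ≤ v.2 ∧ (v.1, 2 * v.2 - 1) ∈ B)}

theorem mem_stack {A B : Set (ℝ × ℝ)} {p t : ℝ} : (p, t) ∈ stack A B ↔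
    (t ≤ 1 / 2 ∧ (p, 2 * t) ∈ A) ∨ (1 / 2 ≤ t ∧ (p, 2 * t - 1) ∈ B) := Iff.rfl

/-- The affine change of the time parameter. -/
noncomputable def timeHomeo (c : ℝ) : ℝ × ℝ ≃ₜ ℝ × ℝ :=
  (Homeomorph.refl ℝ).prodCongr
    ((Homeomorph.mulLeft₀ (2 : ℝ) two_ne_zero).trans (Homeomorph.addRight (-c)))

theorem timeHomeo_apply (c : ℝ) (v : ℝ × ℝ) : timeHomeo c v = (v.1, 2 * v.2 - c) := by
  refine Prod.ext rfl ?_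
  simp [timeHomeo, sub_eq_add_neg]

theorem timeHomeo_symm_apply (c : ℝ) (v : ℝ × ℝ) :
    (timeHomeo c).symm v = (v.1, (v.2 + c) / 2) := by
  rw [Homeomorph.symm_apply_eq, timeHomeo_apply]
  refine Prod.ext rfl ?_
  simp only
  ring

theorem Iso.stack {ψ₀ ψ₁ ψ₂ : Twist} {A A' B B' : Set (ℝ × ℝ)} (hA : Iso ψ₀ ψ₁ A A')
    (hB : Iso ψ₁ ψ₂ B B') : Iso ψ₀ ψ₂ (stack A B) (stack A' B') := by
  obtain ⟨Ha, ha, hA⟩ := hA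
  obtain ⟨Hb, hb, hB⟩ := hB
  -- On the lower half `Hb` acts as `ψ₁`, and on the upper half `Ha` does; in the composite one
  -- superfluous `ψ₁` has to be undone everywhere.
  let mid : ℝ × ℝ ≃ₜ ℝ × ℝ :=
    ((CircleDeg1Lift.toOrderIso ψ₁).symm.toHomeomorph).prodCongr (Homeomorph.refl ℝ)
  have hmid : ∀ v, mid v = ((ψ₁⁻¹ : Twist) v.1, v.2) := fun v => rfl
  let H : ℝ × ℝ ≃ₜ ℝ × ℝ := ((((timeHomeo 1).trans Hb).trans (timeHomeo 1).symm).trans mid).trans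
    (((timeHomeo 0).trans Ha).trans (timeHomeo 0).symm)
  have hH : ∀ p t, H (p, t) = (timeHomeo 0).symm (Ha (timeHomeo 0
    (mid ((timeHomeo 1).symm (Hb (timeHomeo 1 (p, t))))))) := fun p t => rfl
  have e1 : ∀ p t, t ≤ 1 / 2 → H (p, t) = ((Ha (p, 2 * t)).1, (Ha (p, 2 * t)).2 / 2) := by
    intro p t ht
    simp only [hH, timeHomeo_apply, hb.lower p (2 * t - 1) (by linarith), timeHomeo_symm_apply, hmid,
      CircleDeg1Lift.units_inv_apply_apply]
    rw [show 2 * ((2 * t - 1 + 1) / 2) - 0 = 2 * t by ring, add_zero]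
  have e2 : ∀ p t, 1 / 2 ≤ t →
      H (p, t) = ((Hb (p, 2 * t - 1)).1, ((Hb (p, 2 * t - 1)).2 + 1) / 2) := by
    intro p t ht
    have h0 : 0 ≤ (Hb (p, 2 * t - 1)).2 := (hb.nonneg_iff _).2 (by simp only; linarith)
    simp only [hH, timeHomeo_apply, timeHomeo_symm_apply, hmid]
    rw [ha.upper _ _ (by linarith), CircleDeg1Lift.units_apply_inv_apply]
    refine Prod.ext rfl ?_
    simp only
    ring
  refine ⟨H, ⟨fun p t => ?_, fun p t ht => ?_, fun p t ht => ?_⟩, ?_⟩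
  · rcases le_total t (1 / 2) with ht | ht
    · rw [e1 _ _ ht, e1 _ _ ht, ha.per]
    · rw [e2 _ _ ht, e2 _ _ ht, hb.per]
  · rw [e1 _ _ (by linarith), ha.lower _ _ (by linarith)]
    simp
  · rw [e2 _ _ (by linarith), hb.upper _ _ (by linarith)]
    simp
  · rintro ⟨p, t⟩ ⟨h0, h1⟩
    simp only at h0 h1
    have f1 : ∀ t, 0 ≤ t → t ≤ 1 / 2 → ((p, 2 * t) ∈ A ↔ ((H (p, t)).1, 2 * (H (p, t)).2) ∈ A') := by
      intro t h0 ht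
      rw [e1 _ _ ht, hA _ ⟨by simp only; linarith, by simp only; linarith⟩]
      simp only [mul_div_cancel₀ _ (two_ne_zero' ℝ)]
    have f2 : ∀ t, 1 / 2 ≤ t → t ≤ 1 →
        ((p, 2 * t - 1) ∈ B ↔ ((H (p, t)).1, 2 * (H (p, t)).2 - 1) ∈ B') := by
      intro t ht h1
      rw [e2 _ _ ht, hB _ ⟨by simp only; linarith, by simp only; linarith⟩]
      simp only [mul_div_cancel₀ _ (two_ne_zero' ℝ), add_sub_cancel_right]
    have g1 : t ≤ 1 / 2 → (H (p, t)).2 ≤ 1 / 2 := by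
      intro ht
      rw [e1 _ _ ht]
      have := (ha.le_one_iff (p, 2 * t)).2 (by simp only; linarith)
      simp only
      linarith
    have g2 : 1 / 2 ≤ t → 1 / 2 ≤ (H (p, t)).2 := by
      intro ht
      rw [e2 _ _ ht]
      have := (hb.nonneg_iff (p, 2 * t - 1)).2 (by simp only; linarith)
      simp only
      linarith
    have g1' : (H (p, t)).2 ≤ 1 / 2 → t ≤ 1 / 2 := by
      intro h
      by_contra! ht
      rw [e2 _ _ ht.le] at h
      have h3 := (hb.le_zero_iff (p, 2 * t - 1)).1 (by simp only at h; linarith)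
      simp only at h3
      linarith
    have g2' : 1 / 2 ≤ (H (p, t)).2 → 1 / 2 ≤ t := by
      intro h
      by_contra! ht
      rw [e1 _ _ ht.le] at h
      have h3 := (ha.one_le_iff (p, 2 * t)).1 (by simp only at h; linarith)
      simp only at h3
      linarith
    change (_ ∧ _ ∨ _ ∧ _) ↔ (_ ∧ _ ∨ _ ∧ _)
    refine or_congr ⟨fun h => ⟨g1 h.1, (f1 t h0 h.1).1 h.2⟩, fun h => ⟨g1' h.1, (f1 t h0 (g1' h.1)).2 h.2⟩⟩
      ⟨fun h => ⟨g2 h.1, (f2 t h.1 h1).1 h.2⟩, fun h => ⟨g2' h.1, (f2 t (g2' h.1) h1).2 h.2⟩⟩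

/-- Reparametrizing the time. -/
theorem Iso.time {g : ℝ → ℝ} (hc : Continuous g) (hm : StrictMono g) (h0 : ∀ t ≤ 0, g t = t)
    (h1 : ∀ t, 1 ≤ t → g t = t) {A B : Set (ℝ × ℝ)}
    (hAB : ∀ p, ∀ t ∈ Icc (0 : ℝ) 1, (p, t) ∈ A ↔ (p, g t) ∈ B) : Iso 1 1 A B :=
  Iso.vertical (g := fun _ => g) (by fun_prop) (fun _ => hm) (fun _ _ => rfl) (fun _ => h0)
    (fun _ => h1) hAB

theorem strictMono_min {f g : ℝ → ℝ} (hf : StrictMono f) (hg : StrictMono g) :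
    StrictMono fun t => min (f t) (g t) := fun _ _ h => min_lt_min (hf h) (hg h)

theorem strictMono_max {f g : ℝ → ℝ} (hf : StrictMono f) (hg : StrictMono g) :
    StrictMono fun t => max (f t) (g t) := fun _ _ h => max_lt_max (hf h) (hg h)

theorem strictMono_affine {a : ℝ} (ha : 0 < a) (b : ℝ) : StrictMono fun t : ℝ => a * t + b :=
  fun _ _ h => by simp only; nlinarith

/-- The two sides differ only in the heights of the layers, which a polygon with the slopes `1/2`,
`1`, `2` adjusts. Taking the minimum with `t` makes it the identity outside the strip. -/
theorem Iso.stack_assoc (A B C : Set (ℝ × ℝ)) :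
    Iso 1 1 (Dunwoody.stack A (Dunwoody.stack B C)) (Dunwoody.stack (Dunwoody.stack A B) C) := by
  refine Iso.time (g := fun t => min (1 * t + 0) (max (1 / 2 * t + 0) (max (1 * t + -(1 / 4)) (2 * t + -1))))
    (by fun_prop) ?_ (fun t ht => ?_) (fun t ht => ?_) (fun p t ht => ?_)
  · exact strictMono_min (strictMono_affine one_pos _) (strictMono_max
      (strictMono_affine (by norm_num) _) (strictMono_max (strictMono_affine one_pos _)
        (strictMono_affine two_pos _)))
  · rw [min_eq_left]
    · ring
    · exact le_max_of_le_left (by linarith)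
  · rw [min_eq_left]
    · ring
    · exact le_max_of_le_right (le_max_of_le_right (by linarith))
  · obtain ⟨h0, h1⟩ := ht
    generalize hs : min (1 * t + 0) (max (1 / 2 * t + 0) (max (1 * t + -(1 / 4)) (2 * t + -1))) = s
    have a1 : t ≤ 1 / 2 → s = t / 2 := fun h => by
      rw [← hs, max_eq_left (max_le (by linarith) (by linarith)), min_eq_right (by linarith)]
      ring
    have a2 : 1 / 2 ≤ t → t ≤ 3 / 4 → s = t - 1 / 4 := fun h h' => by
      rw [← hs, max_eq_left (a := 1 * t + -(1 / 4)) (by linarith), max_eq_right (by linarith),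
        min_eq_right (by linarith)]
      ring
    have a3 : 3 / 4 ≤ t → s = 2 * t - 1 := fun h => by
      rw [← hs, max_eq_right (a := 1 * t + -(1 / 4)) (by linarith), max_eq_right (by linarith),
        min_eq_right (by linarith)]
      ring
    have e1 : (p, t) ∈ Dunwoody.stack A (Dunwoody.stack B C) ↔ (t ≤ 1 / 2 ∧ (p, 2 * t) ∈ A) ∨
        ((1 / 2 ≤ t ∧ t ≤ 3 / 4) ∧ (p, 4 * t - 2) ∈ B) ∨ (3 / 4 ≤ t ∧ (p, 4 * t - 3) ∈ C) := by
      rw [mem_stack, mem_stack, show 2 * (2 * t - 1) = 4 * t - 2 by ring,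
        show 4 * t - 2 - 1 = 4 * t - 3 by ring, and_or_left, ← and_assoc, ← and_assoc]
      refine or_congr Iff.rfl (or_congr (and_congr_left' (and_congr_right' ?_)) (and_congr_left' ?_))
      · constructor <;> intro h <;> linarith
      · exact ⟨fun h => by linarith [h.2], fun h => ⟨by linarith, by linarith⟩⟩
    have e2 : (p, s) ∈ Dunwoody.stack (Dunwoody.stack A B) C ↔ (s ≤ 1 / 4 ∧ (p, 4 * s) ∈ A) ∨
        ((1 / 4 ≤ s ∧ s ≤ 1 / 2) ∧ (p, 4 * s - 1) ∈ B) ∨ (1 / 2 ≤ s ∧ (p, 2 * s - 1) ∈ C) := by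
      rw [mem_stack, mem_stack, show 2 * (2 * s) = 4 * s by ring, and_or_left, ← and_assoc,
        ← and_assoc, or_assoc]
      refine or_congr (and_congr_left' ?_) (or_congr (and_congr_left' ?_) Iff.rfl)
      · exact ⟨fun h => by linarith [h.2], fun h => ⟨by linarith, by linarith⟩⟩
      · exact ⟨fun h => ⟨by linarith [h.2], h.1⟩, fun h => ⟨h.2, by linarith [h.1]⟩⟩
    rw [e1, e2]
    rcases le_total t (1 / 2) with h | h
    · have hs := a1 h
      have c1 : (1 / 2 ≤ t ∧ t ≤ 3 / 4) ↔ (1 / 4 ≤ s ∧ s ≤ 1 / 2) :=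
        ⟨fun h => ⟨by linarith, by linarith⟩, fun h => ⟨by linarith, by linarith⟩⟩
      have c2 : t ≤ 1 / 2 ↔ s ≤ 1 / 4 := ⟨fun h => by linarith, fun h => by linarith⟩
      have c3 : 3 / 4 ≤ t ↔ 1 / 2 ≤ s := ⟨fun h => by linarith, fun h => by linarith⟩
      refine or_congr (and_congr c2 (by rw [hs, show 4 * (t / 2) = 2 * t by ring]))
        (or_congr ⟨fun h' => ⟨c1.1 h'.1, ?_⟩, fun h' => ⟨c1.2 h'.1, ?_⟩⟩
          ⟨fun h' => by linarith [h'.1], fun h' => by linarith [h'.1]⟩)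
      · rw [show 4 * s - 1 = 4 * t - 2 by linarith [h'.1.1]]; exact h'.2
      · rw [show 4 * t - 2 = 4 * s - 1 by linarith [h'.1.1]]; exact h'.2
    · rcases le_total t (3 / 4) with h' | h'
      · have hs := a2 h h'
        refine or_congr ⟨fun k => ⟨by linarith, ?_⟩, fun k => ⟨by linarith, ?_⟩⟩
          (or_congr ⟨fun k => ⟨⟨by linarith, by linarith⟩, ?_⟩, fun k => ⟨⟨by linarith, by linarith⟩, ?_⟩⟩
          ⟨fun k => ⟨by linarith [k.1], ?_⟩, fun k => ⟨by linarith [k.1], ?_⟩⟩)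
        · rw [show 4 * s = 2 * t by linarith [k.1]]; exact k.2
        · rw [show 2 * t = 4 * s by linarith [k.1]]; exact k.2
        · rw [show 4 * s - 1 = 4 * t - 2 by linarith]; exact k.2
        · rw [show 4 * t - 2 = 4 * s - 1 by linarith]; exact k.2
        · rw [show 2 * s - 1 = 4 * t - 3 by linarith [k.1]]; exact k.2
        · rw [show 4 * t - 3 = 2 * s - 1 by linarith [k.1]]; exact k.2
      · have hs := a3 h'
        refine or_congr ⟨fun k => by linarith [k.1], fun k => by linarith [k.1]⟩
          (or_congr ⟨fun k => ⟨⟨by linarith, by linarith [k.1]⟩, ?_⟩,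
            fun k => ⟨⟨by linarith, by linarith [k.1]⟩, ?_⟩⟩
          ⟨fun k => ⟨by linarith, ?_⟩, fun k => ⟨by linarith, ?_⟩⟩)
        · rw [show 4 * s - 1 = 4 * t - 2 by linarith [k.1.2]]; exact k.2
        · rw [show 4 * t - 2 = 4 * s - 1 by linarith [k.1.2]]; exact k.2
        · rw [show 2 * s - 1 = 4 * t - 3 by linarith]; exact k.2
        · rw [show 4 * t - 3 = 2 * s - 1 by linarith]; exact k.2

/-! ### Changing the cut -/

/-- The torus is cut along another meridian, the middle of the stack. The vertical translation by
`1/2` relates the two cuts and extends over the solid torus; `A` has passed through the gluing, so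
it is now seen through `φ`. -/
theorem Draw.trace {φ : Twist} {A B : Set (ℝ × ℝ)} {D : Set Torus}
    (h : Draw φ (stack A B) D) : Draw φ (stack B {v | (φ v.1, v.2) ∈ A}) D := by
  obtain ⟨F, hF, hD⟩ := h
  have c1 := hF.cont
  have c2 := φ.continuous
  let F' : ℝ → ℝ → ℝ := fun p t => if t ≤ 1 / 2 then F p (t + 1 / 2) else F (φ p) (t - 1 / 2)
  have f1 : ∀ p t, t ≤ 1 / 2 → F' p t = F p (t + 1 / 2) := fun p t ht => if_pos ht
  have f2 : ∀ p t, 1 / 2 ≤ t → F' p t = F (φ p) (t - 1 / 2) := fun p t ht => by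
    rcases eq_or_lt_of_le ht with rfl | ht
    · rw [f1 _ _ le_rfl]
      norm_num
      exact hF.glue p
    · exact if_neg (not_le.2 ht)
  have hF' : IsShear φ F' := by
    refine ⟨?_, fun t ht p p' hpp => ?_, fun p t ht => ?_, fun p => ?_⟩
    · refine Continuous.if_le (by fun_prop) (by fun_prop) (by fun_prop) (by fun_prop) ?_
      rintro ⟨p, t⟩ ht
      simp only at ht
      simp only [ht]
      norm_num
      exact hF.glue p
    · rcases le_total t (1 / 2) with h | h
      · simp only [f1 _ _ h]
        exact hF.mono _ ⟨by linarith [ht.1], by linarith⟩ hpp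
      · simp only [f2 _ _ h]
        exact hF.mono _ ⟨by linarith, by linarith [ht.2]⟩ (φ.strictMono hpp)
    · rcases le_total t (1 / 2) with h | h
      · rw [f1 _ _ h, f1 _ _ h, hF.per _ _ ⟨by linarith [ht.1], by linarith⟩]
      · rw [f2 _ _ h, f2 _ _ h, CircleDeg1Lift.map_add_one,
          hF.per _ _ ⟨by linarith, by linarith [ht.2]⟩]
    · rw [f2 _ _ (by norm_num), f1 _ _ (by norm_num)]
      norm_num
  refine ⟨F', hF', hD.trans (Related.symm ?_)⟩
  refine ⟨_, extends_translation (0, ((1 / 2 : ℝ) : 𝕋)), ?_⟩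
  have g1 : ∀ p t, t ≤ 1 / 2 → Homeomorph.addRight ((0, ((1 / 2 : ℝ) : 𝕋)) : Torus)
      (cut F' (p, t)) = cut F (p, t + 1 / 2) := by
    intro p t ht
    simp only [Homeomorph.coe_addRight, cut, torusProj, f1 _ _ ht, Prod.mk_add_mk, add_zero,
      AddCircle.coe_add]
  have g2 : ∀ p t, 1 / 2 ≤ t → Homeomorph.addRight ((0, ((1 / 2 : ℝ) : 𝕋)) : Torus)
      (cut F' (p, t)) = cut F (φ p, t - 1 / 2) := by
    intro p t ht
    simp only [Homeomorph.coe_addRight, cut, torusProj, f2 _ _ ht, Prod.mk_add_mk, add_zero]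
    refine Prod.ext rfl ?_
    rw [← AddCircle.coe_add]
    refine coe_eq_coe_iff.2 ⟨-1, ?_⟩
    push_cast
    ring
  ext y
  constructor
  · rintro ⟨_, ⟨⟨p, t⟩, ⟨(⟨h1, h2⟩ | ⟨h1, h2⟩), h3, h4⟩, rfl⟩, rfl⟩
    · simp only at h1 h2 h3 h4
      rw [g1 _ _ h1]
      refine ⟨_, ⟨Or.inr ⟨by simp only; linarith, ?_⟩, by simp only; linarith, by simp only; linarith⟩,
        rfl⟩
      rwa [show 2 * (t + 1 / 2) - 1 = 2 * t by ring]
    · simp only at h1 h2 h3 h4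
      rw [g2 _ _ h1]
      refine ⟨_, ⟨Or.inl ⟨by simp only; linarith, ?_⟩, by simp only; linarith, by simp only; linarith⟩,
        rfl⟩
      rw [show 2 * (t - 1 / 2) = 2 * t - 1 by ring]
      exact h2
  · rintro ⟨⟨p, t⟩, ⟨(⟨h1, h2⟩ | ⟨h1, h2⟩), h3, h4⟩, rfl⟩
    · simp only at h1 h2 h3 h4
      refine ⟨_, ⟨((φ⁻¹ : Twist) p, t + 1 / 2), ⟨Or.inr ⟨by simp only; linarith, ?_⟩,
        by simp only; linarith, by simp only; linarith⟩, rfl⟩, ?_⟩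
      · change (φ ((φ⁻¹ : Twist) p), 2 * (t + 1 / 2) - 1) ∈ A
        rw [CircleDeg1Lift.units_apply_inv_apply]
        rwa [show 2 * (t + 1 / 2) - 1 = 2 * t by ring]
      · rw [g2 _ _ (by linarith), CircleDeg1Lift.units_apply_inv_apply, add_sub_cancel_right]
    · simp only at h1 h2 h3 h4
      refine ⟨_, ⟨(p, t - 1 / 2), ⟨Or.inl ⟨by simp only; linarith, ?_⟩,
        by simp only; linarith, by simp only; linarith⟩, rfl⟩, ?_⟩
      · simp only
        rwa [show 2 * (t - 1 / 2) = 2 * t - 1 by ring]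
      · rw [g1 _ _ (by linarith), sub_add_cancel]

theorem exists_reflect (φ : Twist) : ∃ φ' : Twist, ∀ p, φ' p = -φ (-p) := by
  have := φ.continuous
  refine exists_twist (by fun_prop) (fun p p' h => ?_) (fun p => ?_)
  · simpa using φ.strictMono (neg_lt_neg h)
  · have := CircleDeg1Lift.map_sub_int φ (-p) 1
    push_cast at this
    rw [neg_add, ← sub_eq_add_neg, this]
    ring

theorem Draw.reflect {φ φ' : Twist} {A : Set (ℝ × ℝ)} {D : Set Torus} (h : Draw φ A D)
    (hφ : ∀ p, φ' p = -φ (-p)) : Draw φ' {v | (-v.1, v.2) ∈ A} D := by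
  obtain ⟨F, hF, hD⟩ := h
  have c1 := hF.cont
  refine ⟨fun p t => -F (-p) t, ⟨by fun_prop, fun t ht p p' h => ?_, fun p t ht => ?_, fun p => ?_⟩,
    hD.trans ?_⟩
  · simpa using hF.mono t ht (neg_lt_neg h)
  · have := hF.add_int (-p) ht (-1)
    push_cast at this
    rw [neg_add, this]
    ring
  · simp only [hφ, neg_neg, hF.glue]
  · let κ : Torus ≃ₜ Torus := (Homeomorph.neg 𝕋).prodCongr (Homeomorph.refl _)
    have hκ : ∀ v, κ v = (-v.1, v.2) := fun _ => rfl
    refine ⟨κ, extends_of_image_curveC ?_, ?_⟩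
    · ext v
      constructor
      · rintro ⟨w, hw, rfl⟩
        exact hw
      · intro hv
        exact ⟨(-v.1, v.2), hv, by simp [hκ]⟩
    · ext y
      constructor
      · rintro ⟨_, ⟨v, ⟨h1, h2⟩, rfl⟩, rfl⟩
        refine ⟨(-v.1, v.2), ⟨by simpa using h1, h2⟩, ?_⟩
        simp [cut, torusProj, hκ]
      · rintro ⟨v, ⟨h1, h2⟩, rfl⟩
        exact ⟨_, ⟨(-v.1, v.2), ⟨h1, h2⟩, rfl⟩, by simp [cut, torusProj, hκ]⟩

/-! ### Weighted strands and events -/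

theorem periodic_coe (φ : Twist) :
    Function.Periodic (fun p : ℝ => ((φ p : ℝ) : 𝕋)) 1 := fun p => by simp

/-- The map of the circle induced by a homeomorphism of the line. -/
noncomputable def circMap (φ : Twist) : 𝕋 → 𝕋 := (periodic_coe φ).lift

/-- The homeomorphism of the circle induced by a homeomorphism of the line. -/
noncomputable def circ (φ : Twist) : 𝕋 ≃ 𝕋 where
  toFun := circMap φ
  invFun := circMap φ⁻¹
  left_inv a := by
    obtain ⟨x, rfl⟩ := QuotientAddGroup.mk_surjective a
    exact congrArg _ (CircleDeg1Lift.units_inv_apply_apply φ x)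
  right_inv a := by
    obtain ⟨x, rfl⟩ := QuotientAddGroup.mk_surjective a
    exact congrArg _ (CircleDeg1Lift.units_apply_inv_apply φ x)

theorem circ_coe (φ : Twist) (p : ℝ) : circ φ p = ((φ p : ℝ) : 𝕋) := rfl

theorem circ_symm_coe (φ : Twist) (p : ℝ) :
    (circ φ).symm p = (((φ⁻¹ : Twist) p : ℝ) : 𝕋) := rfl

variable {G : Type*} [AddCommGroup G]

/-- The level `s ∘ φ`. -/
noncomputable def pull (φ : Twist) (s : 𝕋 →₀ G) : 𝕋 →₀ G :=
  Finsupp.equivMapDomain (circ φ).symm s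

@[simp] theorem pull_coe (φ : Twist) (s : 𝕋 →₀ G) (p : ℝ) :
    pull φ s p = s ((φ p : ℝ) : 𝕋) := rfl

theorem card_support_pull (φ : Twist) (s : 𝕋 →₀ G) :
    (pull φ s).support.card = s.support.card := by
  have : (pull φ s).support = s.support.map (circ φ).symm.toEmbedding := rfl
  rw [this, Finset.card_map]

theorem level_ext {s s' : 𝕋 →₀ G} (h : ∀ p : ℝ, s p = s' p) : s = s' := by
  ext a
  obtain ⟨x, rfl⟩ := QuotientAddGroup.mk_surjective a
  exact h x

/-- The total weight of a level. -/
noncomputable def total (s : 𝕋 →₀ G) : G := s.sum fun _ g => g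

theorem total_add (s s' : 𝕋 →₀ G) : total (s + s') = total s + total s' :=
  Finsupp.sum_add_index' (fun _ => rfl) (fun _ _ _ => rfl)

theorem total_neg (s : 𝕋 →₀ G) : total (-s) = -total s := by
  have := total_add s (-s)
  rw [add_neg_cancel] at this
  have h0 : total (0 : 𝕋 →₀ G) = 0 := Finsupp.sum_zero_index
  rw [h0] at this
  exact (neg_eq_of_add_eq_zero_right this.symm).symm

theorem total_single (a : 𝕋) (g : G) : total (Finsupp.single a g) = g :=
  Finsupp.sum_single_index rfl

theorem total_pull (φ : Twist) (s : 𝕋 →₀ G) : total (pull φ s) = total s := by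
  rw [total, pull, Finsupp.equivMapDomain_eq_mapDomain]
  exact Finsupp.sum_mapDomain_index (fun _ => rfl) (fun _ _ _ => rfl)

/-- The birth (`cup`) or the death of a pair of strands at the positions `x` and `y`, of weights
`η` and `-η` if they are born. -/
structure Event (G : Type*) where
  cup : Bool
  x : ℝ
  y : ℝ
  η : G

/-- The level after an event. -/
noncomputable def step (s : 𝕋 →₀ G) (e : Event G) : 𝕋 →₀ G :=
  s + (Finsupp.single (e.x : 𝕋) e.η - Finsupp.single (e.y : 𝕋) e.η)

theorem total_step (s : 𝕋 →₀ G) (e : Event G) : total (step s e) = total s := by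
  rw [step, total_add, sub_eq_add_neg, total_add, total_neg, total_single, total_single]
  simp

/-- The positions over the bar of an event. -/
def Event.bar (e : Event G) : Set ℝ := {p | ∃ k : ℤ, p + k ∈ Icc e.x e.y}

theorem Event.bar_add_int {G : Type*} (e : Event G) (p : ℝ) (n : ℤ) : p + n ∈ e.bar ↔ p ∈ e.bar := by
  constructor
  · rintro ⟨k, hk⟩
    exact ⟨n + k, by push_cast; rwa [← add_assoc]⟩
  · rintro ⟨k, hk⟩
    exact ⟨k - n, by push_cast; rwa [show p + n + (k - n) = p + k by ring]⟩

theorem step_coe (s : 𝕋 →₀ G) (e : Event G) (p : ℝ) :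
    step s e p = s p + ((if (e.x : 𝕋) = p then e.η else 0)
      - if (e.y : 𝕋) = p then e.η else 0) := by
  classical
  simp [step, Finsupp.single_apply]

theorem step_of_ne {s : 𝕋 →₀ G} {e : Event G} {p : ℝ}
    (hx : (e.x : 𝕋) ≠ p) (hy : (e.y : 𝕋) ≠ p) : step s e p = s p := by
  rw [step_coe, if_neg hx, if_neg hy]
  simp

theorem step_of_notMem_bar {s : 𝕋 →₀ G} {e : Event G} (he : e.x ≤ e.y) {p : ℝ}
    (hp : p ∉ e.bar) : step s e p = s p := by
  refine step_of_ne (fun h => hp ?_) (fun h => hp ?_)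
  · obtain ⟨n, hn⟩ := coe_eq_coe_iff.1 h
    refine ⟨-n, ?_⟩
    rw [hn]
    push_cast
    rw [add_neg_cancel_right]
    exact ⟨le_rfl, he⟩
  · obtain ⟨n, hn⟩ := coe_eq_coe_iff.1 h
    refine ⟨-n, ?_⟩
    rw [hn]
    push_cast
    rw [add_neg_cancel_right]
    exact ⟨he, le_rfl⟩

theorem coe_ne_of_lt {x y : ℝ} (h : x < y) (h' : y < x + 1) :
    (x : 𝕋) ≠ y := by
  intro hc
  obtain ⟨n, hn⟩ := coe_eq_coe_iff.1 hc
  have h1 : (0 : ℝ) < n := by linarith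
  have h2 : (n : ℝ) < 1 := by linarith
  have h1 : 0 < n := by exact_mod_cast h1
  have h2 : n < 1 := by exact_mod_cast h2
  omega

/-- The event may happen at the level `s`. -/
structure Event.Ok (s : 𝕋 →₀ G) (e : Event G) : Prop where
  ne : e.η ≠ 0
  lt : e.x < e.y
  lt_add : e.y < e.x + 1
  free : e.cup = true → ∀ p ∈ Icc e.x e.y, s p = 0
  left : e.cup = false → s e.x = -e.η
  right : e.cup = false → s e.y = e.η
  between : ∀ p ∈ Ioo e.x e.y, s p = 0

/-- The straight strands at the positions where `s ≠ 0`. -/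
def col (s : 𝕋 →₀ G) : Set (ℝ × ℝ) := {v | s v.1 ≠ 0}

/-- The strands of `s` below the graph of `u`, the strands of `s'` above it, and the part of the graph
over `B`. -/
def gslab (u : ℝ → ℝ) (s s' : 𝕋 →₀ G) (B : Set ℝ) : Set (ℝ × ℝ) :=
  {v | (s v.1 ≠ 0 ∧ v.2 ≤ u v.1) ∨ (s' v.1 ≠ 0 ∧ u v.1 ≤ v.2) ∨ (v.1 ∈ B ∧ v.2 = u v.1)}

theorem mem_gslab {u : ℝ → ℝ} {s s' : 𝕋 →₀ G} {B : Set ℝ} {p t : ℝ} :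
    (p, t) ∈ gslab u s s' B ↔ (s p ≠ 0 ∧ t ≤ u p) ∨ (s' p ≠ 0 ∧ u p ≤ t) ∨ (p ∈ B ∧ t = u p) :=
  Iff.rfl

/-- The picture of one event. -/
noncomputable def slab (s : 𝕋 →₀ G) (e : Event G) : Set (ℝ × ℝ) :=
  gslab (fun _ => 1 / 2) s (step s e) e.bar

/-- The picture of a sequence of events. -/
noncomputable def picture : (𝕋 →₀ G) → List (Event G) → Set (ℝ × ℝ)
  | s, [] => col s
  | s, e :: L => stack (slab s e) (picture (step s e) L)

/-- The level after a sequence of events. -/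
noncomputable def final (s : 𝕋 →₀ G) (L : List (Event G)) : 𝕋 →₀ G :=
  L.foldl step s

theorem final_cons (s : 𝕋 →₀ G) (e : Event G) (L : List (Event G)) :
    final s (e :: L) = final (step s e) L := rfl

theorem final_append (s : 𝕋 →₀ G) (L L' : List (Event G)) :
    final s (L ++ L') = final (final s L) L' := List.foldl_append

theorem Iso.refl (A : Set (ℝ × ℝ)) : Iso 1 1 A A := Iso.of_eqOn fun _ _ => Iff.rfl

/-! ### Graphs over the circle -/

/-- A continuous function on the circle with values between `0` and `1`. -/
structure IsGraph (u : ℝ → ℝ) : Prop where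
  cont : Continuous u
  per : ∀ p, u (p + 1) = u p
  pos : ∀ p, 0 < u p
  lt_one : ∀ p, u p < 1

theorem isGraph_const {c : ℝ} (h0 : 0 < c) (h1 : c < 1) : IsGraph fun _ => c :=
  ⟨by fun_prop, fun _ => rfl, fun _ => h0, fun _ => h1⟩

theorem Iso.gslab_of_le {u v : ℝ → ℝ} (hu : IsGraph u) (hv : IsGraph v) (huv : ∀ p, v p ≤ u p)
    (s s' : 𝕋 →₀ G) (B : Set ℝ) : Iso 1 1 (gslab u s s' B) (gslab v s s' B) := by
  have hu0 : ∀ p, u p ≠ 0 := fun p => (hu.pos p).ne'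
  have hu1 : ∀ p, 1 - u p ≠ 0 := fun p => by linarith [hu.lt_one p]
  have cu := hu.cont
  have cv := hv.cont
  let g : ℝ → ℝ → ℝ := fun p t => min (1 * t + 0) (max (v p / u p * t + 0)
    ((1 - v p) / (1 - u p) * t + (1 - (1 - v p) / (1 - u p))))
  have r1 : ∀ p, v p / u p ≤ 1 := fun p => (div_le_one (hu.pos p)).2 (huv p)
  have r2 : ∀ p, 1 ≤ (1 - v p) / (1 - u p) := fun p =>
    (one_le_div (by linarith [hu.lt_one p])).2 (by linarith [huv p])
  have hm : ∀ p, StrictMono (g p) := fun p =>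
    strictMono_min (strictMono_affine one_pos _) (strictMono_max
      (strictMono_affine (div_pos (hv.pos p) (hu.pos p)) _)
      (strictMono_affine (by linarith [r2 p]) _))
  have hg : ∀ p, g p (u p) = v p := fun p => by
    have e1 : v p / u p * u p + 0 = v p := by rw [div_mul_cancel₀ _ (hu0 p), add_zero]
    have e2 : (1 - v p) / (1 - u p) * u p + (1 - (1 - v p) / (1 - u p)) = v p := by
      have := hu1 p
      field_simp
      ring
    simp only [g]
    rw [e1, e2, max_self, min_eq_right (by linarith [huv p])]
  refine Iso.vertical (g := g) ?_ hm (fun p t => ?_) (fun p t ht => ?_) (fun p t ht => ?_)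
    (fun p t ht => ?_)
  · simp only [g]
    fun_prop (disch := intro x; first | exact hu0 _ | exact hu1 _)
  · simp only [g, hu.per, hv.per]
  · simp only [g]
    rw [min_eq_left]
    · ring
    · refine le_max_of_le_left ?_
      nlinarith [r1 p]
  · simp only [g]
    rw [min_eq_left]
    · ring
    · refine le_max_of_le_right ?_
      nlinarith [r2 p]
  · have h1 : t ≤ u p ↔ g p t ≤ v p := by rw [← hg p, (hm p).le_iff_le]
    have h2 : u p ≤ t ↔ v p ≤ g p t := by rw [← hg p, (hm p).le_iff_le]
    have h3 : t = u p ↔ g p t = v p := by rw [← hg p, (hm p).injective.eq_iff]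
    rw [mem_gslab, mem_gslab, h1, h2, h3]

/-- The heights at which an event happens are immaterial. Both graphs are pushed down to their
minimum, linearly on each side of the graph on every vertical line. -/
theorem Iso.gslab {u v : ℝ → ℝ} (hu : IsGraph u) (hv : IsGraph v)
    (s s' : 𝕋 →₀ G) (B : Set ℝ) :
    Iso 1 1 (Dunwoody.gslab u s s' B) (Dunwoody.gslab v s s' B) := by
  have cu := hu.cont
  have cv := hv.cont
  have hw : IsGraph fun p => min (u p) (v p) :=
    ⟨by fun_prop, fun p => by rw [hu.per, hv.per], fun p => lt_min (hu.pos p) (hv.pos p),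
      fun p => min_lt_of_left_lt (hu.lt_one p)⟩
  exact (Iso.gslab_of_le hu hw (fun p => min_le_left _ _) s s' B).trans_one
    (Iso.gslab_of_le hv hw (fun p => min_le_right _ _) s s' B).symm_one

/-! ### Joining pictures -/

theorem mem_picture_of_le {s : 𝕋 →₀ G} {L : List (Event G)} {p t : ℝ} (ht : t ≤ 1 / 8) :
    (p, t) ∈ picture s L ↔ s p ≠ 0 := by
  cases L with
  | nil => rfl
  | cons e L =>
    rw [picture, mem_stack, slab, mem_gslab]
    constructor
    · rintro (⟨-, h | h | h⟩ | h)
      · exact h.1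
      · linarith [h.2]
      · linarith [h.2]
      · linarith [h.1]
    · exact fun h => Or.inl ⟨by linarith, Or.inl ⟨h, by linarith⟩⟩

theorem Iso.stack_col_picture (s : 𝕋 →₀ G) (L : List (Event G)) :
    Iso 1 1 (Dunwoody.stack (col s) (picture s L)) (picture s L) := by
  -- The break point is `9/16`, sent to `1/8`: up to the height `1/8` a picture consists of straight
  -- strands, which may be stretched.
  refine Iso.time (g := fun t => min (1 * t + 0) (max (2 / 9 * t + 0) (2 * t + -1)))
    (by fun_prop) ?_ (fun t ht => ?_) (fun t ht => ?_) (fun p t ht => ?_)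
  · exact strictMono_min (strictMono_affine one_pos _) (strictMono_max
      (strictMono_affine (by norm_num) _) (strictMono_affine two_pos _))
  · rw [min_eq_left]
    · ring
    · exact le_max_of_le_left (by linarith)
  · rw [min_eq_left]
    · ring
    · exact le_max_of_le_right (by linarith)
  · rcases le_total t (9 / 16) with h | h
    · have h2 : min (1 * t + 0) (max (2 / 9 * t + 0) (2 * t + -1)) ≤ 1 / 8 :=
        min_le_of_right_le (max_le (by linarith) (by linarith))
      rw [mem_picture_of_le h2, mem_stack]
      constructor
      · rintro (h3 | h3)
        · exact h3.2
        · rw [mem_picture_of_le (by linarith)] at h3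
          exact h3.2
      · intro h3
        rcases le_total t (1 / 2) with h4 | h4
        · exact Or.inl ⟨h4, h3⟩
        · exact Or.inr ⟨h4, (mem_picture_of_le (by linarith)).2 h3⟩
    · have h2 : min (1 * t + 0) (max (2 / 9 * t + 0) (2 * t + -1)) = 2 * t - 1 := by
        rw [max_eq_right (by linarith), min_eq_right (by linarith [ht.2])]
        ring
      rw [h2, mem_stack]
      constructor
      · rintro (h3 | h3)
        · linarith [h3.1]
        · exact h3.2
      · exact fun h3 => Or.inr ⟨by linarith, h3⟩

theorem Iso.slab_stack_col (s : 𝕋 →₀ G) (e : Event G) :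
    Iso 1 1 (Dunwoody.stack (slab s e) (col (step s e))) (slab s e) := by
  -- The break point is `3/8`, sent to `3/4`; from there on both sides show only the straight
  -- strands above the bar.
  refine Iso.time (g := fun t => max (1 * t + 0) (min (2 * t + 0) (2 / 5 * t + 3 / 5)))
    (by fun_prop) ?_ (fun t ht => ?_) (fun t ht => ?_) (fun p t ht => ?_)
  · exact strictMono_max (strictMono_affine one_pos _) (strictMono_min
      (strictMono_affine two_pos _) (strictMono_affine (by norm_num) _))
  · rw [max_eq_left]
    · ring
    · exact min_le_of_left_le (by linarith)
  · rw [max_eq_left]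
    · ring
    · exact min_le_of_right_le (by linarith)
  · have top : ∀ t : ℝ, 1 / 2 < t → ((p, t) ∈ slab s e ↔ step s e p ≠ 0) := by
      intro t ht
      rw [slab, mem_gslab]
      constructor
      · rintro (h | h | h)
        · linarith [h.2]
        · exact h.1
        · linarith [h.2]
      · exact fun h => Or.inr (Or.inl ⟨h, ht.le⟩)
    rcases le_total t (3 / 8) with h | h
    · have h2 : max (1 * t + 0) (min (2 * t + 0) (2 / 5 * t + 3 / 5)) = 2 * t := by
        rw [min_eq_left (by linarith), max_eq_right (by linarith [ht.1])]
        ring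
      rw [h2, mem_stack]
      constructor
      · rintro (h3 | h3)
        · exact h3.2
        · linarith [h3.1]
      · exact fun h3 => Or.inl ⟨by linarith, h3⟩
    · have h2 : 1 / 2 < max (1 * t + 0) (min (2 * t + 0) (2 / 5 * t + 3 / 5)) :=
        lt_max_of_lt_right (lt_min (by linarith) (by linarith))
      rw [top _ h2, mem_stack]
      constructor
      · rintro (h3 | h3)
        · rw [top _ (by linarith)] at h3
          exact h3.2
        · exact h3.2
      · intro h3
        rcases le_total t (1 / 2) with h4 | h4
        · exact Or.inl ⟨h4, (top _ (by linarith)).2 h3⟩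
        · exact Or.inr ⟨h4, h3⟩

theorem Iso.picture_append (s : 𝕋 →₀ G) (L L' : List (Event G)) :
    Iso 1 1 (picture s (L ++ L')) (Dunwoody.stack (picture s L) (picture (final s L) L')) := by
  induction L generalizing s with
  | nil => exact (Iso.stack_col_picture s L').symm_one
  | cons e L ih =>
    exact ((Iso.refl _).stack (ih (step s e))).trans_one (Iso.stack_assoc _ _ _)

/-- The event seen through the gluing map. -/
noncomputable def Event.pull (φ : Twist) (e : Event G) : Event G :=
  ⟨e.cup, (φ⁻¹ : Twist) e.x, (φ⁻¹ : Twist) e.y, e.η⟩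

theorem mem_bar_pull {G : Type*} {φ : Twist} {e : Event G} {p : ℝ} : p ∈ (e.pull φ).bar ↔ φ p ∈ e.bar := by
  refine exists_congr fun k => ?_
  rw [← CircleDeg1Lift.map_add_int]
  have h : ∀ x, φ ((φ⁻¹ : Twist) x) = x := CircleDeg1Lift.units_apply_inv_apply φ
  constructor
  · rintro ⟨h1, h2⟩
    refine ⟨?_, ?_⟩
    · rw [← h e.x]; exact φ.strictMono.monotone h1
    · rw [← h e.y]; exact φ.strictMono.monotone h2
  · rintro ⟨h1, h2⟩
    refine ⟨?_, ?_⟩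
    · rw [← h e.x] at h1; exact φ.strictMono.le_iff_le.1 h1
    · rw [← h e.y] at h2; exact φ.strictMono.le_iff_le.1 h2

theorem coe_pull_eq_iff {φ : Twist} {x p : ℝ} :
    (((φ⁻¹ : Twist) x : ℝ) : 𝕋) = p ↔ (x : 𝕋) = (φ p : ℝ) := by
  rw [← circ_symm_coe, ← circ_coe, Equiv.symm_apply_eq]

theorem step_pull (φ : Twist) (s : 𝕋 →₀ G) (e : Event G) :
    step (pull φ s) (e.pull φ) = pull φ (step s e) := by
  refine level_ext fun p => ?_
  simp only [pull_coe, step_coe, Event.pull, coe_pull_eq_iff]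

theorem slab_pull (φ : Twist) (s : 𝕋 →₀ G) (e : Event G) :
    slab (pull φ s) (e.pull φ) = {v | (φ v.1, v.2) ∈ slab s e} := by
  ext ⟨p, t⟩
  change (p, t) ∈ slab (pull φ s) (e.pull φ) ↔ (φ p, t) ∈ slab s e
  simp only [slab, step_pull, mem_gslab, pull_coe, mem_bar_pull]

/-- The first event is carried through the gluing and becomes the last one. So the events matter
only up to cyclic order. -/
theorem Draw.rotate {φ : Twist} {s : 𝕋 →₀ G} {e : Event G} {L : List (Event G)}
    {D : Set Torus} (h : Draw φ (picture s (e :: L)) D) (hf : final s (e :: L) = pull φ s) :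
    Draw φ (picture (step s e) (L ++ [e.pull φ])) D := by
  rw [picture] at h
  have h1 := h.trace
  rw [← slab_pull, ← hf, final_cons] at h1
  refine h1.iso_one (Iso.symm_one ?_)
  refine (Iso.picture_append _ _ _).trans_one ((Iso.refl _).stack ?_)
  exact Iso.slab_stack_col _ _

theorem Event.Ok.pull {s : 𝕋 →₀ G} {e : Event G} (h : e.Ok s) (φ : Twist) :
    (e.pull φ).Ok (Dunwoody.pull φ s) := by
  have hi : ∀ x, φ ((φ⁻¹ : Twist) x) = x := CircleDeg1Lift.units_apply_inv_apply φ
  have mono := (φ⁻¹ : Twist).strictMono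
  refine ⟨h.ne, mono h.lt, ?_, fun hc p hp => ?_, fun hc => ?_, fun hc => ?_, fun p hp => ?_⟩
  · have := mono h.lt_add
    rwa [CircleDeg1Lift.map_add_one] at this
  · rw [pull_coe]
    refine h.free hc _ ⟨?_, ?_⟩
    · rw [← hi e.x]; exact φ.strictMono.monotone hp.1
    · rw [← hi e.y]; exact φ.strictMono.monotone hp.2
  · rw [pull_coe]
    simp only [Event.pull, hi]
    exact h.left hc
  · rw [pull_coe]
    simp only [Event.pull, hi]
    exact h.right hc
  · rw [pull_coe]
    refine h.between _ ⟨?_, ?_⟩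
    · rw [← hi e.x]; exact φ.strictMono hp.1
    · rw [← hi e.y]; exact φ.strictMono hp.2

/-- All the events of the list may happen, one after the other. -/
def OkList : (𝕋 →₀ G) → List (Event G) → Prop
  | _, [] => True
  | s, e :: L => e.Ok s ∧ OkList (step s e) L

theorem okList_append {s : 𝕋 →₀ G} {L L' : List (Event G)} :
    OkList s (L ++ L') ↔ OkList s L ∧ OkList (final s L) L' := by
  induction L generalizing s with
  | nil => simp [OkList, final]
  | cons e L ih => simp only [List.cons_append, OkList, ih, final_cons, and_assoc]

/-- The events may happen, and the last level is glued to the first one by `φ`. -/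
def Valid (s : 𝕋 →₀ G) (L : List (Event G)) (φ : Twist) : Prop :=
  OkList s L ∧ final s L = pull φ s

theorem Valid.rotate {s : 𝕋 →₀ G} {e : Event G} {L : List (Event G)} {φ : Twist}
    (h : Valid s (e :: L) φ) : Valid (step s e) (L ++ [e.pull φ]) φ := by
  obtain ⟨⟨h1, h2⟩, h3⟩ := h
  rw [final_cons] at h3
  refine ⟨okList_append.2 ⟨h2, ?_, trivial⟩, ?_⟩
  · rw [h3]
    exact h1.pull φ
  · rw [final_append, h3]
    exact step_pull φ s e

/-- The total number of strands at the levels just below the events. -/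
noncomputable def strands : (𝕋 →₀ G) → List (Event G) → ℕ
  | _, [] => 0
  | s, e :: L => s.support.card + strands (step s e) L

theorem strands_append (s : 𝕋 →₀ G) (L L' : List (Event G)) :
    strands s (L ++ L') = strands s L + strands (final s L) L' := by
  induction L generalizing s with
  | nil => simp [strands, final]
  | cons e L ih => simp only [List.cons_append, strands, ih, final_cons, add_assoc]

theorem strands_rotate {s : 𝕋 →₀ G} {e : Event G} {L : List (Event G)} {φ : Twist}
    (h : final s (e :: L) = pull φ s) :
    strands (step s e) (L ++ [e.pull φ]) = strands s (e :: L) := by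
  rw [final_cons] at h
  rw [strands_append, h]
  simp only [strands, card_support_pull]
  ring

end Dunwoody

/-! ### Local moves, reduction to standard curves, and the diagram as a sequence of events. -/

namespace Dunwoody

open Topology Filter

variable {G : Type*} [AddCommGroup G]

/-! ### Pairs of consecutive events -/

/-- The picture of two consecutive events. -/
noncomputable def pair (s : 𝕋 →₀ G) (e f : Event G) : Set (ℝ × ℝ) :=
  stack (slab s e) (slab (step s e) f)

theorem Iso.picture_cons_cons (s : 𝕋 →₀ G) (e f : Event G) (L : List (Event G)) :
    Iso 1 1 (picture s (e :: f :: L)) (Dunwoody.stack (pair s e f) (picture (step (step s e) f) L)) :=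
  Iso.stack_assoc _ _ _

theorem mem_pair {s : 𝕋 →₀ G} {e f : Event G} {p t : ℝ} : (p, t) ∈ pair s e f ↔
    (s p ≠ 0 ∧ t ≤ 1 / 4) ∨ (step s e p ≠ 0 ∧ 1 / 4 ≤ t ∧ t ≤ 3 / 4) ∨
      (step (step s e) f p ≠ 0 ∧ 3 / 4 ≤ t) ∨ (p ∈ e.bar ∧ t = 1 / 4) ∨ (p ∈ f.bar ∧ t = 3 / 4) := by
  rw [pair, mem_stack, slab, slab, mem_gslab, mem_gslab]
  constructor
  · rintro (⟨h, h1 | h1 | h1⟩ | ⟨h, h1 | h1 | h1⟩)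
    · exact Or.inl ⟨h1.1, by linarith [h1.2]⟩
    · exact Or.inr (Or.inl ⟨h1.1, by linarith [h1.2], by linarith⟩)
    · exact Or.inr (Or.inr (Or.inr (Or.inl ⟨h1.1, by linarith [h1.2]⟩)))
    · exact Or.inr (Or.inl ⟨h1.1, by linarith, by linarith [h1.2]⟩)
    · exact Or.inr (Or.inr (Or.inl ⟨h1.1, by linarith [h1.2]⟩))
    · exact Or.inr (Or.inr (Or.inr (Or.inr ⟨h1.1, by linarith [h1.2]⟩)))
  · rintro (h | h | h | h | h)
    · exact Or.inl ⟨by linarith [h.2], Or.inl ⟨h.1, by linarith [h.2]⟩⟩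
    · rcases le_total t (1 / 2) with ht | ht
      · exact Or.inl ⟨ht, Or.inr (Or.inl ⟨h.1, by linarith [h.2.1]⟩)⟩
      · exact Or.inr ⟨ht, Or.inl ⟨h.1, by linarith [h.2.2]⟩⟩
    · exact Or.inr ⟨by linarith [h.2], Or.inr (Or.inl ⟨h.1, by linarith [h.2]⟩)⟩
    · exact Or.inl ⟨by linarith [h.2], Or.inr (Or.inr ⟨h.1, by linarith [h.2]⟩)⟩
    · exact Or.inr ⟨by linarith [h.2], Or.inr (Or.inr ⟨h.1, by linarith [h.2]⟩)⟩

/-- Two events with separate bars form one picture with a curved horizon at the height of each bar.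
Away from the bars the levels do not change, so there the course of the graph is invisible. -/
theorem Iso.pair_gslab {s : 𝕋 →₀ G} {e f : Event G} (he : e.x ≤ e.y) (hf : f.x ≤ f.y)
    {u : ℝ → ℝ} (hue : ∀ p ∈ e.bar, u p = 1 / 4) (huf : ∀ p ∈ f.bar, u p = 3 / 4) :
    Iso 1 1 (pair s e f) (Dunwoody.gslab u s (step (step s e) f) (e.bar ∪ f.bar)) := by
  refine Iso.of_eqOn ?_
  rintro ⟨p, t⟩ -
  rw [mem_pair, mem_gslab]
  by_cases h1 : p ∈ e.bar
  · have h2 : p ∉ f.bar := fun h2 => by linarith [hue p h1, huf p h2]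
    rw [step_of_notMem_bar hf h2, hue p h1]
    constructor
    · rintro (h | h | h | h | h)
      · exact Or.inl h
      · exact Or.inr (Or.inl ⟨h.1, h.2.1⟩)
      · exact Or.inr (Or.inl ⟨h.1, by linarith [h.2]⟩)
      · exact Or.inr (Or.inr ⟨Or.inl h.1, h.2⟩)
      · exact absurd h.1 h2
    · rintro (h | h | h)
      · exact Or.inl h
      · rcases le_total t (3 / 4) with ht | ht
        · exact Or.inr (Or.inl ⟨h.1, h.2, ht⟩)
        · exact Or.inr (Or.inr (Or.inl ⟨h.1, ht⟩))
      · exact Or.inr (Or.inr (Or.inr (Or.inl ⟨h1, h.2⟩)))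
  · rw [step_of_notMem_bar he h1]
    by_cases h2 : p ∈ f.bar
    · rw [huf p h2]
      constructor
      · rintro (h | h | h | h | h)
        · exact Or.inl ⟨h.1, by linarith [h.2]⟩
        · exact Or.inl ⟨h.1, h.2.2⟩
        · exact Or.inr (Or.inl h)
        · exact absurd h.1 h1
        · exact Or.inr (Or.inr ⟨Or.inr h.1, h.2⟩)
      · rintro (h | h | h)
        · rcases le_total t (1 / 4) with ht | ht
          · exact Or.inl ⟨h.1, ht⟩
          · exact Or.inr (Or.inl ⟨h.1, ht, h.2⟩)
        · exact Or.inr (Or.inr (Or.inl h))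
        · exact Or.inr (Or.inr (Or.inr (Or.inr ⟨h2, h.2⟩)))
    · rw [step_of_notMem_bar hf h2, step_of_notMem_bar he h1]
      constructor
      · rintro (h | h | h | h | h)
        · exact (le_total t (u p)).imp (fun h' => ⟨h.1, h'⟩) (fun h' => Or.inl ⟨h.1, h'⟩)
        · exact (le_total t (u p)).imp (fun h' => ⟨h.1, h'⟩) (fun h' => Or.inl ⟨h.1, h'⟩)
        · exact (le_total t (u p)).imp (fun h' => ⟨h.1, h'⟩) (fun h' => Or.inl ⟨h.1, h'⟩)
        · exact absurd h.1 h1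
        · exact absurd h.1 h2
      · intro h
        have h3 : s p ≠ 0 := by
          rcases h with h | h | ⟨h | h, -⟩
          · exact h.1
          · exact h.1
          · exact absurd h h1
          · exact absurd h h2
        rcases le_total t (1 / 4) with ht | ht
        · exact Or.inl ⟨h3, ht⟩
        · rcases le_total t (3 / 4) with ht' | ht'
          · exact Or.inr (Or.inl ⟨h3, ht, ht'⟩)
          · exact Or.inr (Or.inr (Or.inl ⟨h3, ht'⟩))

theorem mem_bar_iff_coe {G : Type*} {e : Event G} {p : ℝ} :
    p ∈ e.bar ↔ (p : 𝕋) ∈ (fun x : ℝ => (x : 𝕋)) '' Icc e.x e.y := by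
  constructor
  · rintro ⟨k, hk⟩
    exact ⟨_, hk, coe_add_int p k⟩
  · rintro ⟨q, hq, h⟩
    obtain ⟨n, hn⟩ := coe_eq_coe_iff.1 h
    refine ⟨-n, ?_⟩
    rw [hn]
    push_cast
    rwa [add_neg_cancel_right]

theorem isClosed_coe_Icc (x y : ℝ) : IsClosed ((fun x : ℝ => (x : 𝕋)) '' Icc x y) :=
  (isCompact_Icc.image (AddCircle.continuous_mk' 1)).isClosed

theorem exists_graph_of_disjoint {G : Type*} {e f : Event G} (h : Disjoint e.bar f.bar) :
    ∃ u, IsGraph u ∧ (∀ p ∈ e.bar, u p = 1 / 4) ∧ (∀ p ∈ f.bar, u p = 3 / 4) := by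
  have hd : Disjoint ((fun x : ℝ => (x : 𝕋)) '' Icc e.x e.y)
      ((fun x : ℝ => (x : 𝕋)) '' Icc f.x f.y) := by
    rw [Set.disjoint_left] at h ⊢
    rintro _ ⟨p, hp, rfl⟩ hq
    exact h (mem_bar_iff_coe.2 (mem_image_of_mem _ hp)) (mem_bar_iff_coe.2 hq)
  obtain ⟨g, h0, h1, h2⟩ := exists_continuous_zero_one_of_isClosed (isClosed_coe_Icc e.x e.y)
    (isClosed_coe_Icc f.x f.y) hd
  have hc : Continuous fun x : ℝ => (x : 𝕋) := AddCircle.continuous_mk' 1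
  refine ⟨fun p => 1 / 4 + g p / 2, ⟨by fun_prop, fun p => by simp, fun p => ?_, fun p => ?_⟩,
    fun p hp => ?_, fun p hp => ?_⟩
  · linarith [(h2 p).1]
  · linarith [(h2 p).2]
  · have := h0 (mem_bar_iff_coe.1 hp)
    simp only [Pi.zero_apply] at this
    simp only [this]; norm_num
  · have := h1 (mem_bar_iff_coe.1 hp)
    simp only [Pi.one_apply] at this
    simp only [this]; norm_num

theorem step_comm (s : 𝕋 →₀ G) (e f : Event G) :
    step (step s e) f = step (step s f) e := by
  simp only [step]
  abel

/-- The graph through the two bars can be replaced by any other, in particular by one on which the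
heights of the bars are exchanged. -/
theorem Iso.pair_comm {e f : Event G} (h : Disjoint e.bar f.bar) (he : e.x ≤ e.y)
    (hf : f.x ≤ f.y) (s : 𝕋 →₀ G) : Iso 1 1 (pair s e f) (pair s f e) := by
  obtain ⟨u, hu, hue, huf⟩ := exists_graph_of_disjoint h
  obtain ⟨v, hv, hve, hvf⟩ := exists_graph_of_disjoint h.symm
  have h1 := Iso.pair_gslab (s := s) he hf hue huf
  have h2 := Iso.pair_gslab (s := s) hf he hve hvf
  rw [step_comm, union_comm] at h2
  exact (h1.trans_one (Iso.gslab hu hv _ _ _)).trans_one h2.symm_one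

theorem Iso.picture_swap {e f : Event G} (h : Disjoint e.bar f.bar) (he : e.x ≤ e.y)
    (hf : f.x ≤ f.y) (s : 𝕋 →₀ G) (L : List (Event G)) :
    Iso 1 1 (picture s (e :: f :: L)) (picture s (f :: e :: L)) := by
  refine ((Iso.picture_cons_cons s e f L).trans_one ?_).trans_one
    (Iso.picture_cons_cons s f e L).symm_one
  rw [step_comm]
  exact (Iso.pair_comm h he hf s).stack (Iso.refl _)

/-! ### Translating an event by an integer -/

/-- The same event, with positions moved by an integer. -/
def Event.shift {G : Type*} (e : Event G) (n : ℤ) : Event G := ⟨e.cup, e.x + n, e.y + n, e.η⟩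

theorem Event.bar_shift {G : Type*} (e : Event G) (n : ℤ) : (e.shift n).bar = e.bar := by
  ext p
  constructor
  · rintro ⟨k, h1, h2⟩
    simp only [Event.shift] at h1 h2
    exact ⟨k - n, by push_cast; linarith, by push_cast; linarith⟩
  · rintro ⟨k, h1, h2⟩
    exact ⟨k + n, by simp only [Event.shift]; push_cast; linarith,
      by simp only [Event.shift]; push_cast; linarith⟩

theorem step_shift (s : 𝕋 →₀ G) (e : Event G) (n : ℤ) :
    step s (e.shift n) = step s e := by
  simp [step, Event.shift]

theorem slab_shift (s : 𝕋 →₀ G) (e : Event G) (n : ℤ) :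
    slab s (e.shift n) = slab s e := by
  rw [slab, step_shift, Event.bar_shift, slab]

theorem Event.Ok.shift {s : 𝕋 →₀ G} {e : Event G} (h : e.Ok s) (n : ℤ) :
    (e.shift n).Ok s := by
  have hs : ∀ p : ℝ, s p = s ((p - n : ℝ) : 𝕋) := fun p => by
    rw [← coe_add_int (p - n) n, sub_add_cancel]
  refine ⟨h.ne, by simpa [Event.shift] using h.lt, ?_, fun hc p hp => ?_, fun hc => ?_, fun hc => ?_,
    fun p hp => ?_⟩
  · have := h.lt_add
    simp only [Event.shift]
    linarith
  · rw [hs]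
    refine h.free hc _ ⟨?_, ?_⟩
    · have := hp.1
      simp only [Event.shift] at this
      linarith
    · have := hp.2
      simp only [Event.shift] at this
      linarith
  · simp only [Event.shift, coe_add_int]
    exact h.left hc
  · simp only [Event.shift, coe_add_int]
    exact h.right hc
  · rw [hs]
    refine h.between _ ⟨?_, ?_⟩
    · have := hp.1
      simp only [Event.shift] at this
      linarith
    · have := hp.2
      simp only [Event.shift] at this
      linarith

/-! ### Constructing homeomorphisms of the line -/

/-- Increasing maps of a unit interval depending on a parameter extend to maps of the line
commuting with `p ↦ p + 1`. -/
theorem exists_family_of_Icc {g : ℝ → ℝ → ℝ} {a : ℝ} (hc : Continuous fun v : ℝ × ℝ => g v.1 v.2)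
    (hm : ∀ t, StrictMono (g t)) (ha : ∀ t, g t (a + 1) = g t a + 1) :
    ∃ f : ℝ → ℝ → ℝ, (Continuous fun v : ℝ × ℝ => f v.1 v.2) ∧ (∀ t, StrictMono (f t)) ∧
      (∀ t p, f t (p + 1) = f t p + 1) ∧ ∀ t, ∀ p ∈ Icc a (a + 1), f t p = g t p := by
  -- This displacement takes equal values at `x = 0` and `x = 1`, so its periodic continuation is
  -- continuous.
  let h : ℝ → ℝ → ℝ := fun t x => g t (a + x) - x
  have hcont : Continuous fun v : ℝ × ℝ => h v.1 (Int.fract (v.2 - a)) := by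
    refine ContinuousOn.comp_fract (f := fun (v : ℝ × ℝ) x => h v.1 x) ?_ (by fun_prop) fun v => by
      simp only [h]
      rw [ha, add_zero]
      ring
    refine Continuous.continuousOn ?_
    exact (hc.comp (by fun_prop : Continuous fun v : (ℝ × ℝ) × ℝ => (v.1.1, a + v.2))).sub
      continuous_snd
  let f : ℝ → ℝ → ℝ := fun t p => h t (Int.fract (p - a)) + (p - a)
  have hf : ∀ t p, f t p = g t (a + Int.fract (p - a)) + ⌊p - a⌋ := fun t p => by
    simp only [f, h]
    linarith [Int.fract_add_floor (p - a)]
  refine ⟨f, hcont.add (continuous_snd.sub continuous_const), fun t p q hpq => ?_, fun t p => ?_,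
    fun t p hp => ?_⟩
  · rw [hf, hf]
    have h1 : ⌊p - a⌋ ≤ ⌊q - a⌋ := Int.floor_mono (by linarith)
    rcases eq_or_lt_of_le h1 with h2 | h2
    · rw [h2]
      have : Int.fract (p - a) < Int.fract (q - a) := by
        have e1 := Int.fract_add_floor (p - a)
        have e2 := Int.fract_add_floor (q - a)
        rw [h2] at e1
        linarith
      have := hm t (show a + Int.fract (p - a) < a + Int.fract (q - a) by linarith)
      linarith
    · have h3 : (⌊p - a⌋ : ℝ) + 1 ≤ ⌊q - a⌋ := by exact_mod_cast h2
      have h4 := hm t (show a + Int.fract (p - a) < a + 1 by linarith [Int.fract_lt_one (p - a)])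
      have h5 := (hm t).monotone
        (show a ≤ a + Int.fract (q - a) by linarith [Int.fract_nonneg (q - a)])
      linarith [ha t]
  · have h1 : p + 1 - a = (p - a) + 1 := by ring
    simp only [f, h1, Int.fract_add_one]
    ring
  · rcases eq_or_lt_of_le hp.2 with h1 | h1
    · subst h1
      simp only [f, h, add_sub_cancel_left, Int.fract_one, add_zero]
      linarith [ha t]
    · have : Int.fract (p - a) = p - a := Int.fract_eq_self.2 ⟨by linarith [hp.1], by linarith⟩
      simp only [f, h, this]
      rw [add_sub_cancel]
      ring

theorem exists_twist_of_Icc {g : ℝ → ℝ} {a : ℝ} (hc : Continuous g) (hm : StrictMono g)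
    (ha : g (a + 1) = g a + 1) : ∃ ψ : Twist, ∀ p ∈ Icc a (a + 1), ψ p = g p := by
  obtain ⟨f, h1, h2, h3, h4⟩ := exists_family_of_Icc (g := fun _ => g) (a := a)
    (hc.comp continuous_snd) (fun _ => hm) (fun _ => ha)
  obtain ⟨ψ, hψ⟩ := exists_twist (f := f 0) (h1.comp (Continuous.prodMk_right 0)) (h2 0) (h3 0)
  exact ⟨ψ, fun p hp => by rw [hψ, h4 0 p hp]⟩

/-- A homeomorphism of the line which moves `w` to `x` and is supported in `[x', w']`. -/
theorem exists_push {x' x w w' : ℝ} (h1 : x' < x) (h2 : x < w) (h3 : w < w') (h4 : w' < x' + 1) :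
    ∃ ψ : Twist, ψ w = x ∧ (∀ p ∈ Ioo x' w', ψ p < p) ∧ ψ x' = x' ∧
      ∀ p ∈ Icc w' (x' + 1), ψ p = p := by
  have b1 : 0 < (x - x') / (w - x') := div_pos (by linarith) (by linarith)
  have b2 : (x - x') / (w - x') < 1 := (div_lt_one (by linarith)).2 (by linarith)
  have b3 : 1 < (w' - x) / (w' - w) := (one_lt_div (by linarith)).2 (by linarith)
  set m₁ := (x - x') / (w - x') with hm₁
  set m₂ := (w' - x) / (w' - w) with hm₂
  have c1 : m₁ * (w - x') = x - x' := div_mul_cancel₀ _ (by linarith)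
  have c2 : m₂ * (w' - w) = w' - x := div_mul_cancel₀ _ (by linarith)
  -- Inside `[x', w']` this is the convex polygon through `(x', x')`, `(w, x)` and `(w', w')`; the
  -- minimum with `p` makes it the identity outside.
  let g : ℝ → ℝ := fun p => min (1 * p + 0) (max (m₁ * p + (x' - m₁ * x')) (m₂ * p + (w' - m₂ * w')))
  have hg : StrictMono g := strictMono_min (strictMono_affine one_pos _)
    (strictMono_max (strictMono_affine b1 _) (strictMono_affine (by linarith) _))
  have gx : g x' = x' := by
    simp only [g]
    rw [min_eq_left]
    · ring
    · exact le_max_of_le_left (by linarith)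
  have gw : ∀ p, w' ≤ p → g p = p := by
    intro p hp
    simp only [g]
    rw [min_eq_left]
    · ring
    · refine le_max_of_le_right ?_
      nlinarith
  obtain ⟨ψ, hψ⟩ := exists_twist_of_Icc (g := g) (a := x') (by fun_prop) hg
    (by rw [gx, gw _ (by linarith)])
  refine ⟨ψ, ?_, fun p hp => ?_, ?_, fun p hp => ?_⟩
  · rw [hψ _ ⟨by linarith, by linarith⟩]
    have e1 : m₁ * w + (x' - m₁ * x') = x := by linarith
    have e2 : m₂ * w + (w' - m₂ * w') = x := by linarith
    simp only [g]
    rw [e1, e2, max_self, min_eq_right (by linarith)]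
  · rw [hψ _ ⟨hp.1.le, by linarith [hp.2]⟩]
    refine min_lt_of_right_lt (max_lt ?_ ?_)
    · nlinarith [hp.1]
    · nlinarith [hp.2]
  · rw [hψ _ ⟨le_rfl, by linarith⟩, gx]
  · rw [hψ _ ⟨by linarith [hp.1], hp.2⟩, gw p hp.1]

/-- The strands at a level are isolated. -/
theorem exists_isolated (s : 𝕋 →₀ G) (x : ℝ) :
    ∃ ε > 0, ∀ p : ℝ, p ≠ x → |p - x| < ε → s p = 0 := by
  classical
  have hcl : IsClosed ((s.support.erase (x : 𝕋) : Finset 𝕋) : Set 𝕋) :=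
    Finset.isClosed _
  have hc : Continuous fun x : ℝ => (x : 𝕋) := AddCircle.continuous_mk' 1
  have hn := (hcl.isOpen_compl.preimage hc).mem_nhds (x := x) (by simp)
  obtain ⟨ε, hε, h⟩ := Metric.mem_nhds_iff.1 hn
  refine ⟨min ε 1, lt_min hε one_pos, fun p hp hpx => ?_⟩
  by_contra hs
  have h1 := h (show p ∈ Metric.ball x ε from lt_of_lt_of_le hpx (min_le_left _ _))
  have h2 : (p : 𝕋) = x := by
    by_contra hne
    exact h1 (by simp [hne, hs])
  obtain ⟨n, hn⟩ := coe_eq_coe_iff.1 h2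
  have h3 := abs_lt.1 (lt_of_lt_of_le hpx (min_le_right _ _))
  have n1 : (-1 : ℝ) < n := by linarith
  have n2 : (n : ℝ) < 1 := by linarith
  have n1 : -1 < n := by exact_mod_cast n1
  have n2 : n < 1 := by exact_mod_cast n2
  have n0 : n = 0 := by omega
  rw [n0] at hn
  push_cast at hn
  exact hp (by linarith)

/-! ### Graphs and shears -/

/-- Tietze's theorem on the circle: an interval shorter than a period is a closed subset of it. -/
theorem exists_graph_extension {x w : ℝ} (h : w < x + 1) {c : ℝ → ℝ} (hc : ContinuousOn c (Icc x w))
    (h01 : ∀ p ∈ Icc x w, c p ∈ Ioo (0 : ℝ) 1) :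
    ∃ u, IsGraph u ∧ ∀ p ∈ Icc x w, u p = c p := by
  have hcoe : Continuous fun x : ℝ => (x : 𝕋) := AddCircle.continuous_mk' 1
  let e : Icc x w → 𝕋 := fun p => ((p : ℝ) : 𝕋)
  have he : IsClosedEmbedding e := by
    refine (hcoe.comp continuous_subtype_val).isClosedEmbedding ?_
    rintro ⟨p, hp⟩ ⟨q, hq⟩ hpq
    simp only [Function.comp] at hpq
    apply Subtype.ext
    rcases lt_trichotomy p q with h1 | h1 | h1
    · exact absurd hpq (coe_ne_of_lt h1 (by linarith [hp.1, hq.2]))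
    · exact h1
    · exact absurd hpq.symm (coe_ne_of_lt h1 (by linarith [hq.1, hp.2]))
  obtain ⟨g, h1, h2⟩ := ContinuousMap.exists_extension_forall_mem_of_isClosedEmbedding
    ⟨_, hc.domRestrict⟩ (t := Ioo (0 : ℝ) 1) (fun p => h01 p p.2) ⟨1 / 2, by norm_num⟩ he
  refine ⟨fun p => g p, ⟨by fun_prop, fun p => by simp, fun p => (h1 _).1, fun p => (h1 _).2⟩,
    fun p hp => congrFun h2 ⟨p, hp⟩⟩

theorem IsGraph.add_int {u : ℝ → ℝ} (hu : IsGraph u) (p : ℝ) (n : ℤ) : u (p + n) = u p := by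
  have := add_int_of_add_one (f := fun p => p + u p) (fun p => by rw [hu.per]; ring) p n
  linarith

/-- A tent function of height `δ` at `y` on the circle. -/
noncomputable def tent (δ y p : ℝ) : ℝ := max 0 (δ - ‖((p - y : ℝ) : 𝕋)‖)

theorem norm_coe_le (x : ℝ) (k : ℤ) : ‖(x : 𝕋)‖ ≤ |x - k| := by
  rw [UnitAddCircle.norm_eq]
  exact round_le x k

theorem continuous_tent (δ y : ℝ) : Continuous (tent δ y) := by
  have hcoe : Continuous fun x : ℝ => (x : 𝕋) := AddCircle.continuous_mk' 1
  have : Continuous fun p : ℝ => ((p - y : ℝ) : 𝕋) :=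
    hcoe.comp (continuous_id.sub continuous_const)
  unfold tent
  fun_prop

theorem tent_add_one (δ y p : ℝ) : tent δ y (p + 1) = tent δ y p := by
  have : ((p + 1 - y : ℝ) : 𝕋) = ((p - y : ℝ) : 𝕋) := by
    rw [show p + 1 - y = p - y + (1 : ℤ) by push_cast; ring, coe_add_int]
  rw [tent, tent, this]

theorem tent_self {δ : ℝ} (h : 0 < δ) (y : ℝ) : tent δ y y = δ := by
  rw [tent, sub_self, AddCircle.coe_zero, norm_zero, sub_zero, max_eq_right h.le]

theorem tent_eq_zero {δ y p : ℝ} (h : ∀ k : ℤ, δ ≤ |p + k - y|) : tent δ y p = 0 := by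
  rw [tent, UnitAddCircle.norm_eq, max_eq_left]
  have := h (-round (p - y))
  push_cast at this
  rw [show p + -(round (p - y) : ℝ) - y = p - y - round (p - y) by ring] at this
  linarith

theorem tent_lipschitz (δ y p q : ℝ) : |tent δ y p - tent δ y q| ≤ |p - q| := by
  have h1 : |‖((p - y : ℝ) : 𝕋)‖ - ‖((q - y : ℝ) : 𝕋)‖| ≤ |p - q| := by
    refine (abs_norm_sub_norm_le _ _).trans ?_
    rw [← AddCircle.coe_sub, show p - y - (q - y) = p - q by ring]
    simpa using norm_coe_le (p - q) 0
  unfold tent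
  rw [max_comm 0, max_comm 0]
  refine (abs_max_sub_max_le_abs (δ - ‖((p - y : ℝ) : 𝕋)‖)
    (δ - ‖((q - y : ℝ) : 𝕋)‖) 0).trans ?_
  rwa [sub_sub_sub_cancel_left, abs_sub_comm]

/-- A piecewise linear function of time: `0` outside `[0, 1]`, and `4t - 2` on `[1/4, 3/4]`. -/
noncomputable def zigzag (t : ℝ) : ℝ :=
  min (max (-4 * max 0 (min 1 t)) (4 * max 0 (min 1 t) - 2)) (4 - 4 * max 0 (min 1 t))

theorem zigzag_of_mem {t : ℝ} (h0 : 1 / 4 ≤ t) (h1 : t ≤ 3 / 4) : zigzag t = 4 * t - 2 := by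
  rw [zigzag, min_eq_right (a := 1) (by linarith), max_eq_right (a := 0) (by linarith),
    max_eq_right (by linarith), min_eq_left (by linarith)]

theorem zigzag_of_le {t : ℝ} (h : t ≤ 0) : zigzag t = 0 := by
  rw [zigzag, min_eq_right (a := 1) (by linarith), max_eq_left h]
  norm_num

theorem zigzag_of_ge {t : ℝ} (h : 1 ≤ t) : zigzag t = 0 := by
  rw [zigzag, min_eq_left h]
  norm_num

theorem abs_zigzag_le (t : ℝ) : |zigzag t| ≤ 1 := by
  have h0 : 0 ≤ max 0 (min 1 t) := le_max_left _ _
  have h1 : max 0 (min 1 t) ≤ 1 := max_le zero_le_one (min_le_left _ _)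
  rw [zigzag]
  generalize max 0 (min 1 t) = τ at h0 h1
  rw [abs_le]
  constructor
  · rcases le_total τ (1 / 4) with h | h
    · exact le_min (le_max_of_le_left (by linarith)) (by linarith)
    · exact le_min (le_max_of_le_right (by linarith)) (by linarith)
  · rcases le_total τ (3 / 4) with h | h
    · exact min_le_of_left_le (max_le (by linarith) (by linarith))
    · exact min_le_of_right_le (by linarith)

theorem continuous_zigzag : Continuous zigzag := by
  unfold zigzag
  fun_prop

/-- The horizontal displacement by `k`, with a time-dependent factor. -/
noncomputable def shear (k : ℝ → ℝ) (t p : ℝ) : ℝ := p + zigzag t / 4 * k p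

/-- The displacement has Lipschitz constant at most `1/2`. The factor `2` in the hypothesis leaves
room for the difference of two tents. -/
theorem shear_strictMono {k : ℝ → ℝ} (hl : ∀ p q, |k p - k q| ≤ 2 * |p - q|) (t : ℝ) :
    StrictMono (shear k t) := by
  intro p q hpq
  have h1 := hl q p
  rw [abs_of_pos (show 0 < q - p by linarith)] at h1
  have h2 : |zigzag t / 4 * (k q - k p)| ≤ 1 / 4 * (2 * (q - p)) := by
    rw [abs_mul, abs_div, abs_of_pos (show (0 : ℝ) < 4 by norm_num)]
    have := abs_zigzag_le t
    exact mul_le_mul (by linarith) h1 (abs_nonneg _) (by norm_num)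
  have h3 := (abs_le.1 h2).1
  simp only [shear]
  nlinarith

theorem shear_add_one {k : ℝ → ℝ} (hp : ∀ p, k (p + 1) = k p) (t p : ℝ) :
    shear k t (p + 1) = shear k t p + 1 := by
  rw [shear, hp, shear]
  ring

theorem Iso.shear {k : ℝ → ℝ} (hc : Continuous k) (hp : ∀ p, k (p + 1) = k p)
    (hl : ∀ p q, |k p - k q| ≤ 2 * |p - q|) {A B : Set (ℝ × ℝ)}
    (hAB : ∀ p, ∀ t ∈ Icc (0 : ℝ) 1, (p, t) ∈ A ↔ (shear k t p, t) ∈ B) : Iso 1 1 A B := by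
  have := continuous_zigzag
  refine Iso.level (ψ := Dunwoody.shear k) (by unfold Dunwoody.shear; fun_prop) (shear_strictMono hl)
    (shear_add_one hp) (fun t ht p => ?_) (fun t ht p => ?_) hAB
  · simp [Dunwoody.shear, zigzag_of_le ht]
  · simp [Dunwoody.shear, zigzag_of_ge ht]

/-- A continuous function equal to `1/2 + m/δ` where this is between `1/4` and `3/4`. -/
noncomputable def ramp (δ m : ℝ) : ℝ := max (1 / 4) (min (1 / 2 + m / δ) (3 / 4))

theorem ramp_mem (δ m : ℝ) : ramp δ m ∈ Icc (1 / 4 : ℝ) (3 / 4) :=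
  ⟨le_max_left _ _, max_le (by norm_num) (min_le_right _ _)⟩

/-- Here `m` is a horizontal coordinate, and `zigzag t / 4 * δ` is the position at the time `t` of a
strand that the shear has slanted. The graph of the ramp is this strand between the heights `1/4`
and `3/4`, together with a lower bar on one side and an upper bar on the other. -/
theorem eq_ramp_iff {δ m t : ℝ} (hδ : 0 < δ) (h0 : 1 / 4 ≤ t) (h1 : t ≤ 3 / 4) : t = ramp δ m ↔
    (t = 1 / 4 ∧ m ≤ zigzag t / 4 * δ) ∨ (t = 3 / 4 ∧ zigzag t / 4 * δ ≤ m) ∨ m = zigzag t / 4 * δ := by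
  have e : zigzag t / 4 * δ = (t - 1 / 2) * δ := by rw [zigzag_of_mem h0 h1]; ring
  rw [e]
  have hm : m / δ * δ = m := div_mul_cancel₀ _ hδ.ne'
  constructor
  · intro h
    rcases le_total (1 / 2 + m / δ) (1 / 4) with h2 | h2
    · have : ramp δ m = 1 / 4 := by
        rw [ramp, min_eq_left (by linarith), max_eq_left h2]
      refine Or.inl ⟨by rw [h, this], ?_⟩
      rw [h, this, ← hm]
      nlinarith
    · rcases le_total (3 / 4) (1 / 2 + m / δ) with h3 | h3
      · have : ramp δ m = 3 / 4 := by
          rw [ramp, min_eq_right h3, max_eq_right (by norm_num)]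
        refine Or.inr (Or.inl ⟨by rw [h, this], ?_⟩)
        rw [h, this, ← hm]
        nlinarith
      · have : ramp δ m = 1 / 2 + m / δ := by
          rw [ramp, min_eq_left h3, max_eq_right h2]
        refine Or.inr (Or.inr ?_)
        rw [h, this, add_sub_cancel_left, hm]
  · have key : ∀ a : ℝ, m ≤ a * δ → m / δ ≤ a := fun a h => (div_le_iff₀ hδ).2 h
    have key' : ∀ a : ℝ, a * δ ≤ m → a ≤ m / δ := fun a h => (le_div_iff₀ hδ).2 h
    rintro (⟨rfl, h⟩ | ⟨rfl, h⟩ | h)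
    · have := key _ h
      rw [ramp, min_eq_left (by linarith), max_eq_left (by linarith)]
    · have := key' _ h
      rw [ramp, min_eq_right (by linarith), max_eq_right (by norm_num)]
    · have h2 := key _ h.le
      have h3 := key' _ h.ge
      rw [ramp, min_eq_left (by linarith), max_eq_right (by linarith)]
      linarith

theorem continuous_ramp (δ : ℝ) : Continuous (ramp δ) := by
  unfold ramp
  fun_prop

/-! ### Cancelling a birth and a death which have one strand in common -/

/-- A birth at `x`, `y` followed by a death at `y`, `w`. -/
structure IsZigzag (s : 𝕋 →₀ G) (e f : Event G) : Prop where
  ok : e.Ok s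
  ok' : f.Ok (step s e)
  cup : e.cup = true
  cap : f.cup = false
  eq : f.x = e.y
  lt : f.y < e.x + 1

namespace IsZigzag

variable {s : 𝕋 →₀ G} {e f : Event G}

/-- The values of the three levels between `x` and `w`. -/
theorem levels (h : IsZigzag s e f) : f.η = e.η ∧ ∀ p ∈ Icc e.x f.y,
    s p = (if p = f.y then e.η else 0) ∧
    step s e p = (if p = e.x then e.η else if p = e.y then -e.η else if p = f.y then e.η else 0) ∧
    step (step s e) f p = (if p = e.x then e.η else 0) := by
  have h1 := h.ok.lt
  have h2 := h.ok'.lt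
  have h3 := h.lt
  have he := h.eq
  have inj : ∀ p ∈ Icc e.x f.y, ∀ q ∈ Icc e.x f.y, (p : 𝕋) = q ↔ p = q := by
    intro p hp q hq
    refine ⟨fun hpq => ?_, fun hpq => by rw [hpq]⟩
    rcases lt_trichotomy p q with h4 | h4 | h4
    · exact absurd hpq (coe_ne_of_lt h4 (by linarith [hp.1, hq.2]))
    · exact h4
    · exact absurd hpq.symm (coe_ne_of_lt h4 (by linarith [hq.1, hp.2]))
  have mx : e.x ∈ Icc e.x f.y := ⟨le_rfl, by linarith⟩
  have my : e.y ∈ Icc e.x f.y := ⟨h1.le, by linarith⟩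
  have mw : f.y ∈ Icc e.x f.y := ⟨by linarith, le_rfl⟩
  have s1 : ∀ p ∈ Icc e.x f.y, step s e p
      = s p + ((if e.x = p then e.η else 0) - if e.y = p then e.η else 0) := fun p hp => by
    rw [step_coe]
    simp only [inj _ mx _ hp, inj _ my _ hp]
  have sy : s e.y = 0 := h.ok.free h.cup _ ⟨h1.le, le_rfl⟩
  have s1y : step s e e.y = -e.η := by
    rw [s1 _ my, sy, if_neg h1.ne, if_pos rfl]
    simp
  have hη : f.η = e.η := by
    have := h.ok'.left h.cap
    rw [he, s1y] at this
    exact (neg_injective this).symm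
  have s1w : step s e f.y = e.η := by rw [h.ok'.right h.cap, hη]
  have sw : s f.y = e.η := by
    have := s1 _ mw
    rw [s1w, if_neg (by linarith), if_neg (by linarith)] at this
    simpa using this.symm
  have s0 : ∀ p ∈ Icc e.x f.y, s p = (if p = f.y then e.η else 0) := by
    intro p hp
    split_ifs with h4
    · rw [h4, sw]
    · rcases le_total p e.y with h5 | h5
      · exact h.ok.free h.cup _ ⟨hp.1, h5⟩
      · rcases eq_or_lt_of_le h5 with h6 | h6
        · rw [← h6, sy]
        · have := h.ok'.between p ⟨by rw [he]; exact h6, lt_of_le_of_ne hp.2 h4⟩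
          rw [s1 _ hp, if_neg (by linarith), if_neg (by linarith)] at this
          simpa using this
  refine ⟨hη, fun p hp => ⟨s0 p hp, ?_, ?_⟩⟩
  · rw [s1 _ hp, s0 _ hp]
    by_cases c1 : p = e.x
    · subst c1
      rw [if_neg (by linarith), if_pos rfl, if_neg h1.ne', if_pos rfl]
      simp
    · rw [if_neg (Ne.symm c1), if_neg c1]
      by_cases c2 : p = e.y
      · subst c2
        rw [if_neg (by linarith), if_pos rfl, if_pos rfl]
        simp
      · rw [if_neg (Ne.symm c2), if_neg c2]
        simp
  · rw [step_coe, s1 _ hp, s0 _ hp, he, hη]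
    simp only [inj _ my _ hp, inj _ mw _ hp]
    by_cases c1 : p = e.x
    · subst c1
      have n1 : e.x ≠ f.y := by linarith
      simp [n1, n1.symm, h1.ne']
    · rw [if_neg (Ne.symm c1), if_neg c1]
      by_cases c2 : p = e.y
      · subst c2
        rw [if_neg (by linarith), if_pos rfl, if_neg (by linarith)]
        simp
      · rw [if_neg (Ne.symm c2)]
        by_cases c3 : p = f.y
        · subst c3
          simp
        · rw [if_neg c3, if_neg (Ne.symm c3)]
          simp

/-- The positions over the union of the two bars. -/
def span {G : Type*} (e f : Event G) : Set ℝ := {p | ∃ k : ℤ, p + k ∈ Icc e.x f.y}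

theorem span_add_int {G : Type*} {e f : Event G} (p : ℝ) (n : ℤ) :
    p + n ∈ span e f ↔ p ∈ span e f :=
  Event.bar_add_int (⟨true, e.x, f.y, e.η⟩ : Event G) p n

theorem step_of_notMem (h : IsZigzag s e f) {p : ℝ} (hp : p ∉ span e f) :
    p ∉ e.bar ∧ p ∉ f.bar ∧ step s e p = s p ∧ step (step s e) f p = s p := by
  have h1 := h.ok.lt
  have h2 := h.ok'.lt
  have he := h.eq
  have b1 : p ∉ e.bar := fun ⟨k, hk⟩ => hp ⟨k, hk.1, by linarith [hk.2]⟩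
  have b2 : p ∉ f.bar := fun ⟨k, hk⟩ => hp ⟨k, by linarith [hk.1], hk.2⟩
  have e1 := step_of_notMem_bar (s := s) h1.le b1
  refine ⟨b1, b2, e1, ?_⟩
  rw [step_of_notMem_bar h2.le b2, e1]

theorem mem_pair_iff (h : IsZigzag s e f) {p t : ℝ} (hp : p ∈ Icc e.x f.y) :
    (p, t) ∈ pair s e f ↔ (p = f.y ∧ t ≤ 3 / 4) ∨ (p = e.x ∧ 1 / 4 ≤ t) ∨
      ((t = 1 / 4 ∧ p ≤ e.y) ∨ (t = 3 / 4 ∧ e.y ≤ p) ∨ (1 / 4 ≤ t ∧ t ≤ 3 / 4 ∧ p = e.y)) := by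
  have h1 := h.ok.lt
  have h2 := h.ok'.lt
  have h3 := h.lt
  have he := h.eq
  have hne := h.ok.ne
  obtain ⟨-, hl⟩ := h.levels
  obtain ⟨l0, l1, l2⟩ := hl p hp
  have b1 : p ∈ e.bar ↔ p ≤ e.y := by
    constructor
    · rintro ⟨k, hk⟩
      have k1 : (-1 : ℝ) < k := by linarith [hk.1, hp.2]
      have k1 : -1 < k := by exact_mod_cast k1
      have k0 : 0 ≤ k := by omega
      have : (0 : ℝ) ≤ k := by exact_mod_cast k0
      linarith [hk.2]
    · exact fun h4 => ⟨0, by simpa using ⟨hp.1, h4⟩⟩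
  have b2 : p ∈ f.bar ↔ e.y ≤ p := by
    constructor
    · rintro ⟨k, hk⟩
      have k1 : (k : ℝ) < 1 := by linarith [hk.2, hp.1]
      have k1 : k < 1 := by exact_mod_cast k1
      have k0 : k ≤ 0 := by omega
      have : (k : ℝ) ≤ 0 := by exact_mod_cast k0
      linarith [hk.1]
    · exact fun h4 => ⟨0, by rw [he]; simpa using ⟨h4, hp.2⟩⟩
  have a0 : s p ≠ 0 ↔ p = f.y := by
    rw [l0]
    split_ifs with c <;> simp [c, hne]
  have a1 : step s e p ≠ 0 ↔ p = e.x ∨ p = e.y ∨ p = f.y := by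
    rw [l1]
    split_ifs with c c' c'' <;> simp [*]
  have a2 : step (step s e) f p ≠ 0 ↔ p = e.x := by
    rw [l2]
    split_ifs with c <;> simp [c, hne]
  rw [mem_pair, a0, a1, a2, b1, b2]
  constructor
  · rintro (⟨c, d⟩ | ⟨c | c | c, d, d'⟩ | ⟨c, d⟩ | ⟨c, d⟩ | ⟨c, d⟩)
    · exact Or.inl ⟨c, by linarith⟩
    · exact Or.inr (Or.inl ⟨c, d⟩)
    · exact Or.inr (Or.inr (Or.inr (Or.inr ⟨d, d', c⟩)))
    · exact Or.inl ⟨c, d'⟩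
    · exact Or.inr (Or.inl ⟨c, by linarith⟩)
    · exact Or.inr (Or.inr (Or.inl ⟨d, c⟩))
    · exact Or.inr (Or.inr (Or.inr (Or.inl ⟨d, c⟩)))
  · rintro (⟨c, d⟩ | ⟨c, d⟩ | ⟨c, d⟩ | ⟨c, d⟩ | ⟨c, c', d⟩)
    · rcases le_total t (1 / 4) with ht | ht
      · exact Or.inl ⟨c, ht⟩
      · exact Or.inr (Or.inl ⟨Or.inr (Or.inr c), ht, d⟩)
    · rcases le_total t (3 / 4) with ht | ht
      · exact Or.inr (Or.inl ⟨Or.inl c, d, ht⟩)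
      · exact Or.inr (Or.inr (Or.inl ⟨c, ht⟩))
    · exact Or.inr (Or.inr (Or.inr (Or.inl ⟨d, c⟩)))
    · exact Or.inr (Or.inr (Or.inr (Or.inr ⟨d, c⟩)))
    · exact Or.inr (Or.inl ⟨Or.inr (Or.inl d), c, c'⟩)

theorem pair_add_int (p t : ℝ) (k : ℤ) : (p + k, t) ∈ pair s e f ↔ (p, t) ∈ pair s e f := by
  simp only [mem_pair, coe_add_int, Event.bar_add_int]

/-- The obstacle to a graph is that the middle strand, at `e.y`, is vertical. A shear near `e.y`
slants it, and then the two bars and this strand form the graph of one function over `[e.x, f.y]`.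
-/
theorem exists_iso_gslab (h : IsZigzag s e f) : ∃ u, IsGraph u ∧
    Iso 1 1 (pair s e f) (Dunwoody.gslab u s (step (step s e) f) (span e f)) := by
  have h1 := h.ok.lt
  have h2 := h.ok'.lt
  have h3 := h.lt
  have he := h.eq
  have hne := h.ok.ne
  obtain ⟨-, hl⟩ := h.levels
  obtain ⟨δ, hδ, hδ'⟩ : ∃ δ > 0, δ < min (e.y - e.x) (f.y - e.y) :=
    exists_between (lt_min (by linarith) (by linarith))
  have d1 := lt_of_lt_of_le hδ' (min_le_left _ _)
  have d2 := lt_of_lt_of_le hδ' (min_le_right _ _)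
  have cr := continuous_ramp δ
  obtain ⟨u, hu, hux⟩ := exists_graph_extension h3 (c := fun p => ramp δ (p - e.y))
    (by fun_prop) (fun p _ => by
      have := ramp_mem δ (p - e.y)
      exact ⟨by linarith [this.1], by linarith [this.2]⟩)
  refine ⟨u, hu, ?_⟩
  have hlip : ∀ p q, |tent δ e.y p - tent δ e.y q| ≤ 2 * |p - q| := fun p q =>
    (tent_lipschitz _ _ _ _).trans (by linarith [abs_nonneg (p - q)])
  have hS := shear_strictMono hlip
  have hSp := shear_add_one (tent_add_one δ e.y)
  have hfix : ∀ p : ℝ, (∀ k : ℤ, p + (k : ℝ) ∉ Ioo e.x f.y) → ∀ t, shear (tent δ e.y) t p = p := by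
    intro p hp t
    rw [shear, tent_eq_zero, mul_zero, add_zero]
    intro k
    have := hp k
    rw [mem_Ioo, not_and_or, not_lt, not_lt] at this
    rcases this with h4 | h4
    · rw [abs_of_neg (by linarith)]; linarith
    · rw [abs_of_pos (by linarith)]; linarith
  have hfx : ∀ t, shear (tent δ e.y) t e.x = e.x := fun t => by
    refine hfix _ (fun k hk => ?_) t
    have k1 : (0 : ℝ) < k := by linarith [hk.1]
    have k2 : (k : ℝ) < 1 := by linarith [hk.2]
    have k1 : 0 < k := by exact_mod_cast k1
    have k2 : k < 1 := by exact_mod_cast k2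
    omega
  have hfw : ∀ t, shear (tent δ e.y) t f.y = f.y := fun t => by
    refine hfix _ (fun k hk => ?_) t
    have k1 : (-1 : ℝ) < k := by linarith [hk.1]
    have k2 : (k : ℝ) < 0 := by linarith [hk.2]
    have k1 : -1 < k := by exact_mod_cast k1
    have k2 : k < 0 := by exact_mod_cast k2
    omega
  have hfy : ∀ t, shear (tent δ e.y) t e.y = e.y + zigzag t / 4 * δ := fun t => by
    rw [shear, tent_self hδ]
  refine Iso.shear (continuous_tent δ e.y) (tent_add_one δ e.y) hlip fun p t ht => ?_
  by_cases hp : p ∈ span e f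
  · obtain ⟨k, hk⟩ := hp
    rw [← pair_add_int p t k]
    have e1 : shear (tent δ e.y) t p + k = shear (tent δ e.y) t (p + k) :=
      (add_int_of_add_one (hSp t) p k).symm
    have e2 : (shear (tent δ e.y) t p, t) ∈ Dunwoody.gslab u s (step (step s e) f) (span e f) ↔
        (shear (tent δ e.y) t (p + k), t) ∈ Dunwoody.gslab u s (step (step s e) f) (span e f) := by
      rw [← e1, mem_gslab, mem_gslab, coe_add_int, span_add_int, hu.add_int]
    rw [e2]
    generalize p + k = p at hk
    rw [h.mem_pair_iff hk]
    set q := shear (tent δ e.y) t p with hq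
    have hqm : q ∈ Icc e.x f.y := by
      rw [← hfx t, ← hfw t]
      exact ⟨(hS t).monotone hk.1, (hS t).monotone hk.2⟩
    obtain ⟨l0, -, l2⟩ := hl q hqm
    have pw : p = f.y ↔ q = f.y := by rw [← (hS t).injective.eq_iff (a := p), hfw t]
    have px : p = e.x ↔ q = e.x := by rw [← (hS t).injective.eq_iff (a := p), hfx t]
    have a0 : s q ≠ 0 ↔ p = f.y := by
      rw [l0, pw]
      split_ifs with c <;> simp [c, hne]
    have a2 : step (step s e) f q ≠ 0 ↔ p = e.x := by
      rw [l2, px]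
      split_ifs with c <;> simp [c, hne]
    have hqs : q ∈ span e f := ⟨0, by simpa using hqm⟩
    have uw : q = f.y → u q = 3 / 4 := by
      intro hqw
      rw [hux q hqm, hqw]
      refine ((eq_ramp_iff hδ (by norm_num) le_rfl).2 (Or.inr (Or.inl ⟨rfl, ?_⟩))).symm
      rw [zigzag_of_mem (by norm_num) le_rfl]
      linarith
    have ux : q = e.x → u q = 1 / 4 := by
      intro hqx
      rw [hux q hqm, hqx]
      refine ((eq_ramp_iff hδ le_rfl (by norm_num)).2 (Or.inl ⟨rfl, ?_⟩)).symm
      rw [zigzag_of_mem le_rfl (by norm_num)]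
      linarith
    have c1 : q - e.y ≤ zigzag t / 4 * δ ↔ p ≤ e.y := by
      rw [sub_le_iff_le_add', ← hfy t, (hS t).le_iff_le]
    have c2 : zigzag t / 4 * δ ≤ q - e.y ↔ e.y ≤ p := by
      rw [le_sub_iff_add_le', ← hfy t, (hS t).le_iff_le]
    have c3 : q - e.y = zigzag t / 4 * δ ↔ p = e.y := by
      rw [sub_eq_iff_eq_add', ← hfy t, (hS t).injective.eq_iff]
    have hur : t = u q ↔ (t = 1 / 4 ∧ p ≤ e.y) ∨ (t = 3 / 4 ∧ e.y ≤ p) ∨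
        (1 / 4 ≤ t ∧ t ≤ 3 / 4 ∧ p = e.y) := by
      rw [hux q hqm]
      by_cases hr : 1 / 4 ≤ t ∧ t ≤ 3 / 4
      · rw [eq_ramp_iff hδ hr.1 hr.2, c1, c2, c3]
        simp only [hr, true_and]
      · have r := ramp_mem δ (q - e.y)
        constructor
        · intro h4
          exact absurd (h4 ▸ r) hr
        · rintro (⟨rfl, -⟩ | ⟨rfl, -⟩ | ⟨h4, h5, -⟩)
          · norm_num at hr
          · norm_num at hr
          · exact absurd ⟨h4, h5⟩ hr
    rw [mem_gslab, a0, a2, hur]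
    refine or_congr (and_congr_right fun c => ?_) (or_congr (and_congr_right fun c => ?_) ?_)
    · rw [uw (pw.1 c)]
    · rw [ux (px.1 c)]
    · simp only [hqs, true_and]
  · obtain ⟨b1, b2, l1, l2⟩ := h.step_of_notMem hp
    rw [hfix p (fun k hk => hp ⟨k, hk.1.le, hk.2.le⟩) t, mem_pair, mem_gslab, l1, l2]
    constructor
    · intro h4
      have h5 : s p ≠ 0 := by
        rcases h4 with h4 | h4 | h4 | h4 | h4
        · exact h4.1
        · exact h4.1
        · exact h4.1
        · exact absurd h4.1 b1
        · exact absurd h4.1 b2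
      exact (le_total t (u p)).imp (fun h' => ⟨h5, h'⟩) (fun h' => Or.inl ⟨h5, h'⟩)
    · intro h4
      have h5 : s p ≠ 0 := by
        rcases h4 with h4 | h4 | h4
        · exact h4.1
        · exact h4.1
        · exact absurd h4.1 hp
      rcases le_total t (1 / 4) with ht | ht
      · exact Or.inl ⟨h5, ht⟩
      · rcases le_total t (3 / 4) with ht' | ht'
        · exact Or.inr (Or.inl ⟨h5, ht, ht'⟩)
        · exact Or.inr (Or.inr (Or.inl ⟨h5, ht'⟩))

end IsZigzag

theorem gslab_add_int {u : ℝ → ℝ} (hu : IsGraph u) {B : Set ℝ}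
    (hB : ∀ (p : ℝ) (n : ℤ), p + n ∈ B ↔ p ∈ B) (s s' : 𝕋 →₀ G) (p t : ℝ) (n : ℤ) :
    (p + n, t) ∈ gslab u s s' B ↔ (p, t) ∈ gslab u s s' B := by
  rw [mem_gslab, mem_gslab, coe_add_int, hu.add_int, hB]

/-- The linear isotopy from a homeomorphism of the line to the identity. -/
noncomputable def slide (ψ : Twist) (t p : ℝ) : ℝ :=
  p - max 0 (min 1 (3 / 2 - 2 * t)) * (p - ψ p)

theorem slide_eq (ψ : Twist) (t p : ℝ) : ∃ θ ∈ Icc (0 : ℝ) 1,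
    slide ψ t p = p - θ * (p - ψ p) ∧ (θ = 0 ↔ 3 / 4 ≤ t) ∧ (θ = 1 ↔ t ≤ 1 / 4) ∧
      (θ ∈ Ioo (0 : ℝ) 1 → θ = 3 / 2 - 2 * t) := by
  refine ⟨_, ⟨le_max_left _ _, max_le zero_le_one (min_le_left _ _)⟩, rfl, ?_, ?_, ?_⟩
  · constructor
    · intro h
      have := max_eq_left_iff.1 h
      rcases min_le_iff.1 this with h1 | h1 <;> linarith
    · intro h
      exact max_eq_left (min_le_of_right_le (by linarith))
  · constructor
    · intro h
      by_contra! h1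
      have : max 0 (min 1 (3 / 2 - 2 * t)) < 1 :=
        max_lt one_pos (min_lt_of_right_lt (by linarith))
      linarith
    · intro h
      rw [min_eq_left (by linarith), max_eq_right zero_le_one]
  · rintro ⟨h0, h1⟩
    rcases lt_max_iff.1 h0 with h | h
    · exact absurd h (lt_irrefl _)
    · rw [max_eq_right h.le] at h1 ⊢
      rcases min_lt_iff.1 h1 with h2 | h2
      · exact absurd h2 (lt_irrefl _)
      · exact min_eq_right h2.le

theorem slide_strictMono (ψ : Twist) (t : ℝ) : StrictMono (slide ψ t) := by
  intro p q hpq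
  have h1 : 0 ≤ max 0 (min 1 (3 / 2 - 2 * t)) := le_max_left _ _
  have h2 : max 0 (min 1 (3 / 2 - 2 * t)) ≤ 1 := max_le zero_le_one (min_le_left _ _)
  have h3 := ψ.strictMono hpq
  simp only [slide]
  generalize max 0 (min 1 (3 / 2 - 2 * t)) = θ at h1 h2
  rcases eq_or_lt_of_le h1 with h4 | h4
  · rw [← h4]; linarith
  · nlinarith [mul_pos h4 (sub_pos.2 h3), mul_nonneg (sub_nonneg.2 h2) (sub_pos.2 hpq).le]

theorem slide_add_one (ψ : Twist) (t p : ℝ) : slide ψ t (p + 1) = slide ψ t p + 1 := by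
  simp only [slide, CircleDeg1Lift.map_add_one]
  ring

theorem Iso.slide {ψ : Twist} {A B : Set (ℝ × ℝ)}
    (hAB : ∀ p, ∀ t ∈ Icc (0 : ℝ) 1, (p, t) ∈ A ↔ (slide ψ t p, t) ∈ B) : Iso ψ 1 A B := by
  have := ψ.continuous
  refine Iso.level (ψ := Dunwoody.slide ψ) (by unfold Dunwoody.slide; fun_prop)
    (slide_strictMono ψ) (slide_add_one ψ) (fun t ht p => ?_) (fun t ht p => ?_) hAB
  · obtain ⟨θ, -, h1, -, h2, -⟩ := slide_eq ψ t p
    rw [h1, h2.2 (by linarith)]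
    ring
  · obtain ⟨θ, -, h1, h2, -, -⟩ := slide_eq ψ t p
    rw [h1, h2.2 (by linarith), Twist.one_apply]
    ring

/-- As a graph, the zigzag is a strand that comes up at `f.y`, runs over to `e.x`, and goes up from
there. A homeomorphism `ψ` of the circle pushes `f.y` to `e.x`, and the linear isotopy from `ψ` to
the identity makes the strand vertical. What remains of the zigzag is `ψ` on the lower side, to be
absorbed in the monodromy. -/
theorem IsZigzag.straighten {s : 𝕋 →₀ G} {e f : Event G} (h : IsZigzag s e f) :
    ∃ ψ : Twist, Iso ψ 1 (pair s e f) (col (step (step s e) f)) ∧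
      pull ψ (step (step s e) f) = s := by
  have h1 := h.ok.lt
  have h2 := h.ok'.lt
  have h3 := h.lt
  have he := h.eq
  have hne := h.ok.ne
  obtain ⟨-, hl⟩ := h.levels
  obtain ⟨ε₁, hε₁, hx⟩ := exists_isolated s e.x
  obtain ⟨ε₂, hε₂, hw⟩ := exists_isolated s f.y
  -- The push is supported in `[e.x - δ, f.y + δ]`, which is shorter than a period and, outside
  -- `[e.x, f.y]`, free of strands.
  obtain ⟨δ, hδ, hδ'⟩ : ∃ δ > 0, δ < min (min ε₁ ε₂) ((e.x + 1 - f.y) / 2) :=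
    exists_between (lt_min (lt_min hε₁ hε₂) (by linarith))
  have d1 := hδ'.trans_le ((min_le_left _ _).trans (min_le_left _ _))
  have d2 := hδ'.trans_le ((min_le_left _ _).trans (min_le_right _ _))
  have d3 := hδ'.trans_le (min_le_right _ _)
  have hxw : e.x < f.y := by linarith
  obtain ⟨ψ, ψw, ψlt, ψx', ψid⟩ := exists_push (x' := e.x - δ) (x := e.x) (w := f.y) (w' := f.y + δ)
    (by linarith) hxw (by linarith) (by linarith)
  have ψmono := ψ.strictMono
  -- the values of the levels in the window
  have outside : ∀ p, p ∈ Ico (e.x - δ) (e.x - δ + 1) → p ∉ Icc e.x f.y → p ∉ span e f := by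
    rintro p hp hp' ⟨k, hk⟩
    have k1 : (-1 : ℝ) < k := by linarith [hk.1, hp.2]
    have k2 : (k : ℝ) < 1 := by linarith [hk.2, hp.1]
    have k1 : -1 < k := by exact_mod_cast k1
    have k2 : k < 1 := by exact_mod_cast k2
    have k0 : k = 0 := by omega
    rw [k0] at hk
    exact hp' (by simpa using hk)
  have vs : ∀ p ∈ Icc (e.x - δ) (f.y + δ), s p = if p = f.y then e.η else 0 := by
    intro p hp
    rcases lt_or_ge p e.x with h4 | h4
    · rw [if_neg (by linarith)]
      exact hx p h4.ne (by rw [abs_of_neg (by linarith)]; linarith [hp.1])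
    · rcases le_or_gt p f.y with h5 | h5
      · exact (hl p ⟨h4, h5⟩).1
      · rw [if_neg h5.ne']
        exact hw p h5.ne' (by rw [abs_of_pos (by linarith)]; linarith [hp.2])
  have vs2 : ∀ p ∈ Icc (e.x - δ) (f.y + δ),
      step (step s e) f p = if p = e.x then e.η else 0 := by
    intro p hp
    by_cases h4 : p ∈ Icc e.x f.y
    · exact (hl p h4).2.2
    · rw [(h.step_of_notMem (outside p ⟨hp.1, by linarith [hp.2]⟩ h4)).2.2.2, vs p hp, if_neg, if_neg]
      · rintro rfl
        exact h4 ⟨le_rfl, hxw.le⟩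
      · rintro rfl
        exact h4 ⟨hxw.le, le_rfl⟩
  have ψmem : ∀ p ∈ Icc (e.x - δ) (f.y + δ), ψ p ∈ Icc (e.x - δ) (f.y + δ) := by
    intro p hp
    constructor
    · rw [← ψx']; exact ψmono.monotone hp.1
    · rw [← ψid (f.y + δ) ⟨le_rfl, by linarith⟩]; exact ψmono.monotone hp.2
  have ψle : ∀ p ∈ Icc (e.x - δ) (f.y + δ), ψ p ≤ p := by
    intro p hp
    rcases eq_or_lt_of_le hp.1 with h4 | h4
    · rw [← h4, ψx']
    rcases eq_or_lt_of_le hp.2 with h5 | h5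
    · rw [h5, ψid _ ⟨le_rfl, by linarith⟩]
    exact (ψlt p ⟨h4, h5⟩).le
  have window : ∀ p : ℝ, ∃ n : ℤ, p + n ∈ Ico (e.x - δ) (e.x - δ + 1) := fun p =>
    let ⟨n, hn, _⟩ := existsUnique_add_zsmul_mem_Ico one_pos p (e.x - δ)
    ⟨n, by simpa using hn⟩
  refine ⟨ψ, ?_, ?_⟩
  · obtain ⟨u, hu, huI⟩ := h.exists_iso_gslab
    have cψ := ψ.continuous
    -- The isotopy has brought `p` to `e.x` when its parameter is `θ = (p - e.x) / (p - ψ p)`, that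
    -- is, at the time `3/4 - θ / 2`. The graph is chosen to consist of these points.
    have cr : ContinuousOn (fun p => 3 / 4 - (p - e.x) / (p - ψ p) / 2) (Icc e.x f.y) := by
      refine continuousOn_const.sub (((continuousOn_id.sub continuousOn_const).div
        (continuousOn_id.sub cψ.continuousOn) fun p hp => ?_).div_const 2)
      exact (sub_pos.2 (ψlt p ⟨by linarith [hp.1], by linarith [hp.2]⟩)).ne'
    have r01 : ∀ p ∈ Icc e.x f.y, (p - e.x) / (p - ψ p) ∈ Icc (0 : ℝ) 1 := by
      intro p hp
      have := ψlt p ⟨by linarith [hp.1], by linarith [hp.2]⟩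
      refine ⟨div_nonneg (by linarith [hp.1]) (by linarith), (div_le_one (by linarith)).2 ?_⟩
      have := ψmono.monotone hp.2
      linarith
    obtain ⟨v, hv, hvx⟩ := exists_graph_extension h3 cr (fun p hp => by
      have := r01 p hp
      exact ⟨by linarith [this.2], by linarith [this.1]⟩)
    refine (huI.trans_one (Iso.gslab hu hv _ _ _)).one_trans ?_
    refine Iso.slide fun p t ht => ?_
    obtain ⟨n, hn⟩ := window p
    have e1 : slide ψ t (p + n) = slide ψ t p + n := add_int_of_add_one (slide_add_one ψ t) p n
    have e2 : (slide ψ t p, t) ∈ col (step (step s e) f) ↔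
        step (step s e) f ((slide ψ t (p + n) : ℝ) : 𝕋) ≠ 0 := by
      rw [e1, coe_add_int]
      rfl
    rw [e2, ← gslab_add_int hv span_add_int _ _ p t n]
    generalize p + n = p at hn
    obtain ⟨θ, hθ, sl, hθ0, hθ1, hθm⟩ := slide_eq ψ t p
    rw [sl]
    by_cases hp : p ∈ Icc (e.x - δ) (f.y + δ)
    · have hq : p - θ * (p - ψ p) ∈ Icc (e.x - δ) (f.y + δ) := by
        have := ψle p hp
        have := (ψmem p hp).1
        constructor
        · nlinarith [hθ.1, hθ.2]
        · nlinarith [hθ.1, hθ.2, hp.2]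
      rw [mem_gslab, vs p hp, vs2 p hp, vs2 _ hq]
      simp only [ne_eq, ite_eq_right_iff, hne, imp_false, not_not]
      by_cases hp' : p ∈ Icc e.x f.y
      · have hs : p ∈ span e f := ⟨0, by simpa using hp'⟩
        have pos := sub_pos.2 (ψlt p ⟨by linarith [hp'.1], by linarith [hp'.2]⟩)
        simp only [hs, true_and, hvx p hp']
        have r := r01 p hp'
        have rr : p - θ * (p - ψ p) = e.x ↔ θ = (p - e.x) / (p - ψ p) := by
          rw [eq_div_iff pos.ne']
          constructor <;> intro h <;> linarith
        have r0 : (p - e.x) / (p - ψ p) = 0 ↔ p = e.x := by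
          rw [div_eq_zero_iff, or_iff_left pos.ne', sub_eq_zero]
        have r1 : (p - e.x) / (p - ψ p) = 1 ↔ p = f.y := by
          rw [div_eq_one_iff_eq pos.ne', sub_right_inj, eq_comm, ← ψw, ψmono.injective.eq_iff]
        rw [rr, ← r0, ← r1]
        generalize (p - e.x) / (p - ψ p) = ρ at r
        constructor
        · rintro (⟨rfl, h4⟩ | ⟨rfl, h4⟩ | h4)
          · exact hθ1.2 (by linarith)
          · exact hθ0.2 (by linarith)
          · by_cases c0 : 3 / 4 ≤ t
            · rw [hθ0.2 c0]; linarith [r.1]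
            · by_cases c1 : t ≤ 1 / 4
              · rw [hθ1.2 c1]; linarith [r.2]
              · rw [hθm ⟨lt_of_le_of_ne hθ.1 fun h => c0 (hθ0.1 h.symm),
                  lt_of_le_of_ne hθ.2 fun h => c1 (hθ1.1 h)⟩]
                linarith
        · rintro rfl
          by_cases c0 : θ = 0
          · exact Or.inr (Or.inl ⟨c0, by linarith [hθ0.1 c0]⟩)
          · by_cases c1 : θ = 1
            · exact Or.inl ⟨c1, by linarith [hθ1.1 c1]⟩
            · refine Or.inr (Or.inr ?_)
              have := hθm ⟨lt_of_le_of_ne hθ.1 (Ne.symm c0), lt_of_le_of_ne hθ.2 c1⟩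
              linarith
      · have hs := outside p hn hp'
        have n1 : p ≠ f.y := fun h => hp' ⟨by linarith, h.le⟩
        have n2 : p ≠ e.x := fun h => hp' ⟨h.ge, by linarith⟩
        simp only [hs, n1, n2, false_and, false_or, false_iff]
        have hψ := ψle p hp
        rcases lt_or_ge p e.x with h4 | h4
        · nlinarith [hθ.1]
        · have h5 : f.y < p := by
            by_contra! h5
            exact hp' ⟨h4, h5⟩
          have h6 := ψmono h5
          rw [ψw] at h6
          nlinarith [hθ.1, hθ.2]
    · have hs := outside p hn fun h => hp ⟨by linarith [h.1], by linarith [h.2]⟩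
      have hp2 : f.y + δ < p := by
        by_contra! h4
        exact hp ⟨hn.1, h4⟩
      rw [ψid p ⟨hp2.le, hn.2.le⟩, mem_gslab, (h.step_of_notMem hs).2.2.2, sub_self, mul_zero, sub_zero,
        (h.step_of_notMem hs).2.2.2]
      simp only [hs, false_and, or_false]
      rw [← and_or_left, and_iff_left (le_total _ _)]
  · refine level_ext fun p => ?_
    obtain ⟨n, hn⟩ := window p
    rw [pull_coe, ← coe_add_int p n, ← coe_add_int (ψ p) n, ← CircleDeg1Lift.map_add_int]
    generalize p + n = p at hn
    by_cases hp : p ∈ Icc (e.x - δ) (f.y + δ)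
    · rw [vs2 _ (ψmem p hp), vs p hp]
      have : ψ p = e.x ↔ p = f.y := by rw [← ψw, ψmono.injective.eq_iff]
      simp only [this]
    · have hp2 : f.y + δ < p := by
        by_contra! h4
        exact hp ⟨hn.1, h4⟩
      rw [ψid p ⟨hp2.le, hn.2.le⟩, (h.step_of_notMem
        (outside p hn fun h => hp ⟨by linarith [h.1], by linarith [h.2]⟩)).2.2.2]

theorem OkList.tail_tail {s : 𝕋 →₀ G} {e f : Event G} {L : List (Event G)}
    (h : OkList s (e :: f :: L)) : OkList (step (step s e) f) L := h.2.2

/-- Cancelling a zigzag. -/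
theorem IsZigzag.exists_draw {s : 𝕋 →₀ G} {e f : Event G} {L : List (Event G)} {φ : Twist}
    {D : Set Torus} (h : IsZigzag s e f) (hV : Valid s (e :: f :: L) φ)
    (hD : Draw φ (picture s (e :: f :: L)) D) : ∃ ψ : Twist, pull ψ (step (step s e) f) = s ∧
      Valid (step (step s e) f) L (ψ * φ) ∧ Draw (ψ * φ) (picture (step (step s e) f) L) D := by
  obtain ⟨ψ, hI, hs⟩ := h.straighten
  refine ⟨ψ, hs, ⟨hV.1.tail_tail, ?_⟩, ?_⟩
  · have := hV.2
    rw [final_cons, final_cons] at this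
    rw [this]
    nth_rewrite 1 [← hs]
    exact level_ext fun p => by simp
  · refine hD.iso (ψ₀ := ψ) (ψ₁ := 1) ?_ (mul_one _)
    exact ((Iso.picture_cons_cons s e f L).one_trans (hI.stack (Iso.refl _))).trans_one
      (Iso.stack_col_picture _ _)

/-! ### Reflection -/

/-- The level seen in a mirror. -/
noncomputable def mirror (s : 𝕋 →₀ G) : 𝕋 →₀ G :=
  Finsupp.equivMapDomain (Equiv.neg 𝕋) s

@[simp] theorem mirror_coe (s : 𝕋 →₀ G) (p : ℝ) :
    mirror s p = s ((-p : ℝ) : 𝕋) := by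
  simp [mirror]

theorem card_support_mirror (s : 𝕋 →₀ G) :
    (mirror s).support.card = s.support.card := by
  simp [mirror, Finsupp.equivMapDomain]

theorem total_mirror (s : 𝕋 →₀ G) : total (mirror s) = total s := by
  rw [total, mirror, Finsupp.equivMapDomain_eq_mapDomain, Finsupp.sum_mapDomain_index] <;> simp [total]

/-- The event seen in a mirror. -/
def Event.mirror (e : Event G) : Event G := ⟨e.cup, -e.y, -e.x, -e.η⟩

theorem step_mirror (s : 𝕋 →₀ G) (e : Event G) :
    step (mirror s) e.mirror = mirror (step s e) := by
  refine level_ext fun p => ?_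
  rw [mirror_coe, step_coe, step_coe, mirror_coe]
  have (x : ℝ) : ((-x : ℝ) : 𝕋) = p ↔ (x : 𝕋) = ((-p : ℝ) : 𝕋) := by
    rw [AddCircle.coe_neg, AddCircle.coe_neg, neg_eq_iff_eq_neg]
  simp only [Event.mirror, this]
  split_ifs <;> abel

theorem Event.mem_bar_mirror {e : Event G} {p : ℝ} : p ∈ e.mirror.bar ↔ -p ∈ e.bar := by
  constructor
  · rintro ⟨k, h1, h2⟩
    simp only [Event.mirror] at h1 h2
    exact ⟨-k, by push_cast; linarith, by push_cast; linarith⟩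
  · rintro ⟨k, h1, h2⟩
    exact ⟨-k, by simp only [Event.mirror]; push_cast; linarith,
      by simp only [Event.mirror]; push_cast; linarith⟩

theorem mem_picture_mirror (s : 𝕋 →₀ G) (L : List (Event G)) (p t : ℝ) :
    (p, t) ∈ picture (mirror s) (L.map Event.mirror) ↔ (-p, t) ∈ picture s L := by
  induction L generalizing s t with
  | nil => simp [picture, col]
  | cons e L ih =>
    rw [List.map_cons, picture, picture, mem_stack, mem_stack, step_mirror, ih, slab, slab, mem_gslab,
      mem_gslab, step_mirror, mirror_coe, mirror_coe, Event.mem_bar_mirror]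

theorem Event.Ok.mirror {s : 𝕋 →₀ G} {e : Event G} (h : e.Ok s) :
    e.mirror.Ok (Dunwoody.mirror s) := by
  refine ⟨neg_ne_zero.2 h.ne, neg_lt_neg h.lt, ?_, fun hc p hp => ?_, fun hc => ?_, fun hc => ?_,
    fun p hp => ?_⟩
  · have := h.lt_add
    simp only [Event.mirror]
    linarith
  · rw [mirror_coe]
    exact h.free hc _ ⟨by linarith [hp.2.trans_eq rfl, show e.mirror.y = -e.x from rfl],
      by linarith [hp.1, show e.mirror.x = -e.y from rfl]⟩
  · simp only [Event.mirror, mirror_coe, neg_neg]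
    exact h.right hc
  · simp only [Event.mirror, mirror_coe, neg_neg]
    exact h.left hc
  · rw [mirror_coe]
    exact h.between _ ⟨by linarith [hp.2, show e.mirror.y = -e.x from rfl],
      by linarith [hp.1, show e.mirror.x = -e.y from rfl]⟩

theorem OkList.mirror {s : 𝕋 →₀ G} {L : List (Event G)} (h : OkList s L) :
    OkList (Dunwoody.mirror s) (L.map Event.mirror) := by
  induction L generalizing s with
  | nil => trivial
  | cons e L ih => exact ⟨h.1.mirror, by rw [step_mirror]; exact ih h.2⟩

theorem final_mirror (s : 𝕋 →₀ G) (L : List (Event G)) :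
    final (mirror s) (L.map Event.mirror) = mirror (final s L) := by
  induction L generalizing s with
  | nil => rfl
  | cons e L ih => rw [List.map_cons, final_cons, final_cons, step_mirror, ih]

theorem strands_mirror (s : 𝕋 →₀ G) (L : List (Event G)) :
    strands (mirror s) (L.map Event.mirror) = strands s L := by
  induction L generalizing s with
  | nil => rfl
  | cons e L ih => rw [List.map_cons, strands, strands, step_mirror, ih, card_support_mirror]

/-- Halves the case distinction: a death that meets the left strand of a birth is the mirror image
of one that meets the right strand. -/
theorem exists_mirror {s : 𝕋 →₀ G} {L : List (Event G)} {φ : Twist} {D : Set Torus}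
    (hV : Valid s L φ) (hD : Draw φ (picture s L) D) : ∃ φ' : Twist,
      Valid (mirror s) (L.map Event.mirror) φ' ∧
        Draw φ' (picture (mirror s) (L.map Event.mirror)) D := by
  obtain ⟨φ', hφ⟩ := exists_reflect φ
  refine ⟨φ', ⟨hV.1.mirror, ?_⟩, ?_⟩
  · rw [final_mirror, hV.2]
    refine level_ext fun p => ?_
    simp only [mirror_coe, pull_coe, hφ, neg_neg]
  · have := hD.reflect hφ
    convert! this using 1
    ext ⟨p, t⟩
    exact mem_picture_mirror s L p t

/-! ### Closed curves -/

theorem Related.isConnected {D D' : Set Torus} (h : Related D D') (hD : IsConnected D) :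
    IsConnected D' := by
  obtain ⟨κ, -, rfl⟩ := h
  exact hD.image _ κ.continuous.continuousOn

theorem Related.compl {D D' : Set Torus} (h : Related D D') : Related Dᶜ D'ᶜ := by
  obtain ⟨κ, hκ, rfl⟩ := h
  exact ⟨κ, hκ, image_compl_eq κ.bijective⟩

theorem mem_picture_one (s : 𝕋 →₀ G) (L : List (Event G)) (p : ℝ) :
    (p, (1 : ℝ)) ∈ picture s L ↔ final s L p ≠ 0 := by
  induction L generalizing s with
  | nil => rfl
  | cons e L ih =>
    rw [picture, mem_stack, final_cons, ← ih]
    norm_num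

theorem slab_mem_of_bar {s : 𝕋 →₀ G} {e : Event G} {p : ℝ} (hp : p ∈ e.bar) :
    (p, (1 / 2 : ℝ)) ∈ slab s e := mem_gslab.2 (Or.inr (Or.inr ⟨hp, rfl⟩))

theorem picture_add_int (s : 𝕋 →₀ G) (L : List (Event G)) (p t : ℝ) (n : ℤ) :
    (p + n, t) ∈ picture s L ↔ (p, t) ∈ picture s L := by
  induction L generalizing s t with
  | nil => simp [picture, col]
  | cons e L ih =>
    rw [picture, mem_stack, mem_stack, ih, slab,
      gslab_add_int (isGraph_const (by norm_num) (by norm_num)) (Event.bar_add_int e)]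

theorem coe_mem_image_Ioo {a b t : ℝ} (h0 : 0 ≤ a) (h1 : b ≤ 1) (ht : t ∈ Icc (0 : ℝ) 1) :
    (t : 𝕋) ∈ (fun x : ℝ => (x : 𝕋)) '' Ioo a b ↔ t ∈ Ioo a b := by
  refine ⟨?_, fun h => ⟨t, h, rfl⟩⟩
  rintro ⟨x, hx, h⟩
  simp only at h
  rcases lt_trichotomy x t with h2 | h2 | h2
  · exact absurd h (coe_ne_of_lt h2 (by linarith [hx.1, ht.2]))
  · rwa [← h2]
  · exact absurd h.symm (coe_ne_of_lt h2 (by linarith [hx.2, ht.1]))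

/-- A connected curve cannot cross the levels `0` and `1/2` without meeting them. -/
theorem not_isConnected_cut {F : ℝ → ℝ → ℝ} {A : Set (ℝ × ℝ)}
    (h0 : ∀ v ∈ A, v.2 ≠ 0 ∧ v.2 ≠ 1 ∧ v.2 ≠ 1 / 2) (h1 : ∃ v ∈ A, v.2 ∈ Ioo (0 : ℝ) (1 / 2))
    (h2 : ∃ v ∈ A, v.2 ∈ Ioo (1 / 2 : ℝ) 1) : ¬IsConnected (cut F '' (A ∩ strip)) := by
  intro hc
  have hop (a b : ℝ) : IsOpen {v : Torus | v.2 ∈ (fun x : ℝ => (x : 𝕋)) '' Ioo a b} :=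
    (QuotientAddGroup.isOpenMap_coe _ isOpen_Ioo).preimage continuous_snd
  have hm {a b : ℝ} (ha : 0 ≤ a) (hb : b ≤ 1) {v : ℝ × ℝ} (hv : v ∈ strip) : cut F v ∈
      {v : Torus | v.2 ∈ (fun x : ℝ => (x : 𝕋)) '' Ioo a b} ↔ v.2 ∈ Ioo a b :=
    coe_mem_image_Ioo ha hb hv
  obtain ⟨_, ⟨v, hv, rfl⟩, hv1, hv2⟩ := hc.isPreconnected _ _ (hop 0 (1 / 2)) (hop (1 / 2) 1) (by
      rintro _ ⟨v, hv, rfl⟩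
      obtain ⟨n0, n1, n2⟩ := h0 v hv.1
      rcases lt_or_gt_of_ne n2 with h | h
      · exact Or.inl ((hm le_rfl (by norm_num) hv.2).2 ⟨lt_of_le_of_ne hv.2.1 (Ne.symm n0), h⟩)
      · exact Or.inr ((hm (by norm_num) le_rfl hv.2).2 ⟨h, lt_of_le_of_ne hv.2.2 n1⟩)) (by
      obtain ⟨v, hv, hv'⟩ := h1
      have hs : v ∈ strip := ⟨hv'.1.le, by linarith [hv'.2]⟩
      exact ⟨_, mem_image_of_mem _ ⟨hv, hs⟩, (hm le_rfl (by norm_num) hs).2 hv'⟩) (by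
      obtain ⟨v, hv, hv'⟩ := h2
      have hs : v ∈ strip := ⟨by linarith [hv'.1], hv'.2.le⟩
      exact ⟨_, mem_image_of_mem _ ⟨hv, hs⟩, (hm (by norm_num) le_rfl hs).2 hv'⟩)
  have e1 := (hm le_rfl (by norm_num) hv.2).1 hv1
  have e2 := (hm (by norm_num) le_rfl hv.2).1 hv2
  linarith [e1.2, e2.1]

/-- The two bars together cover the whole circle, which leaves no room for another strand. -/
theorem levels_eq_zero {s : 𝕋 →₀ G} {e f : Event G} (h : e.Ok s)
    (h' : f.Ok (step s e)) (hc : e.cup = true) (hc' : f.cup = false) (hx : f.x = e.y)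
    (hy : f.y = e.x + 1) : s = 0 ∧ step (step s e) f = 0 := by
  have h1 := h.lt
  have h2 := h.lt_add
  have hs : ∀ p ∈ Icc e.x (e.x + 1), s p = 0 := by
    intro p hp
    rcases le_or_gt p e.y with h3 | h3
    · exact h.free hc p ⟨hp.1, h3⟩
    · rcases eq_or_lt_of_le hp.2 with h4 | h4
      · rw [h4, show e.x + 1 = e.x + (1 : ℤ) by simp, coe_add_int]
        exact h.free hc _ ⟨le_rfl, h1.le⟩
      · have := h'.between p ⟨by linarith, by linarith⟩
        rwa [step_of_ne (coe_ne_of_lt (by linarith) h4) (coe_ne_of_lt h3 (by linarith))] at this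
  have hs0 : s = 0 := level_ext fun p => by
    obtain ⟨n, hn, -⟩ := existsUnique_add_zsmul_mem_Ico one_pos p e.x
    rw [← coe_add_int p n]
    exact hs _ ⟨by simpa using hn.1, by simpa using hn.2.le⟩
  refine ⟨hs0, ?_⟩
  have hη := h'.left hc'
  rw [hx, step_coe, hs _ ⟨h1.le, h2.le⟩, if_neg (coe_ne_of_lt h1 h2), if_pos rfl] at hη
  have hη : f.η = e.η := by simpa using hη.symm
  have : ((e.x + 1 : ℝ) : 𝕋) = e.x := by simp
  rw [step, step, hs0, hx, hy, hη, this]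
  abel

/-- The two vertical strands are slanted in opposite directions by a difference of tents. Then the
circle is the graph of a function on the whole of `𝕋`, and such a graph can be flattened. -/
theorem Iso.essential {s : 𝕋 →₀ G} {e f : Event G} (h : e.Ok s)
    (h' : f.Ok (step s e)) (hc : e.cup = true) (hc' : f.cup = false) (hx : f.x = e.y)
    (hy : f.y = e.x + 1) :
    Iso 1 1 (pair s e f) (Dunwoody.gslab (fun _ => 1 / 2) 0 0 (univ : Set ℝ) (G := G)) := by
  obtain ⟨hs, hs2⟩ := levels_eq_zero h h' hc hc' hx hy
  have h1 := h.lt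
  have h2 := h.lt_add
  have hne := h.ne
  obtain ⟨δ, hδ, hδ'⟩ : ∃ δ > 0, δ < min ((e.y - e.x) / 2) ((e.x + 1 - e.y) / 2) :=
    exists_between (lt_min (by linarith) (by linarith))
  have d1 := hδ'.trans_le (min_le_left _ _)
  have d2 := hδ'.trans_le (min_le_right _ _)
  set k : ℝ → ℝ := fun p => tent δ e.y p - tent δ e.x p with hk
  have kc : Continuous k := (continuous_tent _ _).sub (continuous_tent _ _)
  have kp : ∀ p, k (p + 1) = k p := fun p => by simp only [hk, tent_add_one]
  have kl : ∀ p q, |k p - k q| ≤ 2 * |p - q| := fun p q => by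
    have a1 := tent_lipschitz δ e.y p q
    have a2 := tent_lipschitz δ e.x p q
    have : k p - k q = (tent δ e.y p - tent δ e.y q) - (tent δ e.x p - tent δ e.x q) := by
      simp only [hk]; ring
    rw [this]
    exact (abs_sub _ _).trans (by linarith)
  have hS := shear_strictMono kl
  have hSp := shear_add_one kp
  have far : ∀ n : ℤ, δ ≤ |e.y + n - e.x| := by
    intro n
    rcases le_or_gt 0 n with hn | hn
    · have : (0 : ℝ) ≤ n := by exact_mod_cast hn
      rw [abs_of_pos (by linarith)]; linarith
    · have : (n : ℝ) ≤ -1 := by exact_mod_cast Int.le_sub_one_of_lt hn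
      rw [abs_of_neg (by linarith)]; linarith
  have Sx : ∀ t, Dunwoody.shear k t e.x = e.x - zigzag t / 4 * δ := fun t => by
    rw [Dunwoody.shear, hk]
    simp only
    rw [tent_self hδ, tent_eq_zero fun n => ?_]
    · ring
    · have := far (-n)
      rw [abs_sub_comm]
      push_cast at this
      rwa [show e.y - (e.x + n) = e.y + -n - e.x by ring]
  have Sy : ∀ t, Dunwoody.shear k t e.y = e.y + zigzag t / 4 * δ := fun t => by
    rw [Dunwoody.shear, hk]
    simp only
    rw [tent_self hδ, tent_eq_zero far]
    ring
  have Sx1 : ∀ t, Dunwoody.shear k t (e.x + 1) = e.x + 1 - zigzag t / 4 * δ := fun t => by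
    rw [hSp, Sx]; ring
  -- This is negative over the interior of the lower bar, zero at its ends, and positive elsewhere
  -- on the circle, so its ramp runs along the lower bar, up the slanted strands, and along the
  -- upper bar.
  set m : ℝ → ℝ := fun p => ‖((p - (e.x + e.y) / 2 : ℝ) : 𝕋)‖ - (e.y - e.x) / 2 with hm
  have mc : Continuous m := by
    have hcoe : Continuous fun x : ℝ => (x : 𝕋) := AddCircle.continuous_mk' 1
    have : Continuous fun p : ℝ => ((p - (e.x + e.y) / 2 : ℝ) : 𝕋) :=
      hcoe.comp (continuous_id.sub continuous_const)
    exact this.norm.sub continuous_const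
  have mp : ∀ p, m (p + 1) = m p := fun p => by
    simp only [hm]
    rw [show p + 1 - (e.x + e.y) / 2 = p - (e.x + e.y) / 2 + (1 : ℤ) by push_cast; ring, coe_add_int]
  have mle : ∀ q, m q ≤ |q - (e.x + e.y) / 2| - (e.y - e.x) / 2 := fun q => by
    have := norm_coe_le (q - (e.x + e.y) / 2) 0
    simp only [hm]
    simpa using this
  have mge : ∀ q, ∃ n : ℤ, m q = |q - (e.x + e.y) / 2 - n| - (e.y - e.x) / 2 := fun q =>
    ⟨round (q - (e.x + e.y) / 2), by simp only [hm]; rw [UnitAddCircle.norm_eq]⟩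
  have mlow : ∀ q z, e.x - z < q → q < e.y + z → m q < z := fun q z hq hq' => by
    have := mle q
    have : |q - (e.x + e.y) / 2| < (e.y - e.x) / 2 + z := abs_lt.2 ⟨by linarith, by linarith⟩
    linarith
  have mlow' : ∀ q z, e.x - z ≤ q → q ≤ e.y + z → m q ≤ z := fun q z hq hq' => by
    have := mle q
    have : |q - (e.x + e.y) / 2| ≤ (e.y - e.x) / 2 + z := abs_le.2 ⟨by linarith, by linarith⟩
    linarith
  have mhigh : ∀ q z, e.y + z < q → q < e.x + 1 - z → z < m q := fun q z hq hq' => by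
    obtain ⟨n, hn⟩ := mge q
    rcases le_or_gt n 0 with h0 | h0
    · have : (n : ℝ) ≤ 0 := by exact_mod_cast h0
      linarith [le_abs_self (q - (e.x + e.y) / 2 - n)]
    · have : (1 : ℝ) ≤ n := by exact_mod_cast h0
      linarith [neg_le_abs (q - (e.x + e.y) / 2 - n)]
  have mhigh' : ∀ q z, e.y + z ≤ q → q ≤ e.x + 1 - z → z ≤ m q := fun q z hq hq' => by
    obtain ⟨n, hn⟩ := mge q
    rcases le_or_gt n 0 with h0 | h0
    · have : (n : ℝ) ≤ 0 := by exact_mod_cast h0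
      linarith [le_abs_self (q - (e.x + e.y) / 2 - n)]
    · have : (1 : ℝ) ≤ n := by exact_mod_cast h0
      linarith [neg_le_abs (q - (e.x + e.y) / 2 - n)]
  have hu : IsGraph fun p => ramp δ (m p) := by
    have cr := continuous_ramp δ
    refine ⟨by fun_prop, fun p => by rw [mp], fun p => ?_, fun p => ?_⟩
    · linarith [(ramp_mem δ (m p)).1]
    · linarith [(ramp_mem δ (m p)).2]
  refine Iso.trans_one ?_ (Iso.gslab hu (isGraph_const (by norm_num) (by norm_num)) 0 0 univ)
  refine Iso.shear kc kp kl fun p t ht => ?_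
  obtain ⟨n, hn, -⟩ := existsUnique_add_zsmul_mem_Ico one_pos p e.x
  have hn : p + n ∈ Ico e.x (e.x + 1) := by simpa using hn
  have e1 : Dunwoody.shear k t (p + n) = Dunwoody.shear k t p + n := add_int_of_add_one (hSp t) p n
  have per : (p, t) ∈ pair s e f ↔ (p + n, t) ∈ pair s e f := by
    simp only [mem_pair, coe_add_int, Event.bar_add_int]
  rw [per, ← gslab_add_int hu (by simp) _ _ (Dunwoody.shear k t p) t n, ← e1]
  generalize p + n = p at hn
  have hp1 : (p = e.x ∨ p = e.y) ↔ step s e p ≠ 0 := by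
    rw [hs, step_coe]
    constructor
    · rintro (rfl | rfl)
      · rw [if_pos rfl, if_neg (coe_ne_of_lt h1 h2).symm]
        simpa using hne
      · rw [if_pos rfl, if_neg (coe_ne_of_lt h1 h2)]
        simpa using hne
    · intro h3
      by_contra! h4
      rw [if_neg (coe_ne_of_lt (lt_of_le_of_ne hn.1 h4.1.symm) hn.2), if_neg] at h3
      · simp at h3
      · rcases lt_or_gt_of_ne h4.2 with h5 | h5
        · exact (coe_ne_of_lt h5 (by linarith [hn.1])).symm
        · exact coe_ne_of_lt h5 (by linarith [hn.2])
  have b1 : p ∈ e.bar ↔ p ≤ e.y := by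
    constructor
    · rintro ⟨j, hj⟩
      have k1 : (-1 : ℝ) < j := by linarith [hj.1, hn.2]
      have k1 : -1 < j := by exact_mod_cast k1
      have k0 : 0 ≤ j := by omega
      have : (0 : ℝ) ≤ j := by exact_mod_cast k0
      linarith [hj.2]
    · exact fun h4 => ⟨0, by simpa using ⟨hn.1, h4⟩⟩
  have b2 : p ∈ f.bar ↔ p = e.x ∨ e.y ≤ p := by
    constructor
    · rintro ⟨j, hj⟩
      rw [hx, hy] at hj
      rcases le_or_gt j 0 with h3 | h3
      · have : (j : ℝ) ≤ 0 := by exact_mod_cast h3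
        exact Or.inr (by linarith [hj.1])
      · have : (1 : ℝ) ≤ j := by exact_mod_cast h3
        exact Or.inl (le_antisymm (by linarith [hj.2]) hn.1)
    · rintro (rfl | h3)
      · exact ⟨1, by rw [hx, hy]; exact ⟨by push_cast; linarith, by simp⟩⟩
      · exact ⟨0, by rw [hx, hy]; simpa using ⟨h3, hn.2.le⟩⟩
  rw [mem_pair, hs2, ← hp1, hs, mem_gslab, b1, b2]
  simp only [Finsupp.coe_zero, Pi.zero_apply, ne_eq, not_true_eq_false, false_and, false_or, mem_univ,
    true_and]
  set q := Dunwoody.shear k t p with hq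
  have q1 : e.x - zigzag t / 4 * δ ≤ q := by rw [← Sx]; exact (hS t).monotone hn.1
  have q2 : q < e.x + 1 - zigzag t / 4 * δ := by rw [← Sx1]; exact hS t hn.2
  by_cases hr : 1 / 4 ≤ t ∧ t ≤ 3 / 4
  swap
  · have r := ramp_mem δ (m q)
    constructor
    · rintro (⟨-, h4, h5⟩ | ⟨-, rfl⟩ | ⟨-, rfl⟩)
      · exact absurd ⟨h4, h5⟩ hr
      · norm_num at hr
      · norm_num at hr
    · intro h4
      exact absurd (h4 ▸ r) hr
  rw [eq_ramp_iff hδ hr.1 hr.2]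
  have low : m q ≤ zigzag t / 4 * δ ↔ p ≤ e.y ∨ p = e.x := by
    constructor
    · intro h3
      by_contra! h4
      have := hS t h4.1
      rw [Sy] at this
      exact absurd (mhigh q _ this q2) (not_lt.2 h3)
    · intro h3
      have h3 : p ≤ e.y := h3.elim id fun h => h ▸ h1.le
      refine mlow' q _ q1 ?_
      rw [← Sy]
      exact (hS t).monotone h3
  have high : zigzag t / 4 * δ ≤ m q ↔ p = e.x ∨ e.y ≤ p := by
    constructor
    · intro h3
      by_contra! h4
      have a1 := hS t (lt_of_le_of_ne hn.1 h4.1.symm)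
      have a2 := hS t h4.2
      rw [Sx] at a1
      rw [Sy] at a2
      exact absurd (mlow q _ a1 a2) (not_lt.2 h3)
    · rintro (h3 | h3)
      · have a1 := Sx1 t
        rw [hSp, ← h3, ← hq] at a1
        have : m q = m (q + 1) := (mp q).symm
        rw [this, a1]
        refine mhigh' _ _ ?_ (by rw [h3])
        rw [h3, ← Sx1, ← Sy]
        exact (hS t).monotone (by linarith)
      · refine mhigh' q _ ?_ q2.le
        rw [← Sy]
        exact (hS t).monotone h3
  rw [le_antisymm_iff (a := m q), low, high]
  constructor
  · rintro (⟨h3, -, -⟩ | ⟨h3, h4⟩ | ⟨h3, h4⟩)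
    · rcases h3 with rfl | rfl
      · exact Or.inr (Or.inr ⟨Or.inr rfl, Or.inl rfl⟩)
      · exact Or.inr (Or.inr ⟨Or.inl le_rfl, Or.inr le_rfl⟩)
    · exact Or.inl ⟨h4, Or.inl h3⟩
    · exact Or.inr (Or.inl ⟨h4, h3⟩)
  · rintro (⟨h3, h4⟩ | ⟨h3, h4⟩ | ⟨h3, h4⟩)
    · exact Or.inr (Or.inl ⟨h4.elim id fun h => h ▸ h1.le, h3⟩)
    · exact Or.inr (Or.inr ⟨h4, h3⟩)
    · refine Or.inl ⟨?_, hr⟩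
      rcases h4 with h4 | h4
      · exact Or.inl h4
      · rcases h3 with h3 | h3
        · exact Or.inr (le_antisymm h3 h4)
        · exact Or.inl h3

/-- A curve which contains an essential circle is the essential circle. -/
theorem related_middleCurve {s : 𝕋 →₀ G} {e f : Event G} {L : List (Event G)} {φ : Twist}
    {D : Set Torus} (hV : Valid s (e :: f :: L) φ) (hD : Draw φ (picture s (e :: f :: L)) D)
    (hcon : IsConnected D) (hc : e.cup = true) (hc' : f.cup = false) (hx : f.x = e.y)
    (hy : f.y = e.x + 1) : L = [] ∧ s = 0 ∧ Related D middleCurve := by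
  obtain ⟨hs, hs2⟩ := levels_eq_zero hV.1.1 hV.1.2.1 hc hc' hx hy
  have hI := ((Iso.picture_cons_cons s e f L).trans_one
    ((Iso.essential hV.1.1 hV.1.2.1 hc hc' hx hy).stack (Iso.refl _)))
  have hD := hD.iso_one hI
  have hfin := hV.2
  rw [final_cons, final_cons, hs2, hs] at hfin
  have hF := isShear_standard φ
  -- A further event would lie above the closed circle, and the levels `0` and `1/2`, at which there
  -- are no strands, would separate it from the circle.
  have hL : L = [] := by
    by_contra hL
    obtain ⟨g, L', rfl⟩ := List.exists_cons_of_ne_nil hL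
    refine not_isConnected_cut (A := stack (gslab (fun _ => 1 / 2) 0 0 univ (G := G))
      (picture (step (step s e) f) (g :: L'))) ?_ ?_ ?_ ((hD.related hF).isConnected hcon)
    · rintro ⟨p, t⟩ hv
      rw [mem_stack, mem_gslab, hs2] at hv
      simp only [Finsupp.coe_zero, Pi.zero_apply, ne_eq, not_true_eq_false, false_and, false_or,
        mem_univ, true_and] at hv
      refine ⟨?_, ?_, ?_⟩
      · rintro rfl
        norm_num at hv
      · rintro rfl
        norm_num at hv
        rw [mem_picture_one, hfin] at hv
        simp at hv
      · rintro rfl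
        norm_num at hv
        rw [mem_picture_of_le (by norm_num)] at hv
        simp at hv
    · exact ⟨(0, 1 / 4), mem_stack.2 (Or.inl ⟨by norm_num, mem_gslab.2 (Or.inr (Or.inr
        ⟨trivial, by norm_num⟩))⟩), by norm_num⟩
    · refine ⟨(g.x, 1 / 2 + 1 / 8), mem_stack.2 (Or.inr ⟨by norm_num, ?_⟩), by norm_num⟩
      rw [picture, mem_stack]
      refine Or.inl ⟨by norm_num, ?_⟩
      rw [show 2 * (2 * (1 / 2 + 1 / 8 : ℝ) - 1) = 1 / 2 by norm_num]
      exact slab_mem_of_bar ⟨0, by simpa using (hV.1.2.2.1.lt).le⟩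
  refine ⟨hL, hs, ?_⟩
  rw [hL, hs2] at hD
  have hI2 : Iso 1 1 (stack (gslab (fun _ => 1 / 2) 0 0 univ (G := G)) (picture (0 : _ →₀ G) []))
      (gslab (fun _ => 1 / 2) 0 0 univ (G := G)) := by
    refine Iso.trans_one (Iso.of_eqOn ?_) (Iso.gslab (isGraph_const (c := 1 / 4) (by norm_num)
      (by norm_num)) (isGraph_const (by norm_num) (by norm_num)) 0 0 univ)
    rintro ⟨p, t⟩ -
    rw [mem_stack, mem_gslab, mem_gslab, picture, col]
    simp only [Finsupp.coe_zero, Pi.zero_apply, ne_eq, not_true_eq_false, false_and, false_or,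
      mem_univ, true_and, mem_ofPred_eq, and_false, or_false]
    constructor
    · rintro ⟨-, h⟩
      linarith
    · rintro rfl
      norm_num
  have hR := (hD.iso_one hI2).related hF
  convert! hR using 1
  ext ⟨a, b⟩
  constructor
  · intro h
    obtain ⟨v, -, hv, hcut⟩ := hF.exists_cut_eq (a, b)
    have h2 : ((v.2 : ℝ) : 𝕋) = ((1 / 2 : ℝ) : 𝕋) := by
      have := congrArg Prod.snd hcut
      exact this.trans h
    have h3 : v.2 = 1 / 2 := by
      have := (coe_mem_image_Ioo (a := 0) (b := 1) le_rfl le_rfl hv).1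
        ⟨1 / 2, by norm_num, h2.symm⟩
      rcases lt_trichotomy v.2 (1 / 2) with h4 | h4 | h4
      · exact absurd h2 (coe_ne_of_lt h4 (by linarith [this.1]))
      · exact h4
      · exact absurd h2.symm (coe_ne_of_lt h4 (by linarith [this.2]))
    exact ⟨v, ⟨Or.inr (Or.inr ⟨trivial, h3⟩), hv⟩, hcut⟩
  · rintro ⟨⟨p, t⟩, ⟨h, -⟩, hcut⟩
    rw [mem_gslab] at h
    simp only [Finsupp.coe_zero, Pi.zero_apply, ne_eq, not_true_eq_false, false_and, false_or,
      mem_univ, true_and] at h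
    have := congrArg Prod.snd hcut
    rw [middleCurve, mem_ofPred_eq, ← h]
    exact this.symm

/-- A circle which bounds a disc separates the torus. -/
theorem not_connected_of_trivial {s : 𝕋 →₀ G} {e f : Event G} {L : List (Event G)}
    {φ : Twist} {D : Set Torus} (hV : Valid s (e :: f :: L) φ)
    (hD : Draw φ (picture s (e :: f :: L)) D) (hcon : IsConnected Dᶜ) (hc : e.cup = true)
    (hx : f.x = e.x) (hy : f.y = e.y) : False := by
  have h1 := hV.1.1.lt
  have h2 := hV.1.1.lt_add
  have hD := hD.iso_one (Iso.picture_cons_cons s e f L)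
  set A := stack (pair s e f) (picture (step (step s e) f) L) with hA
  have hF := isShear_standard φ
  set F : ℝ → ℝ → ℝ := fun p t => (1 - t) * p + t * φ p with hFdef
  have hper : ∀ (p t : ℝ) (n : ℤ), (p + n, t) ∈ A ↔ (p, t) ∈ A := by
    intro p t n
    rw [hA, mem_stack, mem_stack, picture_add_int, IsZigzag.pair_add_int]
  have hcon := (hD.related hF).compl.isConnected hcon
  -- The interior of the disc: the bars at the heights `1/4` and `3/4` of the pair are at `1/8` and
  -- `3/8` in the stack. Its image is open, and together with its frame on the curve it is the image
  -- of the closed rectangle; so the complement of the curve falls apart.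
  set R : Set (ℝ × ℝ) := {v | ∃ n : ℤ, v.1 + n ∈ Ioo e.x e.y ∧ v.2 ∈ Ioo (1 / 8 : ℝ) (3 / 8)} with hR
  have hRo : IsOpen R := by
    have : R = ⋃ n : ℤ, (fun v : ℝ × ℝ => (v.1 + n, v.2)) ⁻¹' (Ioo e.x e.y ×ˢ Ioo (1 / 8) (3 / 8)) := by
      ext v
      simp [hR]
    rw [this]
    exact isOpen_iUnion fun n => (isOpen_Ioo.prod isOpen_Ioo).preimage (by fun_prop)
  have hRA : ∀ v ∈ R, v ∉ A := by
    rintro ⟨p, t⟩ ⟨n, hp, ht⟩ hv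
    simp only at hp ht
    rw [← hper p t n, hA, mem_stack] at hv
    generalize p + n = p at hp hv
    rcases hv with ⟨-, hv⟩ | ⟨h3, -⟩
    · rw [mem_pair, step_of_ne (coe_ne_of_lt hp.1 (by linarith [hp.2]))
        (coe_ne_of_lt hp.2 (by linarith [hp.1])).symm, hV.1.1.between p hp] at hv
      rcases hv with hv | hv | hv | hv | hv
      · exact hv.1 rfl
      · exact hv.1 rfl
      · linarith [hv.2, ht.2]
      · linarith [hv.2, ht.1]
      · linarith [hv.2, ht.2]
    · linarith [ht.2]
  have hU : IsOpen (cut F '' R) := by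
    rw [← isClosed_compl_iff]
    have : (cut F '' R)ᶜ = cut F '' ((Icc (0 : ℝ) 1 ×ˢ Icc (0 : ℝ) 1) ∩ Rᶜ) := by
      ext x
      constructor
      · intro hx
        obtain ⟨v, hv, -, hvx⟩ := hF.exists_cut_eq x
        exact ⟨v, ⟨hv, fun h => hx ⟨v, h, hvx⟩⟩, hvx⟩
      · rintro ⟨v, ⟨hv, hvR⟩, rfl⟩ ⟨w, hw, hwv⟩
        obtain ⟨n, hwp, hwt⟩ := hw
        have hws : w ∈ strip := ⟨by linarith [hwt.1], by linarith [hwt.2]⟩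
        rcases (hF.cut_eq_iff hws hv.2).1 hwv with ⟨h3, m, h4⟩ | ⟨h3, -⟩ | ⟨h3, -⟩
        · refine hvR ⟨n - m, ?_, h3 ▸ hwt⟩
          rw [h4]
          push_cast
          rwa [show w.1 + m + (n - m) = w.1 + n by ring]
        · linarith [hwt.2]
        · linarith [hwt.1]
    rw [this]
    exact (((isCompact_Icc.prod isCompact_Icc).inter_right hRo.isClosed_compl).image
      hF.continuous_cut).isClosed
  set K : Set (ℝ × ℝ) := Icc e.x e.y ×ˢ Icc (1 / 8 : ℝ) (3 / 8) with hK
  have hKc : IsClosed (cut F '' K) :=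
    ((isCompact_Icc.prod isCompact_Icc).image hF.continuous_cut).isClosed
  have hKs : K ⊆ strip := fun v hv => ⟨by linarith [hv.2.1], by linarith [hv.2.2]⟩
  have hbar : ∀ v ∈ K, v ∉ R → v ∈ A := by
    rintro ⟨p, t⟩ hv hvR
    have hp : p ∈ Icc e.x e.y := hv.1
    have ht : t ∈ Icc (1 / 8 : ℝ) (3 / 8) := hv.2
    rw [hA, mem_stack]
    refine Or.inl ⟨by linarith [ht.2], ?_⟩
    rw [mem_pair]
    have pe : p ∈ e.bar := ⟨0, by simpa using hp⟩
    have pf : p ∈ f.bar := ⟨0, by rw [hx, hy]; simpa using hp⟩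
    have ne : ¬(p ∈ Ioo e.x e.y ∧ t ∈ Ioo (1 / 8 : ℝ) (3 / 8)) :=
      fun h => hvR ⟨0, by simpa using h.1, h.2⟩
    rcases eq_or_lt_of_le ht.1 with h3 | h3
    · exact Or.inr (Or.inr (Or.inr (Or.inl ⟨pe, by linarith⟩)))
    rcases eq_or_lt_of_le ht.2 with h4 | h4
    · exact Or.inr (Or.inr (Or.inr (Or.inr ⟨pf, by linarith⟩)))
    refine Or.inr (Or.inl ⟨?_, by linarith, by linarith⟩)
    have s0 := hV.1.1.free hc p hp
    rcases eq_or_lt_of_le hp.1 with h5 | h5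
    · rw [step_coe, s0, ← h5, if_pos rfl, if_neg (coe_ne_of_lt h1 h2).symm]
      simpa using hV.1.1.ne
    rcases eq_or_lt_of_le hp.2 with h6 | h6
    · rw [step_coe, s0, h6, if_pos rfl, if_neg (coe_ne_of_lt h1 h2)]
      simpa using hV.1.1.ne
    exact absurd ⟨⟨h5, h6⟩, h3, h4⟩ ne
  have hRK : cut F '' R ⊆ cut F '' K := by
    rintro _ ⟨v, ⟨n, hp, ht⟩, rfl⟩
    refine ⟨(v.1 + n, v.2), ⟨Ioo_subset_Icc_self hp, Ioo_subset_Icc_self ht⟩, ?_⟩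
    exact hF.cut_add_int ⟨by linarith [ht.1], by linarith [ht.2]⟩ n
  have notin : ∀ v ∈ strip, v ∉ A → 0 < v.2 → v.2 < 1 → cut F v ∉ cut F '' (A ∩ strip) := by
    rintro v hv hvA h3 h4 ⟨w, ⟨hw, hws⟩, hwv⟩
    rcases (hF.cut_eq_iff hws hv).1 hwv with ⟨h5, m, h6⟩ | ⟨-, h5, -⟩ | ⟨-, h5, -⟩
    · refine hvA ?_
      have : v = (w.1 + m, w.2) := Prod.ext h6 h5.symm
      rw [this]
      exact (hper _ _ _).2 hw
    · linarith
    · linarith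
  obtain ⟨x, -, hxU, hxK⟩ := hcon.isPreconnected _ _ hU hKc.isOpen_compl (by
      intro x hx
      by_cases h3 : x ∈ cut F '' K
      · left
        obtain ⟨v, hv, rfl⟩ := h3
        by_contra h4
        refine hx ⟨v, ⟨hbar v hv fun h5 => h4 (mem_image_of_mem _ h5), hKs hv⟩, rfl⟩
      · exact Or.inr h3) (by
      have hm : (((e.x + e.y) / 2, 1 / 4) : ℝ × ℝ) ∈ R :=
        ⟨0, by constructor <;> push_cast <;> linarith, by norm_num⟩
      exact ⟨_, notin _ (by norm_num [strip]) (hRA _ hm) (by norm_num) (by norm_num),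
        mem_image_of_mem _ hm⟩) (by
      have hs : ((e.x, 1 / 16) : ℝ × ℝ) ∈ strip := by norm_num [strip]
      refine ⟨_, notin (e.x, 1 / 16) hs ?_ (by norm_num) (by norm_num), ?_⟩
      · rw [hA, mem_stack, mem_pair, hV.1.1.free hc e.x ⟨le_rfl, h1.le⟩]
        norm_num
      · rintro ⟨w, hw, hwv⟩
        rcases (hF.cut_eq_iff (hKs hw) hs).1 hwv with ⟨h5, -⟩ | ⟨-, h5, -⟩ | ⟨-, h5, -⟩
        · have := hw.2.1
          rw [h5] at this
          norm_num at this
        · norm_num at h5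
        · norm_num at h5)
  exact hxK (hRK hxU)

/-! ### Curves without births and deaths -/

theorem circ_iterate_coe (φ : Twist) (k : ℕ) (p : ℝ) :
    (circ φ)^[k] (p : 𝕋) = ((φ^[k] p : ℝ) : 𝕋) :=
  ((show Function.Semiconj (fun x : ℝ => (x : 𝕋)) φ (circ φ) from
    fun p => (circ_coe φ p).symm).iterate_right k p).symm

theorem apply_circ {s : 𝕋 →₀ G} {φ : Twist} (h : s = pull φ s) (a : 𝕋) :
    s (circ φ a) = s a := by
  obtain ⟨x, rfl⟩ := QuotientAddGroup.mk_surjective a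
  have := pull_coe φ s x
  rw [← h] at this
  exact this.symm

theorem apply_circ_iterate {s : 𝕋 →₀ G} {φ : Twist} (h : s = pull φ s) (k : ℕ)
    (a : 𝕋) : s ((circ φ)^[k] a) = s a := by
  induction k with
  | zero => rfl
  | succ k ih => rw [Function.iterate_succ_apply', apply_circ h, ih]

theorem mem_periodicPts_of_ne_zero {s : 𝕋 →₀ G} {φ : Twist} (h : s = pull φ s)
    {a : 𝕋} (ha : s a ≠ 0) : a ∈ Function.periodicPts (circ φ) := by
  have hm : ∀ k : ℕ, (circ φ)^[k] a ∈ s.support := fun k => by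
    rw [Finsupp.mem_support_iff, apply_circ_iterate h]
    exact ha
  obtain ⟨i, j, hij, hf⟩ : ∃ i j : ℕ, i ≠ j ∧ (circ φ)^[i] a = (circ φ)^[j] a := by
    obtain ⟨i, j, hij, hf⟩ := Finite.exists_ne_map_eq_of_infinite
      (fun k : ℕ => (⟨_, hm k⟩ : s.support))
    exact ⟨i, j, hij, congrArg Subtype.val hf⟩
  wlog hlt : i < j generalizing i j
  · exact this j i hij.symm hf.symm (lt_of_le_of_ne (not_lt.1 hlt) hij.symm)
  refine Function.mk_mem_periodicPts (n := j - i) (by omega) ?_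
  have : (circ φ)^[i] ((circ φ)^[j - i] a) = (circ φ)^[i] a := by
    rw [← Function.iterate_add_apply, hf]
    congr 2
    omega
  exact ((circ φ).injective.iterate i) this

/-- The strands of a connected curve are permuted transitively by the gluing. -/
theorem exists_iterate_eq {s : 𝕋 →₀ G} {φ : Twist} {D : Set Torus} (h : s = pull φ s)
    (hD : Draw φ (col s) D) (hcon : IsConnected D) {a₀ : 𝕋} (ha₀ : s a₀ ≠ 0)
    {a : 𝕋} (ha : s a ≠ 0) : ∃ k : ℕ, (circ φ)^[k] a₀ = a := by
  by_contra hne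
  have hF := isShear_standard φ
  have hcon := (hD.related hF).isConnected hcon
  set F : ℝ → ℝ → ℝ := fun p t => (1 - t) * p + t * φ p
  have hcoe : Continuous fun x : ℝ => (x : 𝕋) := AddCircle.continuous_mk' 1
  have hclosed : ∀ T : Set 𝕋, T.Finite → IsClosed
      (cut F '' ({v | (v.1 : 𝕋) ∈ T} ∩ Icc (0 : ℝ) 1 ×ˢ Icc (0 : ℝ) 1)) := fun T hT =>
    (((isCompact_Icc.prod isCompact_Icc).inter_left
      (hT.isClosed.preimage (hcoe.comp continuous_fst))).image hF.continuous_cut).isClosed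
  obtain ⟨n, hn, hper⟩ := mem_periodicPts_of_ne_zero h ha₀
  -- As `a₀` is periodic, its forward orbit is invariant under the gluing in both directions. So the
  -- strands in the orbit and the others form two disjoint closed parts of the curve.
  have hinv : ∀ b, (∃ k : ℕ, (circ φ)^[k] a₀ = circ φ b) ↔ ∃ k : ℕ, (circ φ)^[k] a₀ = b := by
    intro b
    constructor
    · rintro ⟨k, hk⟩
      refine ⟨k + (n - 1), (circ φ).injective ?_⟩
      rw [← Function.iterate_succ_apply' (circ φ), show (k + (n - 1)).succ = k + n by omega,
        Function.iterate_add_apply, hper, hk]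
    · rintro ⟨k, hk⟩
      exact ⟨k + 1, by rw [Function.iterate_succ_apply', hk]⟩
  have hsplit : ∀ p t : ℝ, t ∈ Icc (0 : ℝ) 1 → s (p : 𝕋) ≠ 0 → ∀ P : 𝕋 → Prop, P p →
      cut F (p, t) ∈ cut F '' ({v | (v.1 : 𝕋) ∈ {a | s a ≠ 0 ∧ P a}} ∩
        Icc (0 : ℝ) 1 ×ˢ Icc (0 : ℝ) 1) := by
    intro p t ht hp P hP
    obtain ⟨j, hj, -⟩ := existsUnique_add_zsmul_mem_Ico one_pos p 0
    have hj : p + j ∈ Ico (0 : ℝ) 1 := by simpa using hj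
    refine ⟨(p + j, t), ⟨?_, ⟨hj.1, hj.2.le⟩, ht⟩, hF.cut_add_int (v := (p, t)) ht j⟩
    simp only [mem_ofPred_eq, coe_add_int]
    exact ⟨hp, hP⟩
  have hfin : ∀ P : 𝕋 → Prop, {a | s a ≠ 0 ∧ P a}.Finite := fun P =>
    s.support.finite_toSet.subset fun a ha => Finsupp.mem_support_iff.2 ha.1
  obtain ⟨x, -, ⟨v, ⟨hv, -, hvt⟩, hvx⟩, ⟨w, ⟨hw, -, hwt⟩, hwx⟩⟩ :=
    isPreconnected_closed_iff.1 hcon.isPreconnected _ _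
      (hclosed _ (hfin fun b => ∃ k : ℕ, (circ φ)^[k] a₀ = b))
      (hclosed _ (hfin fun b => ¬∃ k : ℕ, (circ φ)^[k] a₀ = b))
      (by
        rintro _ ⟨⟨p, t⟩, ⟨hp, ht⟩, rfl⟩
        by_cases hP : ∃ k : ℕ, (circ φ)^[k] a₀ = p
        · exact Or.inl (hsplit p t ht hp _ hP)
        · exact Or.inr (hsplit p t ht hp _ hP))
      (by
        obtain ⟨p, rfl⟩ := QuotientAddGroup.mk_surjective a₀
        exact ⟨_, ⟨(p, 0), ⟨ha₀, by norm_num [strip]⟩, rfl⟩,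
          hsplit p 0 (by norm_num) ha₀ _ ⟨0, rfl⟩⟩)
      (by
        obtain ⟨p, rfl⟩ := QuotientAddGroup.mk_surjective a
        exact ⟨_, ⟨(p, 0), ⟨ha, by norm_num [strip]⟩, rfl⟩, hsplit p 0 (by norm_num) ha _ hne⟩)
  replace hv : ∃ k : ℕ, (circ φ)^[k] a₀ = v.1 := hv.2
  replace hw : ¬∃ k : ℕ, (circ φ)^[k] a₀ = w.1 := hw.2
  rcases (hF.cut_eq_iff hvt hwt).1 (hvx.trans hwx.symm) with ⟨-, j, hj⟩ | ⟨-, -, j, hj⟩ | ⟨-, -, j, hj⟩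
  · rw [hj, coe_add_int] at hw
    exact hw hv
  · rw [hj, coe_add_int, ← circ_coe, hinv] at hw
    exact hw hv
  · rw [hj, coe_add_int, ← circ_coe, hinv] at hv
    exact hw hv

/-- The average of the iterates of a homeomorphism of the line. -/
theorem exists_average (φ : Twist) {n : ℕ} (hn : 0 < n) :
    ∃ ψ : Twist, ∀ p, ψ p = (∑ k ∈ Finset.range n, φ^[k] p) / n := by
  have hn' : (0 : ℝ) < n := by exact_mod_cast hn
  refine exists_twist ?_ ?_ ?_
  · exact (continuous_finsetSum _ fun k _ => φ.continuous.iterate k).div_const _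
  · intro p q hpq
    refine div_lt_div_of_pos_right (Finset.sum_lt_sum_of_nonempty ⟨0, by simpa using hn⟩ fun k _ =>
      φ.strictMono.iterate k hpq) hn'
  · intro p
    have : ∀ k : ℕ, φ^[k] (p + 1) = φ^[k] p + 1 := fun k => by
      rw [← CircleDeg1Lift.coe_pow, CircleDeg1Lift.map_add_one]
    simp only [this, Finset.sum_add_distrib]
    rw [add_div]
    simp [hn'.ne']

/-- A connected curve without births and deaths is a linear curve. -/
theorem exists_linearCurve {s : 𝕋 →₀ G} {φ : Twist} {D : Set Torus} (h : s = pull φ s)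
    (hD : Draw φ (col s) D) (hcon : IsConnected D) : ∃ (g₀ : G) (n : ℕ) (m : ℤ), 0 < n ∧
      IsCoprime (n : ℤ) m ∧ (∀ a, s a = 0 ∨ s a = g₀) ∧ total s = n • g₀ ∧
      Related D (linearCurve n m) := by
  classical
  obtain ⟨p₀, hp₀⟩ : ∃ p₀ : ℝ, s p₀ ≠ 0 := by
    obtain ⟨_, ⟨p, t⟩, ⟨hp, -⟩, -⟩ := ((hD.related (isShear_standard φ)).isConnected hcon).nonempty
    exact ⟨p, hp⟩
  set f := circ φ with hf
  have hper := mem_periodicPts_of_ne_zero h hp₀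
  set n := Function.minimalPeriod f (p₀ : 𝕋) with hn
  have n0 : 0 < n := Function.minimalPeriod_pos_of_mem_periodicPts hper
  have n0' : (0 : ℝ) < n := by exact_mod_cast n0
  have hall : ∀ a, s a ≠ 0 → ∃ k < n, f^[k] (p₀ : 𝕋) = a := fun a ha => by
    obtain ⟨k, hk⟩ := exists_iterate_eq h hD hcon hp₀ ha
    exact ⟨k % n, Nat.mod_lt _ n0, by rw [Function.iterate_mod_minimalPeriod_eq, hk]⟩
  have hval : ∀ a, s a ≠ 0 → s a = s p₀ := fun a ha => by
    obtain ⟨k, -, rfl⟩ := hall a ha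
    exact apply_circ_iterate h k _
  have hsupp : s.support = (Finset.range n).image fun k => f^[k] (p₀ : 𝕋) := by
    ext a
    rw [Finsupp.mem_support_iff, Finset.mem_image]
    constructor
    · intro ha
      obtain ⟨k, hk, hka⟩ := hall a ha
      exact ⟨k, Finset.mem_range.2 hk, hka⟩
    · rintro ⟨k, -, rfl⟩
      rwa [apply_circ_iterate h]
  have htot : total s = n • s p₀ := by
    rw [total, Finsupp.sum, Finset.sum_congr rfl fun a ha => hval a (Finsupp.mem_support_iff.1 ha),
      Finset.sum_const, hsupp, Finset.card_image_of_injOn, Finset.card_range]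
    intro i hi j hj hij
    exact Function.iterate_injOn_Iio_minimalPeriod (Finset.mem_range.1 hi) (Finset.mem_range.1 hj) hij
  obtain ⟨m, hm⟩ : ∃ m : ℤ, φ^[n] p₀ = p₀ + m := by
    have : ((φ^[n] p₀ : ℝ) : 𝕋) = p₀ := by
      rw [← circ_iterate_coe]
      exact Function.iterate_minimalPeriod
    exact coe_eq_coe_iff.1 this.symm
  -- Let `d` be the greatest common divisor, `n = d n'`, `m = d m'`. For the `n'`-th iterate of `φ`,
  -- which is increasing and commutes with the unit translation, moving `p₀` by `d m'` in `d` steps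
  -- is possible only if one step moves it by `m'`. Then `p₀` has a period `n'` on the circle, and
  -- minimality of `n` forces `d = 1`.
  have hcop : IsCoprime (n : ℤ) m := by
    rw [Int.isCoprime_iff_gcd_eq_one]
    obtain ⟨n', hn'⟩ : (Int.gcd n m) ∣ n := Int.natCast_dvd_natCast.1 (Int.gcd_dvd_left _ _)
    obtain ⟨m', hm'⟩ := Int.gcd_dvd_right (n : ℤ) m
    set d := Int.gcd n m with hd
    have d0 : 0 < d := Nat.pos_of_ne_zero fun h0 => by
      rw [h0, zero_mul] at hn'
      omega
    have n'0 : 0 < n' := Nat.pos_of_ne_zero fun h0 => by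
      rw [h0, mul_zero] at hn'
      omega
    have key : ((φ : CircleDeg1Lift) ^ n')^[d] p₀ = p₀ + d * m' := by
      rw [CircleDeg1Lift.coe_pow, ← Function.iterate_mul, mul_comm, ← hn', hm, hm']
      push_cast
      rfl
    have key := (CircleDeg1Lift.iterate_pos_eq_iff _ d0).1 key
    rw [CircleDeg1Lift.coe_pow] at key
    have : Function.IsPeriodicPt f n' (p₀ : 𝕋) := by
      rw [Function.IsPeriodicPt, Function.IsFixedPt, circ_iterate_coe, key, coe_add_int]
    have := this.minimalPeriod_dvd
    rw [← hn] at this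
    have := Nat.le_of_dvd n'0 this
    nlinarith
  have hφint : ∀ (k : ℕ) (p : ℝ) (j : ℤ), φ^[k] (p + j) = φ^[k] p + j := fun k p j => by
    rw [← CircleDeg1Lift.coe_pow, CircleDeg1Lift.map_add_int]
  -- the strands
  have hS : ∀ p : ℝ, s p ≠ 0 ↔ ∃ (k : ℕ) (j : ℤ), p = φ^[k] p₀ + j := by
    intro p
    constructor
    · intro hp
      obtain ⟨k, -, hk⟩ := hall p hp
      rw [circ_iterate_coe] at hk
      obtain ⟨j, hj⟩ := coe_eq_coe_iff.1 hk
      exact ⟨k, j, hj⟩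
    · rintro ⟨k, j, rfl⟩
      rw [coe_add_int, ← circ_iterate_coe, apply_circ_iterate h]
      exact hp₀
  have hSm : ∀ p : ℝ, s p ≠ 0 → φ^[n] p = p + m := by
    intro p hp
    obtain ⟨k, j, rfl⟩ := (hS p).1 hp
    rw [hφint, ← Function.iterate_add_apply, add_comm n k, Function.iterate_add_apply, hm, hφint]
    ring
  -- On the strands `φ^[n]` is the translation by `m`, so the sum over the iterates telescopes to `ψ
  -- ∘ φ = ψ + m / n`. In the coordinate `ψ` the gluing turns the strands by a constant angle, and
  -- the strands become straight lines.
  obtain ⟨ψ, hψ⟩ := exists_average φ n0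
  have hψφ : ∀ p : ℝ, s p ≠ 0 → ψ (φ p) = ψ p + m / n := by
    intro p hp
    have e1 : ∑ k ∈ Finset.range n, φ^[k] (φ p) = ∑ k ∈ Finset.range n, φ^[k] p + m := by
      have e2 := Finset.sum_range_succ (fun k => φ^[k] p) n
      rw [Finset.sum_range_succ', hSm p hp] at e2
      simp only [Function.iterate_succ_apply, Function.iterate_zero, id] at e2
      linarith
    rw [hψ, hψ, e1, add_div]
  have hF : IsShear φ fun p t => (1 - t) * ψ p + t * ψ (φ p) := by
    have c1 := ψ.continuous
    have c2 := φ.continuous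
    refine ⟨by fun_prop, fun t ht p q hpq => ?_, fun p t _ => ?_, fun p => by simp⟩
    · have a1 := ψ.strictMono hpq
      have a2 := ψ.strictMono (φ.strictMono hpq)
      simp only
      rcases eq_or_lt_of_le ht.1 with h0 | h0
      · rw [← h0]; linarith
      · nlinarith [mul_pos h0 (sub_pos.2 a2), mul_nonneg (sub_nonneg.2 ht.2) (sub_pos.2 a1).le]
    · simp only [CircleDeg1Lift.map_add_one]
      ring
  have hrel := hD.related hF
  have hψS : ∀ (k : ℕ) (j : ℤ), ψ (φ^[k] p₀ + j) = ψ p₀ + k * m / n + j := by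
    intro k j
    rw [CircleDeg1Lift.map_add_int]
    congr 1
    induction k with
    | zero => simp
    | succ k ih =>
      rw [Function.iterate_succ_apply', hψφ _ ((hS _).2 ⟨k, 0, by simp⟩), ih]
      push_cast
      ring
  -- The strands satisfy `n x - m t ∈ n ψ p₀ + ℤ`, whence the sign of `m` and the translation by `ψ
  -- p₀`. Coprimality is needed to reach every line of the linear curve.
  have hcut : cut (fun p t => (1 - t) * ψ p + t * ψ (φ p)) '' (col s ∩ strip) =
      Homeomorph.addRight (((ψ p₀ : ℝ) : 𝕋), (0 : 𝕋)) ''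
        linearCurve n (-m) := by
    ext x
    constructor
    · rintro ⟨⟨p, t⟩, ⟨hp, ht⟩, rfl⟩
      have hp : s p ≠ 0 := hp
      obtain ⟨k, j, hkj⟩ := (hS p).1 hp
      refine ⟨torusProj ((k * m / n + j + t * m / n), t), ⟨_, ⟨k * m + n * j, ?_⟩, rfl⟩, ?_⟩
      · push_cast
        field_simp
        ring
      · simp only [cut, torusProj, Homeomorph.coe_addRight, Prod.mk_add_mk, add_zero]
        rw [hψφ p hp, hkj, hψS, ← AddCircle.coe_add]
        congr 2
        ring
    · rintro ⟨_, ⟨⟨x, t⟩, ⟨i, hi⟩, rfl⟩, rfl⟩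
      simp only at hi
      push_cast at hi
      obtain ⟨z, w, hzw⟩ := hcop
      obtain ⟨τ, hτ, q, hq⟩ : ∃ τ ∈ Icc (0 : ℝ) 1, ∃ q : ℤ, t = τ + q :=
        ⟨Int.fract t, ⟨Int.fract_nonneg t, (Int.fract_lt_one t).le⟩, ⌊t⌋, (Int.fract_add_floor t).symm⟩
      -- solve `k m + n j = i + m q` with `k ≥ 0`
      obtain ⟨k, j, hkj⟩ : ∃ (k : ℕ) (j : ℤ), (k : ℤ) * m + n * j = i + m * q := by
        refine ⟨((w * (i + m * q)) % n).toNat, z * (i + m * q) + (w * (i + m * q)) / n * m, ?_⟩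
        rw [Int.toNat_of_nonneg (Int.emod_nonneg _ (by omega))]
        have := Int.emod_add_mul_ediv (w * (i + m * q)) n
        linear_combination m * this + (i + m * q) * hzw
      have hkj' : (k : ℝ) * m + n * j = i + m * q := by exact_mod_cast hkj
      have hp : s ((φ^[k] p₀ + j : ℝ) : 𝕋) ≠ 0 := (hS _).2 ⟨k, j, rfl⟩
      refine ⟨(φ^[k] p₀ + j, τ), ⟨hp, hτ⟩, ?_⟩
      simp only [cut, torusProj, Homeomorph.coe_addRight, Prod.mk_add_mk, add_zero]
      rw [hψφ _ hp, hψS, ← AddCircle.coe_add, hq, coe_add_int]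
      congr 2
      have : (n : ℝ) * x = i + m * (τ + q) := by rw [← hq]; linarith
      field_simp
      linarith
  refine ⟨s p₀, n, -m, n0, hcop.neg_right, fun a => ?_, htot, ?_⟩
  · by_cases ha : s a = 0
    · exact Or.inl ha
    · exact Or.inr (hval a ha)
  · refine hrel.trans ?_
    rw [hcut]
    exact Related.symm ⟨_, extends_translation _, rfl⟩

/-! ### Reducing the number of events -/

theorem Event.Ok.coe_ne {s : 𝕋 →₀ G} {e : Event G} (h : e.Ok s) :
    (e.x : 𝕋) ≠ e.y := coe_ne_of_lt h.lt h.lt_add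

theorem step_left {s : 𝕋 →₀ G} {e : Event G} (h : e.Ok s) :
    step s e e.x = s e.x + e.η := by
  rw [step_coe, if_pos rfl, if_neg h.coe_ne.symm, sub_zero]

theorem step_right {s : 𝕋 →₀ G} {e : Event G} (h : e.Ok s) :
    step s e e.y = s e.y - e.η := by
  rw [step_coe, if_pos rfl, if_neg h.coe_ne, zero_sub, sub_eq_add_neg]

theorem step_apply_of_ne {s : 𝕋 →₀ G} {e : Event G} {a : 𝕋}
    (hx : (e.x : 𝕋) ≠ a) (hy : (e.y : 𝕋) ≠ a) : step s e a = s a := by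
  obtain ⟨p, rfl⟩ := QuotientAddGroup.mk_surjective a
  exact step_of_ne hx hy

namespace Event.Ok

variable {s : 𝕋 →₀ G} {e f : Event G}

theorem free_left (h : e.Ok s) (hc : e.cup = true) : s e.x = 0 := h.free hc _ ⟨le_rfl, h.lt.le⟩

theorem free_right (h : e.Ok s) (hc : e.cup = true) : s e.y = 0 := h.free hc _ ⟨h.lt.le, le_rfl⟩

theorem card_lt_of_cup (h : e.Ok s) (hc : e.cup = true) :
    s.support.card < (step s e).support.card := by
  refine Finset.card_lt_card (Finset.ssubset_iff_of_subset ?_ |>.2 ⟨(e.x : 𝕋), ?_, ?_⟩)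
  · intro a ha
    rw [Finsupp.mem_support_iff] at ha ⊢
    rwa [step_apply_of_ne]
    · rintro rfl
      exact ha (h.free_left hc)
    · rintro rfl
      exact ha (h.free_right hc)
  · rw [Finsupp.mem_support_iff, step_left h, h.free_left hc, zero_add]
    exact h.ne
  · rw [Finsupp.mem_support_iff, not_not, h.free_left hc]

theorem card_lt_of_cap (h : e.Ok s) (hc : e.cup = false) :
    (step s e).support.card < s.support.card := by
  refine Finset.card_lt_card (Finset.ssubset_iff_of_subset ?_ |>.2 ⟨(e.x : 𝕋), ?_, ?_⟩)
  · intro a ha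
    rw [Finsupp.mem_support_iff] at ha ⊢
    rwa [step_apply_of_ne] at ha
    · rintro rfl
      rw [step_left h, h.left hc, neg_add_cancel] at ha
      exact ha rfl
    · rintro rfl
      rw [step_right h, h.right hc, sub_self] at ha
      exact ha rfl
  · rw [Finsupp.mem_support_iff, h.left hc]
    exact neg_ne_zero.2 h.ne
  · rw [Finsupp.mem_support_iff, not_not, step_left h, h.left hc, neg_add_cancel]

end Event.Ok

theorem card_le_of_forall_cup {s : 𝕋 →₀ G} {L : List (Event G)} (h : OkList s L)
    (hc : ∀ e ∈ L, e.cup = true) : s.support.card + L.length ≤ (final s L).support.card := by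
  induction L generalizing s with
  | nil => exact le_rfl
  | cons e L ih =>
    have h1 := h.1.card_lt_of_cup (hc e (by simp))
    have h2 := ih h.2 fun f hf => hc f (by simp [hf])
    rw [final_cons, List.length_cons]
    omega

theorem card_le_of_forall_cap {s : 𝕋 →₀ G} {L : List (Event G)} (h : OkList s L)
    (hc : ∀ e ∈ L, e.cup = false) : (final s L).support.card + L.length ≤ s.support.card := by
  induction L generalizing s with
  | nil => exact le_rfl
  | cons e L ih =>
    have h1 := h.1.card_lt_of_cap (hc e (by simp))
    have h2 := ih h.2 fun f hf => hc f (by simp [hf])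
    rw [final_cons, List.length_cons]
    omega

/-- The curve `D` is of one of the standard kinds, and this can be read off from the weights. -/
def IsStandard (D : Set Torus) (s : 𝕋 →₀ G) (L : List (Event G)) : Prop :=
  ∃ g : G, (∀ a, s a = 0 ∨ s a = g ∨ s a = -g) ∧ (∀ e ∈ L, e.η = g ∨ e.η = -g) ∧
    ((total s = 0 ∧ Related D middleCurve) ∨ ∃ (n : ℕ) (m : ℤ), 0 < n ∧ IsCoprime (n : ℤ) m ∧
      total s = n • g ∧ Related D (linearCurve n m))

theorem neg_mem_of_mem {g x : G} (h : x = g ∨ x = -g) : -x = g ∨ -x = -g := by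
  rcases h with rfl | rfl <;> simp

namespace IsStandard

variable {D : Set Torus} {s : 𝕋 →₀ G} {e f : Event G} {L : List (Event G)} {φ : Twist}

theorem of_rotate (hV : Valid s (e :: L) φ) (h : IsStandard D (step s e) (L ++ [e.pull φ])) :
    IsStandard D s (e :: L) := by
  obtain ⟨g, h1, h2, h3⟩ := h
  have hη : e.η = g ∨ e.η = -g := h2 (e.pull φ) (by simp)
  refine ⟨g, fun a => ?_, fun f hf => ?_, ?_⟩
  · by_cases hx : (e.x : 𝕋) = a
    · subst hx
      cases hc : e.cup
      · rw [hV.1.1.left hc]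
        exact Or.inr (neg_mem_of_mem hη)
      · exact Or.inl (hV.1.1.free_left hc)
    by_cases hy : (e.y : 𝕋) = a
    · subst hy
      cases hc : e.cup
      · rw [hV.1.1.right hc]
        exact Or.inr hη
      · exact Or.inl (hV.1.1.free_right hc)
    rw [← step_apply_of_ne hx hy]
    exact h1 a
  · rcases List.mem_cons.1 hf with rfl | hf
    · exact hη
    · exact h2 f (by simp [hf])
  · rwa [total_step] at h3

/-- The weight of the cancelled pair is still visible on the strand that survives at `e.x`, so it is
`g` or `-g` as well. -/
theorem of_zigzag (hz : IsZigzag s e f) {ψ : Twist} (hs : pull ψ (step (step s e) f) = s)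
    (h : IsStandard D (step (step s e) f) L) : IsStandard D s (e :: f :: L) := by
  obtain ⟨g, h1, h2, h3⟩ := h
  obtain ⟨hfe, hl⟩ := hz.levels
  have hη : e.η = g ∨ e.η = -g := by
    have h4 := h1 (e.x : 𝕋)
    rw [(hl e.x ⟨le_rfl, by linarith [hz.ok.lt, hz.ok'.lt, hz.eq]⟩).2.2, if_pos rfl] at h4
    exact h4.resolve_left hz.ok.ne
  refine ⟨g, fun a => ?_, fun f' hf => ?_, ?_⟩
  · obtain ⟨p, rfl⟩ := QuotientAddGroup.mk_surjective a
    have := pull_coe ψ (step (step s e) f) p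
    rw [hs] at this
    rw [show s (p : 𝕋) = _ from this]
    exact h1 _
  · rcases List.mem_cons.1 hf with rfl | hf
    · exact hη
    rcases List.mem_cons.1 hf with rfl | hf
    · rwa [hfe]
    · exact h2 f' hf
  · rwa [total_step, total_step] at h3

theorem of_swap (h : IsStandard D s (f :: e :: L)) : IsStandard D s (e :: f :: L) := by
  obtain ⟨g, h1, h2, h3⟩ := h
  refine ⟨g, h1, fun f' hf => h2 f' ?_, h3⟩
  simp only [List.mem_cons] at hf ⊢
  tauto

theorem of_shift {n : ℤ} (h : IsStandard D s (e :: f.shift n :: L)) :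
    IsStandard D s (e :: f :: L) := by
  obtain ⟨g, h1, h2, h3⟩ := h
  refine ⟨g, h1, fun f' hf => ?_, h3⟩
  simp only [List.mem_cons, forall_eq_or_imp] at h2
  rcases List.mem_cons.1 hf with rfl | hf
  · exact h2.1
  rcases List.mem_cons.1 hf with rfl | hf
  · exact h2.2.1
  · exact h2.2.2 f' hf

theorem of_mirror (h : IsStandard D (mirror s) (L.map Event.mirror)) : IsStandard D s L := by
  obtain ⟨g, h1, h2, h3⟩ := h
  refine ⟨g, fun a => ?_, fun e he => ?_, ?_⟩
  · obtain ⟨p, rfl⟩ := QuotientAddGroup.mk_surjective a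
    have := h1 ((-p : ℝ) : 𝕋)
    rwa [mirror_coe, neg_neg] at this
  · have := neg_mem_of_mem (h2 e.mirror (List.mem_map_of_mem he))
    rwa [show -e.mirror.η = e.η from neg_neg _] at this
  · rwa [total_mirror] at h3

end IsStandard

theorem Valid.shift {s : 𝕋 →₀ G} {e f : Event G} {L : List (Event G)} {φ : Twist}
    (h : Valid s (e :: f :: L) φ) (n : ℤ) : Valid s (e :: f.shift n :: L) φ := by
  refine ⟨⟨h.1.1, h.1.2.1.shift n, ?_⟩, ?_⟩
  · rw [step_shift]
    exact h.1.2.2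
  · rw [final_cons, final_cons, step_shift, ← final_cons, ← final_cons]
    exact h.2

theorem picture_shift (s : 𝕋 →₀ G) (e f : Event G) (L : List (Event G)) (n : ℤ) :
    picture s (e :: f.shift n :: L) = picture s (e :: f :: L) := by
  simp only [picture, slab_shift, step_shift]

theorem strands_shift (s : 𝕋 →₀ G) (e f : Event G) (L : List (Event G)) (n : ℤ) :
    strands s (e :: f.shift n :: L) = strands s (e :: f :: L) := by
  simp only [strands, step_shift]

/-- The statement that all the drawings of `D` with fewer events, or with the same number of events
and fewer strands, are standard. -/
def Smaller (G : Type*) [AddCommGroup G] (D : Set Torus) (l k : ℕ) : Prop :=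
  ∀ (s : 𝕋 →₀ G) (L : List (Event G)) (φ : Twist), Valid s L φ → Draw φ (picture s L) D →
    (L.length < l ∨ L.length = l ∧ strands s L < k) → IsStandard D s L

/-! ### A birth immediately followed by a death. -/

section Front

variable {D : Set Torus} {s : 𝕋 →₀ G} {e f : Event G} {L : List (Event G)} {φ : Twist}

/-- The death cannot reach beyond `e.x + 1`, where the other newborn strand stands. If it ends
exactly there, the two bars close up to an essential circle, which is all of `D`; otherwise the pair
is a zigzag and cancels. -/
theorem isStandard_of_eq (hcon : IsConnected D)
    (IH : Smaller G D (L.length + 2) (strands s (e :: f :: L))) (hV : Valid s (e :: f :: L) φ)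
    (hD : Draw φ (picture s (e :: f :: L)) D) (hc : e.cup = true) (hc' : f.cup = false)
    (hx : f.x = e.y) : IsStandard D s (e :: f :: L) := by
  have hle : f.y ≤ e.x + 1 := by
    by_contra! h
    have h1 := hV.1.2.1.between (e.x + 1) ⟨by linarith [hV.1.1.lt_add], h⟩
    rw [show ((e.x + 1 : ℝ) : 𝕋) = e.x by simp, step_left hV.1.1,
      hV.1.1.free_left hc, zero_add] at h1
    exact hV.1.1.ne h1
  rcases eq_or_lt_of_le hle with hy | hy
  · obtain ⟨rfl, rfl, hR⟩ := related_middleCurve hV hD hcon hc hc' hx hy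
    have hη := hV.1.2.1.left hc'
    rw [hx, step_right hV.1.1] at hη
    have hη : f.η = e.η := by simpa using hη.symm
    refine ⟨e.η, fun a => Or.inl rfl, fun f' hf => ?_, Or.inl ⟨by simp [total], hR⟩⟩
    simp only [List.mem_cons, List.not_mem_nil, or_false] at hf
    rcases hf with rfl | rfl
    · exact Or.inl rfl
    · exact Or.inl hη
  · have hz : IsZigzag s e f := ⟨hV.1.1, hV.1.2.1, hc, hc', hx, hy⟩
    obtain ⟨ψ, hs, hV', hD'⟩ := hz.exists_draw hV hD
    exact IsStandard.of_zigzag hz hs (IH _ _ _ hV' hD' (Or.inl (by omega)))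

/-- A longer death would pass over the newborn strand at `e.y`, and a shorter one would end where
there is no strand. So both ends agree, and the circle bounds a disc. -/
theorem false_of_left_eq (hcon : IsConnected Dᶜ) (hV : Valid s (e :: f :: L) φ)
    (hD : Draw φ (picture s (e :: f :: L)) D) (hc : e.cup = true) (hc' : f.cup = false)
    (hx : f.x = e.x) : False := by
  refine not_connected_of_trivial hV hD hcon hc hx ?_
  have h1 := hV.1.1.lt
  have h2 := hV.1.1.lt_add
  refine le_antisymm ?_ ?_
  · by_contra! h
    have := hV.1.2.1.between e.y ⟨by rw [hx]; exact h1, h⟩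
    rw [step_right hV.1.1, hV.1.1.free_right hc, zero_sub, neg_eq_zero] at this
    exact hV.1.1.ne this
  · by_contra! h
    have h3 := hV.1.2.1.lt
    have := hV.1.2.1.right hc'
    rw [step_of_ne (coe_ne_of_lt (by linarith) (by linarith)) (coe_ne_of_lt h (by linarith)).symm,
      hV.1.1.free hc _ ⟨by linarith, h.le⟩] at this
    exact hV.1.2.1.ne this.symm

theorem false_of_right_eq (hcon : IsConnected Dᶜ) (hV : Valid s (e :: f :: L) φ)
    (hD : Draw φ (picture s (e :: f :: L)) D) (hc : e.cup = true) (hc' : f.cup = false)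
    (hy : f.y = e.y) : False := by
  refine not_connected_of_trivial hV hD hcon hc ?_ hy
  have h1 := hV.1.1.lt
  have h2 := hV.1.1.lt_add
  refine le_antisymm ?_ ?_
  · by_contra! h
    have h3 := hV.1.2.1.lt
    have := hV.1.2.1.left hc'
    rw [step_of_ne (coe_ne_of_lt h (by linarith)) (coe_ne_of_lt (by linarith) (by linarith)).symm,
      hV.1.1.free hc _ ⟨h.le, by linarith⟩] at this
    exact hV.1.2.1.ne (neg_eq_zero.1 this.symm)
  · by_contra! h
    have := hV.1.2.1.between e.x ⟨h, by rw [hy]; exact h1⟩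
    rw [step_left hV.1.1, hV.1.1.free_left hc, zero_add] at this
    exact hV.1.1.ne this

/-- The ends of the two events are pairwise different. -/
structure Apart (e f : Event G) : Prop where
  xx : (f.x : 𝕋) ≠ e.x
  xy : (f.x : 𝕋) ≠ e.y
  yx : (f.y : 𝕋) ≠ e.x
  yy : (f.y : 𝕋) ≠ e.y

/-- The strands that die existed before the birth, so they stand outside the bar of the birth. If
the bars met over a point, the bar of the death would therefore contain the whole bar of the birth,
and pass over a newborn strand. -/
theorem Apart.disjoint (h : Apart e f) (he : e.Ok s) (hf : f.Ok (step s e)) (hc : e.cup = true)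
    (hc' : f.cup = false) : Disjoint e.bar f.bar := by
  rw [Set.disjoint_left]
  rintro p ⟨k, hk⟩ ⟨j, hj⟩
  have hf' := hf.shift (k - j)
  have e1 : (f.shift (k - j)).x = f.x + (k - j : ℤ) := rfl
  have e2 : (f.shift (k - j)).y = f.y + (k - j : ℤ) := rfl
  have s1 : s ((f.shift (k - j)).x : ℝ) ≠ 0 := by
    have := hf'.left hc'
    rw [e1, coe_add_int] at this ⊢
    rw [step_of_ne h.xx.symm h.xy.symm] at this
    rw [this]
    exact neg_ne_zero.2 hf.ne
  have s2 : s ((f.shift (k - j)).y : ℝ) ≠ 0 := by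
    have := hf'.right hc'
    rw [e2, coe_add_int] at this ⊢
    rw [step_of_ne h.yx.symm h.yy.symm] at this
    rw [this]
    exact hf.ne
  have b1 : (f.shift (k - j)).x ≤ p + k := by
    rw [e1]; push_cast; linarith [hj.1]
  have b2 : p + k ≤ (f.shift (k - j)).y := by
    rw [e2]; push_cast; linarith [hj.2]
  have c1 : (f.shift (k - j)).x < e.x := by
    by_contra! h3
    exact s1 (he.free hc _ ⟨h3, by linarith [hk.2]⟩)
  have c2 : e.y < (f.shift (k - j)).y := by
    by_contra! h3
    exact s2 (he.free hc _ ⟨by linarith [hk.1], h3⟩)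
  have := hf'.between e.x ⟨c1, by linarith [he.lt]⟩
  rw [step_left he, he.free_left hc, zero_add] at this
  exact he.ne this

theorem Apart.ok_swap (h : Apart e f) (he : e.Ok s) (hf : f.Ok (step s e)) (hc : e.cup = true)
    (hc' : f.cup = false) : f.Ok s ∧ e.Ok (step s f) := by
  have l : s f.x = -f.η := by rw [← step_of_ne h.xx.symm h.xy.symm, hf.left hc']
  have r : s f.y = f.η := by rw [← step_of_ne h.yx.symm h.yy.symm, hf.right hc']
  have hfree : ∀ p ∈ Icc e.x e.y, step s f p = 0 := by
    intro p hp
    have h0 := he.free hc p hp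
    rw [step_of_ne, h0]
    · intro h1
      rw [← h1, l] at h0
      exact hf.ne (neg_eq_zero.1 h0)
    · intro h1
      rw [← h1, r] at h0
      exact hf.ne h0
  refine ⟨⟨hf.ne, hf.lt, hf.lt_add, fun h => ?_, fun _ => l, fun _ => r, fun p hp => ?_⟩,
    ⟨he.ne, he.lt, he.lt_add, fun _ => hfree, fun h => ?_, fun h => ?_,
      fun p hp => hfree p (Ioo_subset_Icc_self hp)⟩⟩
  · rw [hc'] at h
    exact absurd h (by simp)
  · have h0 := hf.between p hp
    rwa [step_of_ne] at h0
    · intro h1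
      rw [← h1, step_left he, he.free_left hc, zero_add] at h0
      exact he.ne h0
    · intro h1
      rw [← h1, step_right he, he.free_right hc, zero_sub] at h0
      exact he.ne (neg_eq_zero.1 h0)
  · rw [hc] at h
    exact absurd h (by simp)
  · rw [hc] at h
    exact absurd h (by simp)

/-- The events are interchanged. The level between them now has fewer strands than `s` instead of
more, which is a gain in the second component of the induction. -/
theorem isStandard_of_apart (h : Apart e f)
    (IH : Smaller G D (L.length + 2) (strands s (e :: f :: L))) (hV : Valid s (e :: f :: L) φ)
    (hD : Draw φ (picture s (e :: f :: L)) D) (hc : e.cup = true) (hc' : f.cup = false) :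
    IsStandard D s (e :: f :: L) := by
  have hd := h.disjoint hV.1.1 hV.1.2.1 hc hc'
  obtain ⟨h1, h2⟩ := h.ok_swap hV.1.1 hV.1.2.1 hc hc'
  have hD' := hD.iso_one (Iso.picture_swap hd hV.1.1.lt.le h1.lt.le s L)
  refine IsStandard.of_swap (IH _ _ φ ⟨⟨h1, h2, ?_⟩, ?_⟩ hD' (Or.inr ⟨by simp, ?_⟩))
  · rw [step_comm]
    exact hV.1.2.2
  · have := hV.2
    rw [final_cons, final_cons] at this ⊢
    rwa [step_comm]
  · simp only [strands]
    rw [step_comm s f e]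
    have := h1.card_lt_of_cap hc'
    have := hV.1.1.card_lt_of_cup hc
    omega

/-- A birth followed by a death can be simplified. -/
theorem isStandard_of_cup_cap (hcon : IsConnected D) (hcon' : IsConnected Dᶜ)
    (IH : Smaller G D (L.length + 2) (strands s (e :: f :: L))) (hV : Valid s (e :: f :: L) φ)
    (hD : Draw φ (picture s (e :: f :: L)) D) (hc : e.cup = true) (hc' : f.cup = false) :
    IsStandard D s (e :: f :: L) := by
  have hDs : ∀ n : ℤ, Draw φ (picture s (e :: f.shift n :: L)) D := fun n => by
    rwa [picture_shift]
  by_cases h1 : (f.x : 𝕋) = e.x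
  · obtain ⟨n, hn⟩ := coe_eq_coe_iff.1 h1
    exact (false_of_left_eq hcon' (hV.shift n) (hDs n) hc hc' hn.symm).elim
  by_cases h2 : (f.y : 𝕋) = e.y
  · obtain ⟨n, hn⟩ := coe_eq_coe_iff.1 h2
    exact (false_of_right_eq hcon' (hV.shift n) (hDs n) hc hc' hn.symm).elim
  by_cases h3 : (f.x : 𝕋) = e.y
  · obtain ⟨n, hn⟩ := coe_eq_coe_iff.1 h3
    refine IsStandard.of_shift (n := n) (isStandard_of_eq hcon ?_ (hV.shift n) (hDs n) hc hc' hn.symm)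
    rwa [strands_shift]
  by_cases h4 : (f.y : 𝕋) = e.x
  · obtain ⟨n, hn⟩ := coe_eq_coe_iff.1 h4
    obtain ⟨φ', hV', hD'⟩ := exists_mirror (hV.shift n) (hDs n)
    refine IsStandard.of_shift (n := n) (IsStandard.of_mirror (isStandard_of_eq hcon ?_ hV' hD' hc hc' ?_))
    · rw [← List.map_cons, ← List.map_cons, strands_mirror, strands_shift, List.length_map]
      exact IH
    · exact congrArg Neg.neg hn.symm
  exact isStandard_of_apart ⟨h1, h3, h4, h2⟩ IH hV hD hc hc'

end Front

theorem exists_first {α : Type*} {P : α → Prop} {L : List α} (h : ∃ a ∈ L, P a) :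
    ∃ L₁ a L₂, L = L₁ ++ a :: L₂ ∧ (∀ b ∈ L₁, ¬P b) ∧ P a := by
  induction L with
  | nil => simp at h
  | cons b L ih =>
    by_cases hb : P b
    · exact ⟨[], b, L, rfl, by simp, hb⟩
    · obtain ⟨L₁, a, L₂, rfl, h1, h2⟩ := ih (by simpa [hb] using h)
      exact ⟨b :: L₁, a, L₂, rfl, by simpa [hb] using h1, h2⟩

/-! ### Rotating the list until a birth stands directly before a death. -/

section Rotation

variable {D : Set Torus} {l k : ℕ}

/-- The leading births are rotated to the end one at a time, until the last of them stands in front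
of the death. Rotation changes neither the number of events nor that of strands. -/
theorem isStandard_of_cups_cap (hcon : IsConnected D) (hcon' : IsConnected Dᶜ)
    (IH : Smaller G D l k) (L₁ L₂ : List (Event G)) (e f : Event G) {s : 𝕋 →₀ G}
    {φ : Twist} (hV : Valid s (e :: (L₁ ++ f :: L₂)) φ)
    (hD : Draw φ (picture s (e :: (L₁ ++ f :: L₂))) D) (hl : (e :: (L₁ ++ f :: L₂)).length = l)
    (hk : strands s (e :: (L₁ ++ f :: L₂)) = k) (hc : ∀ g ∈ e :: L₁, g.cup = true)
    (hc' : f.cup = false) : IsStandard D s (e :: (L₁ ++ f :: L₂)) := by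
  induction L₁ generalizing L₂ e s with
  | nil =>
    refine isStandard_of_cup_cap hcon hcon' ?_ hV hD (hc e (by simp)) hc'
    rw [List.nil_append] at hk hl
    rw [hk]
    simp only [List.length_cons] at hl
    rwa [hl]
  | cons e' L₁ ih =>
    have e1 : e' :: L₁ ++ f :: L₂ ++ [e.pull φ] = e' :: (L₁ ++ f :: (L₂ ++ [e.pull φ])) := by simp
    refine IsStandard.of_rotate hV ?_
    rw [e1]
    refine ih (L₂ ++ [e.pull φ]) e' ?_ ?_ ?_ ?_ fun g hg => hc g (List.mem_cons_of_mem _ hg)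
    · rw [← e1]; exact hV.rotate
    · rw [← e1]; exact hD.rotate hV.2
    · simp only [List.length_cons, List.length_append, List.length_nil] at hl ⊢
      omega
    · rw [← e1, strands_rotate hV.2, hk]

/-- The leading deaths are rotated away. They reappear behind the birth, so a death is still
available for `isStandard_of_cups_cap`. -/
theorem isStandard_of_caps_cup (hcon : IsConnected D) (hcon' : IsConnected Dᶜ)
    (IH : Smaller G D l k) (L₁ L₂ : List (Event G)) (e : Event G) {s : 𝕋 →₀ G}
    {φ : Twist} (hV : Valid s (L₁ ++ e :: L₂) φ)
    (hD : Draw φ (picture s (L₁ ++ e :: L₂)) D) (hl : (L₁ ++ e :: L₂).length = l)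
    (hk : strands s (L₁ ++ e :: L₂) = k) (hc : ∀ g ∈ L₁, g.cup = false)
    (hc' : e.cup = true) (hcap : ∃ f ∈ L₁ ++ L₂, f.cup = false) : IsStandard D s (L₁ ++ e :: L₂) := by
  induction L₁ generalizing L₂ s with
  | nil =>
    obtain ⟨M, f, M', rfl, h1, h2⟩ := exists_first hcap
    refine isStandard_of_cups_cap hcon hcon' IH M M' e f hV hD hl hk (fun g hg => ?_) h2
    rcases List.mem_cons.1 hg with rfl | hg
    · exact hc'
    · exact Bool.eq_true_of_not_eq_false (h1 g hg)
  | cons g L₁ ih =>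
    have e1 : L₁ ++ e :: L₂ ++ [g.pull φ] = L₁ ++ e :: (L₂ ++ [g.pull φ]) := by simp
    refine IsStandard.of_rotate (e := g) (L := L₁ ++ e :: L₂) hV ?_
    rw [e1]
    refine ih (L₂ ++ [g.pull φ]) ?_ ?_ ?_ ?_ (fun f hf => hc f (List.mem_cons_of_mem _ hf))
      ⟨g.pull φ, by simp, hc g (by simp)⟩
    · rw [← e1]; exact Valid.rotate (L := L₁ ++ e :: L₂) hV
    · rw [← e1]; exact Draw.rotate (L := L₁ ++ e :: L₂) hD hV.2
    · simp only [List.length_cons, List.length_append, List.length_nil] at hl ⊢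
      omega
    · rw [← e1]
      exact (strands_rotate (L := L₁ ++ e :: L₂) hV.2).trans hk

end Rotation

/-- The last level has as many strands as the first, while each birth raises the number and each
death lowers it. So a nonempty list contains both kinds of events; the empty list is the case of a
linear curve. -/
theorem isStandard_of_smaller {D : Set Torus} (hcon : IsConnected D) (hcon' : IsConnected Dᶜ)
    {s : 𝕋 →₀ G} {L : List (Event G)} {φ : Twist} (hV : Valid s L φ)
    (hD : Draw φ (picture s L) D) (IH : Smaller G D L.length (strands s L)) : IsStandard D s L := by
  rcases eq_or_ne L [] with rfl | hL
  · obtain ⟨g, n, m, h1, h2, h3, h4, h5⟩ := exists_linearCurve hV.2 hD hcon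
    exact ⟨g, fun a => (h3 a).imp_right Or.inl, by simp, Or.inr ⟨n, m, h1, h2, h4, h5⟩⟩
  have hlen : 0 < L.length := List.length_pos_of_ne_nil hL
  have hcard : (final s L).support.card = s.support.card := by rw [hV.2, card_support_pull]
  have h1 : ∃ e ∈ L, e.cup = true := by
    by_contra! h
    have := card_le_of_forall_cap hV.1 fun e he => Bool.eq_false_of_not_eq_true (h e he)
    omega
  have h2 : ∃ e ∈ L, e.cup = false := by
    by_contra! h
    have := card_le_of_forall_cup hV.1 fun e he => Bool.eq_true_of_not_eq_false (h e he)
    omega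
  obtain ⟨L₁, e, L₂, rfl, h3, h4⟩ := exists_first h1
  refine isStandard_of_caps_cup hcon hcon' IH L₁ L₂ e hV hD rfl rfl
    (fun g hg => Bool.eq_false_of_not_eq_true (h3 g hg)) h4 ?_
  obtain ⟨f, hf, hf'⟩ := h2
  simp only [List.mem_append, List.mem_cons] at hf ⊢
  rcases hf with hf | rfl | hf
  · exact ⟨f, Or.inl hf, hf'⟩
  · rw [h4] at hf'
    exact absurd hf' (by simp)
  · exact ⟨f, Or.inr hf, hf'⟩

/-- Every connected curve with a connected complement drawn by a sequence of events is standard. -/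
theorem isStandard_of_draw {D : Set Torus} (hcon : IsConnected D) (hcon' : IsConnected Dᶜ)
    {s : 𝕋 →₀ G} {L : List (Event G)} {φ : Twist} (hV : Valid s L φ)
    (hD : Draw φ (picture s L) D) : IsStandard D s L := by
  -- Induction in the lexicographic order: first the number of events, then the total number of
  -- strands.
  have key : ∀ l k, Smaller G D l k := by
    intro l
    induction l using Nat.strong_induction_on with
    | _ l ihl =>
      intro k
      induction k using Nat.strong_induction_on with
      | _ k ihk =>
        rintro s L φ hV hD (h | ⟨rfl, h⟩)
        · exact isStandard_of_smaller hcon hcon' hV hD (ihl _ h _)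
        · exact isStandard_of_smaller hcon hcon' hV hD (ihk _ h)
  exact isStandard_of_smaller hcon hcon' hV hD (key _ _)

/-! ### Recognizing the picture of a sequence of events -/

/-- The part above the level `α`, with its time rescaled. -/
def rescale (α : ℝ) (A : Set (ℝ × ℝ)) : Set (ℝ × ℝ) := {v | (v.1, α + (1 - α) * v.2) ∈ A}

/-- The polygon through `(0, 0)`, `(μ, 1/2)` and `(1, 1)` is concave for `μ ≤ 1/2` and convex for `μ
≥ 1/2`, so it is the minimum or the maximum of its two lines. Comparing it with `t` gives the
identity outside `[0, 1]`. -/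
theorem exists_time {μ : ℝ} (h0 : 0 < μ) (h1 : μ < 1) : ∃ g : ℝ → ℝ, Continuous g ∧ StrictMono g ∧
    (∀ t ≤ 0, g t = t) ∧ (∀ t, 1 ≤ t → g t = t) ∧ (∀ t ∈ Icc 0 μ, g t = t / μ / 2) ∧
    ∀ t ∈ Icc μ 1, g t = (1 + (t - μ) / (1 - μ)) / 2 := by
  have d1 : 0 < 1 - μ := by linarith
  have e1 : ∀ t, t / μ / 2 = 1 / (2 * μ) * t + 0 := fun t => by field_simp; ring
  have e2 : ∀ t, (1 + (t - μ) / (1 - μ)) / 2 = 1 / (2 * (1 - μ)) * t + (1 / 2 - μ / (2 * (1 - μ))) :=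
    fun t => by field_simp; ring
  have m1 : StrictMono fun t : ℝ => t / μ / 2 := by
    simp only [e1]
    exact strictMono_affine (by positivity) _
  have m2 : StrictMono fun t : ℝ => (1 + (t - μ) / (1 - μ)) / 2 := by
    simp only [e2]
    exact strictMono_affine (by positivity) _
  have c1 : ∀ t, t / μ / 2 * (2 * μ) = t := fun t => by field_simp
  have c2 : ∀ t, (1 + (t - μ) / (1 - μ)) / 2 * (2 * (1 - μ)) = 1 + t - 2 * μ := fun t => by
    field_simp
    ring
  rcases le_total μ (1 / 2) with h | h
  · refine ⟨fun t => max t (min (t / μ / 2) ((1 + (t - μ) / (1 - μ)) / 2)), by fun_prop,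
      strictMono_max strictMono_id (strictMono_min m1 m2), fun t ht => ?_, fun t ht => ?_,
      fun t ht => ?_, fun t ht => ?_⟩
    · refine max_eq_left (min_le_of_left_le ?_)
      nlinarith [c1 t]
    · refine max_eq_left (min_le_of_right_le ?_)
      nlinarith [c2 t]
    · simp only
      rw [min_eq_left, max_eq_right]
      · nlinarith [c1 t, ht.1]
      · have := c1 t
        have := c2 t
        have : 0 ≤ (μ - t) * (1 - 2 * μ) := mul_nonneg (by linarith [ht.2]) (by linarith)
        by_contra! h4
        nlinarith [mul_pos h0 d1, mul_pos (mul_pos h0 d1) (sub_pos.2 h4)]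
    · simp only
      rw [min_eq_right, max_eq_right]
      · nlinarith [c2 t, ht.2]
      · have := c1 t
        have := c2 t
        have : 0 ≤ (t - μ) * (1 - 2 * μ) := mul_nonneg (by linarith [ht.1]) (by linarith)
        by_contra! h4
        nlinarith [mul_pos h0 d1, mul_pos (mul_pos h0 d1) (sub_pos.2 h4)]
  · refine ⟨fun t => min t (max (t / μ / 2) ((1 + (t - μ) / (1 - μ)) / 2)), by fun_prop,
      strictMono_min strictMono_id (strictMono_max m1 m2), fun t ht => ?_, fun t ht => ?_,
      fun t ht => ?_, fun t ht => ?_⟩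
    · refine min_eq_left (le_max_of_le_left ?_)
      nlinarith [c1 t]
    · refine min_eq_left (le_max_of_le_right ?_)
      nlinarith [c2 t]
    · simp only
      rw [max_eq_left, min_eq_right]
      · nlinarith [c1 t, ht.1]
      · have := c1 t
        have := c2 t
        have : 0 ≤ (μ - t) * (2 * μ - 1) := mul_nonneg (by linarith [ht.2]) (by linarith)
        by_contra! h4
        nlinarith [mul_pos h0 d1, mul_pos (mul_pos h0 d1) (sub_pos.2 h4)]
    · simp only
      rw [max_eq_right, min_eq_right]
      · nlinarith [c2 t, ht.2]
      · have := c1 t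
        have := c2 t
        have : 0 ≤ (t - μ) * (2 * μ - 1) := mul_nonneg (by linarith [ht.1]) (by linarith)
        by_contra! h4
        nlinarith [mul_pos h0 d1, mul_pos (mul_pos h0 d1) (sub_pos.2 h4)]

/-- The set `A` above the level `α` consists of the strands and bars of a sequence of events. -/
def IsPicture : ℝ → (𝕋 →₀ G) → List (Event G) → Set (ℝ × ℝ) → Prop
  | α, s, [], A => ∀ p : ℝ, ∀ t ∈ Icc α 1, (p, t) ∈ A ↔ s p ≠ 0
  | α, s, e :: L, A => ∃ (m : ℝ) (u : ℝ → ℝ), IsGraph u ∧ (∀ p, α < u p ∧ u p < m) ∧ m < 1 ∧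
      (∀ p : ℝ, ∀ t ∈ Icc α m, (p, t) ∈ A ↔ (p, t) ∈ gslab u s (step s e) e.bar) ∧
      IsPicture m (step s e) L A

/-- The level `m` above the first event is moved to the middle. The part below is then a slab up to
the shape of its horizon, and the part above is treated by induction. -/
theorem IsPicture.iso {α : ℝ} {s : 𝕋 →₀ G} {L : List (Event G)} {A : Set (ℝ × ℝ)}
    (h : IsPicture α s L A) (h0 : 0 ≤ α) (h1 : α < 1) : Iso 1 1 (rescale α A) (picture s L) := by
  induction L generalizing α s with
  | nil =>
    refine Iso.of_eqOn ?_
    rintro ⟨p, t⟩ ht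
    exact h p _ ⟨by nlinarith [ht.1], by nlinarith [ht.2]⟩
  | cons e L ih =>
    obtain ⟨m, u, hu, hum, hm1, hA, hL⟩ := h
    have hαm : α < m := (hum 0).1.trans (hum 0).2
    have d1 : 0 < 1 - α := by linarith
    have d2 : 0 < m - α := by linarith
    have d3 : 0 < 1 - m := by linarith
    obtain ⟨g, gc, gm, g0, g1, gl, gr⟩ := exists_time (μ := (m - α) / (1 - α)) (div_pos d2 d1)
      ((div_lt_one d1).2 (by linarith))
    have hv : IsGraph fun p => (u p - α) / (m - α) := by
      refine ⟨(hu.cont.sub continuous_const).div_const _, fun p => by rw [hu.per], fun p => ?_,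
        fun p => ?_⟩
      · exact div_pos (by linarith [(hum p).1]) d2
      · exact (div_lt_one d2).2 (by linarith [(hum p).2])
    have hstack : Iso 1 1 (rescale α A)
        (stack (gslab (fun p => (u p - α) / (m - α)) s (step s e) e.bar) (rescale m A)) := by
      refine Iso.time gc gm g0 g1 fun p t ht => ?_
      rw [mem_stack]
      have low : ∀ p t : ℝ, t ∈ Icc (0 : ℝ) 1 → ((p, t) ∈ gslab (fun p => (u p - α) / (m - α)) s (step s e) e.bar ↔
          (p, α + (m - α) * t) ∈ A) := by
        intro p t ht
        rw [hA p _ ⟨by nlinarith [ht.1], by nlinarith [ht.2]⟩, mem_gslab, mem_gslab]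
        have a1 : t ≤ (u p - α) / (m - α) ↔ α + (m - α) * t ≤ u p := by
          rw [le_div_iff₀ d2]
          constructor <;> intro h <;> linarith
        have a2 : (u p - α) / (m - α) ≤ t ↔ u p ≤ α + (m - α) * t := by
          rw [div_le_iff₀ d2]
          constructor <;> intro h <;> linarith
        have a3 : t = (u p - α) / (m - α) ↔ α + (m - α) * t = u p := by
          rw [eq_div_iff d2.ne']
          constructor <;> intro h <;> linarith
        rw [a1, a2, a3]
      have e1 : (m - α) / (1 - α) * (1 - α) = m - α := div_mul_cancel₀ _ d1.ne'
      have e2 : 1 - (m - α) / (1 - α) = (1 - m) / (1 - α) := by field_simp; ring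
      have cl : t ≤ (m - α) / (1 - α) → (g t ≤ 1 / 2 ∧ 2 * g t = t / ((m - α) / (1 - α))) := by
        intro h
        rw [gl t ⟨ht.1, h⟩]
        refine ⟨?_, by ring⟩
        have := (div_le_one (div_pos d2 d1)).2 h
        linarith
      have cr : (m - α) / (1 - α) ≤ t → (1 / 2 ≤ g t ∧
          2 * g t - 1 = (t - (m - α) / (1 - α)) / (1 - (m - α) / (1 - α))) := by
        intro h
        rw [gr t ⟨h, ht.2⟩]
        refine ⟨?_, by ring⟩
        have : 0 ≤ (t - (m - α) / (1 - α)) / (1 - (m - α) / (1 - α)) :=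
          div_nonneg (by linarith) (by rw [e2]; exact (div_pos d3 d1).le)
        linarith
      have vl : t ≤ (m - α) / (1 - α) → ((p, 2 * g t) ∈ gslab (fun p => (u p - α) / (m - α)) s (step s e) e.bar ↔
          (p, t) ∈ rescale α A) := by
        intro h
        rw [(cl h).2, low]
        · have : α + (m - α) * (t / ((m - α) / (1 - α))) = α + (1 - α) * t := by field_simp
          rw [this]
          rfl
        · exact ⟨div_nonneg ht.1 (div_pos d2 d1).le, (div_le_one (div_pos d2 d1)).2 h⟩
      have vr : (m - α) / (1 - α) ≤ t → ((p, 2 * g t - 1) ∈ rescale m A ↔ (p, t) ∈ rescale α A) := by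
        intro h
        rw [(cr h).2, e2]
        have : m + (1 - m) * ((t - (m - α) / (1 - α)) / ((1 - m) / (1 - α))) = α + (1 - α) * t := by
          field_simp
          ring
        rw [rescale, mem_ofPred_eq, this]
        rfl
      constructor
      · intro h
        rcases le_total t ((m - α) / (1 - α)) with h2 | h2
        · exact Or.inl ⟨(cl h2).1, (vl h2).2 h⟩
        · exact Or.inr ⟨(cr h2).1, (vr h2).2 h⟩
      · have gμ : g ((m - α) / (1 - α)) = 1 / 2 := by
          rw [gl _ ⟨(div_pos d2 d1).le, le_rfl⟩, div_self (div_pos d2 d1).ne']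
        rintro (⟨h2, h3⟩ | ⟨h2, h3⟩)
        · rw [← gμ, gm.le_iff_le] at h2
          exact (vl h2).1 h3
        · rw [← gμ, gm.le_iff_le] at h2
          exact (vr h2).1 h3
    refine hstack.trans_one (Iso.stack (Iso.gslab hv (isGraph_const (by norm_num) (by norm_num)) _ _ _)
      (ih hL (by linarith) hm1))

theorem IsPicture.iso_zero {s : 𝕋 →₀ G} {L : List (Event G)} {A : Set (ℝ × ℝ)}
    (h : IsPicture 0 s L A) : Iso 1 1 A (picture s L) := by
  convert! h.iso le_rfl one_pos using 1
  ext ⟨p, t⟩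
  simp [rescale]

/-! ### Nested arcs -/

/-- The distance from the center of the ends of the `j`-th arc of a nest. -/
noncomputable def radius (d j : ℕ) : ℝ := (j + 1 / 2) / d

/-- The profile of the straightened `j`-th arc of a nest of `a` arcs. -/
noncomputable def bend (a d j : ℕ) (y : ℝ) : ℝ := (radius d j - y / (2 * a + 1)) / 3

/-- The points at distance `y` from the center and height `t` on the straightened `j`-th arc. -/
def Hook (a d j : ℕ) (y t : ℝ) : Prop :=
  (y = radius d j ∧ t ≤ bend a d j y) ∨ (y ≤ radius d j ∧ t = bend a d j y)

/-- The least height of the profile of the `j`-th arc. -/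
noncomputable def shoulder (a d j : ℕ) : ℝ := bend a d j (radius d j)

section

variable {a d : ℕ}

theorem radius_pos (hd : 0 < d) (j : ℕ) : 0 < radius d j := by
  have : (0 : ℝ) < d := by exact_mod_cast hd
  unfold radius
  positivity

theorem radius_strictMono (hd : 0 < d) : StrictMono (radius d) := by
  intro i j hij
  have : (0 : ℝ) < d := by exact_mod_cast hd
  have : (i : ℝ) < j := by exact_mod_cast hij
  unfold radius
  gcongr

theorem radius_lt_half (hd : 0 < d) (had : 2 * a ≤ d) {j : ℕ} (hj : j < a) : radius d j < 1 / 2 := by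
  have h0 : (0 : ℝ) < d := by exact_mod_cast hd
  have h1 : (2 : ℝ) * a ≤ d := by exact_mod_cast had
  have h2 : (j : ℝ) + 1 ≤ a := by exact_mod_cast hj
  rw [radius, div_lt_iff₀ h0]
  linarith

theorem div_le_half (hd : 0 < d) (had : 2 * a ≤ d) : (a : ℝ) / d ≤ 1 / 2 := by
  have h : (2 : ℝ) * a ≤ d := by exact_mod_cast had
  rw [div_le_iff₀ (by exact_mod_cast hd)]
  linarith

theorem bend_le (j : ℕ) {y : ℝ} (hy : 0 ≤ y) : bend a d j y ≤ radius d j / 3 := by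
  have : 0 ≤ y / (2 * a + 1) := by positivity
  unfold bend
  linarith

theorem shoulder_le (j : ℕ) {y : ℝ} (hy : y ≤ radius d j) : shoulder a d j ≤ bend a d j y := by
  have : y / (2 * a + 1) ≤ radius d j / (2 * a + 1) := by gcongr
  unfold shoulder bend
  linarith

/-- The denominator `2 a + 1` in `bend` makes the tilt so small that the bar of the `j`-th arc stays
between the heights `j / (3 d)` and `(j + 1) / (3 d)`. So the bars of a nest occur at different
times, in the order of `j`; the extra term leaves room for a level between two consecutive bars. -/
theorem lt_shoulder (hd : 0 < d) {j : ℕ} (hj : j < a) :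
    (j + 1 / (2 * (2 * a + 1))) / d / 3 < shoulder a d j := by
  have h0 : (0 : ℝ) < d := by exact_mod_cast hd
  have h2 : (j : ℝ) + 1 ≤ a := by exact_mod_cast hj
  unfold shoulder bend radius
  rw [div_right_comm _ (d : ℝ) (2 * (a : ℝ) + 1), ← sub_div]
  gcongr
  have h3 : (0 : ℝ) < 2 * a + 1 := by positivity
  have e1 : (1 / (2 * (2 * a + 1)) : ℝ) = 1 / 2 / (2 * a + 1) := by field_simp
  rw [e1, lt_sub_iff_add_lt, add_assoc, ← add_div]
  have : (1 / 2 + ((j : ℝ) + 1 / 2)) / (2 * a + 1) < 1 / 2 := by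
    rw [div_lt_iff₀ h3]
    linarith
  linarith

theorem radius_lt (hd : 0 < d) (j : ℕ) : radius d j < ((j + 1 : ℕ) : ℝ) / d := by
  have h0 : (0 : ℝ) < d := by exact_mod_cast hd
  unfold radius
  push_cast
  gcongr
  norm_num

theorem lt_radius (hd : 0 < d) (j : ℕ) : (j : ℝ) / d < radius d j := by
  have h0 : (0 : ℝ) < d := by exact_mod_cast hd
  unfold radius
  gcongr
  norm_num

end

/-- A level whose strands are at the positions `Q + (k + 1/2) / d`, with weights which are opposite at
the ends of the arcs of a nest with center `Q`. -/
structure IsNest (a d : ℕ) (Q : ℝ) (S : 𝕋 →₀ G) : Prop where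
  pos : 0 < d
  le : 2 * a ≤ d
  supp : ∀ z : ℝ, S z ≠ 0 ↔ ∃ k : ℤ, z = Q + (k + 1 / 2) / d
  anti : ∀ j < a, S ((Q - radius d j : ℝ) : 𝕋) = -S ((Q + radius d j : ℝ) : 𝕋)

open Classical in
/-- The strands which do not belong to the first `j` arcs of the nest. -/
noncomputable def nest (d : ℕ) (Q : ℝ) (S : 𝕋 →₀ G) (j : ℕ) : 𝕋 →₀ G :=
  S.filter fun z => (j : ℝ) / d ≤ ‖z - (Q : 𝕋)‖

/-- The death of the strands at the ends of an arc. -/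
noncomputable def capEvent (d : ℕ) (Q : ℝ) (S : 𝕋 →₀ G) (j : ℕ) : Event G :=
  ⟨false, Q - radius d j, Q + radius d j, S ((Q + radius d j : ℝ) : 𝕋)⟩

/-- The birth of the strands at the ends of an arc. -/
noncomputable def cupEvent (d : ℕ) (Q : ℝ) (S : 𝕋 →₀ G) (j : ℕ) : Event G :=
  ⟨true, Q - radius d j, Q + radius d j, S ((Q - radius d j : ℝ) : 𝕋)⟩

/-- The deaths at the ends of `n` arcs of a nest, starting from the `j`-th one. -/
noncomputable def caps (d : ℕ) (Q : ℝ) (S : 𝕋 →₀ G) : ℕ → ℕ → List (Event G)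
  | _, 0 => []
  | j, n + 1 => capEvent d Q S j :: caps d Q S (j + 1) n

/-- The births at the ends of the first `n` arcs of a nest. -/
noncomputable def cups (d : ℕ) (Q : ℝ) (S : 𝕋 →₀ G) : ℕ → List (Event G)
  | 0 => []
  | n + 1 => cupEvent d Q S n :: cups d Q S n

theorem norm_coe_of_abs_le {v : ℝ} (hv : |v| ≤ 1 / 2) : ‖(v : 𝕋)‖ = |v| :=
  (AddCircle.norm_coe_eq_abs_iff (1 : ℝ) one_ne_zero).2 (by simpa using hv)

theorem exists_of_norm_eq {v ρ : ℝ} (h : ‖(v : 𝕋)‖ = ρ) :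
    ∃ n : ℤ, v = -ρ + n ∨ v = ρ + n := by
  rw [UnitAddCircle.norm_eq] at h
  refine ⟨round v, ?_⟩
  rcases abs_choice (v - round v) with h1 | h1
  · right; linarith
  · left; linarith

section

variable {a d : ℕ} {Q : ℝ} {S : 𝕋 →₀ G}

theorem nest_coe (j : ℕ) (z : ℝ) : nest d Q S j z =
    if (j : ℝ) / d ≤ ‖((z - Q : ℝ) : 𝕋)‖ then S z else 0 := by
  classical
  rw [nest, Finsupp.filter_apply, ← AddCircle.coe_sub]

theorem nest_zero : nest d Q S 0 = S := by
  refine level_ext fun p => ?_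
  rw [nest_coe, if_pos (by simp)]

theorem mem_bar_arc {G : Type*} {d j : ℕ} {Q p : ℝ} {η : G} {c : Bool} : p ∈ (⟨c, Q - radius d j, Q + radius d j, η⟩ : Event G).bar ↔
    ‖((p - Q : ℝ) : 𝕋)‖ ≤ radius d j := by
  constructor
  · rintro ⟨k, h1, h2⟩
    simp only at h1 h2
    have := norm_coe_le (p - Q) (-k)
    refine this.trans (abs_le.2 ⟨?_, ?_⟩) <;> push_cast <;> linarith
  · intro h
    rw [UnitAddCircle.norm_eq, abs_le] at h
    refine ⟨-round (p - Q), ?_, ?_⟩ <;> push_cast <;> linarith [h.1, h.2]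

namespace IsNest

theorem exists_radius (h : IsNest a d Q S) {z : ℝ} (hz : S z ≠ 0) :
    ∃ i : ℕ, ‖((z - Q : ℝ) : 𝕋)‖ = radius d i := by
  have h0 : (0 : ℝ) < d := by exact_mod_cast h.pos
  obtain ⟨k, rfl⟩ := (h.supp z).1 hz
  rw [add_sub_cancel_left, UnitAddCircle.norm_eq]
  set n := round (((k : ℝ) + 1 / 2) / d)
  have e1 : ((k : ℝ) + 1 / 2) / d - n = ((k - d * n : ℤ) + 1 / 2) / d := by
    push_cast
    field_simp
    ring
  rw [e1, abs_div, abs_of_pos h0]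
  generalize k - d * n = K
  rcases le_or_gt 0 K with hK | hK
  · refine ⟨K.toNat, ?_⟩
    have : ((K.toNat : ℕ) : ℝ) = K := by exact_mod_cast Int.toNat_of_nonneg hK
    have hK' : (0 : ℝ) ≤ K := by exact_mod_cast hK
    rw [radius, this, abs_of_pos (by linarith)]
  · refine ⟨(-K - 1).toNat, ?_⟩
    have : (((-K - 1).toNat : ℕ) : ℝ) = -K - 1 := by
      exact_mod_cast Int.toNat_of_nonneg (show 0 ≤ -K - 1 by omega)
    have hK' : (K : ℝ) ≤ -1 := by exact_mod_cast Int.le_sub_one_of_lt hK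
    rw [radius, this, abs_of_neg (by linarith)]
    congr 1
    ring

theorem norm_left (h : IsNest a d Q S) {j : ℕ} (hj : j < a) :
    ‖((Q - radius d j - Q : ℝ) : 𝕋)‖ = radius d j := by
  have h1 := radius_pos h.pos j
  have h2 := radius_lt_half h.pos h.le hj
  rw [sub_right_comm, sub_self, zero_sub, norm_coe_of_abs_le] <;> rw [abs_neg, abs_of_pos h1]
  exact h2.le

theorem norm_right (h : IsNest a d Q S) {j : ℕ} (hj : j < a) :
    ‖((Q + radius d j - Q : ℝ) : 𝕋)‖ = radius d j := by
  have h1 := radius_pos h.pos j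
  have h2 := radius_lt_half h.pos h.le hj
  rw [add_sub_cancel_left, norm_coe_of_abs_le] <;> rw [abs_of_pos h1]
  exact h2.le

theorem ne_zero_of_norm (h : IsNest a d Q S) {j : ℕ} {z : ℝ}
    (hz : ‖((z - Q : ℝ) : 𝕋)‖ = radius d j) : S z ≠ 0 := by
  have h0 : (0 : ℝ) < d := by exact_mod_cast h.pos
  obtain ⟨n, hn | hn⟩ := exists_of_norm_eq hz
  · refine (h.supp z).2 ⟨-j - 1 + d * n, ?_⟩
    rw [sub_eq_iff_eq_add'.1 hn, radius]
    push_cast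
    field_simp
    ring
  · refine (h.supp z).2 ⟨j + d * n, ?_⟩
    rw [sub_eq_iff_eq_add'.1 hn, radius]
    push_cast
    field_simp
    ring

theorem left_ne_zero (h : IsNest a d Q S) {j : ℕ} (hj : j < a) :
    S ((Q - radius d j : ℝ) : 𝕋) ≠ 0 := h.ne_zero_of_norm (h.norm_left hj)

theorem right_ne_zero (h : IsNest a d Q S) {j : ℕ} (hj : j < a) :
    S ((Q + radius d j : ℝ) : 𝕋) ≠ 0 := h.ne_zero_of_norm (h.norm_right hj)

theorem radius_of_le (h : IsNest a d Q S) {i j : ℕ} : (j : ℝ) / d ≤ radius d i ↔ j ≤ i := by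
  have h0 : (0 : ℝ) < d := by exact_mod_cast h.pos
  rw [radius, div_le_div_iff_of_pos_right h0]
  constructor
  · intro h1
    have : (j : ℝ) < i + 1 := by linarith
    have : j < i + 1 := by exact_mod_cast this
    omega
  · intro h1
    have : (j : ℝ) ≤ i := by exact_mod_cast h1
    linarith

theorem nest_ne_zero_iff (h : IsNest a d Q S) {j : ℕ} {z : ℝ} : nest d Q S j z ≠ 0 ↔
    ∃ i, j ≤ i ∧ ‖((z - Q : ℝ) : 𝕋)‖ = radius d i := by
  rw [nest_coe]
  constructor
  · intro h1
    split_ifs at h1 with h2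
    · obtain ⟨i, hi⟩ := h.exists_radius h1
      rw [hi, h.radius_of_le] at h2
      exact ⟨i, h2, hi⟩
    · exact absurd rfl h1
  · rintro ⟨i, h1, h2⟩
    rw [h2, if_pos (h.radius_of_le.2 h1)]
    exact h.ne_zero_of_norm h2

theorem nest_eq_add (h : IsNest a d Q S) {j : ℕ} (hj : j < a) : nest d Q S j = nest d Q S (j + 1) +
    (Finsupp.single ((Q - radius d j : ℝ) : 𝕋) (S ((Q - radius d j : ℝ) : 𝕋)) +
      Finsupp.single ((Q + radius d j : ℝ) : 𝕋)
        (S ((Q + radius d j : ℝ) : 𝕋))) := by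
  classical
  have hne : ((Q - radius d j : ℝ) : 𝕋) ≠ ((Q + radius d j : ℝ) : 𝕋) :=
    coe_ne_of_lt (by linarith [radius_pos h.pos j]) (by linarith [radius_lt_half h.pos h.le hj])
  have val : ∀ (m : ℕ) (z : ℝ) (i : ℕ), ‖((z - Q : ℝ) : 𝕋)‖ = radius d i →
      nest d Q S m z = if m ≤ i then S z else 0 := fun m z i hi => by
    rw [nest_coe, hi]
    simp only [h.radius_of_le]
  refine level_ext fun z => ?_
  rw [Finsupp.add_apply, Finsupp.add_apply, Finsupp.single_apply, Finsupp.single_apply]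
  by_cases h1 : ((Q - radius d j : ℝ) : 𝕋) = z
  · rw [if_pos h1, ← h1, if_neg hne.symm, val _ _ j (h.norm_left hj), val _ _ j (h.norm_left hj),
      if_pos le_rfl, if_neg (by omega), zero_add, add_zero]
  by_cases h2 : ((Q + radius d j : ℝ) : 𝕋) = z
  · rw [if_pos h2, ← h2, if_neg hne, val _ _ j (h.norm_right hj), val _ _ j (h.norm_right hj),
      if_pos le_rfl, if_neg (by omega), zero_add, zero_add]
  rw [if_neg h1, if_neg h2, add_zero, add_zero]
  by_cases hz : S z = 0
  · rw [nest_coe, nest_coe, hz, ite_self, ite_self]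
  obtain ⟨i, hi⟩ := h.exists_radius hz
  have hij : i ≠ j := by
    rintro rfl
    obtain ⟨n, hn | hn⟩ := exists_of_norm_eq hi
    · refine h1 (coe_eq_coe_iff.2 ⟨n, by linarith⟩)
    · refine h2 (coe_eq_coe_iff.2 ⟨n, by linarith⟩)
  rw [val _ _ i hi, val _ _ i hi]
  have : j ≤ i ↔ j + 1 ≤ i := by omega
  simp only [this]

theorem step_cap (h : IsNest a d Q S) {j : ℕ} (hj : j < a) :
    step (nest d Q S j) (capEvent d Q S j) = nest d Q S (j + 1) := by
  rw [step, h.nest_eq_add hj, capEvent, h.anti j hj, Finsupp.single_neg]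
  abel

theorem step_cup (h : IsNest a d Q S) {j : ℕ} (hj : j < a) :
    step (nest d Q S (j + 1)) (cupEvent d Q S j) = nest d Q S j := by
  rw [step, h.nest_eq_add hj, cupEvent, h.anti j hj, Finsupp.single_neg, Finsupp.single_neg]
  abel

theorem nest_eq_zero (h : IsNest a d Q S) {j : ℕ} {z : ℝ}
    (hz : z ∈ Icc (Q - radius d j) (Q + radius d j)) : nest d Q S (j + 1) z = 0 := by
  rw [nest_coe, if_neg, ]
  rw [not_le]
  refine lt_of_le_of_lt ?_ (radius_lt h.pos j)
  have := norm_coe_le (z - Q) 0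
  refine this.trans (abs_le.2 ⟨?_, ?_⟩) <;> push_cast <;> linarith [hz.1, hz.2]

theorem nest_eq_zero_of_mem_Ioo (h : IsNest a d Q S) {j : ℕ} {z : ℝ}
    (hz : z ∈ Ioo (Q - radius d j) (Q + radius d j)) : nest d Q S j z = 0 := by
  by_contra h1
  obtain ⟨i, h2, h3⟩ := h.nest_ne_zero_iff.1 h1
  have h4 := norm_coe_le (z - Q) 0
  have h5 : |z - Q - (0 : ℤ)| < radius d j := by
    refine abs_lt.2 ⟨?_, ?_⟩ <;> push_cast <;> linarith [hz.1, hz.2]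
  have h6 := (radius_strictMono h.pos).monotone h2
  linarith

theorem ok_cap (h : IsNest a d Q S) {j : ℕ} (hj : j < a) :
    (capEvent d Q S j).Ok (nest d Q S j) := by
  have h1 := radius_pos h.pos j
  have h2 := radius_lt_half h.pos h.le hj
  refine ⟨h.right_ne_zero hj, ?_, ?_, fun hc => by simp [capEvent] at hc, fun _ => ?_, fun _ => ?_,
    fun z hz => h.nest_eq_zero_of_mem_Ioo hz⟩
  · simp only [capEvent]; linarith
  · simp only [capEvent]; linarith
  · simp only [capEvent]
    rw [nest_coe, h.norm_left hj, if_pos (lt_radius h.pos j).le, h.anti j hj]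
  · simp only [capEvent]
    rw [nest_coe, h.norm_right hj, if_pos (lt_radius h.pos j).le]

theorem ok_cup (h : IsNest a d Q S) {j : ℕ} (hj : j < a) :
    (cupEvent d Q S j).Ok (nest d Q S (j + 1)) := by
  have h1 := radius_pos h.pos j
  have h2 := radius_lt_half h.pos h.le hj
  refine ⟨h.left_ne_zero hj, ?_, ?_, fun _ z hz => h.nest_eq_zero hz, fun hc => by simp [cupEvent] at hc,
    fun hc => by simp [cupEvent] at hc, fun z hz => h.nest_eq_zero (Ioo_subset_Icc_self hz)⟩
  · simp only [cupEvent]; linarith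
  · simp only [cupEvent]; linarith

theorem okList_caps (h : IsNest a d Q S) {j n : ℕ} (hn : j + n ≤ a) :
    OkList (nest d Q S j) (caps d Q S j n) ∧ final (nest d Q S j) (caps d Q S j n) =
      nest d Q S (j + n) := by
  induction n generalizing j with
  | zero => exact ⟨trivial, rfl⟩
  | succ n ih =>
    rw [caps, final_cons, OkList, h.step_cap (by omega)]
    have := ih (j := j + 1) (by omega)
    exact ⟨⟨h.ok_cap (by omega), this.1⟩, by rw [this.2]; congr 1; omega⟩

theorem okList_cups (h : IsNest a d Q S) {n : ℕ} (hn : n ≤ a) :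
    OkList (nest d Q S n) (cups d Q S n) ∧ final (nest d Q S n) (cups d Q S n) = S := by
  induction n with
  | zero => exact ⟨trivial, nest_zero⟩
  | succ n ih =>
    rw [cups, final_cons, OkList, h.step_cup (by omega)]
    exact ⟨⟨h.ok_cup (by omega), (ih (by omega)).1⟩, (ih (by omega)).2⟩

/-- The part of the straightened nest at the heights of the `j`-th arc. -/
theorem hook_slice (h : IsNest a d Q S) {j : ℕ} (hj : j < a) {z t : ℝ}
    (hlow : ∀ i < j, radius d i / 3 < t) (hup : ∀ i, j < i → i < a → t < shoulder a d i) :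
    (nest d Q S a z ≠ 0 ∨ ∃ i < a, Hook a d i ‖((z - Q : ℝ) : 𝕋)‖ t) ↔
      (nest d Q S j z ≠ 0 ∧ t ≤ bend a d j (min ‖((z - Q : ℝ) : 𝕋)‖ (radius d j))) ∨
      (nest d Q S (j + 1) z ≠ 0 ∧ bend a d j (min ‖((z - Q : ℝ) : 𝕋)‖ (radius d j)) ≤ t) ∨
      (‖((z - Q : ℝ) : 𝕋)‖ ≤ radius d j ∧
        t = bend a d j (min ‖((z - Q : ℝ) : 𝕋)‖ (radius d j))) := by
  simp only [h.nest_ne_zero_iff]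
  have hy : 0 ≤ ‖((z - Q : ℝ) : 𝕋)‖ := norm_nonneg _
  generalize ‖((z - Q : ℝ) : 𝕋)‖ = y at hy
  constructor
  · rintro (⟨i, hi, hyi⟩ | ⟨i, hi, hH⟩)
    · exact (le_total t (bend a d j (min y (radius d j)))).imp (fun h1 => ⟨⟨i, by omega, hyi⟩, h1⟩)
        (fun h1 => Or.inl ⟨⟨i, by omega, hyi⟩, h1⟩)
    · rcases lt_trichotomy i j with hij | rfl | hij
      · have h1 := hlow i hij
        have h2 := bend_le (a := a) (d := d) i hy
        rcases hH with ⟨-, hH⟩ | ⟨-, hH⟩ <;> linarith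
      · rcases hH with ⟨rfl, hH⟩ | ⟨hyi, hH⟩
        · exact Or.inl ⟨⟨i, le_rfl, rfl⟩, by rwa [min_self]⟩
        · exact Or.inr (Or.inr ⟨hyi, by rwa [min_eq_left hyi]⟩)
      · have h1 := hup i hij hi
        rcases hH with ⟨rfl, hH⟩ | ⟨hyi, hH⟩
        · exact (le_total t (bend a d j (min (radius d i) (radius d j)))).imp
            (fun h1 => ⟨⟨i, by omega, rfl⟩, h1⟩) (fun h1 => Or.inl ⟨⟨i, by omega, rfl⟩, h1⟩)
        · have := shoulder_le (a := a) i hyi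
          linarith
  · have key : ∀ i, j < i → y = radius d i → (∃ i, a ≤ i ∧ y = radius d i) ∨
        ∃ i < a, Hook a d i y t := by
      intro i hij hyi
      by_cases hi : a ≤ i
      · exact Or.inl ⟨i, hi, hyi⟩
      · push Not at hi
        refine Or.inr ⟨i, hi, Or.inl ⟨hyi, ?_⟩⟩
        rw [hyi]
        exact (hup i hij hi).le
    rintro (⟨⟨i, hi, hyi⟩, ht⟩ | ⟨⟨i, hi, hyi⟩, ht⟩ | ⟨hyi, ht⟩)
    · rcases eq_or_lt_of_le hi with rfl | hij
      · rw [← hyi, min_self] at ht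
        exact Or.inr ⟨j, hj, Or.inl ⟨hyi, ht⟩⟩
      · exact key i hij hyi
    · exact key i hi hyi
    · rw [min_eq_left hyi] at ht
      exact Or.inr ⟨j, hj, Or.inr ⟨hyi, ht⟩⟩

end IsNest

end

theorem OkList.pull {s : 𝕋 →₀ G} {L : List (Event G)} (h : OkList s L) (φ : Twist) :
    OkList (pull φ s) (L.map (Event.pull φ)) := by
  induction L generalizing s with
  | nil => trivial
  | cons e L ih => exact ⟨h.1.pull φ, by rw [step_pull]; exact ih h.2⟩

theorem final_pull (φ : Twist) (s : 𝕋 →₀ G) (L : List (Event G)) :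
    final (pull φ s) (L.map (Event.pull φ)) = pull φ (final s L) := by
  induction L generalizing s with
  | nil => rfl
  | cons e L ih => rw [List.map_cons, final_cons, final_cons, step_pull, ih]

/-! ### The picture of two nests -/

section

variable {a d : ℕ} {P Q : ℝ} {S : 𝕋 →₀ G} {χ : Twist} {A : Set (ℝ × ℝ)}

/-- The set `A` consists of a nest at the bottom, another one at the top, and of vertical strands. -/
def IsDoubleNest (a d : ℕ) (P Q : ℝ) (S : 𝕋 →₀ G) (χ : Twist) (A : Set (ℝ × ℝ)) : Prop :=
  ∀ p : ℝ, ∀ t ∈ Icc (0 : ℝ) 1, (p, t) ∈ A ↔ nest d P S a p ≠ 0 ∨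
    (∃ i < a, Hook a d i ‖((χ p - Q : ℝ) : 𝕋)‖ t) ∨
      ∃ i < a, Hook a d i ‖((p - P : ℝ) : 𝕋)‖ (1 - t)

theorem isGraph_norm {f : ℝ → ℝ} (hf : Continuous f) (hp : ∀ p, f (p + 1) = f p + 1)
    {u : ℝ → ℝ} (hu : Continuous u) (Q : ℝ)
    (h01 : ∀ y, 0 ≤ y → u y ∈ Ioo (0 : ℝ) 1) : IsGraph fun p => u ‖((f p - Q : ℝ) : 𝕋)‖ := by
  have hcoe : Continuous fun x : ℝ => (x : 𝕋) := AddCircle.continuous_mk' 1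
  refine ⟨?_, fun p => ?_, fun p => (h01 _ (norm_nonneg _)).1,
    fun p => (h01 _ (norm_nonneg _)).2⟩
  · have : Continuous fun p : ℝ => ((f p - Q : ℝ) : 𝕋) :=
      hcoe.comp (hf.sub continuous_const)
    fun_prop
  · rw [hp, show f p + 1 - Q = f p - Q + (1 : ℤ) by push_cast; ring, coe_add_int]

theorem hook_le (hd : 0 < d) {i : ℕ} (hi : i < a) {y t : ℝ} (hy : 0 ≤ y) (h : Hook a d i y t) :
    t < a / d / 3 := by
  have h1 := bend_le (a := a) (d := d) i hy
  have h2 : radius d i < a / d := (radius_lt hd i).trans_le (by gcongr; exact hi)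
  rcases h with ⟨-, h⟩ | ⟨-, h⟩ <;> linarith

theorem continuous_bend (a d j : ℕ) : Continuous fun y => bend a d j (min y (radius d j)) := by
  unfold bend
  fun_prop

theorem bend_min_mem (hd : 0 < d) {j : ℕ} {y : ℝ} (hy : 0 ≤ y) :
    bend a d j (min y (radius d j)) ∈ Icc (shoulder a d j) (radius d j / 3) :=
  ⟨shoulder_le j (min_le_right _ _), bend_le j (le_min hy (radius_pos hd j).le)⟩

/-- The upper nest hangs from the top, so its outermost arc reaches lowest and is born first. The
hypotheses on `α` say that it separates the arcs with numbers below `n`, still to be born, from the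
others. -/
theorem isPicture_cups (hP : IsNest a d P S) (hA : IsDoubleNest a d P Q S χ A) {n : ℕ} (hn : n ≤ a)
    {α : ℝ} (h0 : (a : ℝ) / d / 3 ≤ α) (h1 : ∀ i, i < n → radius d i / 3 < 1 - α)
    (h2 : ∀ i, n ≤ i → i < a → 1 - α < shoulder a d i) :
    IsPicture α (nest d P S n) (cups d P S n) A := by
  have hd := hP.pos
  have hd' : (0 : ℝ) < d := by exact_mod_cast hd
  have hlow : ∀ p t : ℝ, t ∈ Icc α 1 → ((p, t) ∈ A ↔ nest d P S a p ≠ 0 ∨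
      ∃ i < a, Hook a d i ‖((p - P : ℝ) : 𝕋)‖ (1 - t)) := by
    intro p t ht
    have hα : 0 ≤ α := le_trans (by positivity) h0
    rw [hA p t ⟨hα.trans ht.1, ht.2⟩]
    refine or_congr_right (or_iff_right ?_)
    rintro ⟨i, hi, hH⟩
    have := hook_le hd hi (norm_nonneg _) hH
    linarith [ht.1]
  induction n generalizing α with
  | zero =>
    intro p t ht
    rw [hlow p t ht]
    simp only [hP.nest_ne_zero_iff]
    constructor
    · rintro (⟨i, hi, hyi⟩ | ⟨i, hi, hH⟩)
      · exact ⟨i, by omega, hyi⟩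
      · refine ⟨i, by omega, ?_⟩
        rcases hH with ⟨h, -⟩ | ⟨h3, h4⟩
        · exact h
        · have := h2 i (by omega) hi
          have := shoulder_le (a := a) i h3
          linarith [ht.1]
    · rintro ⟨i, -, hyi⟩
      by_cases hi : i < a
      · refine Or.inr ⟨i, hi, Or.inl ⟨hyi, ?_⟩⟩
        have := h2 i (by omega) hi
        have := shoulder_le (a := a) (d := d) i hyi.le
        linarith [ht.1]
      · exact Or.inl ⟨i, by omega, hyi⟩
  | succ n ih =>
    have hna : n < a := hn
    -- the level between the arcs
    set m : ℝ := (n + 1 / (2 * (2 * a + 1))) / d / 3 with hm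
    have hm0 : 0 < m := by positivity
    have hm1 := lt_shoulder hd hna
    have hmr : ∀ i, i < n → radius d i / 3 < m := by
      intro i hi
      have h3 : radius d i ≤ n / d := (radius_lt hd i).le.trans (by gcongr; exact hi)
      have h4 : (n : ℝ) / d < (n + 1 / (2 * (2 * a + 1))) / d := by
        gcongr
        have : (0 : ℝ) < 1 / (2 * (2 * a + 1)) := by positivity
        linarith
      rw [hm]
      linarith
    have hr2 := radius_lt_half hd hP.le hna
    have hr3 : shoulder a d n ≤ radius d n / 3 := bend_le n (radius_pos hd n).le
    have had := div_le_half hd hP.le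
    refine ⟨1 - m, fun p => 1 - bend a d n (min ‖((p - P : ℝ) : 𝕋)‖ (radius d n)), ?_, ?_, ?_,
      ?_, ?_⟩
    · refine isGraph_norm (u := fun y => 1 - bend a d n (min y (radius d n))) continuous_id (fun _ => rfl)
        (continuous_const.sub (continuous_bend a d n)) P fun y hy => ?_
      have h3 := bend_min_mem (a := a) (j := n) hd hy
      exact ⟨by linarith [h3.2], by linarith [h3.1]⟩
    · intro p
      have h3 := bend_min_mem (a := a) (j := n) hd (norm_nonneg ((p - P : ℝ) : 𝕋))
      have h4 := h1 n (by omega)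
      exact ⟨by linarith [h3.2], by linarith [h3.1]⟩
    · linarith
    · intro p t ht
      rw [hlow p t ⟨ht.1, by linarith [ht.2]⟩, hP.hook_slice hna (t := 1 - t)
        (fun i hi => by linarith [hmr i hi, ht.2]) (fun i hi hia => by linarith [h2 i hi hia, ht.1]),
        mem_gslab, hP.step_cup hna, cupEvent, mem_bar_arc]
      have e1 (b : ℝ) : 1 - t ≤ b ↔ 1 - b ≤ t := by constructor <;> intro h <;> linarith
      have e2 (b : ℝ) : b ≤ 1 - t ↔ t ≤ 1 - b := by constructor <;> intro h <;> linarith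
      have e3 (b : ℝ) : 1 - t = b ↔ t = 1 - b := by constructor <;> intro h <;> linarith
      rw [e1, e2, e3]
      tauto
    · rw [hP.step_cup hna]
      refine ih hna.le ?_ ?_ ?_ ?_
      · linarith
      · intro i hi
        rw [sub_sub_cancel]
        exact hmr i hi
      · intro i hi hia
        rw [sub_sub_cancel]
        refine lt_of_le_of_lt ?_ (lt_shoulder hd hia)
        have : (n : ℝ) ≤ i := by exact_mod_cast hi
        rw [hm]
        gcongr
      · intro p t ht
        refine hlow p t ⟨?_, ht.2⟩
        linarith [h1 n (by omega), ht.1]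

/-- The `j`-th arc of the lower nest dies between the levels `j / (3 d)` and `(j + 1) / (3 d)`,
innermost arc first. When the nest is used up, the level consists of the through strands, and the
births of the upper nest follow. -/
theorem isPicture_caps (hP : IsNest a d P S) (hQ : IsNest a d Q S) (hA : IsDoubleNest a d P Q S χ A)
    (hT : pull χ (nest d Q S a) = nest d P S a) {j n : ℕ} (hn : j + n = a) :
    IsPicture ((j : ℝ) / d / 3) (pull χ (nest d Q S j))
      ((caps d Q S j n).map (Event.pull χ) ++ cups d P S a) A := by
  have hd := hP.pos
  have hd' : (0 : ℝ) < d := by exact_mod_cast hd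
  have had := div_le_half hd hP.le
  induction n generalizing j with
  | zero =>
    obtain rfl : j = a := hn
    rw [hT, caps, List.map_nil, List.nil_append]
    refine isPicture_cups hP hA le_rfl le_rfl (fun i hi => ?_) (fun i h1 h2 => by omega)
    have := radius_lt_half hd hP.le hi
    linarith
  | succ n ih =>
    have hja : j < a := by omega
    have hr2 := radius_lt_half hd hP.le hja
    have hr1 := radius_lt hd j
    have lo : ∀ i : ℕ, i < a → (i : ℝ) / d / 3 < shoulder a d i := by
      intro i hi
      refine lt_of_le_of_lt ?_ (lt_shoulder hd hi)
      have : (0 : ℝ) ≤ 1 / (2 * (2 * a + 1)) := by positivity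
      gcongr
      linarith
    have hj1 : ((j + 1 : ℕ) : ℝ) / d ≤ a / d := by gcongr; omega
    have hj0 : (0 : ℝ) ≤ j / d / 3 := by positivity
    have hstep : step (pull χ (nest d Q S j)) ((capEvent d Q S j).pull χ) =
        pull χ (nest d Q S (j + 1)) := by rw [step_pull, hQ.step_cap hja]
    refine ⟨((j + 1 : ℕ) : ℝ) / d / 3,
      fun p => bend a d j (min ‖((χ p - Q : ℝ) : 𝕋)‖ (radius d j)), ?_, ?_, ?_, ?_, ?_⟩
    · refine isGraph_norm (u := fun y => bend a d j (min y (radius d j))) χ.continuous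
        (CircleDeg1Lift.map_add_one _) (continuous_bend a d j) Q fun y hy => ?_
      have h3 := bend_min_mem (a := a) (j := j) hd hy
      exact ⟨by linarith [h3.1, lo j hja], by linarith [h3.2]⟩
    · intro p
      have h3 := bend_min_mem (a := a) (j := j) hd (norm_nonneg ((χ p - Q : ℝ) : 𝕋))
      exact ⟨by linarith [h3.1, lo j hja], by linarith [h3.2]⟩
    · linarith
    · intro p t ht
      have hlevel : nest d P S a p ≠ 0 ↔ nest d Q S a ((χ p : ℝ) : 𝕋) ≠ 0 := by
        rw [← hT, pull_coe]
      rw [hA p t ⟨hj0.trans ht.1, by linarith [ht.2]⟩, ← or_assoc, or_iff_left, hlevel,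
        hQ.hook_slice hja, hstep, mem_gslab, pull_coe, pull_coe, mem_bar_pull, capEvent, mem_bar_arc]
      · intro i hi
        have : radius d i < j / d := (radius_lt hd i).trans_le (by gcongr; exact hi)
        linarith [ht.1]
      · intro i hi hia
        refine lt_of_le_of_lt (ht.2.trans ?_) (lo i hia)
        gcongr
        exact hi
      · rintro ⟨i, hi, hH⟩
        have := hook_le hd hi (norm_nonneg _) hH
        linarith [ht.2]
    · rw [hstep]
      exact ih (by omega)

theorem valid_doubleNest (hP : IsNest a d P S) (hQ : IsNest a d Q S)
    (hT : pull χ (nest d Q S a) = nest d P S a) :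
    Valid (pull χ S) ((caps d Q S 0 a).map (Event.pull χ) ++ cups d P S a) χ⁻¹ := by
  have h1 := hQ.okList_caps (j := 0) (n := a) (by omega)
  have h2 := hP.okList_cups (n := a) le_rfl
  rw [nest_zero, zero_add] at h1
  have h3 : final (pull χ S) ((caps d Q S 0 a).map (Event.pull χ)) = nest d P S a := by
    rw [final_pull, h1.2, hT]
  refine ⟨okList_append.2 ⟨h1.1.pull χ, by rw [h3]; exact h2.1⟩, ?_⟩
  rw [final_append, h3, h2.2]
  refine level_ext fun p => ?_
  rw [pull_coe, pull_coe, CircleDeg1Lift.units_apply_inv_apply]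

theorem iso_doubleNest (hP : IsNest a d P S) (hQ : IsNest a d Q S) (hA : IsDoubleNest a d P Q S χ A)
    (hT : pull χ (nest d Q S a) = nest d P S a) :
    Iso 1 1 A (picture (pull χ S) ((caps d Q S 0 a).map (Event.pull χ) ++ cups d P S a)) := by
  have := isPicture_caps hP hQ hA hT (j := 0) (n := a) (by omega)
  rw [nest_zero, Nat.cast_zero, zero_div, zero_div] at this
  exact this.iso_zero

end

/-! ### Straightening a nest of arcs -/

/-- The inverse of the map which straightens the arcs of a nest, on the distances from the center. -/
noncomputable def crush (a d : ℕ) (τ y : ℝ) : ℝ :=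
  max (max (y - 3 * τ) (min y ((2 * a + 1) * (y - a / d) + a / d))) (y / (2 * a + 1))

/-- The odd extension of `crush`. -/
noncomputable def oddCrush (a d : ℕ) (τ v : ℝ) : ℝ :=
  crush a d τ (max v 0) - crush a d τ (max (-v) 0)

section

variable {a d : ℕ}

theorem crush_strictMono (τ : ℝ) : StrictMono (crush a d τ) := by
  have h3 : (0 : ℝ) < 2 * a + 1 := by positivity
  refine strictMono_max (strictMono_max (fun y z h => ?_) (strictMono_min strictMono_id fun y z h => ?_))
    fun y z h => ?_
  · linarith
  · nlinarith
  · exact div_lt_div_of_pos_right h h3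

theorem crush_zero {τ : ℝ} (hτ : 0 ≤ τ) : crush a d τ 0 = 0 := by
  have h1 : (0 : ℝ) ≤ a / d := by positivity
  have h2 : (0 : ℝ) ≤ a := by positivity
  rw [crush, zero_div]
  refine max_eq_right (max_le (by linarith) (min_le_left _ _))

theorem crush_of_le {τ y : ℝ} (hτ : 0 ≤ τ) (hy : (a : ℝ) / d ≤ y) : crush a d τ y = y := by
  have h1 : (0 : ℝ) ≤ a / d := by positivity
  have h2 : (0 : ℝ) ≤ a := by positivity
  have h3 : (0 : ℝ) < 2 * a + 1 := by positivity
  have h4 : y / (2 * a + 1) ≤ y := div_le_self (by linarith) (by linarith)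
  have h5 : y ≤ (2 * a + 1) * (y - a / d) + a / d := by nlinarith
  rw [crush, min_eq_left h5, max_eq_right (a := y - 3 * τ) (by linarith), max_eq_left h4]

theorem crush_zero_left {y : ℝ} (hy : 0 ≤ y) : crush a d 0 y = y := by
  have h2 : (0 : ℝ) ≤ a := by positivity
  have h4 : y / (2 * a + 1) ≤ y := div_le_self hy (by linarith)
  rw [crush, mul_zero, sub_zero, max_eq_left (min_le_left _ _), max_eq_left h4]

/-- Up to the largest radius `(a - 1/2) / d` only two terms of `crush` count: `y - 3 t` produces the
leg of the hook, and `y / (2 a + 1)`, which keeps the map injective where the plain shift would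
collapse it, produces the tilted bar. The slope `2 a + 1` in the third term is large enough for it
to take effect only between that radius and `a / d`, beyond which the map is the identity. -/
theorem crush_eq_iff (hd : 0 < d) {j : ℕ} (hj : j < a) {t y : ℝ} (hy : 0 ≤ y) :
    crush a d t y = radius d j - 3 * t ↔ Hook a d j y t := by
  have hd' : (0 : ℝ) < d := by exact_mod_cast hd
  have h3 : (0 : ℝ) < 2 * a + 1 := by positivity
  have h0 : 0 ≤ y / (2 * a + 1) := by positivity
  have key : y ≤ radius d j → crush a d t y = max (y - 3 * t) (y / (2 * a + 1)) := by
    intro h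
    have h4 : y ≤ a / d - 1 / (2 * d) := by
      refine h.trans ?_
      have : (j : ℝ) + 1 ≤ a := by exact_mod_cast hj
      rw [radius, show (a : ℝ) / d - 1 / (2 * d) = (a - 1 / 2) / d by field_simp]
      gcongr
      linarith
    have h5 : (2 * a + 1) * (y - a / d) + a / d ≤ y / (2 * a + 1) := by
      have e1 : (2 * a + 1) * (y - a / d) ≤ (2 * a + 1) * (-(1 / (2 * d))) := by gcongr; linarith
      have e2 : (2 * (a : ℝ) + 1) * (-(1 / (2 * d))) + a / d = -(1 / (2 * d)) := by field_simp; ring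
      have e3 : (0 : ℝ) ≤ 1 / (2 * d) := by positivity
      linarith
    have h6 : min y ((2 * a + 1) * (y - a / d) + a / d) ≤ y / (2 * a + 1) :=
      (min_le_right _ _).trans h5
    rw [crush, max_assoc, max_eq_right h6]
  constructor
  · intro h
    have h1 : y - 3 * t ≤ crush a d t y := (le_max_left _ _).trans (le_max_left _ _)
    have h2 : y ≤ radius d j := by linarith
    rw [key h2] at h
    rcases le_total (y / (2 * a + 1)) (y - 3 * t) with h4 | h4
    · rw [max_eq_left h4] at h
      refine Or.inl ⟨by linarith, ?_⟩
      rw [bend]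
      linarith
    · rw [max_eq_right h4] at h
      refine Or.inr ⟨h2, ?_⟩
      rw [bend]
      linarith
  · rintro (⟨h1, h2⟩ | ⟨h1, h2⟩)
    · rw [key h1.le, h1, max_eq_left]
      rw [bend, h1] at h2
      linarith
    · rw [key h1, max_eq_right] <;> rw [bend] at h2 <;> linarith

theorem continuous_oddCrush (a d : ℕ) : Continuous fun v : ℝ × ℝ => oddCrush a d v.1 v.2 := by
  unfold oddCrush crush
  fun_prop

theorem oddCrush_strictMono (τ : ℝ) : StrictMono (oddCrush a d τ) := by
  intro v w h
  have hm := (crush_strictMono (a := a) (d := d) τ)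
  unfold oddCrush
  have h1 : crush a d τ (max v 0) ≤ crush a d τ (max w 0) := hm.monotone (max_le_max h.le le_rfl)
  have h2 : crush a d τ (max (-w) 0) ≤ crush a d τ (max (-v) 0) :=
    hm.monotone (max_le_max (by linarith) le_rfl)
  rcases lt_or_ge 0 w with hw | hw
  · have := hm (show max v 0 < max w 0 from max_lt (lt_max_of_lt_left h) (lt_max_of_lt_left hw))
    linarith
  · have := hm (show max (-w) 0 < max (-v) 0 from
      max_lt (lt_max_of_lt_left (by linarith)) (lt_max_of_lt_left (by linarith)))
    linarith

theorem oddCrush_of_nonneg {τ v : ℝ} (hτ : 0 ≤ τ) (hv : 0 ≤ v) : oddCrush a d τ v = crush a d τ v := by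
  rw [oddCrush, max_eq_left hv, max_eq_right (by linarith), crush_zero hτ, sub_zero]

theorem oddCrush_of_nonpos {τ v : ℝ} (hτ : 0 ≤ τ) (hv : v ≤ 0) :
    oddCrush a d τ v = -crush a d τ (-v) := by
  rw [oddCrush, max_eq_right hv, max_eq_left (by linarith), crush_zero hτ, zero_sub]

theorem crush_nonneg {τ y : ℝ} (hτ : 0 ≤ τ) (hy : 0 ≤ y) : 0 ≤ crush a d τ y := by
  rw [← crush_zero hτ]
  exact (crush_strictMono τ).monotone hy

theorem abs_oddCrush {τ : ℝ} (hτ : 0 ≤ τ) (v : ℝ) : |oddCrush a d τ v| = crush a d τ |v| := by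
  rcases le_total 0 v with h | h
  · rw [oddCrush_of_nonneg hτ h, abs_of_nonneg h, abs_of_nonneg (crush_nonneg hτ h)]
  · rw [oddCrush_of_nonpos hτ h, abs_of_nonpos h, abs_neg,
      abs_of_nonneg (crush_nonneg hτ (by linarith))]

theorem oddCrush_of_le {τ v : ℝ} (hτ : 0 ≤ τ) (hv : (a : ℝ) / d ≤ |v|) : oddCrush a d τ v = v := by
  rcases le_total 0 v with h | h
  · rw [abs_of_nonneg h] at hv
    rw [oddCrush_of_nonneg hτ h, crush_of_le hτ hv]
  · rw [abs_of_nonpos h] at hv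
    rw [oddCrush_of_nonpos hτ h, crush_of_le hτ hv, neg_neg]

theorem oddCrush_zero (v : ℝ) : oddCrush a d 0 v = v := by
  rcases le_total 0 v with h | h
  · rw [oddCrush_of_nonneg le_rfl h, crush_zero_left h]
  · rw [oddCrush_of_nonpos le_rfl h, crush_zero_left (by linarith), neg_neg]

/-- A family of homeomorphisms of the line which bends vertical lines to the arcs of a nest. -/
structure IsBending (a d : ℕ) (Q : ℝ) (f : ℝ → ℝ → ℝ) : Prop where
  cont : Continuous fun v : ℝ × ℝ => f v.1 v.2
  mono : ∀ t, StrictMono (f t)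
  per : ∀ t p, f t (p + 1) = f t p + 1
  eq : ∀ τ, 0 ≤ τ → ∀ v, |v| ≤ 1 / 2 → f τ (Q + v) = Q + oddCrush a d τ v

/-- The odd extension of `crush` about `Q` is the identity at distances from `a / d` on, in
particular at distance `1/2`, so it continues periodically. Negative times are cut off at `0`. -/
theorem exists_isBending (hd : 0 < d) (had : 2 * a ≤ d) (Q : ℝ) : ∃ f, IsBending a d Q f := by
  have had' := div_le_half hd had
  have hc := continuous_oddCrush a d
  obtain ⟨f, h1, h2, h3, h4⟩ := exists_family_of_Icc (a := Q - 1 / 2)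
    (g := fun τ p => Q + oddCrush a d (max τ 0) (p - Q))
    (continuous_const.add (hc.comp (by fun_prop : Continuous fun v : ℝ × ℝ => (max v.1 0, v.2 - Q))))
    (fun τ p q h => by
      have := oddCrush_strictMono (a := a) (d := d) (max τ 0) (show p - Q < q - Q by linarith)
      linarith)
    (fun τ => by
      rw [oddCrush_of_le (le_max_right _ _), oddCrush_of_le (le_max_right _ _)]
      · ring
      · rw [show Q - 1 / 2 - Q = -(1 / 2) by ring, abs_neg, abs_of_pos (by norm_num)]
        exact had'
      · rw [show Q - 1 / 2 + 1 - Q = 1 / 2 by ring, abs_of_pos (by norm_num)]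
        exact had')
  refine ⟨f, h1, h2, h3, fun τ hτ v hv => ?_⟩
  rw [abs_le] at hv
  rw [h4 τ _ ⟨by linarith [hv.1], by linarith [hv.2]⟩, max_eq_left hτ, add_sub_cancel_left]

theorem exists_eq_add (Q z : ℝ) : ∃ (v : ℝ) (m : ℤ), |v| ≤ 1 / 2 ∧ z = Q + v + m ∧
    ‖((z - Q : ℝ) : 𝕋)‖ = |v| := by
  refine ⟨z - Q - round (z - Q), round (z - Q), abs_sub_round _, by ring, ?_⟩
  rw [UnitAddCircle.norm_eq]

namespace IsBending

variable {Q : ℝ} {f : ℝ → ℝ → ℝ}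

theorem apply_zero (h : IsBending a d Q f) (z : ℝ) : f 0 z = z := by
  obtain ⟨v, m, hv, rfl, -⟩ := exists_eq_add Q z
  rw [add_int_of_add_one (h.per 0), h.eq 0 le_rfl v hv, oddCrush_zero]

theorem apply_of_le (h : IsBending a d Q f) {τ z : ℝ} (hτ : 0 ≤ τ)
    (hz : (a : ℝ) / d ≤ ‖((z - Q : ℝ) : 𝕋)‖) : f τ z = z := by
  obtain ⟨v, m, hv, rfl, hn⟩ := exists_eq_add Q z
  rw [hn] at hz
  rw [add_int_of_add_one (h.per τ), h.eq τ hτ v hv, oddCrush_of_le hτ hz]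

theorem exists_abs_iff (h : IsBending a d Q f) (hd : 0 < d) (had : 2 * a ≤ d) {j : ℕ} (hj : j < a)
    {t : ℝ} (ht : 0 ≤ t) (z : ℝ) : (∃ n : ℤ, |f t z + n - Q| = radius d j - 3 * t) ↔
      Hook a d j ‖((z - Q : ℝ) : 𝕋)‖ t := by
  have hr := radius_lt_half hd had hj
  have had' := div_le_half hd had
  obtain ⟨v, m, hv, rfl, hn⟩ := exists_eq_add Q z
  rw [hn, ← crush_eq_iff hd hj (abs_nonneg v), add_int_of_add_one (h.per t), h.eq t ht v hv,
    ← abs_oddCrush ht]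
  have hb : |oddCrush a d t v| ≤ 1 / 2 := by
    rw [abs_oddCrush ht]
    refine ((crush_strictMono t).monotone hv).trans_eq ?_
    exact crush_of_le ht had'
  generalize oddCrush a d t v = w at hb
  rw [abs_le] at hb
  constructor
  · rintro ⟨n, hn⟩
    rw [show Q + w + m + n - Q = w + (m + n : ℤ) by push_cast; ring] at hn
    have hlt : |w + (m + n : ℤ)| < 1 / 2 := by linarith
    rw [abs_lt] at hlt
    have k1 : (-1 : ℝ) < (m + n : ℤ) := by linarith [hb.2, hlt.1]
    have k2 : ((m + n : ℤ) : ℝ) < 1 := by linarith [hb.1, hlt.2]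
    have k1 : -1 < m + n := by exact_mod_cast k1
    have k2 : m + n < 1 := by exact_mod_cast k2
    have k0 : m + n = 0 := by omega
    rwa [k0, Int.cast_zero, add_zero] at hn
  · intro h1
    refine ⟨-m, ?_⟩
    rw [← h1]
    congr 1
    push_cast
    ring

end IsBending

end

/-! ### The arcs of the diagram -/

theorem mem_segment_iff {x₀ t₀ x₁ t₁ x t : ℝ} (h : t₀ < t₁) : (x, t) ∈ segment ℝ (x₀, t₀) (x₁, t₁) ↔
    t ∈ Icc t₀ t₁ ∧ (x - x₀) * (t₁ - t₀) = (x₁ - x₀) * (t - t₀) := by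
  have hpos : 0 < t₁ - t₀ := by linarith
  constructor
  · rintro ⟨α, β, hα, hβ, hαβ, e⟩
    have e1 : α * x₀ + β * x₁ = x := congrArg Prod.fst e
    have e2 : α * t₀ + β * t₁ = t := congrArg Prod.snd e
    obtain rfl : α = 1 - β := by linarith
    subst e1 e2
    exact ⟨⟨by nlinarith, by nlinarith⟩, by ring⟩
  · rintro ⟨⟨h1, h2⟩, h3⟩
    refine ⟨(t₁ - t) / (t₁ - t₀), (t - t₀) / (t₁ - t₀), div_nonneg (by linarith) hpos.le,
      div_nonneg (by linarith) hpos.le, ?_, ?_⟩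
    · rw [← add_div, div_eq_one_iff_eq hpos.ne']
      ring
    · refine Prod.ext ?_ ?_
      · simp only [Prod.fst_add, Prod.smul_fst, smul_eq_mul]
        field_simp
        linarith
      · simp only [Prod.snd_add, Prod.smul_snd, smul_eq_mul]
        field_simp
        ring

/-- The height of the tip is a third of the radius for every arc. So all the arcs of the nest are
level curves of the single function `|x - x₀| + 3 t`, and one bending straightens all of them. -/
theorem mem_lowerArc {d : ℕ} (hd : 0 < d) {r : ℤ} {q : ℕ} {x t : ℝ} :
    (x, t) ∈ lowerArc d r q ↔ 0 ≤ t ∧ |x - (-(1 / 2) - r) / d| = radius d q - 3 * t := by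
  have hd' : (0 : ℝ) < d := by exact_mod_cast hd
  have hr := radius_pos hd q
  have e1 : ((q : ℝ) - r) / d = (-(1 / 2) - r) / d + radius d q := by
    rw [radius]
    field_simp
    ring
  have e2 : (-1 - (q : ℝ) - r) / d = (-(1 / 2) - r) / d - radius d q := by
    rw [radius]
    field_simp
    ring
  have e3 : (2 * (q : ℝ) + 1) / (6 * d) = radius d q / 3 := by
    rw [radius]
    field_simp
    ring
  have e4 : ((-1 / 2 : ℝ) - r) / d = (-(1 / 2) - r) / d := by ring
  rw [lowerArc, mem_union, pt, pt, pt, e1, e2, e3, e4,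
    mem_segment_iff (by linarith), segment_symm, mem_segment_iff (by linarith)]
  generalize (-(1 / 2) - (r : ℝ)) / d = x₀
  generalize radius d q = c at hr
  have c3 : (0 : ℝ) < c / 3 := by positivity
  have i1 : (x - (x₀ + c)) * (c / 3 - 0) = (x₀ - (x₀ + c)) * (t - 0) ↔ x - x₀ = c - 3 * t := by
    constructor
    · intro h
      have : (c / 3) * (x - x₀ - (c - 3 * t)) = 0 := by linarith
      have := (mul_eq_zero.1 this).resolve_left c3.ne'
      linarith
    · intro h
      rw [show x - (x₀ + c) = -(3 * t) by linarith]
      ring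
  have i2 : (x - (x₀ - c)) * (c / 3 - 0) = (x₀ - (x₀ - c)) * (t - 0) ↔ -(x - x₀) = c - 3 * t := by
    constructor
    · intro h
      have : (c / 3) * (x - x₀ + (c - 3 * t)) = 0 := by linarith
      have := (mul_eq_zero.1 this).resolve_left c3.ne'
      linarith
    · intro h
      rw [show x - (x₀ - c) = 3 * t by linarith]
      ring
  rw [i1, i2]
  constructor
  · rintro (⟨h1, h2⟩ | ⟨h1, h2⟩)
    · exact ⟨h1.1, by rw [abs_of_nonneg (by linarith [h1.2])]; exact h2⟩
    · exact ⟨h1.1, by rw [abs_of_nonpos (by linarith [h1.2])]; exact h2⟩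
  · rintro ⟨h1, h2⟩
    have h3 := abs_nonneg (x - x₀)
    rcases abs_choice (x - x₀) with h4 | h4
    · exact Or.inl ⟨⟨h1, by linarith⟩, by linarith⟩
    · exact Or.inr ⟨⟨h1, by linarith⟩, by linarith⟩

theorem mem_upperArc {d : ℕ} (hd : 0 < d) {q : ℕ} {x t : ℝ} :
    (x, t) ∈ upperArc d q ↔ t ≤ 1 ∧ |x - (-(1 / 2)) / d| = radius d q - 3 * (1 - t) := by
  have hd' : (0 : ℝ) < d := by exact_mod_cast hd
  have hr := radius_pos hd q
  have e1 : (q : ℝ) / d = (-(1 / 2)) / d + radius d q := by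
    rw [radius]
    field_simp
    ring
  have e2 : (-1 - (q : ℝ)) / d = (-(1 / 2)) / d - radius d q := by
    rw [radius]
    field_simp
    ring
  have e3 : (2 * (q : ℝ) + 1) / (6 * d) = radius d q / 3 := by
    rw [radius]
    field_simp
    ring
  have e4 : (-1 / 2 : ℝ) / d = (-(1 / 2)) / d := by ring
  rw [upperArc, mem_union, pt, pt, pt, e1, e2, e3, e4, segment_symm,
    mem_segment_iff (by linarith), mem_segment_iff (by linarith)]
  generalize (-(1 / 2) : ℝ) / d = x₀
  generalize radius d q = c at hr
  have c3 : (0 : ℝ) < c / 3 := by positivity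
  have i1 : (x - x₀) * (1 - (1 - c / 3)) = (x₀ + c - x₀) * (t - (1 - c / 3)) ↔
      x - x₀ = c - 3 * (1 - t) := by
    constructor
    · intro h
      have : (c / 3) * (x - x₀ - (c - 3 * (1 - t))) = 0 := by linarith
      have := (mul_eq_zero.1 this).resolve_left c3.ne'
      linarith
    · intro h
      rw [h]
      ring
  have i2 : (x - x₀) * (1 - (1 - c / 3)) = (x₀ - c - x₀) * (t - (1 - c / 3)) ↔
      -(x - x₀) = c - 3 * (1 - t) := by
    constructor
    · intro h
      have : (c / 3) * (x - x₀ + (c - 3 * (1 - t))) = 0 := by linarith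
      have := (mul_eq_zero.1 this).resolve_left c3.ne'
      linarith
    · intro h
      rw [show x - x₀ = -(c - 3 * (1 - t)) by linarith]
      ring
  rw [i1, i2]
  constructor
  · rintro (⟨h1, h2⟩ | ⟨h1, h2⟩)
    · exact ⟨h1.2, by rw [abs_of_nonneg (by linarith [h1.1])]; exact h2⟩
    · exact ⟨h1.2, by rw [abs_of_nonpos (by linarith [h1.1])]; exact h2⟩
  · rintro ⟨h1, h2⟩
    have h3 := abs_nonneg (x - x₀)
    rcases abs_choice (x - x₀) with h4 | h4
    · exact Or.inl ⟨⟨by linarith, h1⟩, by linarith⟩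
    · exact Or.inr ⟨⟨by linarith, h1⟩, by linarith⟩

/-- The time parameter of the middle third. -/
noncomputable def midTime (t : ℝ) : ℝ := max 0 (min 1 (3 * t - 1))

theorem midTime_of_le {t : ℝ} (h : t ≤ 1 / 3) : midTime t = 0 :=
  max_eq_left (min_le_of_right_le (by linarith))

theorem midTime_of_ge {t : ℝ} (h : 2 / 3 ≤ t) : midTime t = 1 := by
  rw [midTime, min_eq_left (by linarith), max_eq_right zero_le_one]

theorem midTime_of_mem {t : ℝ} (h : 1 / 3 ≤ t) (h' : t ≤ 2 / 3) : midTime t = 3 * t - 1 := by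
  rw [midTime, min_eq_right (by linarith), max_eq_right (by linarith)]

theorem midTime_mem (t : ℝ) : midTime t ∈ Icc (0 : ℝ) 1 :=
  ⟨le_max_left _ _, max_le zero_le_one (min_le_left _ _)⟩

theorem mem_throughArc {d : ℕ} {x y z t : ℝ} : (z, t) ∈ throughArc d x y ↔
    t ∈ Icc (0 : ℝ) 1 ∧ z = midTime t * (x / d) + (1 - midTime t) * (y / d) := by
  rw [throughArc, mem_union, mem_union, pt, pt, pt, pt, segment_symm, mem_segment_iff (by norm_num),
    segment_symm, mem_segment_iff (by norm_num), segment_symm, mem_segment_iff (by norm_num)]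
  generalize x / d = x
  generalize y / d = y
  constructor
  · rintro ((⟨h, e⟩ | ⟨h, e⟩) | ⟨h, e⟩)
    · rw [midTime_of_ge h.1]
      exact ⟨⟨by linarith [h.1], h.2⟩, by linarith⟩
    · rw [midTime_of_mem h.1 h.2]
      exact ⟨⟨by linarith [h.1], by linarith [h.2]⟩, by linarith⟩
    · rw [midTime_of_le h.2]
      exact ⟨⟨h.1, by linarith [h.2]⟩, by linarith⟩
  · rintro ⟨h, rfl⟩
    rcases le_total t (1 / 3) with h1 | h1
    · rw [midTime_of_le h1]
      exact Or.inr ⟨⟨h.1, h1⟩, by ring⟩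
    · rcases le_total t (2 / 3) with h2 | h2
      · rw [midTime_of_mem h1 h2]
        exact Or.inl (Or.inr ⟨⟨h1, h2⟩, by ring⟩)
      · rw [midTime_of_ge h2]
        exact Or.inl (Or.inl ⟨⟨h2, h.2⟩, by ring⟩)

/-! ### Weights on the vertices -/

/-- The weights `W 0, …, W (d - 1)` at the `d` equidistant points of the circle. -/
noncomputable def level (d : ℕ) (W : ℤ → G) : 𝕋 →₀ G :=
  ∑ k ∈ Finset.range d, Finsupp.single (((k : ℝ) / d : ℝ) : 𝕋) (W k)

section

variable {d : ℕ} {W : ℤ → G}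

theorem total_level (d : ℕ) (W : ℤ → G) : total (level d W) = ∑ k ∈ Finset.range d, W k := by
  induction d with
  | zero => simp [level, total]
  | succ n =>
    have key : ∀ (s : Finset ℕ) (f : ℕ → 𝕋 →₀ G), total (∑ k ∈ s, f k) = ∑ k ∈ s, total (f k) := by
      intro s f
      induction s using Finset.cons_induction with
      | empty => simp [total]
      | cons a s h ih => rw [Finset.sum_cons, Finset.sum_cons, total_add, ih]
    rw [level, key]
    exact Finset.sum_congr rfl fun k _ => total_single _ _

theorem coe_div_eq_iff (hd : 0 < d) {k l : ℤ} :
    (((k : ℝ) / d : ℝ) : 𝕋) = ((l : ℝ) / d : ℝ) ↔ ∃ n : ℤ, l = k + d * n := by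
  have hd' : (0 : ℝ) < d := by exact_mod_cast hd
  rw [coe_eq_coe_iff]
  refine exists_congr fun n => ?_
  rw [div_eq_iff hd'.ne', add_mul, div_mul_cancel₀ _ hd'.ne', mul_comm (n : ℝ)]
  exact_mod_cast Iff.rfl

theorem level_coe (hd : 0 < d) (hW : ∀ k, W (k + d) = W k) (k : ℤ) :
    level d W (((k : ℝ) / d : ℝ) : 𝕋) = W k := by
  have hd' : (0 : ℤ) < d := by exact_mod_cast hd
  have hm := Int.emod_nonneg k hd'.ne'
  have hm' := Int.emod_lt_of_pos k hd'
  have hper : Function.Periodic W (d : ℤ) := hW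
  rw [level, Finsupp.finsetSum_apply, Finset.sum_eq_single (k % d).toNat]
  · have e : (((k % d).toNat : ℕ) : ℤ) = k % d := Int.toNat_of_nonneg hm
    have e' : ((((k % d).toNat : ℕ) : ℝ)) = ((k % d : ℤ) : ℝ) := by exact_mod_cast e
    rw [e, e', (coe_div_eq_iff hd).2 ⟨k / d, (Int.emod_add_mul_ediv k d).symm⟩,
      Finsupp.single_eq_same]
    have := hper.int_mul (k / d) (k % d)
    rw [mul_comm, Int.cast_id, Int.emod_add_mul_ediv] at this
    exact this.symm
  · intro j hj hne
    refine Finsupp.single_eq_of_ne fun h => hne ?_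
    have h2 : (((k : ℝ) / d : ℝ) : 𝕋) = (((j : ℤ) : ℝ) / d : ℝ) := by
      rw [h, Int.cast_natCast]
    obtain ⟨n, hn⟩ := (coe_div_eq_iff hd).1 h2
    have hj' := Finset.mem_range.1 hj
    have : k % d = j := by
      rw [show k = j + d * (-n) by linarith, Int.add_mul_emod_self_left]
      exact Int.emod_eq_of_lt (by positivity) (by exact_mod_cast hj')
    rw [this, Int.toNat_natCast]
  · intro h
    refine absurd (Finset.mem_range.2 ?_) h
    zify
    rw [Int.toNat_of_nonneg hm]
    exact hm'

theorem level_ne_zero_iff (hd : 0 < d) (hW : ∀ k, W (k + d) = W k) (h0 : ∀ k, W k ≠ 0) {z : ℝ} :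
    level d W (z : 𝕋) ≠ 0 ↔ ∃ k : ℤ, z = (k : ℝ) / d := by
  constructor
  · intro h
    rw [level, Finsupp.finsetSum_apply] at h
    obtain ⟨k, -, hk⟩ := Finset.exists_ne_zero_of_sum_ne_zero h
    have e : (((k : ℝ) / d : ℝ) : 𝕋) = z := by
      by_contra e
      exact hk (Finsupp.single_eq_of_ne' e)
    obtain ⟨n, rfl⟩ := coe_eq_coe_iff.1 e
    have hd' : (0 : ℝ) < d := by exact_mod_cast hd
    exact ⟨k + n * d, by push_cast; field_simp⟩
  · rintro ⟨k, rfl⟩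
    rw [level_coe hd hW]
    exact h0 k

/-- The weights are symmetric about the point `-1 / 2 - r` up to the sign. -/
theorem isNest_level {a : ℕ} (hd : 0 < d) (had : 2 * a ≤ d) (hW : ∀ k, W (k + d) = W k)
    (h0 : ∀ k, W k ≠ 0) {r : ℤ} (hr : ∀ j : ℕ, j < a → W (-1 - j - r) = -W (j - r)) :
    IsNest a d ((-(1 / 2) - r) / d) (level d W) := by
  have hd' : (0 : ℝ) < d := by exact_mod_cast hd
  refine ⟨hd, had, fun z => ?_, fun j hj => ?_⟩
  · rw [level_ne_zero_iff hd hW h0]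
    constructor
    · rintro ⟨k, rfl⟩
      exact ⟨k + r, by push_cast; ring⟩
    · rintro ⟨k, rfl⟩
      exact ⟨k - r, by push_cast; ring⟩
  · rw [show (-(1 / 2) - (r : ℝ)) / d - radius d j = ((-1 - j - r : ℤ) : ℝ) / d by
        rw [radius]; push_cast; ring,
      show (-(1 / 2) - (r : ℝ)) / d + radius d j = ((j - r : ℤ) : ℝ) / d by
        rw [radius]; push_cast; ring, level_coe hd hW, level_coe hd hW]
    exact hr j hj

theorem le_norm_iff {a : ℕ} (hd : 0 < d) (had : 2 * a ≤ d) {k : ℤ} (h0 : 0 ≤ k) (h1 : k < d) :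
    (a : ℝ) / d ≤ ‖((((k : ℝ) + 1 / 2) / d : ℝ) : 𝕋)‖ ↔ (a : ℤ) ≤ k ∧ k < d - a := by
  have hd' : (0 : ℝ) < d := by exact_mod_cast hd
  have h0' : (0 : ℝ) ≤ k := by exact_mod_cast h0
  have h1' : (k : ℝ) + 1 ≤ d := by exact_mod_cast h1
  have had' : (2 : ℝ) * a ≤ d := by exact_mod_cast had
  have ea : (a : ℝ) ≤ k + 1 / 2 ↔ (a : ℤ) ≤ k := by
    constructor
    · intro h
      by_contra hc
      have : (k : ℝ) + 1 ≤ a := by exact_mod_cast Int.not_le.1 hc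
      linarith
    · intro h
      have : (a : ℝ) ≤ k := by exact_mod_cast h
      linarith
  have eb : (a : ℝ) ≤ d - k - 1 / 2 ↔ k < d - a := by
    constructor
    · intro h
      by_contra hc
      have : (d : ℝ) - a ≤ k := by exact_mod_cast Int.not_lt.1 hc
      linarith
    · intro h
      have : (k : ℝ) + 1 ≤ d - a := by exact_mod_cast h
      linarith
  rcases le_total ((k : ℝ) + 1 / 2) (d / 2) with h | h
  · have hv : 0 ≤ ((k : ℝ) + 1 / 2) / d := by positivity
    rw [norm_coe_of_abs_le (by rw [abs_of_nonneg hv, div_le_iff₀ hd']; linarith), abs_of_nonneg hv,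
      div_le_div_iff_of_pos_right hd', ← ea, ← eb]
    exact ⟨fun h' => ⟨h', by linarith⟩, fun h' => h'.1⟩
  · have e : ((k : ℝ) + 1 / 2) / d = -((d - k - 1 / 2) / d) + (1 : ℤ) := by
      push_cast
      field_simp
      ring
    have hv : 0 ≤ ((d : ℝ) - k - 1 / 2) / d := div_nonneg (by linarith) hd'.le
    rw [e, coe_add_int, norm_coe_of_abs_le (by rw [abs_neg, abs_of_nonneg hv, div_le_iff₀ hd']; linarith),
      abs_neg, abs_of_nonneg hv, div_le_div_iff_of_pos_right hd', ← ea, ← eb]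
    exact ⟨fun h' => ⟨by linarith, h'⟩, fun h' => h'.2⟩

theorem le_norm_of_vertex {a : ℕ} (hd : 0 < d) (had : 2 * a ≤ d) {r q n : ℤ} (h0 : (a : ℤ) ≤ q)
    (h1 : q < d - a) :
    (a : ℝ) / d ≤ ‖(((((q - r + d * n : ℤ) : ℝ) / d - (-(1 / 2) - r) / d) : ℝ) : 𝕋)‖ := by
  have hd' : (0 : ℝ) < d := by exact_mod_cast hd
  rw [show (((q - r + d * n : ℤ) : ℝ) / d - (-(1 / 2) - r) / d) = (q + 1 / 2) / d + n by
    push_cast; field_simp; ring, coe_add_int]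
  exact (le_norm_iff hd had (by omega) (by omega)).2 ⟨h0, h1⟩

theorem nest_level_ne_zero_iff {a : ℕ} (hd : 0 < d) (had : 2 * a ≤ d) (hW : ∀ k, W (k + d) = W k)
    (h0 : ∀ k, W k ≠ 0) {r : ℤ} {z : ℝ} :
    nest d ((-(1 / 2) - r) / d) (level d W) a z ≠ 0 ↔
      ∃ q n : ℤ, (a : ℤ) ≤ q ∧ q < d - a ∧ z = ((q - r + d * n : ℤ) : ℝ) / d := by
  have hd' : (0 : ℤ) < d := by exact_mod_cast hd
  rw [nest_coe]
  constructor
  · intro h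
    split_ifs at h with h'
    · obtain ⟨k, rfl⟩ := (level_ne_zero_iff hd hW h0).1 h
      have hm := Int.emod_nonneg (k + r) hd'.ne'
      have hm' := Int.emod_lt_of_pos (k + r) hd'
      have e : k = (k + r) % d - r + d * ((k + r) / d) := by
        linarith [Int.emod_add_mul_ediv (k + r) d]
      have e2 : ((k : ℝ) / d - (-(1 / 2) - r) / d) =
          (((k + r) % d : ℤ) + 1 / 2) / d + ((k + r) / d : ℤ) := by
        have e3 : (k : ℝ) = ((k + r) % d : ℤ) - r + d * ((k + r) / d : ℤ) := by exact_mod_cast e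
        have hd'' : (d : ℝ) ≠ 0 := by exact_mod_cast hd.ne'
        nth_rw 1 [e3]
        field_simp
        ring
      rw [e2, coe_add_int, le_norm_iff hd had hm hm'] at h'
      exact ⟨_, _, h'.1, h'.2, by rw [← e]⟩
    · exact absurd rfl h
  · rintro ⟨q, n, h1, h2, rfl⟩
    rw [if_pos (le_norm_of_vertex hd had h1 h2), level_coe hd hW]
    exact h0 _

end

/-! ### The arcs between the two circles -/

/-- The position on the lower circle of the other end of the arc which starts at the position `x`
of the upper circle. -/
def lowerEnd (a b c : ℕ) (r x : ℤ) : ℤ :=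
  if x < a + b then x + c - r - numVertices a b c else x - b - r

/-- The through arcs end in the same cyclic order on both circles. Between the last oblique and the
first vertical one, the lower circle has the `2 a` ends of its nest; between the last vertical and
the next oblique one, the upper circle has those of its own. -/
theorem exists_twist_lowerEnd {a b c : ℕ} (h : 0 < a + b + c) (r : ℤ) :
    ∃ χ : Twist, ∀ x : ℤ, a ≤ x → x < a + b + c →
      χ ((x : ℝ) / numVertices a b c) = (lowerEnd a b c r x : ℝ) / numVertices a b c := by
  have hd : (0 : ℝ) < numVertices a b c := by
    rw [numVertices]
    exact_mod_cast (by omega : 0 < 2 * a + b + c)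
  have hd2 : (numVertices a b c : ℝ) = 2 * a + b + c := by
    rw [numVertices]
    push_cast
    ring
  rcases Nat.eq_zero_or_pos b with rfl | hb
  -- Without oblique arcs all the ends are shifted by the same amount.
  · obtain ⟨χ, hχ⟩ := exists_twist (f := fun p => p - r / numVertices a 0 c)
      (by fun_prop) (fun p q h => by simpa using h) (fun p => by ring)
    refine ⟨χ, fun x h1 h2 => ?_⟩
    rw [hχ, lowerEnd, if_neg (by push_cast; omega)]
    push_cast
    ring
  · have ha0 : (0 : ℝ) ≤ a := by positivity
    have hb0 : (1 : ℝ) ≤ b := by exact_mod_cast hb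
    have hκ : (0 : ℝ) < 2 * a + 1 := by positivity
    set d : ℝ := ((numVertices a b c : ℕ) : ℝ) with hdd
    set m : ℝ := a + b - 1 with hm
    set e : ℝ := a + b + c - 1 with he
    -- On `[a, a + d]` this polygon has the slope `2 a + 1` between the last oblique arc `m` and the
    -- first vertical position `m + 1`, the slope `1 / (2 a + 1)` after the last through arc `e`,
    -- and slope `1` otherwise. Since `a + d = e + 2 a + 1`, the gain and the loss cancel.
    set f : ℝ → ℝ := fun x => min (max x (min ((2 * a + 1) * (x - m) + m) (x + 2 * a)))
      ((x - e) / (2 * a + 1) + e + 2 * a) with hf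
    have hfc : Continuous f := by fun_prop
    have hfm : StrictMono f := by
      refine strictMono_min (strictMono_max strictMono_id (strictMono_min ?_ ?_)) ?_
      · intro x y hxy
        have := mul_lt_mul_of_pos_left (show x - m < y - m by linarith) hκ
        linarith
      · intro x y hxy
        linarith
      · intro x y hxy
        have := div_lt_div_of_pos_right (show x - e < y - e by linarith) hκ
        linarith
    have hme : m ≤ e := by
      have : (0 : ℝ) ≤ c := by positivity
      linarith
    have h3 : ∀ x, x ≤ e → x + 2 * a ≤ (x - e) / (2 * a + 1) + e + 2 * a := by
      intro x hx
      have : x - e ≤ (x - e) / (2 * a + 1) := by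
        rw [le_div_iff₀ hκ]
        nlinarith
      linarith
    have h1 : ∀ x, x ≤ m → f x = x := by
      intro x hx
      have i1 : min ((2 * a + 1) * (x - m) + m) (x + 2 * a) ≤ x :=
        min_le_of_left_le (by nlinarith)
      simp only [hf]
      rw [max_eq_left i1, min_eq_left (by linarith [h3 x (hx.trans hme)])]
    have h2 : ∀ x, m + 1 ≤ x → x ≤ e → f x = x + 2 * a := by
      intro x hx hx'
      have i1 : x + 2 * a ≤ (2 * a + 1) * (x - m) + m := by nlinarith
      simp only [hf]
      rw [min_eq_right i1, max_eq_right (by linarith), min_eq_left (h3 x hx')]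
    have h4 : f (a + d) = a + d := by
      have i1 : (a : ℝ) + d = e + (2 * a + 1) := by linarith
      simp only [hf, i1]
      rw [min_eq_right (a := (2 * (a : ℝ) + 1) * (e + (2 * a + 1) - m) + m) (by nlinarith),
        max_eq_right (by linarith), add_sub_cancel_left, div_self hκ.ne', min_eq_right (by linarith)]
      ring
    obtain ⟨χ, hχ⟩ := exists_twist_of_Icc (a := a / d)
      (g := fun p => (f (d * p) + (c - r - d)) / d) (by fun_prop)
      (fun p q hpq => by
        have := hfm (mul_lt_mul_of_pos_left hpq hd)
        exact div_lt_div_of_pos_right (by linarith) hd)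
      (by
        have i1 : d * (a / d + 1) = a + d := by field_simp
        have i2 : d * (a / d) = a := by field_simp
        simp only [i1, i2, h4]
        rw [h1 a (by linarith)]
        field_simp
        ring)
    refine ⟨χ, fun x hx hx' => ?_⟩
    have hxr : (a : ℝ) ≤ x := by exact_mod_cast hx
    have hxr' : (x : ℝ) ≤ e := by
      have : (x : ℝ) + 1 ≤ a + b + c := by exact_mod_cast hx'
      linarith
    have ex : d * (x / d) = x := by field_simp
    rw [hχ _ ⟨by gcongr, by rw [div_add_one hd.ne']; gcongr; linarith⟩]
    simp only [ex]
    congr 1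
    rw [lowerEnd]
    split_ifs with hc
    · rw [h1 x (by have : (x : ℝ) + 1 ≤ a + b := by exact_mod_cast hc
                   linarith)]
      push_cast
      ring
    · have : (a : ℝ) + b ≤ x := by exact_mod_cast Int.not_lt.1 hc
      rw [h2 x (by linarith) hxr']
      push_cast
      linarith

theorem exists_vertex_lowerEnd {a b c : ℕ} (r : ℤ) {x : ℤ} (h : a ≤ x) (h' : x < a + b + c) :
    ∃ q n : ℤ, (a : ℤ) ≤ q ∧ q < numVertices a b c - a ∧
      lowerEnd a b c r x = q - r + numVertices a b c * n := by
  rw [lowerEnd, numVertices]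
  split_ifs with hc
  · exact ⟨x + c, -1, by omega, by push_cast; omega, by ring⟩
  · exact ⟨x - b, 0, by omega, by push_cast; omega, by ring⟩

theorem exists_lowerEnd_eq {a b c : ℕ} (r : ℤ) {q : ℤ} (h : a ≤ q) (h' : q < numVertices a b c - a) :
    ∃ x n : ℤ, (a : ℤ) ≤ x ∧ x < a + b + c ∧
      q - r = lowerEnd a b c r x + numVertices a b c * n := by
  rw [numVertices] at *
  push_cast at h'
  by_cases hc : q < a + c
  · refine ⟨q + b, 0, by omega, by omega, ?_⟩
    rw [lowerEnd, if_neg (by omega)]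
    ring
  · refine ⟨q - c, 1, by omega, by omega, ?_⟩
    rw [lowerEnd, if_pos (by omega), numVertices]
    ring

theorem mem_arcs {a b c : ℕ} {r : ℤ} (h : 0 < a + b + c) {z t : ℝ} : (z, t) ∈ arcs a b c r ↔
    (∃ j < a, t ≤ 1 ∧ |z - (-(1 / 2)) / numVertices a b c| =
      radius (numVertices a b c) j - 3 * (1 - t)) ∨
    (∃ j < a, 0 ≤ t ∧ |z - (-(1 / 2) - r) / numVertices a b c| =
      radius (numVertices a b c) j - 3 * t) ∨
    t ∈ Icc (0 : ℝ) 1 ∧ ∃ x : ℤ, a ≤ x ∧ x < a + b + c ∧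
      z = midTime t * ((x : ℝ) / numVertices a b c) +
        (1 - midTime t) * ((lowerEnd a b c r x : ℝ) / numVertices a b c) := by
  have hd : 0 < numVertices a b c := by
    rw [numVertices]
    omega
  rw [arcs, mem_union, mem_union, mem_union, or_assoc, or_assoc]
  refine or_congr ?_ (or_congr ?_ ?_)
  · simp only [mem_iUnion, mem_upperArc hd, Fin.exists_iff, exists_prop]
  · simp only [mem_iUnion, mem_lowerArc hd, Fin.exists_iff, exists_prop]
  · simp only [mem_iUnion, mem_throughArc, Fin.exists_iff, exists_prop]
    constructor
    · rintro (⟨k, hk, ht, rfl⟩ | ⟨k, hk, ht, rfl⟩)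
      · refine ⟨ht, a + k, by omega, by omega, ?_⟩
        rw [lowerEnd, if_pos (by omega)]
        push_cast
        ring
      · refine ⟨ht, a + b + k, by omega, by omega, ?_⟩
        rw [lowerEnd, if_neg (by omega)]
        push_cast
        ring
    · rintro ⟨ht, x, h1, h2, rfl⟩
      by_cases hc : x < a + b
      · obtain ⟨k, rfl⟩ : ∃ k : ℕ, x = a + k := ⟨(x - a).toNat, by omega⟩
        refine Or.inl ⟨k, by omega, ht, ?_⟩
        rw [lowerEnd, if_pos (by omega)]
        push_cast
        ring
      · obtain ⟨k, rfl⟩ : ∃ k : ℕ, x = a + b + k := ⟨(x - a - b).toNat, by omega⟩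
        refine Or.inr ⟨k, by omega, ht, ?_⟩
        rw [lowerEnd, if_neg (by omega)]
        push_cast
        ring

/-! ### The diagram as a sequence of events -/

/-- The time parameter of the bending near the two boundary circles. -/
noncomputable def bendTime (t : ℝ) : ℝ := max 0 (min t (1 / 3 - t))

theorem bendTime_nonneg (t : ℝ) : 0 ≤ bendTime t := le_max_left _ _

theorem bendTime_of_le {t : ℝ} (h0 : 0 ≤ t) (h : t ≤ 1 / 6) : bendTime t = t := by
  rw [bendTime, min_eq_left (by linarith), max_eq_right h0]

theorem bendTime_of_ge {t : ℝ} (h : 1 / 3 ≤ t) : bendTime t = 0 :=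
  max_eq_left (min_le_of_right_le (by linarith))

theorem Hook.zero_iff {a d j : ℕ} (hd : 0 < d) (hj : j < a) {y : ℝ} (hy : 0 ≤ y) :
    Hook a d j y 0 ↔ y = radius d j := by
  rw [← crush_eq_iff hd hj hy, crush_zero_left hy, mul_zero, sub_zero]

/-- The position at the time `t` of the point `p` of the upper circle, moved by `χ` in the middle
of the annulus, and by the bendings `f` and `g` near the two circles. -/
noncomputable def bentShear (χ : Twist) (f g : ℝ → ℝ → ℝ) (p t : ℝ) : ℝ :=
  f (bendTime (1 - t)) (g (bendTime t) (midTime t * p + (1 - midTime t) * χ p))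

/-! ### Coordinates in which the diagram is a double nest. -/

section

variable {a d : ℕ} {P Q : ℝ} {f g : ℝ → ℝ → ℝ} {χ : Twist}

theorem bentShear_of_le (hf : IsBending a d P f) {t : ℝ} (ht : t ≤ 1 / 3) (p : ℝ) :
    bentShear χ f g p t = g (bendTime t) (χ p) := by
  rw [bentShear, bendTime_of_ge (show 1 / 3 ≤ 1 - t by linarith), hf.apply_zero, midTime_of_le ht,
    zero_mul, sub_zero, zero_add, one_mul]

theorem bentShear_of_ge (hg : IsBending a d Q g) {t : ℝ} (ht : 2 / 3 ≤ t) (p : ℝ) :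
    bentShear χ f g p t = f (bendTime (1 - t)) p := by
  rw [bentShear, bendTime_of_ge (show 1 / 3 ≤ t by linarith), hg.apply_zero, midTime_of_ge ht,
    sub_self, zero_mul, add_zero, one_mul]

theorem bentShear_zero (hf : IsBending a d P f) (hg : IsBending a d Q g) (p : ℝ) :
    bentShear χ f g p 0 = χ p := by
  rw [bentShear_of_le hf (by norm_num), bendTime_of_le le_rfl (by norm_num), hg.apply_zero]

theorem bentShear_one (hf : IsBending a d P f) (hg : IsBending a d Q g) (p : ℝ) :
    bentShear χ f g p 1 = p := by
  rw [bentShear_of_ge hg (by norm_num), sub_self, bendTime_of_le le_rfl (by norm_num), hf.apply_zero]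

theorem isShear_bentShear (hf : IsBending a d P f) (hg : IsBending a d Q g) :
    IsShear χ⁻¹ (bentShear χ f g) := by
  have hχ := χ.continuous
  have hm : Continuous midTime := by unfold midTime; fun_prop
  have hb : Continuous bendTime := by unfold bendTime; fun_prop
  refine ⟨?_, fun t _ => ?_, fun p t _ => ?_, fun p => ?_⟩
  · have h1 : Continuous fun v : ℝ × ℝ =>
        (bendTime v.2, midTime v.2 * v.1 + (1 - midTime v.2) * χ v.1) := by fun_prop
    have h2 : Continuous fun v : ℝ × ℝ => bendTime (1 - v.2) := by fun_prop
    exact hf.cont.comp (h2.prodMk (hg.cont.comp h1))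
  · refine (hf.mono _).comp ((hg.mono _).comp fun p q hpq => ?_)
    have h1 := midTime_mem t
    have h2 := χ.strictMono hpq
    rcases h1.1.eq_or_lt with h3 | h3
    · simpa [← h3] using h2
    · have h4 := mul_lt_mul_of_pos_left hpq h3
      have h5 := mul_le_mul_of_nonneg_left h2.le (sub_nonneg.2 h1.2)
      exact add_lt_add_of_lt_of_le h4 h5
  · have e : midTime t * (p + 1) + (1 - midTime t) * χ (p + 1) =
        midTime t * p + (1 - midTime t) * χ p + 1 := by
      rw [CircleDeg1Lift.map_add_one]
      ring
    rw [bentShear, bentShear, e, hg.per, hf.per]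
  · rw [bentShear_one hf hg, bentShear_zero hf hg]
    exact (CircleDeg1Lift.units_apply_inv_apply χ p).symm

theorem bentShear_eq (hf : IsBending a d P f) (hg : IsBending a d Q g) {x y : ℝ} (hχ : χ x = y)
    (hx : (a : ℝ) / d ≤ ‖((x - P : ℝ) : 𝕋)‖)
    (hy : (a : ℝ) / d ≤ ‖((y - Q : ℝ) : 𝕋)‖) (t : ℝ) :
    bentShear χ f g x t = midTime t * x + (1 - midTime t) * y := by
  rw [bentShear, hχ]
  have h1 : g (bendTime t) (midTime t * x + (1 - midTime t) * y) =
      midTime t * x + (1 - midTime t) * y := by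
    rcases le_total t (1 / 3) with h | h
    · rw [midTime_of_le h, zero_mul, zero_add, sub_zero, one_mul, hg.apply_of_le (bendTime_nonneg _) hy]
    · rw [bendTime_of_ge h, hg.apply_zero]
  rw [h1]
  rcases le_total (1 / 3) (1 - t) with h | h
  · rw [bendTime_of_ge h, hf.apply_zero]
  · rw [midTime_of_ge (by linarith), sub_self, zero_mul, add_zero, one_mul,
      hf.apply_of_le (bendTime_nonneg _) hx]

/-- Up to the height `1/6` the shear is `χ` followed by the bending `g` at the true time. Higher up
neither side can hold, because all radii are less than `1/2`. -/
theorem exists_abs_bentShear_lower (hf : IsBending a d P f) (hg : IsBending a d Q g) (hd : 0 < d)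
    (had : 2 * a ≤ d) {j : ℕ} (hj : j < a) {t : ℝ} (ht : 0 ≤ t) (p : ℝ) :
    (∃ n : ℤ, |bentShear χ f g p t + n - Q| = radius d j - 3 * t) ↔
      Hook a d j ‖((χ p - Q : ℝ) : 𝕋)‖ t := by
  rcases le_total t (1 / 6) with h | h
  · rw [bentShear_of_le hf (by linarith), bendTime_of_le ht h]
    exact hg.exists_abs_iff hd had hj ht _
  · refine iff_of_false ?_ fun h' => ?_
    · rintro ⟨n, hn⟩
      have h1 := radius_lt_half hd had hj
      have h2 := abs_nonneg (bentShear χ f g p t + n - Q)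
      linarith
    · have h1 := hook_le hd hj (norm_nonneg _) h'
      linarith [div_le_half hd had]

theorem exists_abs_bentShear_upper (hf : IsBending a d P f) (hg : IsBending a d Q g) (hd : 0 < d)
    (had : 2 * a ≤ d) {j : ℕ} (hj : j < a) {t : ℝ} (ht : t ≤ 1) (p : ℝ) :
    (∃ n : ℤ, |bentShear χ f g p t + n - P| = radius d j - 3 * (1 - t)) ↔
      Hook a d j ‖((p - P : ℝ) : 𝕋)‖ (1 - t) := by
  rcases le_total (1 - t) (1 / 6) with h | h
  · rw [bentShear_of_ge hg (by linarith), bendTime_of_le (by linarith) h]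
    exact hf.exists_abs_iff hd had hj (by linarith) _
  · refine iff_of_false ?_ fun h' => ?_
    · rintro ⟨n, hn⟩
      have h1 := radius_lt_half hd had hj
      have h2 := abs_nonneg (bentShear χ f g p t + n - P)
      linarith
    · have h1 := hook_le hd hj (norm_nonneg _) h'
      linarith [div_le_half hd had]

end

/-- Nonzero weights of the vertices, opposite at the two ends of each of the arcs which do not
change the side, and equal at the two ends of each of the other arcs. -/
structure IsWeight (a b c : ℕ) (r : ℤ) (W : ℤ → G) : Prop where
  per : ∀ k, W (k + numVertices a b c) = W k
  ne_zero : ∀ k, W k ≠ 0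
  upper : ∀ j : ℕ, j < a → W (-1 - j) = -W j
  lower : ∀ j : ℕ, j < a → W (-1 - j - r) = -W (j - r)
  through : ∀ x : ℤ, a ≤ x → x < a + b + c → W (lowerEnd a b c r x) = W x

namespace IsWeight

variable {a b c : ℕ} {r : ℤ} {W : ℤ → G} {χ : Twist}

theorem isNest_lower (h : IsWeight a b c r W) (hd : 0 < numVertices a b c) :
    IsNest a (numVertices a b c) ((-(1 / 2) - r) / numVertices a b c)
      (level (numVertices a b c) W) :=
  isNest_level hd (by rw [numVertices]; omega) h.per h.ne_zero h.lower

theorem isNest_upper (h : IsWeight a b c r W) (hd : 0 < numVertices a b c) :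
    IsNest a (numVertices a b c) ((-(1 / 2)) / numVertices a b c)
      (level (numVertices a b c) W) := by
  have := isNest_level (a := a) (r := 0) hd (by rw [numVertices]; omega) h.per h.ne_zero
    (fun j hj => by rw [sub_zero, sub_zero]; exact h.upper j hj)
  rwa [Int.cast_zero, sub_zero] at this

theorem le_norm_upper (hd : 0 < numVertices a b c) {x : ℤ} (h1 : a ≤ x) (h2 : x < a + b + c) :
    (a : ℝ) / numVertices a b c ≤
      ‖(((x : ℝ) / numVertices a b c - (-(1 / 2)) / numVertices a b c : ℝ) : 𝕋)‖ := by
  have := le_norm_of_vertex (a := a) (r := 0) (n := 0) hd (by rw [numVertices]; omega) h1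
    (by rw [numVertices]; omega)
  rwa [mul_zero, add_zero, sub_zero, Int.cast_zero, sub_zero] at this

theorem le_norm_lower (r : ℤ) (hd : 0 < numVertices a b c) {x : ℤ} (h1 : a ≤ x) (h2 : x < a + b + c) :
    (a : ℝ) / numVertices a b c ≤ ‖(((lowerEnd a b c r x : ℝ) / numVertices a b c -
      (-(1 / 2) - r) / numVertices a b c : ℝ) : 𝕋)‖ := by
  obtain ⟨q, n, h3, h4, h5⟩ := exists_vertex_lowerEnd r h1 h2
  rw [h5]
  exact le_norm_of_vertex hd (by rw [numVertices]; omega) h3 h4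

theorem nest_upper_ne_zero_iff (h : IsWeight a b c r W) (hd : 0 < numVertices a b c) {z : ℝ} :
    nest (numVertices a b c) ((-(1 / 2)) / numVertices a b c) (level (numVertices a b c) W) a z ≠ 0 ↔
      ∃ x n : ℤ, a ≤ x ∧ x < a + b + c ∧ z = (x : ℝ) / numVertices a b c + n := by
  have hd' : (numVertices a b c : ℝ) ≠ 0 := by exact_mod_cast hd.ne'
  have := nest_level_ne_zero_iff (a := a) (r := 0) (z := z) hd (by rw [numVertices]; omega)
    h.per h.ne_zero
  rw [Int.cast_zero, sub_zero] at this
  rw [this]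
  refine exists_congr fun x => exists_congr fun n => and_congr_right fun _ => and_congr ?_ ?_
  · rw [numVertices]
    push_cast
    constructor <;> intro <;> omega
  · rw [show (((x - 0 + numVertices a b c * n : ℤ) : ℝ) / numVertices a b c) =
      (x : ℝ) / numVertices a b c + n by push_cast; field_simp; ring]

/-- After the deaths of the lower nest exactly the through strands are left, and these are the
strands present before the births of the upper nest; `χ` matches their positions and
`IsWeight.through` their weights. -/
theorem pull_nest (h : IsWeight a b c r W) (hd : 0 < numVertices a b c)
    (hχ : ∀ x : ℤ, a ≤ x → x < a + b + c →
      χ ((x : ℝ) / numVertices a b c) = (lowerEnd a b c r x : ℝ) / numVertices a b c) :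
    pull χ (nest (numVertices a b c) ((-(1 / 2) - r) / numVertices a b c)
        (level (numVertices a b c) W) a) =
      nest (numVertices a b c) ((-(1 / 2)) / numVertices a b c) (level (numVertices a b c) W) a := by
  have hd' : (numVertices a b c : ℝ) ≠ 0 := by exact_mod_cast hd.ne'
  have key : ∀ (x n : ℤ), a ≤ x → x < a + b + c →
      nest (numVertices a b c) ((-(1 / 2) - r) / numVertices a b c) (level (numVertices a b c) W) a
        ((χ ((x : ℝ) / numVertices a b c + n) : ℝ) : 𝕋) =
      nest (numVertices a b c) ((-(1 / 2)) / numVertices a b c) (level (numVertices a b c) W) a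
        (((x : ℝ) / numVertices a b c + n : ℝ) : 𝕋) := by
    intro x n h1 h2
    rw [CircleDeg1Lift.map_add_int, coe_add_int, coe_add_int, hχ x h1 h2, nest_coe, nest_coe,
      if_pos (le_norm_lower r hd h1 h2), if_pos (le_norm_upper hd h1 h2), level_coe hd h.per,
      level_coe hd h.per, h.through x h1 h2]
  refine level_ext fun p => ?_
  rw [pull_coe]
  by_cases h1 : nest (numVertices a b c) ((-(1 / 2)) / numVertices a b c)
      (level (numVertices a b c) W) a p = 0
  · rw [h1]
    by_contra h2
    obtain ⟨q, n, h3, h4, h5⟩ :=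
      (nest_level_ne_zero_iff hd (by rw [numVertices]; omega) h.per h.ne_zero).1 h2
    obtain ⟨x, m, h6, h7, h8⟩ := exists_lowerEnd_eq r h3 h4
    have e : χ p = χ ((x : ℝ) / numVertices a b c + (m + n : ℤ)) := by
      rw [CircleDeg1Lift.map_add_int, hχ x h6 h7, h5, h8]
      push_cast
      field_simp
      ring
    obtain rfl := χ.strictMono.injective e
    rw [key x _ h6 h7] at h2
    exact h2 h1
  · obtain ⟨x, n, h2, h3, rfl⟩ := (h.nest_upper_ne_zero_iff hd).1 h1
    exact key x n h2 h3

variable {f g : ℝ → ℝ → ℝ}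

/-- The description of the diagram in the coordinates given by `bentShear`. -/
theorem exists_mem_arcs_iff (h : IsWeight a b c r W) (habc : 0 < a + b + c)
    (hd : 0 < numVertices a b c)
    (hχ : ∀ x : ℤ, a ≤ x → x < a + b + c →
      χ ((x : ℝ) / numVertices a b c) = (lowerEnd a b c r x : ℝ) / numVertices a b c)
    (hf : IsBending a (numVertices a b c) ((-(1 / 2)) / numVertices a b c) f)
    (hg : IsBending a (numVertices a b c) ((-(1 / 2) - r) / numVertices a b c) g)
    (p : ℝ) {t : ℝ} (ht : t ∈ Icc (0 : ℝ) 1) :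
    (∃ n : ℤ, (bentShear χ f g p t + n, t) ∈ arcs a b c r) ↔
      nest (numVertices a b c) ((-(1 / 2)) / numVertices a b c) (level (numVertices a b c) W) a p ≠ 0 ∨
      (∃ i < a, Hook a (numVertices a b c) i
        ‖((χ p - (-(1 / 2) - r) / numVertices a b c : ℝ) : 𝕋)‖ t) ∨
      ∃ i < a, Hook a (numVertices a b c) i
        ‖((p - (-(1 / 2)) / numVertices a b c : ℝ) : 𝕋)‖ (1 - t) := by
  have had : 2 * a ≤ numVertices a b c := by
    rw [numVertices]
    omega
  have hS := isShear_bentShear (χ := χ) hf hg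
  simp only [mem_arcs habc, exists_or]
  rw [← or_assoc, or_comm, or_comm (a := ∃ i < a, Hook _ _ _ _ t)]
  refine or_congr ?_ (or_congr ?_ ?_)
  · rw [h.nest_upper_ne_zero_iff hd]
    constructor
    · rintro ⟨n, -, x, h1, h2, e⟩
      refine ⟨x, -n, h1, h2, ?_⟩
      rw [← bentShear_eq hf hg (hχ x h1 h2) (le_norm_upper hd h1 h2) (le_norm_lower r hd h1 h2),
        ← hS.add_int p ht] at e
      have e' := (hS.mono t ht).injective e
      push_cast
      linarith
    · rintro ⟨x, n, h1, h2, rfl⟩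
      refine ⟨-n, ht, x, h1, h2, ?_⟩
      rw [← bentShear_eq hf hg (hχ x h1 h2) (le_norm_upper hd h1 h2) (le_norm_lower r hd h1 h2),
        hS.add_int _ ht]
      push_cast
      ring
  · rw [exists_comm]
    refine exists_congr fun j => ?_
    constructor
    · rintro ⟨n, hj, h1, e⟩
      exact ⟨hj, (exists_abs_bentShear_upper hf hg hd had hj h1 p).1 ⟨n, e⟩⟩
    · rintro ⟨hj, e⟩
      obtain ⟨n, hn⟩ := (exists_abs_bentShear_upper (χ := χ) hf hg hd had hj ht.2 p).2 e
      exact ⟨n, hj, ht.2, hn⟩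
  · rw [exists_comm]
    refine exists_congr fun j => ?_
    constructor
    · rintro ⟨n, hj, h1, e⟩
      exact ⟨hj, (exists_abs_bentShear_lower hf hg hd had hj h1 p).1 ⟨n, e⟩⟩
    · rintro ⟨hj, e⟩
      obtain ⟨n, hn⟩ := (exists_abs_bentShear_lower (χ := χ) hf hg hd had hj ht.1 p).2 e
      exact ⟨n, hj, ht.1, hn⟩

end IsWeight

theorem not_hook_one {a d : ℕ} (hd : 0 < d) (had : 2 * a ≤ d) {i : ℕ} (hi : i < a) {y : ℝ}
    (hy : 0 ≤ y) : ¬Hook a d i y 1 := by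
  intro h
  linarith [hook_le hd hi hy h, div_le_half hd had]

theorem IsNest.nest_or_hook_zero {a d : ℕ} {Q : ℝ} {S : 𝕋 →₀ G} (h : IsNest a d Q S)
    (z : ℝ) : (nest d Q S a z ≠ 0 ∨ ∃ i < a, Hook a d i ‖((z - Q : ℝ) : 𝕋)‖ 0) ↔
      S z ≠ 0 := by
  rw [← nest_zero (d := d) (Q := Q) (S := S), h.nest_ne_zero_iff, nest_zero, h.nest_ne_zero_iff]
  constructor
  · rintro (⟨i, -, e⟩ | ⟨i, hi, e⟩)
    · exact ⟨i, i.zero_le, e⟩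
    · exact ⟨i, i.zero_le, (Hook.zero_iff h.pos hi (norm_nonneg _)).1 e⟩
  · rintro ⟨i, -, e⟩
    rcases lt_or_ge i a with hi | hi
    · exact Or.inr ⟨i, hi, (Hook.zero_iff h.pos hi (norm_nonneg _)).2 e⟩
    · exact Or.inl ⟨i, hi, e⟩

theorem torusProj_mem_image_iff {A : Set (ℝ × ℝ)} (hA : ∀ v ∈ A, v.2 ∈ Icc (0 : ℝ) 1) {x t : ℝ}
    (ht : t ∈ Icc (0 : ℝ) 1) : torusProj (x, t) ∈ torusProj '' A ↔ (∃ n : ℤ, (x + n, t) ∈ A) ∨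
      (t = 0 ∧ ∃ n : ℤ, (x + n, (1 : ℝ)) ∈ A) ∨ (t = 1 ∧ ∃ n : ℤ, (x + n, (0 : ℝ)) ∈ A) := by
  constructor
  · rintro ⟨⟨y, u⟩, hv, e⟩
    have hu := hA _ hv
    obtain ⟨e1, e2⟩ := Prod.ext_iff.1 e
    obtain ⟨n, hn⟩ := coe_eq_coe_iff.1 e1.symm
    obtain ⟨m, hm⟩ := coe_eq_coe_iff.1 e2.symm
    simp only at hn hm hu
    subst hn hm
    have h1 : (m : ℝ) ≤ 1 := by linarith [ht.1, hu.2]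
    have h2 : (-1 : ℝ) ≤ m := by linarith [ht.2, hu.1]
    have h1' : m ≤ 1 := by exact_mod_cast h1
    have h2' : -1 ≤ m := by exact_mod_cast h2
    obtain rfl | rfl | rfl : m = -1 ∨ m = 0 ∨ m = 1 := by omega
    · obtain rfl : t = 1 := by
        have := hu.1
        push_cast at this
        linarith [ht.2]
      exact Or.inr (Or.inr ⟨rfl, n, by simpa using hv⟩)
    · exact Or.inl ⟨n, by simpa using hv⟩
    · obtain rfl : t = 0 := by
        have := hu.2
        push_cast at this
        linarith [ht.1]
      exact Or.inr (Or.inl ⟨rfl, n, by simpa using hv⟩)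
  · have h01 : ((1 : ℝ) : 𝕋) = (0 : ℝ) := coe_eq_coe_iff.2 ⟨-1, by norm_num⟩
    rintro (⟨n, hn⟩ | ⟨rfl, n, hn⟩ | ⟨rfl, n, hn⟩)
    · exact ⟨_, hn, by rw [torusProj, torusProj, coe_add_int]⟩
    · exact ⟨_, hn, by rw [torusProj, torusProj, coe_add_int, h01]⟩
    · exact ⟨_, hn, by rw [torusProj, torusProj, coe_add_int, h01]⟩

namespace IsWeight

variable {a b c : ℕ} {r : ℤ} {W : ℤ → G}

/-- In the coordinates of `bentShear` the through arcs are vertical, the lower nest dies near the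
bottom, and the upper nest is born near the top. This coordinate system is `χ` on the lower side and
the identity on the upper side, so the monodromy is `χ⁻¹` and the first level is the vertex level
seen through `χ`. -/
theorem exists_draw (h : IsWeight a b c r W) (habc : 0 < a + b + c) :
    ∃ (χ : Twist) (L : List (Event G)), Valid (pull χ (level (numVertices a b c) W)) L χ⁻¹ ∧
      Draw χ⁻¹ (picture (pull χ (level (numVertices a b c) W)) L) (curveD a b c r) := by
  have hd : 0 < numVertices a b c := by
    rw [numVertices]
    omega
  have had : 2 * a ≤ numVertices a b c := by
    rw [numVertices]
    omega
  obtain ⟨χ, hχ⟩ := exists_twist_lowerEnd habc r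
  have hP := h.isNest_upper hd
  have hQ := h.isNest_lower hd
  have hT := h.pull_nest hd hχ
  obtain ⟨f, hf⟩ := exists_isBending hd had ((-(1 / 2)) / numVertices a b c)
  obtain ⟨g, hg⟩ := exists_isBending hd had ((-(1 / 2) - r) / numVertices a b c)
  have hS := isShear_bentShear (χ := χ) hf hg
  have hstrip : ∀ v ∈ arcs a b c r, v.2 ∈ Icc (0 : ℝ) 1 := by
    rintro ⟨x, t⟩ hv
    have hr : ∀ j < a, radius (numVertices a b c) j < 1 / 2 := fun j hj => radius_lt_half hd had hj
    rcases (mem_arcs habc).1 hv with ⟨j, hj, h1, e⟩ | ⟨j, hj, h1, e⟩ | ⟨h1, -⟩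
    · have h2 := abs_nonneg (x - (-(1 / 2)) / numVertices a b c)
      exact ⟨by simp only; linarith [hr j hj], h1⟩
    · have h2 := abs_nonneg (x - (-(1 / 2) - r) / numVertices a b c)
      exact ⟨h1, by simp only; linarith [hr j hj]⟩
    · exact h1
  have hA : IsDoubleNest a (numVertices a b c) ((-(1 / 2)) / numVertices a b c)
      ((-(1 / 2) - r) / numVertices a b c) (level (numVertices a b c) W) χ
      (cut (bentShear χ f g) ⁻¹' curveD a b c r) := by
    intro p t ht
    rw [mem_preimage, curveD, cut, torusProj_mem_image_iff hstrip ht]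
    -- At the heights `0` and `1` the curve on the torus also contains the ends of the arcs on the
    -- other side of `C`. These give nothing new, because on either side the ends are all the
    -- vertices.
    refine (or_iff_left_of_imp ?_).trans (h.exists_mem_arcs_iff habc hd hχ hf hg p ht)
    have h0 : ∀ q, (∃ n : ℤ, (bentShear χ f g q 0 + n, (0 : ℝ)) ∈ arcs a b c r) ↔
        level (numVertices a b c) W (χ q : ℝ) ≠ 0 := by
      intro q
      rw [h.exists_mem_arcs_iff habc hd hχ hf hg q ⟨le_rfl, zero_le_one⟩,
        ← hQ.nest_or_hook_zero, ← or_assoc, ← hT, pull_coe]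
      refine or_iff_left_of_imp ?_
      rintro ⟨i, hi, hh⟩
      rw [sub_zero] at hh
      exact absurd hh (not_hook_one hd had hi (norm_nonneg _))
    have h1 : ∀ q : ℝ, (∃ n : ℤ, (bentShear χ f g q 1 + n, (1 : ℝ)) ∈ arcs a b c r) ↔
        level (numVertices a b c) W q ≠ 0 := by
      intro q
      rw [h.exists_mem_arcs_iff habc hd hχ hf hg q ⟨zero_le_one, le_rfl⟩,
        ← hP.nest_or_hook_zero, sub_self]
      refine or_congr_right (or_iff_right_of_imp ?_)
      rintro ⟨i, hi, hh⟩
      exact absurd hh (not_hook_one hd had hi (norm_nonneg _))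
    rintro (⟨rfl, hn⟩ | ⟨rfl, hn⟩)
    · rw [h0, ← h1, bentShear_one hf hg, ← bentShear_zero (χ := χ) hf hg]
      exact hn
    · rw [h1, ← CircleDeg1Lift.units_apply_inv_apply χ p, ← h0, bentShear_zero hf hg,
        CircleDeg1Lift.units_apply_inv_apply, ← bentShear_one (χ := χ) (p := p) hf hg]
      exact hn
  refine ⟨χ, _, valid_doubleNest hP hQ hT, Draw.iso_one ⟨_, hS, ?_⟩ (iso_doubleNest hP hQ hA hT)⟩
  have e : cut (bentShear χ f g) '' ((cut (bentShear χ f g) ⁻¹' curveD a b c r) ∩ strip) =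
      curveD a b c r := by
    refine Subset.antisymm ?_ fun x hx => ?_
    · rintro _ ⟨v, hv, rfl⟩
      exact hv.1
    · obtain ⟨v, -, hv, rfl⟩ := hS.exists_cut_eq x
      exact ⟨v, ⟨hx, hv⟩, rfl⟩
  rw [e]
  exact Related.refl _

/-- Every vertex carries a strand of the first level, so what the reduction says about the weights
of the strands applies to every `W k`. -/
theorem exists_related (h : IsWeight a b c r W) (hadm : Admissible a b c r) :
    ∃ g : G, (∀ k, W k = g ∨ W k = -g) ∧
      ((∑ k ∈ Finset.range (numVertices a b c), W k = 0 ∧ Related (curveD a b c r) middleCurve) ∨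
        ∃ (n : ℕ) (m : ℤ), 0 < n ∧ IsCoprime (n : ℤ) m ∧
          ∑ k ∈ Finset.range (numVertices a b c), W k = n • g ∧
          Related (curveD a b c r) (linearCurve n m)) := by
  obtain ⟨habc, hcon, hcon'⟩ := hadm
  have hd : 0 < numVertices a b c := by
    rw [numVertices]
    omega
  obtain ⟨χ, L, hV, hD⟩ := h.exists_draw habc
  obtain ⟨g, hg, -, hs⟩ := isStandard_of_draw hcon hcon' hV hD
  rw [total_pull, total_level] at hs
  refine ⟨g, fun k => ?_, hs⟩
  have := hg (((χ⁻¹ : Twist) ((k : ℝ) / numVertices a b c) : ℝ) : 𝕋)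
  rw [pull_coe, CircleDeg1Lift.units_apply_inv_apply, level_coe hd h.per] at this
  exact this.resolve_left (h.ne_zero k)

end IsWeight

end Dunwoody

/-! ### The order of the arcs along the curve, and the exponent sum. -/

namespace Dunwoody

/-! ### Permutations which are products of two involutions without fixed points -/

section

variable {E : Type*} {ω γ : Equiv.Perm E}

/-- Two involutions generate a dihedral group: `ω` conjugates `γ * ω` to its inverse. Geometrically,
`ω` reverses the direction in which the curve is run through. -/
theorem mul_zpow_conj (hω : ∀ e, ω (ω e) = e) (hγ : ∀ e, γ (γ e) = e) (k : ℤ) (e : E) :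
    ω (((γ * ω) ^ k) e) = ((γ * ω) ^ (-k)) (ω e) := by
  have hω' : ω * ω = 1 := Equiv.ext hω
  have hγ' : γ * γ = 1 := Equiv.ext hγ
  have h1 : ω⁻¹ = ω := inv_eq_of_mul_eq_one_left hω'
  have h2 : γ⁻¹ = γ := inv_eq_of_mul_eq_one_left hγ'
  have h3 : ω * (γ * ω) * ω⁻¹ = (γ * ω)⁻¹ := by
    rw [mul_inv_rev, h1, h2, mul_assoc, mul_assoc, hω', mul_one]
  have h4 : ω * (γ * ω) ^ k * ω⁻¹ = (γ * ω) ^ (-k) := by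
    rw [← conj_zpow, h3, inv_zpow']
  have h5 : ω * (γ * ω) ^ k = (γ * ω) ^ (-k) * ω := by
    rw [← h4, inv_mul_cancel_right]
  exact congrArg (fun f : Equiv.Perm E => f e) h5

/-- The two directions of a curve never agree. -/
theorem not_sameCycle_apply (hω : ∀ e, ω (ω e) = e) (hγ : ∀ e, γ (γ e) = e) (hω0 : ∀ e, ω e ≠ e)
    (hγ0 : ∀ e, γ e ≠ e) (e : E) : ¬(γ * ω).SameCycle e (ω e) := by
  rintro ⟨k, hk⟩
  -- If running along the curve led from `e` to `ω e`, there would be a turning point half-way: a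
  -- fixed point of `ω` for an even number of steps, of `γ` for an odd one.
  obtain ⟨j, rfl | rfl⟩ := Int.even_or_odd' k
  · refine hω0 (((γ * ω) ^ j) e) ?_
    rw [mul_zpow_conj hω hγ, ← hk, ← Equiv.Perm.mul_apply, ← zpow_add]
    congr 2
    ring
  · refine hγ0 (((γ * ω) ^ (j + 1)) e) ?_
    have h1 : ((γ * ω) ^ (j + 1)) e = ω (((γ * ω) ^ j) e) := by
      rw [mul_zpow_conj hω hγ, ← hk, ← Equiv.Perm.mul_apply, ← zpow_add]
      congr 2
      ring
    nth_rw 1 [h1]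
    rw [add_comm j 1, zpow_add, zpow_one]
    rfl

open Classical in
/-- The formal difference of the two directions through the end `e`. -/
noncomputable def direction (ω γ : Equiv.Perm E) (e : E) : E → ℤ := fun x =>
  (if (γ * ω).SameCycle x e then 1 else 0) - if (γ * ω).SameCycle x (ω e) then 1 else 0

open Classical in
theorem direction_congr (hω : ∀ e, ω (ω e) = e) (hγ : ∀ e, γ (γ e) = e) {e e' : E}
    (h : (γ * ω).SameCycle e e') : direction ω γ e = direction ω γ e' := by
  have h' : (γ * ω).SameCycle (ω e) (ω e') := by
    obtain ⟨k, rfl⟩ := h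
    exact ⟨-k, (mul_zpow_conj hω hγ k e).symm⟩
  funext x
  have h1 : (γ * ω).SameCycle x e ↔ (γ * ω).SameCycle x e' := ⟨fun i => i.trans h, fun i => i.trans h.symm⟩
  have h2 : (γ * ω).SameCycle x (ω e) ↔ (γ * ω).SameCycle x (ω e') :=
    ⟨fun i => i.trans h', fun i => i.trans h'.symm⟩
  rw [direction, direction, if_congr h1 rfl rfl, if_congr h2 rfl rfl]

open Classical in
theorem direction_other (hω : ∀ e, ω (ω e) = e) (e : E) :
    direction ω γ (ω e) = -direction ω γ e := by
  funext x
  rw [Pi.neg_apply, direction, direction, neg_sub]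
  exact congrArg₂ _ rfl (if_congr (by rw [hω]) rfl rfl)

theorem sameCycle_glued (hω : ∀ e, ω (ω e) = e) (e : E) : (γ * ω).SameCycle (ω e) (γ e) :=
  ⟨1, by rw [zpow_one, Equiv.Perm.mul_apply, hω]⟩

theorem direction_glued (hω : ∀ e, ω (ω e) = e) (hγ : ∀ e, γ (γ e) = e) (e : E) :
    direction ω γ (γ e) = -direction ω γ e := by
  rw [← direction_other hω, direction_congr hω hγ (sameCycle_glued hω e)]

theorem direction_self (hω : ∀ e, ω (ω e) = e) (hγ : ∀ e, γ (γ e) = e) (hω0 : ∀ e, ω e ≠ e)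
    (hγ0 : ∀ e, γ e ≠ e) (e : E) : direction ω γ e e = 1 := by
  rw [direction, if_pos (Equiv.Perm.SameCycle.refl _ _),
    if_neg (not_sameCycle_apply hω hγ hω0 hγ0 e), sub_zero]

/-- The weight of `x` has the value `1` at `x`, so if it agrees with that of `e` up to sign, the
weight of `e` cannot vanish at `x`. -/
theorem sameCycle_of_direction (hω : ∀ e, ω (ω e) = e) (hγ : ∀ e, γ (γ e) = e)
    (hω0 : ∀ e, ω e ≠ e) (hγ0 : ∀ e, γ e ≠ e) {e x : E}
    (h : direction ω γ x = direction ω γ e ∨ direction ω γ x = -direction ω γ e) :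
    (γ * ω).SameCycle x e ∨ (γ * ω).SameCycle x (ω e) := by
  have h1 := direction_self hω hγ hω0 hγ0 x
  by_contra! hc
  have h2 : direction ω γ e x = 0 := by
    rw [direction, if_neg hc.1, if_neg hc.2, sub_zero]
  rcases h with h | h
  · rw [h, h2] at h1
    exact zero_ne_one h1
  · rw [h, Pi.neg_apply, h2] at h1
    exact absurd h1 (by norm_num)

/-- If all ends lie on a single curve, then the weights of the ends of a half `T` of all ends, which
is interchanged by the gluing with its complement, add up to the direction of the curve times the
number of its passages through `T`, counted with signs. -/
theorem sum_direction [Finite E] (hω : ∀ e, ω (ω e) = e) (hγ : ∀ e, γ (γ e) = e)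
    (hω0 : ∀ e, ω e ≠ e) (hγ0 : ∀ e, γ e ≠ e) {s : E}
    (hs : ∀ x, (γ * ω).SameCycle x s ∨ (γ * ω).SameCycle x (ω s)) (side : E → Bool)
    (hside : ∀ e, side (γ e) = !side e) {T : Finset E} (hT : ∀ e, e ∈ T ↔ side e = true) :
    ∑ e ∈ T, direction ω γ e =
      (∑ h ∈ Finset.range T.card, if side (((γ * ω) ^ h) s) then (1 : ℤ) else -1) •
        direction ω γ s := by
  set σ := γ * ω with hσ
  have hper : s ∈ Function.periodicPts σ := by
    obtain ⟨n, hn, e⟩ := (isOfFinOrder_of_finite σ).exists_pow_eq_one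
    refine ⟨n, hn, ?_⟩
    rw [Function.IsPeriodicPt, Function.IsFixedPt, ← Equiv.Perm.coe_pow, e, Equiv.Perm.one_apply]
  set N := Function.minimalPeriod σ s with hN
  have hN0 : 0 < N := Function.minimalPeriod_pos_of_mem_periodicPts hper
  have hpow : ∀ h, (σ ^ h) s = σ^[h] s := fun h => by rw [Equiv.Perm.coe_pow]
  have hcyc : ∀ h, σ.SameCycle s ((σ ^ h) s) := fun h => ⟨h, by rw [zpow_natCast]⟩
  have hexists : ∀ x, σ.SameCycle s x → ∃ h < N, (σ ^ h) s = x := by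
    intro x hx
    obtain ⟨n, hn⟩ := hx.exists_nat_pow_eq
    refine ⟨n % N, Nat.mod_lt _ hN0, ?_⟩
    rw [hpow, Function.iterate_mod_minimalPeriod_eq, ← hpow, hn]
  have hdisj : ∀ h h', (σ ^ h) s ≠ γ ((σ ^ h') s) := by
    intro h h' e
    have h1 : σ.SameCycle s (γ ((σ ^ h') s)) := e ▸ hcyc h
    have h2 : σ.SameCycle ((σ ^ h') s) (ω ((σ ^ h') s)) :=
      ((hcyc h').symm.trans h1).trans (sameCycle_glued hω _).symm
    exact not_sameCycle_apply hω hγ hω0 hγ0 _ h2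
  have hinj : ∀ h < N, ∀ h' < N, (σ ^ h) s = (σ ^ h') s → h = h' := by
    intro h hh h' hh' e
    rw [hpow, hpow] at e
    exact Function.iterate_injOn_Iio_minimalPeriod hh hh' e
  -- The step `h` of the curve is assigned the vertex where its arc starts, represented by that one
  -- of the two glued ends which lies in `T`. A passage through the other side carries the opposite
  -- weight, hence the sign `-1`.
  set i : ℕ → E := fun h => if side ((σ ^ h) s) then (σ ^ h) s else γ ((σ ^ h) s) with hi
  have himem : ∀ h ∈ Finset.range N, i h ∈ T := by
    intro h _
    rw [hT]
    simp only [hi]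
    split_ifs with hc
    · exact hc
    · rw [hside]
      simpa using hc
  have hiinj : ∀ h ∈ Finset.range N, ∀ h' ∈ Finset.range N, i h = i h' → h = h' := by
    intro h hh h' hh' e
    rw [Finset.mem_range] at hh hh'
    simp only [hi] at e
    split_ifs at e with h1 h2 h2
    · exact hinj h hh h' hh' e
    · exact absurd e (hdisj _ _)
    · exact absurd e.symm (hdisj _ _)
    · exact hinj h hh h' hh' (γ.injective e)
  have hisurj : ∀ e ∈ T, ∃ h ∈ Finset.range N, i h = e := by
    intro e he
    rw [hT] at he
    rcases hs e with h1 | h1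
    · obtain ⟨h, hh, rfl⟩ := hexists e h1.symm
      exact ⟨h, Finset.mem_range.2 hh, if_pos he⟩
    · have h2 : σ.SameCycle s (γ e) := by
        obtain ⟨k, hk⟩ := h1.symm
        have h3 : σ.SameCycle s (ω e) := ⟨-k, by rw [← hk, mul_zpow_conj hω hγ, hω]⟩
        exact h3.trans (sameCycle_glued hω e)
      obtain ⟨h, hh, e'⟩ := hexists _ h2
      refine ⟨h, Finset.mem_range.2 hh, ?_⟩
      simp only [hi]
      rw [e', hside, he, if_neg (by simp), hγ]
  -- The curve passes through every vertex exactly once, so its period is the number of vertices.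
  have hcard : N = T.card := by
    rw [← Finset.card_range N]
    exact Finset.card_bij (fun h _ => i h) himem hiinj fun e he => by
      obtain ⟨h, hh, rfl⟩ := hisurj e he
      exact ⟨h, hh, rfl⟩
  rw [← hcard, Finset.sum_smul]
  symm
  refine Finset.sum_bij (fun h _ => i h) himem hiinj (fun e he => by
    obtain ⟨h, hh, rfl⟩ := hisurj e he
    exact ⟨h, hh, rfl⟩) fun h _ => ?_
  have h1 := direction_congr hω hγ (hcyc h)
  simp only [hi]
  split_ifs with hc
  · rw [one_smul, h1]
  · rw [direction_glued hω hγ, neg_smul, one_smul, h1]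

end

/-! ### The ends of the arcs -/

/-- The ends of the arcs: the vertices of both circles. -/
def ends (d : ℕ) : Set (Bool × ℤ) := {e | e.2 ∈ Ico (0 : ℤ) d}

theorem finite_ends (d : ℕ) : Finite (ends d) := by
  have : ends d = univ ×ˢ Ico (0 : ℤ) d := by
    ext e
    simp [ends]
  rw [this]
  exact (finite_univ.prod (finite_Ico _ _)).to_subtype

section

variable {a b c : ℕ}

theorem coe_numVertices (a b c : ℕ) : (numVertices a b c : ℤ) = 2 * a + b + c := by
  rw [numVertices]
  push_cast
  ring

theorem otherEnd_mem {e : Bool × ℤ} (h : e ∈ ends (numVertices a b c)) :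
    otherEnd a b c e ∈ ends (numVertices a b c) := by
  have hn := coe_numVertices a b c
  obtain ⟨e | e, p⟩ := e <;> obtain ⟨h0, h1⟩ := h <;> simp only at h0 h1 <;>
    simp only [otherEnd] <;> split_ifs <;> constructor <;> dsimp only <;> omega

theorem otherEnd_otherEnd {e : Bool × ℤ} (h : e ∈ ends (numVertices a b c)) :
    otherEnd a b c (otherEnd a b c e) = e := by
  have hn := coe_numVertices a b c
  obtain ⟨e | e, p⟩ := e <;> obtain ⟨h0, h1⟩ := h <;> simp only at h0 h1 <;>
    simp only [otherEnd] <;> split_ifs <;> simp only <;> split_ifs <;>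
    first | omega | (refine Prod.ext rfl ?_; dsimp only; omega)

theorem otherEnd_ne {e : Bool × ℤ} (h : e ∈ ends (numVertices a b c)) :
    otherEnd a b c e ≠ e := by
  have hn := coe_numVertices a b c
  obtain ⟨e | e, p⟩ := e <;> obtain ⟨h0, h1⟩ := h <;> simp only at h0 h1 <;>
    simp only [otherEnd] <;> split_ifs <;> intro h2 <;> have h3 := congrArg Prod.snd h2 <;>
    have h4 := congrArg Prod.fst h2 <;> simp only at h3 h4 <;> first | omega | cases h4

end

section

variable {d : ℕ}

theorem gluedVertex_mem (hd : 0 < d) (r : ℤ) (e : Bool × ℤ) : gluedVertex d r e ∈ ends d := by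
  have hd' : (0 : ℤ) < d := by exact_mod_cast hd
  obtain ⟨e | e, p⟩ := e
  · exact ⟨Int.emod_nonneg _ hd'.ne', Int.emod_lt_of_pos _ hd'⟩
  · exact ⟨Int.emod_nonneg _ hd'.ne', Int.emod_lt_of_pos _ hd'⟩

theorem gluedVertex_fst (d : ℕ) (r : ℤ) (e : Bool × ℤ) : (gluedVertex d r e).1 = !e.1 := by
  obtain ⟨e | e, p⟩ := e <;> rfl

theorem gluedVertex_gluedVertex {r : ℤ} {e : Bool × ℤ} (h : e ∈ ends d) :
    gluedVertex d r (gluedVertex d r e) = e := by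
  obtain ⟨e | e, p⟩ := e
  · have : ((p - r) % d + r) % d = p := by
      rw [Int.emod_add_emod, sub_add_cancel, Int.emod_eq_of_lt h.1 h.2]
    simp only [gluedVertex, this]
  · have : ((p + r) % d - r) % d = p := by
      rw [Int.emod_sub_emod, add_sub_cancel_right, Int.emod_eq_of_lt h.1 h.2]
    simp only [gluedVertex, this]

end

/-- The permutation of the ends which interchanges the two ends of each arc. -/
def otherPerm (a b c : ℕ) : Equiv.Perm (ends (numVertices a b c)) :=
  Function.Involutive.toPerm (fun e => ⟨otherEnd a b c e, otherEnd_mem e.2⟩)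
    fun e => Subtype.ext (otherEnd_otherEnd e.2)

/-- The permutation of the ends which interchanges the two vertices which are glued together. -/
def gluedPerm {d : ℕ} (hd : 0 < d) (r : ℤ) : Equiv.Perm (ends d) :=
  Function.Involutive.toPerm (fun e => ⟨gluedVertex d r e, gluedVertex_mem hd r e⟩)
    fun e => Subtype.ext (gluedVertex_gluedVertex e.2)

section

variable {a b c : ℕ}

theorem otherPerm_otherPerm (e : ends (numVertices a b c)) :
    otherPerm a b c (otherPerm a b c e) = e := Subtype.ext (otherEnd_otherEnd e.2)

theorem otherPerm_ne (e : ends (numVertices a b c)) : otherPerm a b c e ≠ e :=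
  fun h => otherEnd_ne e.2 (congrArg Subtype.val h)

theorem gluedPerm_gluedPerm {d : ℕ} (hd : 0 < d) (r : ℤ) (e : ends d) :
    gluedPerm hd r (gluedPerm hd r e) = e := Subtype.ext (gluedVertex_gluedVertex e.2)

theorem gluedPerm_fst {d : ℕ} (hd : 0 < d) (r : ℤ) (e : ends d) :
    (gluedPerm hd r e).1.1 = !e.1.1 := gluedVertex_fst d r e

theorem gluedPerm_ne {d : ℕ} (hd : 0 < d) (r : ℤ) (e : ends d) : gluedPerm hd r e ≠ e := by
  intro h
  have := gluedPerm_fst hd r e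
  rw [h] at this
  simp at this

/-- The vertex of one of the circles with a given number modulo `d`. -/
def vertex {d : ℕ} (hd : 0 < d) (i : Bool) (k : ℤ) : ends d :=
  ⟨(i, k % d), Int.emod_nonneg _ (by omega), Int.emod_lt_of_pos _ (by omega)⟩

theorem vertex_add_mul {d : ℕ} (hd : 0 < d) (i : Bool) (k n : ℤ) :
    vertex hd i (k + d * n) = vertex hd i k := by
  simp only [vertex, Int.add_mul_emod_self_left]

theorem gluedPerm_vertex {d : ℕ} (hd : 0 < d) (r k : ℤ) :
    gluedPerm hd r (vertex hd true k) = vertex hd false (k + r) := by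
  refine Subtype.ext (Prod.ext rfl ?_)
  exact Int.emod_add_emod ..

theorem otherPerm_vertex (hd : 0 < numVertices a b c) {i j : Bool} {k l : ℤ} (hk : 0 ≤ k)
    (hk' : k < numVertices a b c) (h : otherEnd a b c (i, k) = (j, l)) :
    otherPerm a b c (vertex hd i k) = vertex hd j l := by
  have h1 : (vertex hd i k).1 = (i, k) := Prod.ext rfl (Int.emod_eq_of_lt hk hk')
  have h2 : otherEnd a b c (i, k) ∈ ends (numVertices a b c) := h1 ▸ otherEnd_mem (vertex hd i k).2
  rw [h] at h2
  refine Subtype.ext ?_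
  change otherEnd a b c (vertex hd i k).1 = _
  rw [h1, h]
  exact Prod.ext rfl (Int.emod_eq_of_lt h2.1 h2.2).symm

/-- The direction of the curve through a vertex of the upper circle. -/
noncomputable def vertexWeight (hd : 0 < numVertices a b c) (r k : ℤ) :
    ends (numVertices a b c) → ℤ :=
  direction (otherPerm a b c) (gluedPerm hd r) (vertex hd true k)

theorem direction_vertex_false (hd : 0 < numVertices a b c) (r k : ℤ) :
    direction (otherPerm a b c) (gluedPerm hd r) (vertex hd false k) =
      -vertexWeight hd r (k - r) := by
  rw [vertexWeight, ← direction_glued otherPerm_otherPerm (gluedPerm_gluedPerm hd r),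
    gluedPerm_vertex, sub_add_cancel]

/-- The direction changes sign from one end of an arc to the other, and also under the gluing. An
arc that returns to its circle involves one change between positions on `C`, while a through arc
involves two. -/
theorem isWeight_vertexWeight (hd : 0 < numVertices a b c) (r : ℤ) :
    IsWeight a b c r (vertexWeight hd r) := by
  have hn := coe_numVertices a b c
  have hper : ∀ k n : ℤ, vertexWeight hd r (k + numVertices a b c * n) = vertexWeight hd r k := by
    intro k n
    rw [vertexWeight, vertexWeight, vertex_add_mul]
  refine ⟨fun k => ?_, fun k h => ?_, fun j hj => ?_, fun j hj => ?_, fun x h1 h2 => ?_⟩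
  · simpa using hper k 1
  · have := direction_self otherPerm_otherPerm (gluedPerm_gluedPerm hd r) otherPerm_ne
      (gluedPerm_ne hd r) (vertex hd true k)
    rw [vertexWeight] at h
    rw [h] at this
    exact zero_ne_one this
  · have h1 : otherEnd a b c (true, (j : ℤ)) = (true, 2 * (a : ℤ) + b + c - 1 - j) := by
      simp only [otherEnd]
      rw [if_pos (Or.inl (by exact_mod_cast hj))]
    rw [vertexWeight, vertexWeight, ← direction_other otherPerm_otherPerm,
      otherPerm_vertex hd (by positivity) (by omega) h1, ← vertex_add_mul hd true (-1 - (j : ℤ)) 1]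
    congr 2
    linarith
  · have h1 : otherEnd a b c (false, (j : ℤ)) = (false, 2 * (a : ℤ) + b + c - 1 - j) := by
      simp only [otherEnd]
      rw [if_pos (Or.inl (by exact_mod_cast hj))]
    rw [← neg_inj, ← direction_vertex_false hd r (-1 - (j : ℤ)), ← direction_vertex_false hd r j,
      ← direction_other otherPerm_otherPerm,
      otherPerm_vertex hd (by positivity) (by omega) h1, ← vertex_add_mul hd false (-1 - (j : ℤ)) 1]
    congr 2
    linarith
  · have key : ∀ y, otherEnd a b c (true, x) = (false, y) →
        vertexWeight hd r (y - r) = vertexWeight hd r x := by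
      intro y hy
      rw [← neg_inj, ← direction_vertex_false, vertexWeight, ← direction_other otherPerm_otherPerm,
        otherPerm_vertex hd (by omega) (by omega) hy]
    rw [lowerEnd]
    split_ifs with hc
    · rw [← key (x + c) (by simp only [otherEnd]; rw [if_neg (by omega), if_pos (by omega)]),
        ← hper (x + c - r) (-1)]
      congr 1
      ring
    · exact key (x - b) (by simp only [otherEnd]; rw [if_neg (by omega), if_neg (by omega)])

theorem coe_pow_vertex (hd : 0 < numVertices a b c) (r : ℤ) (h : ℕ) :
    (((gluedPerm hd r * otherPerm a b c) ^ h) (vertex hd true (a + b))).1 = arcStart a b c r h := by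
  rw [arcStart]
  induction h with
  | zero => rfl
  | succ n ih =>
    rw [pow_succ', Equiv.Perm.mul_apply, Function.iterate_succ_apply', ← ih]
    rfl

theorem exponentSum_word (a b c : ℕ) (r : ℤ) : exponentSum (word a b c r) =
    ∑ h ∈ Finset.range (numVertices a b c), if (arcStart a b c r h).1 then (1 : ℤ) else -1 := by
  rw [exponentSum, word]
  induction numVertices a b c with
  | zero => rfl
  | succ n ih =>
    rw [List.range_succ, List.map_append, List.prod_append, map_mul, toAdd_mul, ih,
      Finset.sum_range_succ, List.map_singleton, List.prod_singleton]
    congr 1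
    split_ifs
    · rw [FreeGroup.lift_apply_of, toAdd_ofAdd]
    · rw [map_inv, FreeGroup.lift_apply_of, toAdd_inv, toAdd_ofAdd]

end

/-- The model curve to which the curve of an admissible diagram is related is determined by the
exponent sum of the word. -/
theorem exists_related_curve {a b c : ℕ} {r : ℤ} (h : Admissible a b c r) :
    (exponentSum (word a b c r) = 0 ∧ Related (curveD a b c r) middleCurve) ∨
      ∃ m : ℤ, 0 < (exponentSum (word a b c r)).natAbs ∧
        IsCoprime ((exponentSum (word a b c r)).natAbs : ℤ) m ∧
        Related (curveD a b c r) (linearCurve (exponentSum (word a b c r)).natAbs m) := by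
  have hd : 0 < numVertices a b c := by
    have := h.1
    rw [numVertices]
    omega
  have := finite_ends (numVertices a b c)
  have hω := otherPerm_otherPerm (a := a) (b := b) (c := c)
  have hγ := gluedPerm_gluedPerm hd r
  have hω0 := otherPerm_ne (a := a) (b := b) (c := c)
  have hγ0 := gluedPerm_ne hd r
  set s := vertex hd true (a + b) with hs
  set u := direction (otherPerm a b c) (gluedPerm hd r) s with hu
  have hus : u s = 1 := direction_self hω hγ hω0 hγ0 s
  obtain ⟨g, hg, hsum⟩ := (isWeight_vertexWeight hd r).exists_related h
  have hall : ∀ x : ends (numVertices a b c),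
      direction (otherPerm a b c) (gluedPerm hd r) x = g ∨
        direction (otherPerm a b c) (gluedPerm hd r) x = -g := by
    rintro ⟨⟨_ | _, k⟩, hk⟩
    · have e : (⟨(false, k), hk⟩ : ends (numVertices a b c)) = vertex hd false k :=
        Subtype.ext (Prod.ext rfl (Int.emod_eq_of_lt hk.1 hk.2).symm)
      rw [e, direction_vertex_false, neg_eq_iff_eq_neg, neg_inj]
      exact (hg _).symm
    · have e : (⟨(true, k), hk⟩ : ends (numVertices a b c)) = vertex hd true k :=
        Subtype.ext (Prod.ext rfl (Int.emod_eq_of_lt hk.1 hk.2).symm)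
      rw [e]
      exact hg k
  have hgu : g = u ∨ g = -u := by
    rcases hall s with h1 | h1
    · exact Or.inl h1.symm
    · exact Or.inr (by rw [hu, h1, neg_neg])
  -- Here the topology yields the combinatorics: since all the weights agree up to sign, all the
  -- ends lie on a single curve, run through in one direction or the other.
  have hcyc : ∀ x, (gluedPerm hd r * otherPerm a b c).SameCycle x s ∨
      (gluedPerm hd r * otherPerm a b c).SameCycle x (otherPerm a b c s) := by
    refine fun x => sameCycle_of_direction hω hγ hω0 hγ0 ?_
    rcases hall x with h1 | h1 <;> rcases hgu with h2 | h2 <;> rw [h1, h2]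
    · exact Or.inl rfl
    · exact Or.inr rfl
    · exact Or.inr rfl
    · exact Or.inl (neg_neg _)
  have hinj : Function.Injective fun k : Fin (numVertices a b c) => vertex hd true k := by
    intro k l hkl
    have h1 := congrArg (fun e => e.1.2) hkl
    simp only [vertex] at h1
    rw [Int.emod_eq_of_lt (by positivity) (by exact_mod_cast k.2),
      Int.emod_eq_of_lt (by positivity) (by exact_mod_cast l.2)] at h1
    exact Fin.ext (by exact_mod_cast h1)
  set T : Finset (ends (numVertices a b c)) := Finset.univ.map ⟨_, hinj⟩ with hT
  have hmem : ∀ e, e ∈ T ↔ e.1.1 = true := by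
    intro e
    simp only [hT, Finset.mem_map, Finset.mem_univ, true_and, Function.Embedding.coeFn_mk]
    constructor
    · rintro ⟨k, rfl⟩
      rfl
    · obtain ⟨⟨i, k⟩, hk⟩ := e
      rintro rfl
      have h0 : (0 : ℤ) ≤ k := hk.1
      have h1 : k < numVertices a b c := hk.2
      refine ⟨⟨k.toNat, by omega⟩, Subtype.ext (Prod.ext rfl ?_)⟩
      change ((k.toNat : ℕ) : ℤ) % _ = k
      rw [Int.toNat_of_nonneg h0, Int.emod_eq_of_lt h0 h1]
  have hcard : T.card = numVertices a b c := by
    rw [hT, Finset.card_map, Finset.card_univ, Fintype.card_fin]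
  have key := sum_direction hω hγ hω0 hγ0 hcyc (fun e => e.1.1) (gluedPerm_fst hd r) hmem
  have e1 : ∑ e ∈ T, direction (otherPerm a b c) (gluedPerm hd r) e =
      ∑ k ∈ Finset.range (numVertices a b c), vertexWeight hd r k := by
    rw [hT, Finset.sum_map, Finset.sum_range]
    rfl
  have e2 : (∑ h ∈ Finset.range (numVertices a b c),
      if (((gluedPerm hd r * otherPerm a b c) ^ h) s).1.1 then (1 : ℤ) else -1) =
      exponentSum (word a b c r) := by
    rw [exponentSum_word]
    exact Finset.sum_congr rfl fun k _ => by rw [hs, coe_pow_vertex]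
  rw [e1, hcard, e2] at key
  rcases hsum with ⟨h0, hrel⟩ | ⟨n, m, hn, hnm, h1, hrel⟩
  · left
    refine ⟨?_, hrel⟩
    -- The weights are functions on the ends; evaluating at `s`, where `u` is `1`, turns the
    -- identity into one between integers.
    have := congrFun (key.symm.trans h0) s
    rwa [Pi.smul_apply, ← hu, hus, smul_eq_mul, mul_one] at this
  · right
    have h2 := congrFun (key.symm.trans h1) s
    rw [Pi.smul_apply, ← hu, hus, smul_eq_mul, mul_one, Pi.smul_apply, nsmul_eq_mul] at h2
    have h3 : (exponentSum (word a b c r)).natAbs = n := by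
      rcases hgu with rfl | rfl
      · rw [hus] at h2
        omega
      · rw [Pi.neg_apply, hus] at h2
        omega
    rw [h3]
    exact ⟨m, hn, hnm, hrel⟩

end Dunwoody

theorem proposition1 (a b c : ℕ) (r : ℤ) (h : Dunwoody.Admissible a b c r) :
    (∃ (M : Type) (_ : TopologicalSpace M), Dunwoody.IsDunwoodyManifold a b c r M) ∧
    (Dunwoody.exponentSum (Dunwoody.word a b c r) = 1 ∨
        Dunwoody.exponentSum (Dunwoody.word a b c r) = -1 →
      ∀ (M : Type*) [TopologicalSpace M], Dunwoody.IsDunwoodyManifold a b c r M →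
        Nonempty (M ≃ₜ Dunwoody.S3)) ∧
    (Dunwoody.exponentSum (Dunwoody.word a b c r) = 0 →
      ∀ (M : Type*) [TopologicalSpace M], Dunwoody.IsDunwoodyManifold a b c r M →
        Nonempty (M ≃ₜ Circle × Dunwoody.S2)) ∧
    (1 < |Dunwoody.exponentSum (Dunwoody.word a b c r)| →
      ∃ β : ℕ, Nat.Coprime (Dunwoody.exponentSum (Dunwoody.word a b c r)).natAbs β ∧
        ∀ (M : Type*) [TopologicalSpace M], Dunwoody.IsDunwoodyManifold a b c r M →
          Nonempty (M ≃ₜ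
            Dunwoody.LensSpace (Dunwoody.exponentSum (Dunwoody.word a b c r)).natAbs β)) := by
  simp only [Dunwoody.IsDunwoodyManifold, Dunwoody.isRepresentedBy_iff]
  have hrel := Dunwoody.exists_related_curve h
  generalize Dunwoody.exponentSum (Dunwoody.word a b c r) = ε at hrel ⊢
  rcases hrel with ⟨rfl, hrel⟩ | ⟨m, hε, hm, hrel⟩
  · have hM := Dunwoody.isGluedAlong_product.of_related hrel.symm
    refine ⟨⟨_, _, hM⟩, fun h => ?_, fun _ M _ hM' => hM'.unique hM, fun h => ?_⟩
    · omega
    · simp at h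
  -- The parameter `β` is the inverse of the slope `m` modulo `|ε|`, reduced to a natural number. It
  -- is chosen from the curve alone, before any manifold is considered.
  · obtain ⟨β, hβ, hβm⟩ : ∃ β : ℕ, Nat.Coprime ε.natAbs β ∧
        ∃ z : ℤ, (β : ℤ) * m = 1 + (ε.natAbs : ℕ) * z := by
      obtain ⟨u, v, huv⟩ := hm
      have hn : (0 : ℤ) < (ε.natAbs : ℕ) := by exact_mod_cast hε
      have e : (((v % (ε.natAbs : ℕ)).toNat : ℕ) : ℤ) = v % (ε.natAbs : ℕ) :=
        Int.toNat_of_nonneg (Int.emod_nonneg _ hn.ne')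
      have e' : v % (ε.natAbs : ℕ) * m = 1 + (ε.natAbs : ℕ) * (-u - v / (ε.natAbs : ℕ) * m) := by
        rw [Int.emod_def]
        linear_combination huv
      refine ⟨(v % (ε.natAbs : ℕ)).toNat, ?_, _, by rw [e, e']⟩
      rw [← Nat.isCoprime_iff_coprime, e]
      exact ⟨u + v / (ε.natAbs : ℕ) * m, m, by linear_combination e'⟩
    have hM := (Dunwoody.isGluedAlong_lensSpace hε hβm).of_related hrel.symm
    refine ⟨⟨_, _, hM⟩, fun h M _ hM' => ?_, fun h => ?_, fun _ => ⟨β, hβ, fun M _ hM' => hM'.unique hM⟩⟩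
    -- For `|ε| = 1` the linear curve is also the gluing curve of `S³`, so uniqueness is applied to
    -- that model instead of `L(1, β)`.
    · have e : ε.natAbs = 1 := by omega
      rw [e] at hrel
      obtain ⟨f⟩ := hM'.unique ((Dunwoody.isGluedAlong_S3 m).of_related hrel.symm)
      obtain ⟨g⟩ := Dunwoody.nonempty_S3C_homeomorph_S3
      exact ⟨f.trans g⟩
    · omega
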